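/- **Setting.** Let $\mathbb T=\mathbb R/2\pi\mathbb Z$, let $\mathfrak U\ge 1$, and let $u\in C^3(\mathbb R)$ satisfy $$\frac1{\mathfrak U}\le u'(y),\qquad \frac{|u''(y)|}{u'(y)}\le \mathfrak U,\qquad \frac{|u'''(y)|}{u'(y)}\le\mathfrak U\qquad\text{for all } y\in\mathbb R. \tag{H}$$ For $\nu\ge 0$ let $f$ be a real-valued solution on $[0,\infty)\times\mathbb T\times\mathbb R$, with initial datum $f(0)=f^{in}$, of the hypoelliptic equation $\partial_t f+u\,\partial_x f=\nu\,\partial_{yy}f$ or of the drift-diffusion equation $\partial_t f+u\,\partial_x f=\nu\,\Delta f$. Solution means: $f$ is locally integrable on $[0,\infty)\times\mathbb T\times\mathbb R$ (and so is $f(t)$ on $\mathbb T\times\mathbb R$ for each $t$), it satisfies the equation with its initial datum in the sense of distributions, and its projection $f_{\neq}$ onto the nonzero $x$-modes ($f$ minus its $x$-average) belongs to $C([0,\infty);L^2(\mathbb T\times\mathbb R))$, with $\partial_y f_{\neq}\in L^2((0,T);L^2)$ for every $T>0$ if $\nu>0$. For $k\in\mathbb N$ write $g_k(x,y)=\sum_{|\ell|=k}\widehat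 g(\ell,y)e^{i\ell x}$ with $\widehat g(\ell,y)=\frac1{2\pi}\int_{\mathbb T}g(x,y)e^{-i\ell x}\,dx$, and let $f_k(t)=(f(t))_k$, $f^{in}_k=(f^{in})_k$. Put $$\|g\|_{u'}^2=\|g\|_{L^2}^2+\|u'g\|_{L^2}^2,\qquad \|g\|_{\dot H^{-1}}=\sup\Big\{\Big|\int_{\mathbb T\times\mathbb R} g\,\varphi\Big| : \varphi\in C_c^\infty(\mathbb T\times\mathbb R),\ \|\nabla\varphi\|_{L^2}\le1\Big\}.$$ Norms take values in $[0,\infty]$; $\partial_y f_k^{in}$ is the weak derivative (a locally integrable function), and the estimates involving it are asserted when it exists. **Theorem 4.1.** There exist $C_0\ge1$ and $\varepsilon_0,\nu_0\in(0,1)$, depending only on $\mathfrak U$, such that for all $u,\nu,f$ as above and every integer $k\ge1$ with $\nu k^{-1}\in[0,\nu_0]$ we have the enhanced diffusion estimate $$\|f_k(t)\|_{u'}\le C_0\,e^{-\varepsilon_0\nu^{1/3}k^{2/3}t}\,\|f_k^{in}\|_{u'},\qquad\forall t\ge0,$$ and the stable mixing estimate $$\|f_k(t)\|_{\dot H^{-1}}\le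 C_0\,\frac{e^{-\varepsilon_0\nu^{1/3}k^{2/3}t}}{\sqrt{1+(kt)^2}}\Big[\|f_k^{in}\|_{u'}+\|\partial_yf_k^{in}\|_{u'}\Big],\qquad\forall t\ge0.$$ In particular, if $\nu=0$, we have the inviscid mixing estimate $$\|f_k(t)\|_{\dot H^{-1}}\le \frac{C_0}{\sqrt{1+(kt)^2}}\Big[\|f_k^{in}\|_{u'}+\|\partial_yf_k^{in}\|_{u'}\Big],\qquad\forall t\ge0.$$ -/

import Mathlib

open Real Set Filter Topology MeasureTheory
open scoped ENNReal ContDiff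

noncomputable section

namespace StableMixing

instance factTwoPiPos : Fact (0 < 2 * π) := ⟨Real.two_pi_pos⟩

/-- The circle `ℝ / 2πℤ`; its `volume` is Lebesgue measure, of total mass `2π`. -/
abbrev Circ : Type := AddCircle (2 * π)

/-- The spatial domain `𝕋 × ℝ`, with points `(x, y)`. -/
abbrev Dom : Type := Circ × ℝ

/-! ### Test functions and derivatives -/

/-- The partial derivative in `x` of a function on `𝕋 × ℝ`. -/
def dX (φ : Dom → ℝ) (p : Dom) : ℝ := deriv (fun s : ℝ => φ (p.1 + (s : Circ), p.2)) 0

/-- The partial derivative in `y` of a function on `𝕋 × ℝ`. -/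
def dY (φ : Dom → ℝ) (p : Dom) : ℝ := deriv (fun s : ℝ => φ (p.1, s)) p.2

/-- `φ ∈ C_c^∞(𝕋 × ℝ)`; smoothness is that of the `2π`-periodic lift to `ℝ × ℝ`. -/
def IsTest (φ : Dom → ℝ) : Prop :=
  ContDiff ℝ ∞ (fun q : ℝ × ℝ => φ ((q.1 : Circ), q.2)) ∧ HasCompactSupport φ

/-- `φ ∈ C_c^∞(ℝ × 𝕋 × ℝ)`, with variables `(t, x, y)`. -/
def IsSpaceTimeTest (φ : ℝ → Dom → ℝ) : Prop :=
  ContDiff ℝ ∞ (fun q : ℝ × ℝ × ℝ => φ q.1 ((q.2.1 : Circ), q.2.2)) ∧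
    HasCompactSupport (fun q : ℝ × Dom => φ q.1 q.2)

/-- `g` is the weak (distributional) derivative `∂_y h` on `𝕋 × ℝ`. -/
def IsWeakDerivY (h g : Dom → ℝ) : Prop :=
  LocallyIntegrable h ∧ LocallyIntegrable g ∧
    ∀ φ : Dom → ℝ, IsTest φ → ∫ p, h p * dY φ p = -∫ p, g p * φ p

/-! ### Fourier bands in `x` -/

/-- The Fourier coefficient `ĝ(ℓ, y) = (2π)⁻¹ ∫_𝕋 g(x, y) e^{-iℓx} dx`. -/
def xCoeff (g : Dom → ℝ) (l : ℤ) (y : ℝ) : ℂ := fourierCoeff (fun x : Circ => (g (x, y) : ℂ)) l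

/-- The band `g_k(x, y) = ∑_{|ℓ| = k} ĝ(ℓ, y) e^{iℓx}`. The sum is real, see `ofReal_band`. -/
def band (k : ℕ) (g : Dom → ℝ) (p : Dom) : ℝ :=
  (∑ l ∈ ({(k : ℤ), -(k : ℤ)} : Finset ℤ), xCoeff g l p.2 * fourier l p.1).re

/-- The projection `g_≠` onto the nonzero modes in `x`: `g` minus its `x`-average. -/
def nonzeroPart (g : Dom → ℝ) (p : Dom) : ℝ := g p - (2 * π)⁻¹ * ∫ x : Circ, g (x, p.2)

theorem xCoeff_neg (g : Dom → ℝ) (l : ℤ) (y : ℝ) :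
    xCoeff g (-l) y = (starRingEnd ℂ) (xCoeff g l y) := by
  simp only [xCoeff, fourierCoeff]
  rw [← integral_conj]
  refine integral_congr_ae (Filter.Eventually.of_forall fun x => ?_)
  simp

theorem ofReal_band (k : ℕ) (g : Dom → ℝ) (p : Dom) :
    (band k g p : ℂ)
      = ∑ l ∈ ({(k : ℤ), -(k : ℤ)} : Finset ℤ), xCoeff g l p.2 * fourier l p.1 := by
  refine Complex.conj_eq_iff_re.mp ?_
  have h : ∀ l : ℤ, (starRingEnd ℂ) (xCoeff g l p.2 * fourier l p.1)
      = xCoeff g (-l) p.2 * fourier (-l) p.1 := fun l => by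
    rw [map_mul, xCoeff_neg, fourier_neg]
  rw [map_sum, Finset.sum_congr rfl fun l _ => h l]
  refine Finset.sum_bij (fun l _ => -l) ?_ ?_ ?_ ?_
  · intro l hl
    simp only [Finset.mem_insert, Finset.mem_singleton] at hl ⊢
    omega
  · intro a _ b _ hab
    exact neg_injective hab
  · intro b hb
    refine ⟨-b, ?_, by simp⟩
    simp only [Finset.mem_insert, Finset.mem_singleton] at hb ⊢
    omega
  · intro l _
    rfl

/-! ### Norms (with values in `[0, ∞]`) -/

/-- The weighted norm `‖g‖_{u'}`, where `‖g‖_{u'}² = ‖g‖_{L²}² + ‖u' g‖_{L²}²`. -/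
def weightedNorm (u : ℝ → ℝ) (g : Dom → ℝ) : ℝ≥0∞ :=
  (eLpNorm g 2 volume ^ 2 + eLpNorm (fun p : Dom => deriv u p.2 * g p) 2 volume ^ 2) ^ (1 / 2 : ℝ)

/-- The homogeneous norm `‖g‖_{Ḣ⁻¹}` on `𝕋 × ℝ`, as the norm dual to `φ ↦ ‖∇φ‖_{L²}`:
the supremum of `|∫ g φ|` over `φ ∈ C_c^∞` with `‖∇φ‖_{L²} ≤ 1`. It equals `‖∇ψ‖_{L²}`
for the stream function `ψ`, `Δψ = g`, whenever the latter is defined. -/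
def hNegOneNorm (g : Dom → ℝ) : ℝ≥0∞ :=
  ⨆ (φ : Dom → ℝ) (_ : IsTest φ)
    (_ : ∫⁻ p, ENNReal.ofReal (dX φ p ^ 2 + dY φ p ^ 2) ≤ 1), ENNReal.ofReal |∫ p, g p * φ p|

/-! ### Shear flows and solutions -/

/-- The assumption on the shear flow `u`, with constant `U`. -/
structure IsShear (U : ℝ) (u : ℝ → ℝ) : Prop where
  contDiff : ContDiff ℝ 3 u
  lower : ∀ y, 1 / U ≤ deriv u y
  second : ∀ y, |iteratedDeriv 2 u y| / deriv u y ≤ U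
  third : ∀ y, |iteratedDeriv 3 u y| / deriv u y ≤ U

/-- `f` is a (weak, finite energy) solution on `[0, ∞) × 𝕋 × ℝ` of
`∂_t f + u ∂_x f = ν (σ ∂_xx f + ∂_yy f)`, `f(0) = fin`.
`σ = 1` is the full drift-diffusion equation and `σ = 0` is the hypoelliptic one.
No finite energy is asked of the `x`-average of `f`. -/
structure IsSolution (σ ν : ℝ) (u : ℝ → ℝ) (fin : Dom → ℝ) (f : ℝ → Dom → ℝ) : Prop where
  locInt : LocallyIntegrableOn (fun q : ℝ × Dom => f q.1 q.2) (Ici (0 : ℝ) ×ˢ univ)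
  locInt_slice : ∀ t, 0 ≤ t → LocallyIntegrable (f t)
  initial : f 0 =ᵐ[volume] fin
  /-- `f_≠ ∈ C([0, ∞); L²)`. -/
  memLp : ∀ t, 0 ≤ t → MemLp (nonzeroPart (f t)) 2
  continuous : ∀ t₀, 0 ≤ t₀ →
    Tendsto (fun t => eLpNorm (nonzeroPart (f t) - nonzeroPart (f t₀)) 2 volume)
      (𝓝[Ici 0] t₀) (𝓝 0)
  /-- If `ν > 0`, then `∂_y f_≠ ∈ L²((0, T); L²)` for every `T`. -/
  dissipation : 0 < ν → ∃ g : ℝ → Dom → ℝ,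
    AEStronglyMeasurable (fun q : ℝ × Dom => g q.1 q.2)
      (volume.restrict (Ioi (0 : ℝ) ×ˢ univ)) ∧
    (∀ᵐ t ∂(volume.restrict (Ioi (0 : ℝ))), IsWeakDerivY (nonzeroPart (f t)) (g t)) ∧
    ∀ T : ℝ, ∫⁻ t in Ioc 0 T, eLpNorm (g t) 2 volume ^ 2 < ⊤
  /-- The equation with its initial datum, in the sense of distributions. -/
  weak : ∀ φ : ℝ → Dom → ℝ, IsSpaceTimeTest φ →
    (∫ q in Ioi (0 : ℝ) ×ˢ (univ : Set Dom),
      f q.1 q.2 * (deriv (fun s => φ s q.2) q.1 + u q.2.2 * dX (φ q.1) q.2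
        + ν * (σ * dX (dX (φ q.1)) q.2 + dY (dY (φ q.1)) q.2)))
      + ∫ p, fin p * φ 0 p = 0

end StableMixing

end

/-! Only one Fourier mode matters. The coefficient of `e^{ikx}`, multiplied by `exp(νσk²t)` and read
at time `t/k`, solves `∂_t h + i u h = μ ∂_yy h` with `μ = ν/k`. The factor removed is at most 1
when undone, so both equations are handled at once (`exists_isWeakSol`). The band `k` is twice the
real part of this mode, and `weightedNorm_band` and `integral_band_mul` carry both norms over to
`h`.

Everything rests on the vector field `J = v ∂_y + i(t - c)` with `v = 1/u'` (`vf`). Since `v u' =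
1`, it commutes with `∂_t + iu`, so `JF` solves the same equation up to terms that carry `μ`. The
hypotheses on `u''` and `u'''` bound `v'` and `v''` by multiples of `v`, and `v F_y = JF - i(t -
c)F` then closes the estimate. The workhorse is `energy_estimate`: on a time interval short compared
with `1/μ`, weighted energies at most double and the dissipation is controlled by the initial energy
and the source.

Enhanced diffusion (`window`). Put `ρ = μ^{1/3}` and cut time into windows of length `T = M/ρ`, so
that `μT³ = M³` is large while `μT` is small. If the energy is at most `X` at the start of a window,
the dissipation bound yields a time `t₁` in the first quarter with `‖F_y‖² ≲ X/(μT)`. With `c = t₁`,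
`JF` starts from that size and stays small up to a time `t₂` in the second half where `F_y` is small
too. From `i(t₂ - t₁)F = JF - vF_y` one gets `‖F‖² ≲ X(1/(μT³) + μT)`, much less than `X`. Iteration
gives a factor 256 per window. The argument allows any bounded weight with `|p'| ≤ 2Up`, and such
weights increase to `1 + u'²`.

Mixing (`decay_vf`, `mixing`). With `c = 0`, integration by parts gives `it∫Fφ = ∫JF φ + ∫F (vφ)'`,
so it suffices that `JF` decays. The same window argument is run one level higher: a second order
operator (`vf₂`) takes the place of `JF`, and `JF` that of `F`. The energy of `JF` contracts by 64
per window up to a source made of `F`, which decays faster. This works up to times of order `ρ⁻²`;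
later, the spare exponential decay of `F` is stronger than the missing factor `1/t`.

Regularity. A weak solution is averaged in time with a kernel that looks forward. The equation then
gives a second derivative in `y`, and a local parametrix makes the average a classical solution with
all time derivatives, from which derivatives in `y` up to the fourth are read off. Bounds pass to
the averages because their sublevel sets are closed and convex. The kernel sees only positive times,
so the bound on `∂_y` of the datum is first propagated for a short time by difference quotients;
their commutator is essentially `u'F`, which is where the weight `u'` enters the mixing estimate.
For `ν = 0` nothing can be divided by `ν`; there the solution is `e^{-iut}` times the datum, and
mixing is nonstationary phase. -/

noncomputable section

namespace StableMixing

/-! ### The shear and its inverse slope -/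

/-- The inverse slope `v = 1 / u'`. -/
def invSlope (u : ℝ → ℝ) (y : ℝ) : ℝ := (deriv u y)⁻¹

/-- The derivative of `invSlope`. -/
def invSlope₁ (u : ℝ → ℝ) (y : ℝ) : ℝ := -iteratedDeriv 2 u y / deriv u y ^ 2

/-- The second derivative of `invSlope`. -/
def invSlope₂ (u : ℝ → ℝ) (y : ℝ) : ℝ :=
  -iteratedDeriv 3 u y / deriv u y ^ 2 + 2 * iteratedDeriv 2 u y ^ 2 / deriv u y ^ 3

namespace IsShear

variable {U : ℝ} {u : ℝ → ℝ}

theorem deriv_pos (h : IsShear U u) (hU : 1 ≤ U) (y : ℝ) : 0 < deriv u y :=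
  lt_of_lt_of_le (by positivity) (h.lower y)

theorem hasDerivAt (h : IsShear U u) (y : ℝ) : HasDerivAt u (deriv u y) y :=
  (h.contDiff.differentiable (by norm_num) y).hasDerivAt

theorem hasDerivAt_deriv (h : IsShear U u) (y : ℝ) :
    HasDerivAt (deriv u) (iteratedDeriv 2 u y) y := by
  have := (h.contDiff.differentiable_iteratedDeriv 1 (by norm_num) y).hasDerivAt
  rwa [← iteratedDeriv_succ, iteratedDeriv_one] at this

theorem hasDerivAt_deriv2 (h : IsShear U u) (y : ℝ) :
    HasDerivAt (iteratedDeriv 2 u) (iteratedDeriv 3 u y) y := by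
  have := (h.contDiff.differentiable_iteratedDeriv 2 (by norm_num) y).hasDerivAt
  rwa [← iteratedDeriv_succ] at this

theorem continuous (h : IsShear U u) : Continuous u := h.contDiff.continuous

theorem continuous_deriv (h : IsShear U u) : Continuous (deriv u) :=
  h.contDiff.continuous_deriv (by norm_num)

theorem continuous_deriv2 (h : IsShear U u) : Continuous (iteratedDeriv 2 u) :=
  h.contDiff.continuous_iteratedDeriv 2 (by norm_num)

theorem continuous_deriv3 (h : IsShear U u) : Continuous (iteratedDeriv 3 u) :=
  h.contDiff.continuous_iteratedDeriv 3 (by norm_num)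

theorem invSlope_pos (h : IsShear U u) (hU : 1 ≤ U) (y : ℝ) : 0 < invSlope u y :=
  inv_pos.2 (h.deriv_pos hU y)

theorem invSlope_le (h : IsShear U u) (hU : 1 ≤ U) (y : ℝ) : invSlope u y ≤ U := by
  rw [invSlope, inv_le_comm₀ (h.deriv_pos hU y) (by linarith), ← one_div]
  exact h.lower y

theorem invSlope_mul (h : IsShear U u) (hU : 1 ≤ U) (y : ℝ) : invSlope u y * deriv u y = 1 :=
  inv_mul_cancel₀ (h.deriv_pos hU y).ne'

theorem abs_deriv2_le (h : IsShear U u) (hU : 1 ≤ U) (y : ℝ) :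
    |iteratedDeriv 2 u y| ≤ U * deriv u y :=
  (div_le_iff₀ (h.deriv_pos hU y)).1 (h.second y)

theorem abs_deriv3_le (h : IsShear U u) (hU : 1 ≤ U) (y : ℝ) :
    |iteratedDeriv 3 u y| ≤ U * deriv u y :=
  (div_le_iff₀ (h.deriv_pos hU y)).1 (h.third y)

theorem invSlope₁_eq (h : IsShear U u) (hU : 1 ≤ U) (y : ℝ) :
    invSlope₁ u y = -invSlope u y ^ 2 * iteratedDeriv 2 u y := by
  have := (h.deriv_pos hU y).ne'
  rw [invSlope₁, invSlope]; field_simp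

theorem hasDerivAt_invSlope (h : IsShear U u) (hU : 1 ≤ U) (y : ℝ) :
    HasDerivAt (invSlope u) (invSlope₁ u y) y :=
  (h.hasDerivAt_deriv y).inv (h.deriv_pos hU y).ne'

theorem hasDerivAt_invSlope₁ (h : IsShear U u) (hU : 1 ≤ U) (y : ℝ) :
    HasDerivAt (invSlope₁ u) (invSlope₂ u y) y := by
  have h0 := (h.deriv_pos hU y).ne'
  have := ((h.hasDerivAt_deriv2 y).neg).div ((h.hasDerivAt_deriv y).pow 2) (pow_ne_zero 2 h0)
  refine this.congr_deriv ?_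
  rw [invSlope₂]; simp only [Pi.pow_apply, Pi.neg_apply]; field_simp; ring

theorem abs_invSlope₁_le (h : IsShear U u) (hU : 1 ≤ U) (y : ℝ) :
    |invSlope₁ u y| ≤ U * invSlope u y := by
  have h0 := h.deriv_pos hU y
  rw [invSlope₁, abs_div, abs_neg, abs_of_pos (pow_pos h0 2), div_le_iff₀ (pow_pos h0 2), invSlope]
  calc _ ≤ _ := h.abs_deriv2_le hU y
    _ = _ := by field_simp

/-- The two terms of `v''` contribute `U v` and `2U² v`; since `U ≥ 1` the sum is at most `3U² v`. A
bound relative to `v`, not merely a bound, is what lets commutator terms be measured by `v F_y`. -/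
theorem abs_invSlope₂_le (h : IsShear U u) (hU : 1 ≤ U) (y : ℝ) :
    |invSlope₂ u y| ≤ 3 * U ^ 2 * invSlope u y := by
  have h0 := h.deriv_pos hU y
  have h2 := h.abs_deriv2_le hU y
  have h3 := h.abs_deriv3_le hU y
  have e : invSlope₂ u y = (-iteratedDeriv 3 u y * deriv u y + 2 * iteratedDeriv 2 u y ^ 2)
      / deriv u y ^ 3 := by rw [invSlope₂]; field_simp
  rw [e, abs_div, abs_of_pos (pow_pos h0 3), div_le_iff₀ (pow_pos h0 3), invSlope]
  have e2 : 3 * U ^ 2 * (deriv u y)⁻¹ * deriv u y ^ 3 = 3 * U ^ 2 * deriv u y ^ 2 := by field_simp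
  rw [e2]
  refine (abs_add_le _ _).trans ?_
  rw [abs_mul, abs_neg, abs_of_pos h0, abs_mul, abs_of_pos (two_pos : (0 : ℝ) < 2), abs_pow]
  have : |iteratedDeriv 2 u y| ^ 2 ≤ (U * deriv u y) ^ 2 := by gcongr
  have : |iteratedDeriv 3 u y| * deriv u y ≤ U * deriv u y * deriv u y := by gcongr
  nlinarith [mul_pos h0 h0, mul_nonneg (mul_pos h0 h0).le (mul_nonneg (by linarith : 0 ≤ U) (by linarith : 0 ≤ U - 1))]

theorem continuous_invSlope (h : IsShear U u) (hU : 1 ≤ U) : Continuous (invSlope u) :=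
  continuous_iff_continuousAt.2 fun y => (h.hasDerivAt_invSlope hU y).continuousAt

theorem continuous_invSlope₁ (h : IsShear U u) (hU : 1 ≤ U) : Continuous (invSlope₁ u) :=
  continuous_iff_continuousAt.2 fun y => (h.hasDerivAt_invSlope₁ hU y).continuousAt

theorem continuous_invSlope₂ (h : IsShear U u) (hU : 1 ≤ U) : Continuous (invSlope₂ u) := by
  have h0 := fun y => (h.deriv_pos hU y).ne'
  exact ((h.continuous_deriv3.neg).div (h.continuous_deriv.pow 2) fun y => pow_ne_zero 2 (h0 y)).add
    ((continuous_const.mul (h.continuous_deriv2.pow 2)).div (h.continuous_deriv.pow 3)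
      fun y => pow_ne_zero 3 (h0 y))

end IsShear

/-! ### Admissible weights -/

/-- Weights comparable with themselves on unit scale. -/
structure IsWeight (U : ℝ) (p p' : ℝ → ℝ) : Prop where
  pos : ∀ y, 0 < p y
  hasDerivAt : ∀ y, HasDerivAt p (p' y) y
  continuous' : Continuous p'
  bound : ∀ y, |p' y| ≤ 2 * U * p y

namespace IsWeight
variable {U : ℝ} {p p' : ℝ → ℝ}

theorem continuous (h : IsWeight U p p') : Continuous p :=
  continuous_iff_continuousAt.2 fun y => (h.hasDerivAt y).continuousAt

theorem one {U : ℝ} (hU : 1 ≤ U) : IsWeight U (fun _ => 1) (fun _ => 0) :=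
  ⟨fun _ => one_pos, fun y => hasDerivAt_const y 1, continuous_const, fun _ => by simp; linarith⟩

end IsWeight

/-- The bounded weights increasing to `1 + u'²`. -/
def slopeWeight (u : ℝ → ℝ) (n : ℝ) (y : ℝ) : ℝ := (1 + deriv u y ^ 2) / (1 + (1 + deriv u y ^ 2) / n)

/-- With `q = 1 + u'²`, the derivative of `q/(1 + q/n)` is `q'/(1 + q/n)²`, so the saturation only
improves the ratio of derivative to value. The constant `2U` in `IsWeight` comes from `|q'| =
2u'|u''| ≤ 2U q`. The saturation is needed because energies are known to be finite a priori only for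
bounded weights. -/
theorem isWeight_slopeWeight {U : ℝ} {u : ℝ → ℝ} (h : IsShear U u) (hU : 1 ≤ U) {n : ℝ} (hn : 0 < n) :
    IsWeight U (slopeWeight u n) (fun y => (2 * deriv u y * iteratedDeriv 2 u y)
      / (1 + (1 + deriv u y ^ 2) / n) ^ 2) := by
  have hd : ∀ y, 0 < 1 + (1 + deriv u y ^ 2) / n := fun y => by positivity
  refine ⟨fun y => div_pos (by positivity) (hd y), fun y => ?_, ?_, fun y => ?_⟩
  · have h1 : HasDerivAt (fun y => 1 + deriv u y ^ 2) (2 * deriv u y * iteratedDeriv 2 u y) y := by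
      simpa using ((h.hasDerivAt_deriv y).pow 2).const_add 1
    refine (h1.div ((h1.div_const n).const_add 1) (hd y).ne').congr_deriv ?_
    have := (hd y).ne'
    field_simp
    ring
  · exact ((continuous_const.mul h.continuous_deriv).mul h.continuous_deriv2).div
      ((continuous_const.add ((continuous_const.add (h.continuous_deriv.pow 2)).div_const n)).pow 2)
      fun y => pow_ne_zero 2 (hd y).ne'
  · rw [slopeWeight, abs_div, abs_of_pos (pow_pos (hd y) 2), div_le_iff₀ (pow_pos (hd y) 2)]
    have h0 := h.deriv_pos hU y
    have h1 : 1 ≤ 1 + (1 + deriv u y ^ 2) / n := by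
      have : 0 ≤ (1 + deriv u y ^ 2) / n := by positivity
      linarith
    have e : 2 * U * ((1 + deriv u y ^ 2) / (1 + (1 + deriv u y ^ 2) / n))
        * (1 + (1 + deriv u y ^ 2) / n) ^ 2
        = 2 * U * (1 + deriv u y ^ 2) * (1 + (1 + deriv u y ^ 2) / n) := by
      have := (hd y).ne'
      generalize 1 + (1 + deriv u y ^ 2) / n = a at *
      field_simp
    rw [e, abs_mul, abs_mul, abs_of_pos h0, abs_of_pos (two_pos : (0:ℝ) < 2)]
    have h2 := h.abs_deriv2_le hU y
    calc 2 * deriv u y * |iteratedDeriv 2 u y| ≤ 2 * deriv u y * (U * deriv u y) := by gcongr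
      _ ≤ 2 * U * (1 + deriv u y ^ 2) := by nlinarith
      _ ≤ _ := le_mul_of_one_le_right (by positivity) h1

theorem slopeWeight_le {u : ℝ → ℝ} {n : ℝ} (hn : 0 < n) (y : ℝ) :
    slopeWeight u n y ≤ n := by
  rw [slopeWeight, div_le_iff₀ (by positivity)]
  have : n * (1 + (1 + deriv u y ^ 2) / n) = n + (1 + deriv u y ^ 2) := by field_simp
  rw [this]; linarith

theorem slopeWeight_le' {u : ℝ → ℝ} {n : ℝ} (hn : 0 < n) (y : ℝ) :
    slopeWeight u n y ≤ 1 + deriv u y ^ 2 := by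
  rw [slopeWeight]
  refine div_le_self (by positivity) ?_
  have : 0 ≤ (1 + deriv u y ^ 2) / n := by positivity
  linarith

theorem tendsto_slopeWeight (u : ℝ → ℝ) (y : ℝ) :
    Tendsto (fun n : ℕ => slopeWeight u (n + 1) y) atTop (𝓝 (1 + deriv u y ^ 2)) := by
  have h1 : Tendsto (fun n : ℕ => (1 + deriv u y ^ 2) / ((n : ℝ) + 1)) atTop (𝓝 0) :=
    tendsto_const_nhds.div_atTop (tendsto_natCast_atTop_atTop.atTop_add tendsto_const_nhds)
  have := (tendsto_const_nhds (x := 1 + deriv u y ^ 2)).div (h1.const_add 1) (by norm_num)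
  rw [add_zero, div_one] at this
  exact this

/-! ### Integrals over compact intervals depending on a parameter -/

theorem continuousOn_integral_param {a b : ℝ} (hab : a ≤ b) {φ : ℝ → ℝ → ℝ}
    (h : ContinuousOn (Function.uncurry φ) (Icc a b ×ˢ univ)) (c d : ℝ) :
    ContinuousOn (fun t => ∫ y in c..d, φ t y) (Icc a b) := by
  have h1 : Continuous (Function.uncurry fun t y => φ (projIcc a b hab t) y) := by
    rw [← continuousOn_univ]
    refine h.comp (f := fun q : ℝ × ℝ => ((projIcc a b hab q.1 : ℝ), q.2)) ?_ ?_
    · exact (((continuous_subtype_val.comp continuous_projIcc).comp continuous_fst).prodMk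
        continuous_snd).continuousOn
    · exact fun q _ => ⟨(projIcc a b hab q.1).2, mem_univ _⟩
  have h2 := intervalIntegral.continuous_parametric_intervalIntegral_of_continuous'
    (μ := volume) h1 c d
  refine h2.continuousOn.congr fun t ht => ?_
  simp only [projIcc_of_mem hab ht]

theorem hasDerivAt_integral_param {E : Type*} [NormedAddCommGroup E] [NormedSpace ℝ E]
    {a b : ℝ} {φ ψ : ℝ → ℝ → E}
    (hφ : ContinuousOn (Function.uncurry φ) (Icc a b ×ˢ univ))
    (hψ : ContinuousOn (Function.uncurry ψ) (Icc a b ×ˢ univ))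
    (hd : ∀ t ∈ Ioo a b, ∀ y, HasDerivAt (fun s => φ s y) (ψ t y) t) (c d : ℝ) {t : ℝ}
    (ht : t ∈ Ioo a b) :
    HasDerivAt (fun t => ∫ y in c..d, φ t y) (∫ y in c..d, ψ t y) t := by
  have slice : ∀ {χ : ℝ → ℝ → E}, ContinuousOn (Function.uncurry χ) (Icc a b ×ˢ univ) →
      ∀ s ∈ Icc a b, Continuous (χ s) := fun {χ} hχ s hs => by
    rw [← continuousOn_univ]
    exact hχ.comp (f := fun y : ℝ => (s, y)) (by fun_prop) fun y _ => ⟨hs, mem_univ _⟩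
  obtain ⟨M, hM⟩ : ∃ M, ∀ q ∈ Icc a b ×ˢ uIcc c d, ‖Function.uncurry ψ q‖ ≤ M :=
    (isCompact_Icc.prod isCompact_uIcc).exists_bound_of_continuousOn
      (hψ.mono (prod_mono Subset.rfl (subset_univ _)))
  refine (intervalIntegral.hasDerivAt_integral_of_dominated_loc_of_deriv_le (bound := fun _ => M)
    (s := Ioo a b) (Ioo_mem_nhds ht.1 ht.2) ?_ ?_ ?_ ?_ ?_ ?_).2
  · filter_upwards [Ioo_mem_nhds ht.1 ht.2] with s hs
    exact (slice hφ s (Ioo_subset_Icc_self hs)).aestronglyMeasurable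
  · exact (slice hφ t (Ioo_subset_Icc_self ht)).intervalIntegrable _ _
  · exact (slice hψ t (Ioo_subset_Icc_self ht)).aestronglyMeasurable
  · exact Eventually.of_forall fun y hy s hs =>
      hM (s, y) ⟨Ioo_subset_Icc_self hs, uIoc_subset_uIcc hy⟩
  · exact intervalIntegrable_const
  · exact Eventually.of_forall fun y _ s hs => hd s hs y

/-! ### Cutoffs -/

theorem exists_cutoff : ∃ (χ : ℝ → ℝ) (c : ℝ), ContDiff ℝ ∞ χ ∧ (∀ y, 0 ≤ χ y) ∧ (∀ y, χ y ≤ 1) ∧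
    (∀ y, |y| ≤ 1 → χ y = 1) ∧ (∀ y, 2 ≤ |y| → χ y = 0) ∧ 0 ≤ c ∧ ∀ y, |deriv χ y| ≤ c := by
  let χ : ContDiffBump (0 : ℝ) := ⟨1, 2, one_pos, one_lt_two⟩
  have hs : HasCompactSupport (deriv χ) := χ.hasCompactSupport.deriv
  obtain ⟨c, hc⟩ := hs.exists_bound_of_continuous (χ.contDiff.continuous_deriv (n := 1) le_rfl)
  refine ⟨χ, c, χ.contDiff, fun y => χ.nonneg, fun y => χ.le_one, fun y hy => ?_, fun y hy => ?_,
    (norm_nonneg _).trans (hc 0), hc⟩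
  · exact χ.one_of_mem_closedBall (by simpa using hy)
  · exact χ.zero_of_le_dist (by simpa using hy)

/-! ### The energy estimate -/

/-- The weighted square integral `∫ p |w|²`. -/
def wInt (p : ℝ → ℝ) (w : ℝ → ℂ) : ℝ≥0∞ := ∫⁻ y, ENNReal.ofReal (p y * ‖w y‖ ^ 2)

/-- This is the integrand left when `∂_y(w_y + E)` is tested with `p χ² w̄` and integrated by parts.
Of the two units of dissipation `p χ² |w_y|²`, one is kept and the other pays for every cross term,
including those in `p'` and `χ'`. -/
theorem energy_pointwise {U p p' χ χ' : ℝ} (hU : 1 ≤ U) (hp : 0 ≤ p) (hp' : |p'| ≤ 2 * U * p)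
    (hχ : 0 ≤ χ) (w wy E : ℂ) :
    -2 * (((p' * χ ^ 2 + p * (2 * χ * χ') : ℝ) * (starRingEnd ℂ) w
      + (p * χ ^ 2 : ℝ) * (starRingEnd ℂ) wy) * (wy + E)).re ≤
      -(p * χ ^ 2 * ‖wy‖ ^ 2) + 14 * U ^ 2 * (p * χ ^ 2 * (‖w‖ ^ 2 + ‖E‖ ^ 2))
        + 14 * (p * χ' ^ 2 * ‖w‖ ^ 2) := by
  set P' := p' * χ ^ 2 + p * (2 * χ * χ') with hP'
  have hP'le : |P'| ≤ 2 * U * p * χ ^ 2 + 2 * p * χ * |χ'| := by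
    refine (abs_add_le _ _).trans ?_
    rw [abs_mul, abs_mul, abs_mul, abs_mul, abs_of_nonneg hp, abs_of_nonneg hχ,
      abs_of_nonneg (sq_nonneg χ), abs_of_pos (two_pos : (0:ℝ) < 2)]
    nlinarith [mul_le_mul_of_nonneg_right hp' (sq_nonneg χ)]
  have e1 : (((P' : ℝ) * (starRingEnd ℂ) w + (p * χ ^ 2 : ℝ) * (starRingEnd ℂ) wy) * (wy + E)).re
      = P' * ((starRingEnd ℂ) w * (wy + E)).re + p * χ ^ 2 * ‖wy‖ ^ 2
        + p * χ ^ 2 * ((starRingEnd ℂ) wy * E).re := by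
    rw [← Complex.normSq_eq_norm_sq, Complex.normSq_apply]
    simp only [Complex.mul_re, Complex.add_re, Complex.add_im, Complex.mul_im, Complex.conj_re,
      Complex.conj_im, Complex.ofReal_re, Complex.ofReal_im]
    ring
  rw [e1]
  have h2 : |((starRingEnd ℂ) w * (wy + E)).re| ≤ ‖w‖ * (‖wy‖ + ‖E‖) := by
    refine (Complex.abs_re_le_norm _).trans ?_
    rw [norm_mul, Complex.norm_conj]
    gcongr; exact norm_add_le _ _
  have h3 : |((starRingEnd ℂ) wy * E).re| ≤ ‖wy‖ * ‖E‖ := by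
    refine (Complex.abs_re_le_norm _).trans ?_
    rw [norm_mul, Complex.norm_conj]
  have h4 : -(P' * ((starRingEnd ℂ) w * (wy + E)).re) ≤
      (2 * U * p * χ ^ 2 + 2 * p * χ * |χ'|) * (‖w‖ * (‖wy‖ + ‖E‖)) := by
    refine (neg_le_abs _).trans ?_
    rw [abs_mul]
    gcongr
  have h5 : -(p * χ ^ 2 * ((starRingEnd ℂ) wy * E).re) ≤ p * χ ^ 2 * (‖wy‖ * ‖E‖) := by
    rw [← mul_neg]
    exact mul_le_mul_of_nonneg_left ((neg_le_abs _).trans h3) (by positivity)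
  -- After division by `p`, all that remains is one quadratic inequality in `X = |w_y|`, `Y = |w|`,
  -- `Z = |E|`, `η = |χ'|`.
  have key : ∀ X Y Z η : ℝ, 0 ≤ X → 0 ≤ Y → 0 ≤ Z → 0 ≤ η →
      2 * (2 * U * χ ^ 2 + 2 * χ * η) * (Y * (X + Z)) - 2 * (χ ^ 2 * X ^ 2) + 2 * χ ^ 2 * (X * Z)
      ≤ -(χ ^ 2 * X ^ 2) + 14 * U ^ 2 * (χ ^ 2 * (Y ^ 2 + Z ^ 2)) + 14 * (η ^ 2 * Y ^ 2) := by
    intro X Y Z η hX hY hZ hη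
    have hUU : 1 ≤ U ^ 2 := by nlinarith
    have q : 0 ≤ (U ^ 2 - 1) * (χ ^ 2 * Z ^ 2) := by
      have : 0 ≤ U ^ 2 - 1 := by linarith
      positivity
    nlinarith [sq_nonneg (χ * X - 3 * (χ * Z)), sq_nonneg (χ * X - 6 * U * (χ * Y)),
      sq_nonneg (χ * X - 6 * (η * Y)), sq_nonneg (χ * Z - U * (χ * Y)),
      sq_nonneg (χ * Z - η * Y), q, sq_nonneg (χ * Z), sq_nonneg (χ * X)]
  have := mul_le_mul_of_nonneg_left (key ‖wy‖ ‖w‖ ‖E‖ |χ'| (norm_nonneg _) (norm_nonneg _)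
    (norm_nonneg _) (abs_nonneg _)) hp
  rw [sq_abs] at this
  linarith

/-- The transport term `-iuw` is skew, so it disappears from `Re(w_t w̄)`, and the flux integrates
by parts without boundary terms because `χ` vanishes at `±2R`. The correction `E` is kept under the
derivative together with `w_y`, so that only its size, and not its derivative, enters the estimate.
-/
theorem energy_cutoff_fixed_time {U ν L R : ℝ} (hU : 1 ≤ U) (hν : 0 ≤ ν) {p p' : ℝ → ℝ}
    (hp : IsWeight U p p') {u : ℝ → ℝ} {w wt wy E Z E0 : ℝ → ℂ} {S : ℝ → ℝ}
    {χ : ℝ → ℝ} (hχ : ContDiff ℝ ∞ χ) (hχ0 : ∀ y, 0 ≤ χ y) (hχ2 : ∀ y, 2 * R ≤ |y| → χ y = 0)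
    (hR : 0 < R)
    (cw : Continuous w) (cwy : Continuous wy) (cE : Continuous E)
    (cE0 : Continuous E0) (cZ : Continuous Z) (cS : Continuous S)
    (hy : ∀ y, HasDerivAt w (wy y) y) (hZ : ∀ y, HasDerivAt (fun y => wy y + E y) (Z y) y)
    (heq : ∀ y, wt y = -Complex.I * u y * w y + ν * Z y + E0 y)
    (hS : ∀ y, 2 * ‖E0 y‖ * ‖w y‖ + 14 * U ^ 2 * ν * (‖w y‖ ^ 2 + ‖E y‖ ^ 2)
      ≤ ‖w y‖ ^ 2 / (2 * L) + S y) :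
    ∫ y in (-(2 * R))..(2 * R), p y * χ y ^ 2 * (2 * (wt y * (starRingEnd ℂ) (w y)).re) ≤
      (∫ y in (-(2 * R))..(2 * R), (p y * χ y ^ 2 * (‖w y‖ ^ 2 / (2 * L) + S y)
        + 14 * ν * (p y * deriv χ y ^ 2 * ‖w y‖ ^ 2) - ν * (p y * χ y ^ 2 * ‖wy y‖ ^ 2))) := by
  have cp := hp.continuous
  have cχ := hχ.continuous
  have cχ' : Continuous (deriv χ) := hχ.continuous_deriv (by norm_cast)
  set P' : ℝ → ℝ := fun y => p' y * χ y ^ 2 + p y * (2 * χ y * deriv χ y) with hP'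
  have cP' : Continuous P' :=
    (hp.continuous'.mul (cχ.pow 2)).add (cp.mul ((continuous_const.mul cχ).mul cχ'))
  set A : ℝ → ℂ := fun y => ((P' y : ℝ) * (starRingEnd ℂ) (w y)
    + (p y * χ y ^ 2 : ℝ) * (starRingEnd ℂ) (wy y)) * (wy y + E y) with hA
  set B : ℝ → ℂ := fun y => ((p y * χ y ^ 2 : ℝ) * (starRingEnd ℂ) (w y)) * Z y with hB
  have cA : Continuous A := by
    have := Complex.continuous_conj; fun_prop
  have cB : Continuous B := by
    have := Complex.continuous_conj; fun_prop
  have hP : ∀ y, HasDerivAt (fun y => p y * χ y ^ 2) (P' y) y := fun y => by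
    have h1 := (hχ.differentiable (by norm_cast) y).hasDerivAt
    refine ((hp.hasDerivAt y).mul (h1.pow 2)).congr_deriv ?_
    simp [hP']
  have hder : ∀ y, HasDerivAt (fun y => ((p y * χ y ^ 2 : ℝ) * (starRingEnd ℂ) (w y))
      * (wy y + E y)) (A y + B y) y := fun y => by
    have h1 := (hP y).ofReal_comp
    have h2 : HasDerivAt (fun y => (starRingEnd ℂ) (w y)) ((starRingEnd ℂ) (wy y)) y :=
      (Complex.conjCLE.toContinuousLinearMap.hasFDerivAt.comp_hasDerivAt y (hy y))
    exact ((h1.mul h2).mul (hZ y)).congr_deriv (by simp [hA, hB])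
  have hint : ∫ y in (-(2 * R))..(2 * R), (A y + B y) = 0 := by
    rw [intervalIntegral.integral_eq_sub_of_hasDerivAt (fun y _ => hder y)
      ((cA.add cB).intervalIntegrable _ _)]
    rw [hχ2 (2 * R) (le_abs_self _), hχ2 (-(2 * R)) (by rw [abs_neg]; exact le_abs_self _)]
    simp
  have hre : ∫ y in (-(2 * R))..(2 * R), (A y + B y).re = 0 := by
    have cAB : Continuous fun y => A y + B y := by fun_prop
    have := (Complex.reCLM.intervalIntegral_comp_comm (cAB.intervalIntegrable (μ := volume)
      (-(2 * R)) (2 * R)))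
    simp only [Complex.reCLM_apply] at this
    rw [this]
    simp [hint]
  have hpt : ∀ y, p y * χ y ^ 2 * (2 * (wt y * (starRingEnd ℂ) (w y)).re)
      = 2 * ν * (A y + B y).re + (ν * (-2 * (A y).re)
        + p y * χ y ^ 2 * (2 * (E0 y * (starRingEnd ℂ) (w y)).re)) := fun y => by
    rw [heq]
    simp only [hB, Complex.add_re, Complex.mul_re, Complex.mul_im, Complex.add_im, Complex.neg_re,
      Complex.neg_im, Complex.I_re, Complex.I_im, Complex.ofReal_re, Complex.ofReal_im,
      Complex.conj_re, Complex.conj_im]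
    ring
  have cre : Continuous fun y => (A y + B y).re := Complex.continuous_re.comp (cA.add cB)
  have crest : Continuous fun y => (ν * (-2 * (A y).re)
        + p y * χ y ^ 2 * (2 * (E0 y * (starRingEnd ℂ) (w y)).re)) := by
    have := Complex.continuous_conj
    have := Complex.continuous_re
    fun_prop
  simp_rw [hpt]
  have cre2 : Continuous fun y => 2 * ν * (A y + B y).re := by fun_prop
  rw [intervalIntegral.integral_add (cre2.intervalIntegrable _ _)
    (crest.intervalIntegrable _ _), intervalIntegral.integral_const_mul, hre, mul_zero, zero_add]
  refine intervalIntegral.integral_mono (by linarith) (crest.intervalIntegrable _ _)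
    (Continuous.intervalIntegrable (by fun_prop) _ _) fun y => ?_
  have h1 := energy_pointwise (χ' := deriv χ y) hU (hp.pos y).le (hp.bound y) (hχ0 y)
    (w y) (wy y) (E y)
  have h1' := mul_le_mul_of_nonneg_left h1 hν
  have h2 : (E0 y * (starRingEnd ℂ) (w y)).re ≤ ‖E0 y‖ * ‖w y‖ := by
    refine (Complex.re_le_norm _).trans ?_
    rw [norm_mul, Complex.norm_conj]
  have hP0 : 0 ≤ p y * χ y ^ 2 := mul_nonneg (hp.pos y).le (sq_nonneg _)
  have h3 := mul_le_mul_of_nonneg_left h2 hP0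
  have h4 := mul_le_mul_of_nonneg_left (hS y) hP0
  simp only [hA, hP']
  linarith

theorem slice_continuous {X : Type*} [TopologicalSpace X] {a b : ℝ} {φ : ℝ → ℝ → X}
    (h : ContinuousOn (Function.uncurry φ) (Icc a b ×ˢ univ)) {t : ℝ} (ht : t ∈ Icc a b) :
    Continuous (φ t) := by
  rw [← continuousOn_univ]
  exact h.comp (f := fun y : ℝ => (t, y)) (by fun_prop) fun y _ => ⟨ht, mem_univ _⟩

theorem continuousOn_snd_comp {X : Type*} [TopologicalSpace X] {φ : ℝ → X} (h : Continuous φ)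
    (s : Set (ℝ × ℝ)) : ContinuousOn (fun q : ℝ × ℝ => φ q.2) s :=
  (h.comp continuous_snd).continuousOn

theorem continuousOn_integral_weight {a b : ℝ} (hab : a ≤ b) {q : ℝ → ℝ} (cq : Continuous q)
    {φ : ℝ → ℝ → ℝ} (h : ContinuousOn (Function.uncurry φ) (Icc a b ×ˢ univ)) (c d : ℝ) :
    ContinuousOn (fun t => ∫ y in c..d, q y * φ t y) (Icc a b) :=
  continuousOn_integral_param (φ := fun t y => q y * φ t y) hab
    ((continuousOn_snd_comp cq _).mul h) c d

theorem continuousOn_norm_sq {a b : ℝ} {w : ℝ → ℝ → ℂ}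
    (h : ContinuousOn (Function.uncurry w) (Icc a b ×ˢ univ)) :
    ContinuousOn (Function.uncurry fun t y => ‖w t y‖ ^ 2) (Icc a b ×ˢ univ) :=
  h.norm.pow 2

/-- The hypothesis `hS` says that all lower order terms cost at most `|w|²/(2(b - a))` besides the
source `S`. Integrated over the whole interval this is at most half the maximal energy and can be
absorbed, which replaces Gronwall's inequality and yields the factor 2. -/
theorem energy_cutoff {U ν a b R : ℝ} (hU : 1 ≤ U) (hν : 0 ≤ ν) (hab : a < b) {p p' : ℝ → ℝ}
    (hp : IsWeight U p p') {u : ℝ → ℝ} {w wt wy E Z E0 : ℝ → ℝ → ℂ} {S : ℝ → ℝ → ℝ}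
    {χ : ℝ → ℝ} (hχ : ContDiff ℝ ∞ χ) (hχ0 : ∀ y, 0 ≤ χ y) (hχ2 : ∀ y, 2 * R ≤ |y| → χ y = 0)
    (hR : 0 < R)
    (cw : ContinuousOn (Function.uncurry w) (Icc a b ×ˢ univ))
    (cwt : ContinuousOn (Function.uncurry wt) (Icc a b ×ˢ univ))
    (cwy : ContinuousOn (Function.uncurry wy) (Icc a b ×ˢ univ))
    (cE : ∀ t ∈ Icc a b, Continuous (E t)) (cE0 : ∀ t ∈ Icc a b, Continuous (E0 t))
    (cZ : ∀ t ∈ Icc a b, Continuous (Z t))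
    (cS : ContinuousOn (Function.uncurry S) (Icc a b ×ˢ univ))
    (hy : ∀ t ∈ Icc a b, ∀ y, HasDerivAt (w t) (wy t y) y)
    (hZ : ∀ t ∈ Icc a b, ∀ y, HasDerivAt (fun y => wy t y + E t y) (Z t y) y)
    (ht : ∀ t ∈ Ioo a b, ∀ y, HasDerivAt (fun s => w s y) (wt t y) t)
    (heq : ∀ t ∈ Icc a b, ∀ y, wt t y = -Complex.I * u y * w t y + ν * Z t y + E0 t y)
    (hS0 : ∀ t y, 0 ≤ S t y)
    (hS : ∀ t ∈ Icc a b, ∀ y, 2 * ‖E0 t y‖ * ‖w t y‖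
      + 14 * U ^ 2 * ν * (‖w t y‖ ^ 2 + ‖E t y‖ ^ 2) ≤ ‖w t y‖ ^ 2 / (2 * (b - a)) + S t y) :
    let e := fun t => ∫ y in (-(2 * R))..(2 * R), p y * χ y ^ 2 * ‖w t y‖ ^ 2
    let σ := ∫ t in a..b, ((∫ y in (-(2 * R))..(2 * R), p y * χ y ^ 2 * S t y)
      + 14 * ν * ∫ y in (-(2 * R))..(2 * R), p y * deriv χ y ^ 2 * ‖w t y‖ ^ 2)
    (∀ t ∈ Icc a b, e t ≤ 2 * (e a + σ)) ∧
      ν * (∫ t in a..b, ∫ y in (-(2 * R))..(2 * R), p y * χ y ^ 2 * ‖wy t y‖ ^ 2)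
        ≤ 2 * (e a + σ) := by
  intro e σ
  have cp := hp.continuous
  have cχ := hχ.continuous
  have cχ' : Continuous (deriv χ) := hχ.continuous_deriv (by norm_cast)
  have cpχ : Continuous fun y => p y * χ y ^ 2 := by fun_prop
  have cpχ' : Continuous fun y => p y * deriv χ y ^ 2 := by fun_prop
  have hL : 0 < b - a := sub_pos.2 hab
  set d := fun t => ∫ y in (-(2 * R))..(2 * R), p y * χ y ^ 2 * ‖wy t y‖ ^ 2 with hd
  set s := fun t => ∫ y in (-(2 * R))..(2 * R), p y * χ y ^ 2 * S t y with hs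
  set g := fun t => ∫ y in (-(2 * R))..(2 * R), p y * deriv χ y ^ 2 * ‖w t y‖ ^ 2 with hg
  set e' := fun t => ∫ y in (-(2 * R))..(2 * R),
    p y * χ y ^ 2 * (2 * (wt t y * (starRingEnd ℂ) (w t y)).re) with he'
  have ce0 : ContinuousOn (Function.uncurry fun t y => p y * χ y ^ 2 * ‖w t y‖ ^ 2)
      (Icc a b ×ˢ univ) := (continuousOn_snd_comp cpχ _).mul (cw.norm.pow 2)
  have ce'0 : ContinuousOn (Function.uncurry fun t y => p y * χ y ^ 2 *
      (2 * (wt t y * (starRingEnd ℂ) (w t y)).re)) (Icc a b ×ˢ univ) :=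
    (continuousOn_snd_comp cpχ _).mul (continuousOn_const.mul
      (Complex.continuous_re.comp_continuousOn (cwt.mul
        (Complex.continuous_conj.comp_continuousOn cw))))
  have ce : ContinuousOn e (Icc a b) := continuousOn_integral_param hab.le ce0 _ _
  have ce' : ContinuousOn e' (Icc a b) := continuousOn_integral_param hab.le ce'0 _ _
  have cd : ContinuousOn d (Icc a b) := continuousOn_integral_weight hab.le cpχ (continuousOn_norm_sq cwy) _ _
  have cs : ContinuousOn s (Icc a b) := continuousOn_integral_weight hab.le cpχ cS _ _
  have cg : ContinuousOn g (Icc a b) := continuousOn_integral_weight hab.le cpχ' (continuousOn_norm_sq cw) _ _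
  have hR2 : -(2 * R) ≤ 2 * R := by linarith
  have hd0 : ∀ t, 0 ≤ d t := fun t => intervalIntegral.integral_nonneg hR2 fun y _ =>
    mul_nonneg (mul_nonneg (hp.pos y).le (sq_nonneg _)) (sq_nonneg _)
  have hs0 : ∀ t, 0 ≤ s t := fun t => intervalIntegral.integral_nonneg hR2 fun y _ =>
    mul_nonneg (mul_nonneg (hp.pos y).le (sq_nonneg _)) (hS0 _ _)
  have hg0 : ∀ t, 0 ≤ g t := fun t => intervalIntegral.integral_nonneg hR2 fun y _ =>
    mul_nonneg (mul_nonneg (hp.pos y).le (sq_nonneg _)) (sq_nonneg _)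
  have he0 : ∀ t, 0 ≤ e t := fun t => intervalIntegral.integral_nonneg hR2 fun y _ =>
    mul_nonneg (mul_nonneg (hp.pos y).le (sq_nonneg _)) (sq_nonneg _)
  have hder : ∀ t ∈ Ioo a b, HasDerivAt e (e' t) t := fun t h =>
    hasDerivAt_integral_param ce0 ce'0 (fun r hr y => by
      have h1 := ht r hr y
      have h2 : HasDerivAt (fun s => ‖w s y‖ ^ 2) (2 * (wt r y * (starRingEnd ℂ) (w r y)).re) r := by
        refine h1.norm_sq.congr_deriv ?_
        simp only [Complex.inner]
      exact h2.const_mul _) _ _ h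
  have hle : ∀ t ∈ Icc a b, e' t ≤ e t / (2 * (b - a)) + s t + 14 * ν * g t - ν * d t := by
    intro t h
    have h1 := energy_cutoff_fixed_time (u := u) (L := b - a) hU hν hp hχ hχ0 hχ2 hR
      (slice_continuous cw h)
      (slice_continuous cwy h) (cE t h) (cE0 t h) (cZ t h)
      (slice_continuous cS h) (hy t h) (hZ t h) (heq t h) (hS t h)
    refine h1.trans (le_of_eq ?_)
    have cw' := slice_continuous cw h
    have cwy' := slice_continuous cwy h
    have cS' := slice_continuous cS h
    have i1 : IntervalIntegrable (fun y => p y * χ y ^ 2 * ‖w t y‖ ^ 2) volume (-(2 * R)) (2 * R) :=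
      Continuous.intervalIntegrable (by fun_prop) _ _
    have i2 : IntervalIntegrable (fun y => p y * χ y ^ 2 * S t y) volume (-(2 * R)) (2 * R) :=
      Continuous.intervalIntegrable (by fun_prop) _ _
    have i3 : IntervalIntegrable (fun y => p y * deriv χ y ^ 2 * ‖w t y‖ ^ 2) volume
      (-(2 * R)) (2 * R) := Continuous.intervalIntegrable (by fun_prop) _ _
    have i4 : IntervalIntegrable (fun y => p y * χ y ^ 2 * ‖wy t y‖ ^ 2) volume
      (-(2 * R)) (2 * R) := Continuous.intervalIntegrable (by fun_prop) _ _
    simp only [e, hd, hs, hg]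
    rw [div_eq_inv_mul, ← intervalIntegral.integral_const_mul, ← intervalIntegral.integral_const_mul,
      ← intervalIntegral.integral_const_mul, ← intervalIntegral.integral_add (i1.const_mul _) i2,
      ← intervalIntegral.integral_add ((i1.const_mul _).add i2) (i3.const_mul _),
      ← intervalIntegral.integral_sub (((i1.const_mul _).add i2).add (i3.const_mul _))
        (i4.const_mul _)]
    refine intervalIntegral.integral_congr fun y _ => ?_
    ring
  have ii : ∀ {φ : ℝ → ℝ}, ContinuousOn φ (Icc a b) → ∀ t ∈ Icc a b,
      IntervalIntegrable φ volume a t := fun hφ t h =>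
    (hφ.mono (by rw [uIcc_of_le h.1]; exact Icc_subset_Icc_right h.2)).intervalIntegrable
  -- At the time `m` of maximal energy, `main` bounds `e m` by half of itself plus the data.
  obtain ⟨m, hm, hmax⟩ := isCompact_Icc.exists_isMaxOn (nonempty_Icc.2 hab.le) ce
  have main : ∀ t ∈ Icc a b, e t + ν * ∫ r in a..t, d r ≤ e a + e m / 2 + σ := by
    intro t h
    have h1 : ∫ r in a..t, e' r = e t - e a :=
      intervalIntegral.integral_eq_sub_of_hasDerivAt_of_le h.1
        (ce.mono (Icc_subset_Icc_right h.2))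
        (fun r hr => hder r ⟨hr.1, hr.2.trans_le h.2⟩) (ii ce' t h)
    have h2 : ∫ r in a..t, e' r ≤ ∫ r in a..t, (e m / (2 * (b - a)) + (s r + 14 * ν * g r)
        - ν * d r) := by
      refine intervalIntegral.integral_mono_on h.1 (ii ce' t h)
        (((intervalIntegrable_const).add ((ii cs t h).add ((ii cg t h).const_mul _))).sub
          ((ii cd t h).const_mul _)) fun r hr => ?_
      have hr' : r ∈ Icc a b := ⟨hr.1, hr.2.trans h.2⟩
      have h3 := hle r hr'
      have h4 : e r / (2 * (b - a)) ≤ e m / (2 * (b - a)) := by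
        have := hmax hr'
        simp only [mem_ofPred_eq] at this
        gcongr
      linarith
    rw [intervalIntegral.integral_sub ((intervalIntegrable_const).add
        ((ii cs t h).add ((ii cg t h).const_mul _))) ((ii cd t h).const_mul _),
      intervalIntegral.integral_add intervalIntegrable_const
        ((ii cs t h).add ((ii cg t h).const_mul _)), intervalIntegral.integral_const,
      intervalIntegral.integral_const_mul, h1] at h2
    have h5 : ∫ r in a..t, (s r + 14 * ν * g r) ≤ σ := by
      refine intervalIntegral.integral_mono_interval le_rfl h.1 h.2
        (Eventually.of_forall fun r => ?_) ((ii cs b ⟨hab.le, le_rfl⟩).add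
          ((ii cg b ⟨hab.le, le_rfl⟩).const_mul _))
      have := hs0 r
      have := hg0 r
      simp only [Pi.zero_apply]
      positivity
    have h6 : (t - a) • (e m / (2 * (b - a))) ≤ e m / 2 := by
      rw [smul_eq_mul, mul_div_assoc', div_le_div_iff₀ (by positivity) (by positivity)]
      nlinarith [h.2, he0 m, mul_nonneg (he0 m) (sub_nonneg.2 h.2)]
    linarith
  have hmm : e m ≤ 2 * (e a + σ) := by
    have := main m hm
    have h2 : 0 ≤ ν * ∫ r in a..m, d r :=
      mul_nonneg hν (intervalIntegral.integral_nonneg hm.1 fun r _ => hd0 r)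
    linarith
  refine ⟨fun t h => (hmax h).trans hmm, ?_⟩
  have := main b ⟨hab.le, le_rfl⟩
  have h2 := he0 b
  have h3 : e a ≤ e m := hmax ⟨le_rfl, hab.le⟩
  linarith

/-! ### Removal of the cutoff -/

theorem ofReal_integral_cutoff {R : ℝ} {φ : ℝ → ℝ} (hc : Continuous φ)
    (h0 : ∀ y, 0 ≤ φ y) (h2 : ∀ y, 2 * R ≤ |y| → φ y = 0) :
    ENNReal.ofReal (∫ y in (-(2 * R))..(2 * R), φ y) = ∫⁻ y, ENNReal.ofReal (φ y) := by
  have hsup : Function.support φ ⊆ Ioo (-(2 * R)) (2 * R) := fun y hy => by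
    by_contra hcon
    refine hy (h2 y ?_)
    by_contra hlt
    exact hcon (abs_lt.1 (not_le.1 hlt))
  rw [intervalIntegral.integral_eq_integral_of_support_subset (hsup.trans Ioo_subset_Ioc_self)]
  refine ofReal_integral_eq_lintegral_ofReal ?_ (Eventually.of_forall h0)
  refine hc.integrable_of_hasCompactSupport ?_
  exact HasCompactSupport.of_support_subset_isCompact isCompact_Icc
    (hsup.trans Ioo_subset_Icc_self)

theorem ofReal_integral_Icc {a b : ℝ} (hab : a ≤ b) {φ : ℝ → ℝ} (hc : ContinuousOn φ (Icc a b))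
    (h0 : ∀ y, 0 ≤ φ y) :
    ENNReal.ofReal (∫ y in a..b, φ y) = ∫⁻ y in Icc a b, ENNReal.ofReal (φ y) := by
  rw [intervalIntegral.integral_of_le hab, ← integral_Icc_eq_integral_Ioc]
  exact ofReal_integral_eq_lintegral_ofReal hc.integrableOn_Icc (Eventually.of_forall h0)

/-- The cutoff at scale `n + 1`. -/
def scaleCut (χ : ℝ → ℝ) (n : ℕ) (y : ℝ) : ℝ := χ (y / (n + 1))

theorem wInt_le_liminf {χ p : ℝ → ℝ} {w : ℝ → ℂ} (cχ : Continuous χ)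
    (h1 : ∀ y, |y| ≤ 1 → χ y = 1) (h2 : ∀ y, 2 ≤ |y| → χ y = 0) (cp : Continuous p)
    (hp : ∀ y, 0 ≤ p y) (cw : Continuous w) :
    wInt p w ≤ liminf (fun n : ℕ => ENNReal.ofReal
      (∫ y in (-(2 * ((n : ℝ) + 1)))..(2 * ((n : ℝ) + 1)),
        p y * scaleCut χ n y ^ 2 * ‖w y‖ ^ 2)) atTop := by
  have cs : ∀ n, Continuous (scaleCut χ n) := fun n => cχ.comp (continuous_id.div_const _)
  have e : ∀ n : ℕ, ENNReal.ofReal (∫ y in (-(2 * ((n : ℝ) + 1)))..(2 * ((n : ℝ) + 1)),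
        p y * scaleCut χ n y ^ 2 * ‖w y‖ ^ 2)
      = ∫⁻ y, ENNReal.ofReal (p y * scaleCut χ n y ^ 2 * ‖w y‖ ^ 2) := fun n => by
    have := cs n
    refine ofReal_integral_cutoff (by fun_prop) (fun y => ?_) fun y hy => ?_
    · have := hp y; positivity
    · rw [scaleCut, h2, zero_pow two_ne_zero, mul_zero, zero_mul]
      rw [abs_div, abs_of_pos (by positivity : (0:ℝ) < n + 1), le_div_iff₀ (by positivity)]
      exact hy
  simp_rw [e]
  refine le_trans (lintegral_mono fun y => ?_) (lintegral_liminf_le fun n => ?_)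
  · refine le_of_eq (Tendsto.liminf_eq ?_).symm
    refine tendsto_const_nhds.congr' ?_
    filter_upwards [eventually_ge_atTop ⌈|y|⌉₊] with n hn
    rw [scaleCut, h1, one_pow, mul_one]
    rw [abs_div, abs_of_pos (by positivity : (0:ℝ) < n + 1), div_le_one (by positivity)]
    have := (Nat.ceil_le.1 hn)
    linarith
  · have := cs n
    exact (Continuous.measurable (by fun_prop)).ennreal_ofReal

/-- The cutoff at scale `n + 1` costs `14ν(c/(n+1))²` times the integral of the energy. The
finiteness `hfin` is used only to send this error to 0 and leaves no trace in the bound; Fatou's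
lemma recovers the uncut energy and dissipation. -/
theorem energy_estimate {U ν a b : ℝ} (hU : 1 ≤ U) (hν : 0 ≤ ν) (hab : a < b) {p p' : ℝ → ℝ}
    (hp : IsWeight U p p') {u : ℝ → ℝ} {w wt wy E Z E0 : ℝ → ℝ → ℂ} {S : ℝ → ℝ → ℝ}
    (cw : ContinuousOn (Function.uncurry w) (Icc a b ×ˢ univ))
    (cwt : ContinuousOn (Function.uncurry wt) (Icc a b ×ˢ univ))
    (cwy : ContinuousOn (Function.uncurry wy) (Icc a b ×ˢ univ))
    (cE : ∀ t ∈ Icc a b, Continuous (E t)) (cE0 : ∀ t ∈ Icc a b, Continuous (E0 t))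
    (cZ : ∀ t ∈ Icc a b, Continuous (Z t))
    (cS : ContinuousOn (Function.uncurry S) (Icc a b ×ˢ univ))
    (hy : ∀ t ∈ Icc a b, ∀ y, HasDerivAt (w t) (wy t y) y)
    (hZ : ∀ t ∈ Icc a b, ∀ y, HasDerivAt (fun y => wy t y + E t y) (Z t y) y)
    (ht : ∀ t ∈ Ioo a b, ∀ y, HasDerivAt (fun s => w s y) (wt t y) t)
    (heq : ∀ t ∈ Icc a b, ∀ y, wt t y = -Complex.I * u y * w t y + ν * Z t y + E0 t y)
    (hS0 : ∀ t y, 0 ≤ S t y)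
    (hS : ∀ t ∈ Icc a b, ∀ y, 2 * ‖E0 t y‖ * ‖w t y‖
      + 14 * U ^ 2 * ν * (‖w t y‖ ^ 2 + ‖E t y‖ ^ 2) ≤ ‖w t y‖ ^ 2 / (2 * (b - a)) + S t y)
    (hfin : ∫⁻ t in Icc a b, wInt p (w t) ≠ ⊤) :
    (∀ t ∈ Icc a b, wInt p (w t) ≤
      2 * (wInt p (w a) + ∫⁻ t in Icc a b, ∫⁻ y, ENNReal.ofReal (p y * S t y))) ∧
    ENNReal.ofReal ν * ∫⁻ t in Icc a b, wInt p (wy t) ≤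
      2 * (wInt p (w a) + ∫⁻ t in Icc a b, ∫⁻ y, ENNReal.ofReal (p y * S t y)) := by
  obtain ⟨χ, c, hχ, hχ0, hχle, hχ1, hχ2, hc, hχ'⟩ := exists_cutoff
  have cp := hp.continuous
  have hp0 := fun y => (hp.pos y).le
  set X := wInt p (w a) + ∫⁻ t in Icc a b, ∫⁻ y, ENNReal.ofReal (p y * S t y) with hX
  have cut_smooth : ∀ n, ContDiff ℝ ∞ (scaleCut χ n) := fun n =>
    hχ.comp (contDiff_id.div_const _)
  have cut_zero : ∀ (n : ℕ) (y : ℝ), 2 * ((n : ℝ) + 1) ≤ |y| → scaleCut χ n y = 0 := fun n y hy => by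
    refine hχ2 _ ?_
    rw [abs_div, abs_of_pos (by positivity : (0:ℝ) < n + 1), le_div_iff₀ (by positivity)]
    exact hy
  have cut_deriv : ∀ (n : ℕ) (y : ℝ), deriv (scaleCut χ n) y ^ 2 ≤ (c / (n + 1)) ^ 2 := fun n y => by
    have h1 : HasDerivAt (scaleCut χ n) (deriv χ (y / (n + 1)) * (1 / (n + 1))) y :=
      ((hχ.differentiable (by norm_cast) _).hasDerivAt).comp y ((hasDerivAt_id y).div_const _)
    rw [h1.deriv, ← sq_abs, abs_mul, abs_of_nonneg (by positivity : (0:ℝ) ≤ 1 / (n + 1)),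
      mul_one_div]
    gcongr
    exact hχ' _
  have cut_le : ∀ (n : ℕ) (y : ℝ), scaleCut χ n y ^ 2 ≤ 1 := fun n y =>
    pow_le_one₀ (hχ0 _) (hχle _)
  set er : ℕ → ℝ≥0∞ := fun n => ENNReal.ofReal (14 * ν * (c / (n + 1)) ^ 2) *
    ∫⁻ t in Icc a b, wInt p (w t) with her
  have her0 : Tendsto er atTop (𝓝 0) := by
    have h1 : Tendsto (fun n : ℕ => 14 * ν * (c / ((n : ℝ) + 1)) ^ 2) atTop (𝓝 0) := by
      have : Tendsto (fun n : ℕ => c / ((n : ℝ) + 1)) atTop (𝓝 0) :=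
        tendsto_const_nhds.div_atTop (tendsto_natCast_atTop_atTop.atTop_add tendsto_const_nhds)
      have h := ((this.pow 2).const_mul (14 * ν))
      simpa using h
    have h2 := ENNReal.tendsto_ofReal h1
    rw [ENNReal.ofReal_zero] at h2
    simpa using ENNReal.Tendsto.mul_const h2 (Or.inr hfin)
  have hlim : Tendsto (fun n => 2 * (X + er n)) atTop (𝓝 (2 * X)) := by
    have := ENNReal.Tendsto.const_mul (her0.const_add X) (Or.inr (ENNReal.ofNat_ne_top (n := 2)))
    simpa using this
  have step : ∀ n : ℕ,
      let e := fun t => ∫ y in (-(2 * ((n : ℝ) + 1)))..(2 * ((n : ℝ) + 1)),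
        p y * scaleCut χ n y ^ 2 * ‖w t y‖ ^ 2
      (∀ t ∈ Icc a b, ENNReal.ofReal (e t) ≤ 2 * (X + er n)) ∧
      ENNReal.ofReal ν * ∫⁻ t in Icc a b, ENNReal.ofReal
        (∫ y in (-(2 * ((n : ℝ) + 1)))..(2 * ((n : ℝ) + 1)),
          p y * scaleCut χ n y ^ 2 * ‖wy t y‖ ^ 2) ≤ 2 * (X + er n) := by
    intro n e
    have hR : (0 : ℝ) < (n : ℝ) + 1 := by positivity
    have hR2 : -(2 * ((n : ℝ) + 1)) ≤ 2 * ((n : ℝ) + 1) := by linarith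
    obtain ⟨k1, k2⟩ := energy_cutoff (R := (n : ℝ) + 1) hU hν hab hp (cut_smooth n)
      (fun y => hχ0 _) (cut_zero n) hR cw cwt cwy cE cE0 cZ cS hy hZ ht heq hS0 hS
    have cc := (cut_smooth n).continuous
    have cc' : Continuous (deriv (scaleCut χ n)) := (cut_smooth n).continuous_deriv (by norm_cast)
    have cpχ : Continuous fun y => p y * scaleCut χ n y ^ 2 := by fun_prop
    have cpχ' : Continuous fun y => p y * deriv (scaleCut χ n) y ^ 2 := by fun_prop
    have cs := continuousOn_integral_weight hab.le cpχ cS (-(2 * ((n : ℝ) + 1))) (2 * ((n : ℝ) + 1))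
    have cg := continuousOn_integral_weight hab.le cpχ' (continuousOn_norm_sq cw) (-(2 * ((n : ℝ) + 1))) (2 * ((n : ℝ) + 1))
    have cd := continuousOn_integral_weight hab.le cpχ (continuousOn_norm_sq cwy) (-(2 * ((n : ℝ) + 1))) (2 * ((n : ℝ) + 1))
    have hs0 : ∀ t, 0 ≤ ∫ y in (-(2 * ((n : ℝ) + 1)))..(2 * ((n : ℝ) + 1)),
        p y * scaleCut χ n y ^ 2 * S t y := fun t =>
      intervalIntegral.integral_nonneg hR2 fun y _ =>
        mul_nonneg (mul_nonneg (hp0 y) (sq_nonneg _)) (hS0 _ _)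
    have hg0 : ∀ t, 0 ≤ ∫ y in (-(2 * ((n : ℝ) + 1)))..(2 * ((n : ℝ) + 1)),
        p y * deriv (scaleCut χ n) y ^ 2 * ‖w t y‖ ^ 2 := fun t =>
      intervalIntegral.integral_nonneg hR2 fun y _ =>
        mul_nonneg (mul_nonneg (hp0 y) (sq_nonneg _)) (sq_nonneg _)
    have he0 : 0 ≤ e a := intervalIntegral.integral_nonneg hR2 fun y _ =>
      mul_nonneg (mul_nonneg (hp0 y) (sq_nonneg _)) (sq_nonneg _)
    have bound : ENNReal.ofReal (2 * (e a + ∫ t in a..b,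
        ((∫ y in (-(2 * ((n : ℝ) + 1)))..(2 * ((n : ℝ) + 1)), p y * scaleCut χ n y ^ 2 * S t y)
        + 14 * ν * ∫ y in (-(2 * ((n : ℝ) + 1)))..(2 * ((n : ℝ) + 1)),
          p y * deriv (scaleCut χ n) y ^ 2 * ‖w t y‖ ^ 2))) ≤ 2 * (X + er n) := by
      have hσ0 : ∀ t, 0 ≤ (∫ y in (-(2 * ((n : ℝ) + 1)))..(2 * ((n : ℝ) + 1)),
          p y * scaleCut χ n y ^ 2 * S t y)
        + 14 * ν * ∫ y in (-(2 * ((n : ℝ) + 1)))..(2 * ((n : ℝ) + 1)),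
          p y * deriv (scaleCut χ n) y ^ 2 * ‖w t y‖ ^ 2 := fun t => by
        have := hs0 t
        have := hg0 t
        positivity
      rw [ENNReal.ofReal_mul (by norm_num), ENNReal.ofReal_ofNat, ENNReal.ofReal_add he0
        (intervalIntegral.integral_nonneg hab.le fun t _ => hσ0 t), hX, add_assoc]
      gcongr
      · have : Continuous (w a) := slice_continuous cw ⟨le_rfl, hab.le⟩
        rw [ofReal_integral_cutoff (by fun_prop)
          (fun y => mul_nonneg (mul_nonneg (hp0 y) (sq_nonneg _)) (sq_nonneg _))
          (fun y hy => by rw [cut_zero n y hy]; simp)]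
        refine lintegral_mono fun y => ENNReal.ofReal_le_ofReal ?_
        have := mul_le_mul_of_nonneg_right (mul_le_of_le_one_right (hp0 y) (cut_le n y))
          (sq_nonneg ‖w a y‖)
        exact this
      · have csum : ContinuousOn (fun t => (∫ y in (-(2 * ((n : ℝ) + 1)))..(2 * ((n : ℝ) + 1)),
            p y * scaleCut χ n y ^ 2 * S t y)
          + 14 * ν * ∫ y in (-(2 * ((n : ℝ) + 1)))..(2 * ((n : ℝ) + 1)),
            p y * deriv (scaleCut χ n) y ^ 2 * ‖w t y‖ ^ 2) (Icc a b) :=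
          cs.add (continuousOn_const.mul cg)
        rw [ofReal_integral_Icc hab.le csum hσ0]
        simp only [her]
        rw [← lintegral_const_mul' _ _ ENNReal.ofReal_ne_top]
        have e1 : ∀ t, ENNReal.ofReal ((∫ y in (-(2 * ((n : ℝ) + 1)))..(2 * ((n : ℝ) + 1)),
            p y * scaleCut χ n y ^ 2 * S t y)
          + 14 * ν * ∫ y in (-(2 * ((n : ℝ) + 1)))..(2 * ((n : ℝ) + 1)),
            p y * deriv (scaleCut χ n) y ^ 2 * ‖w t y‖ ^ 2) =
            ENNReal.ofReal (∫ y in (-(2 * ((n : ℝ) + 1)))..(2 * ((n : ℝ) + 1)),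
              p y * scaleCut χ n y ^ 2 * S t y) +
            ENNReal.ofReal (14 * ν * ∫ y in (-(2 * ((n : ℝ) + 1)))..(2 * ((n : ℝ) + 1)),
            p y * deriv (scaleCut χ n) y ^ 2 * ‖w t y‖ ^ 2) := fun t =>
          ENNReal.ofReal_add (hs0 t) (mul_nonneg (by positivity) (hg0 t))
        simp_rw [e1]
        rw [lintegral_add_left' (cs.aemeasurable measurableSet_Icc).ennreal_ofReal]
        refine add_le_add (setLIntegral_mono' measurableSet_Icc fun t h => ?_)
          (setLIntegral_mono' measurableSet_Icc fun t h => ?_)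
        · have : Continuous (S t) := slice_continuous cS h
          rw [ofReal_integral_cutoff (by fun_prop)
            (fun y => mul_nonneg (mul_nonneg (hp0 y) (sq_nonneg _)) (hS0 _ _))
            (fun y hy => by rw [cut_zero n y hy]; simp)]
          refine lintegral_mono fun y => ENNReal.ofReal_le_ofReal ?_
          exact mul_le_mul_of_nonneg_right (mul_le_of_le_one_right (hp0 y) (cut_le n y)) (hS0 t y)
        · have hw : Continuous (w t) := slice_continuous cw h
          have e2 : 14 * ν * ∫ y in (-(2 * ((n : ℝ) + 1)))..(2 * ((n : ℝ) + 1)),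
              p y * deriv (scaleCut χ n) y ^ 2 * ‖w t y‖ ^ 2 ≤ 14 * ν * (c / (n + 1)) ^ 2 *
              ∫ y in (-(2 * ((n : ℝ) + 1)))..(2 * ((n : ℝ) + 1)), p y * ‖w t y‖ ^ 2 := by
            rw [mul_assoc (14 * ν)]
            refine mul_le_mul_of_nonneg_left ?_ (by positivity)
            rw [← intervalIntegral.integral_const_mul]
            refine intervalIntegral.integral_mono hR2
              (Continuous.intervalIntegrable (by fun_prop) _ _)
              (Continuous.intervalIntegrable (by fun_prop) _ _) fun y => ?_
            have h1 := mul_le_mul_of_nonneg_left (cut_deriv n y)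
              (mul_nonneg (hp0 y) (sq_nonneg ‖w t y‖))
            simp only
            linarith
          refine (ENNReal.ofReal_le_ofReal e2).trans ?_
          rw [ENNReal.ofReal_mul (by positivity)]
          gcongr
          rw [intervalIntegral.integral_of_le hR2, ofReal_integral_eq_lintegral_ofReal]
          · exact setLIntegral_le_lintegral _ _
          · have : Continuous fun y => p y * ‖w t y‖ ^ 2 := by fun_prop
            exact (this.intervalIntegrable _ _).1
          · exact Eventually.of_forall fun y => mul_nonneg (hp0 y) (sq_nonneg _)
    refine ⟨fun t h => (ENNReal.ofReal_le_ofReal (k1 t h)).trans bound, ?_⟩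
    rw [← ofReal_integral_Icc hab.le cd (fun t => intervalIntegral.integral_nonneg hR2 fun y _ =>
        mul_nonneg (mul_nonneg (hp0 y) (sq_nonneg _)) (sq_nonneg _)), ← ENNReal.ofReal_mul hν]
    exact (ENNReal.ofReal_le_ofReal k2).trans bound
  constructor
  · intro t h
    refine (wInt_le_liminf hχ.continuous hχ1 hχ2 cp hp0 (slice_continuous cw h)).trans ?_
    rw [← hlim.liminf_eq]
    exact liminf_le_liminf (Eventually.of_forall fun n => (step n).1 t h)
  · rw [← hlim.liminf_eq]
    refine le_trans ?_ (liminf_le_liminf (Eventually.of_forall fun n => (step n).2))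
    have h1 : ∫⁻ t in Icc a b, wInt p (wy t) ≤ liminf (fun n : ℕ => ∫⁻ t in Icc a b,
        ENNReal.ofReal (∫ y in (-(2 * ((n : ℝ) + 1)))..(2 * ((n : ℝ) + 1)),
          p y * scaleCut χ n y ^ 2 * ‖wy t y‖ ^ 2)) atTop := by
      refine le_trans (setLIntegral_mono' measurableSet_Icc fun t h =>
        wInt_le_liminf hχ.continuous hχ1 hχ2 cp hp0 (slice_continuous cwy h)) ?_
      refine lintegral_liminf_le' fun n => ?_
      have cc := (cut_smooth n).continuous
      have cpχ : Continuous fun y => p y * scaleCut χ n y ^ 2 := by fun_prop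
      have cd := continuousOn_integral_weight hab.le cpχ (continuousOn_norm_sq cwy) (-(2 * ((n : ℝ) + 1))) (2 * ((n : ℝ) + 1))
      exact (cd.aemeasurable measurableSet_Icc).ennreal_ofReal
    refine (mul_le_mul_right h1 _).trans ?_
    rcases eq_or_ne ν 0 with rfl | h
    · simp
    · rw [ENNReal.liminf_const_mul_of_ne_zero_of_ne_top
        (ENNReal.ofReal_pos.2 (lt_of_le_of_ne hν h.symm)).ne' ENNReal.ofReal_ne_top]

/-! ### Classical solutions and the commuting vector field -/

/-- A classical solution of `∂_t F + i u F = ν ∂_yy F` on `t ≥ 0`: `F j` is the `j`-th time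
derivative and `Fy j` its derivative in `y`. -/
structure ClassicalSol (ν : ℝ) (u : ℝ → ℝ) (F Fy : ℕ → ℝ → ℝ → ℂ) : Prop where
  continuous : ∀ j, ContinuousOn (Function.uncurry (F j)) (Ici 0 ×ˢ univ)
  continuous_y : ∀ j, ContinuousOn (Function.uncurry (Fy j)) (Ici 0 ×ˢ univ)
  deriv_y : ∀ j t, 0 ≤ t → ∀ y, HasDerivAt (F j t) (Fy j t y) y
  deriv_yy : ∀ j t, 0 ≤ t → ∀ y,
    HasDerivAt (Fy j t) ((F (j + 1) t y + Complex.I * u y * F j t y) / ν) y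
  deriv_t : ∀ j t, 0 < t → ∀ y, HasDerivAt (fun s => F j s y) (F (j + 1) t y) t
  deriv_ty : ∀ j t, 0 < t → ∀ y, HasDerivAt (fun s => Fy j s y) (Fy (j + 1) t y) t
  bounded : ∀ T : ℝ, ∃ M : ℝ, ∀ t ∈ Icc 0 T, wInt (fun _ => 1) (F 0 t) ≤ ENNReal.ofReal M

theorem wInt_mono_weight {p q : ℝ → ℝ} (h : ∀ y, p y ≤ q y) (w : ℝ → ℂ) : wInt p w ≤ wInt q w :=
  lintegral_mono fun y => ENNReal.ofReal_le_ofReal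
    (mul_le_mul_of_nonneg_right (h y) (sq_nonneg _))

theorem wInt_const_mul {p : ℝ → ℝ} {c : ℝ} (hc : 0 ≤ c) (w : ℝ → ℂ) :
    wInt (fun y => c * p y) w = ENNReal.ofReal c * wInt p w := by
  rw [wInt, wInt, ← lintegral_const_mul' _ _ ENNReal.ofReal_ne_top]
  simp_rw [mul_assoc, ENNReal.ofReal_mul hc]

theorem wInt_le_of_bound {p : ℝ → ℝ} {K : ℝ} (hK : 0 ≤ K) (h : ∀ y, p y ≤ K) (w : ℝ → ℂ) :
    wInt p w ≤ ENNReal.ofReal K * wInt (fun _ => 1) w := by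
  rw [← wInt_const_mul hK]
  exact wInt_mono_weight (by simpa using h) w

theorem source_bound {a b K : ℝ} (hK : 0 ≤ K) {p : ℝ → ℝ} (hp : ∀ y, 0 ≤ p y)
    {F : ℝ → ℝ → ℂ} {k : ℝ → ℝ} (hk : ∀ t ∈ Icc a b, k t ≤ K) {x : ℝ≥0∞}
    (hx : ∀ t ∈ Icc a b, wInt p (F t) ≤ x) :
    ∫⁻ t in Icc a b, ∫⁻ y, ENNReal.ofReal (p y * (k t * ‖F t y‖ ^ 2)) ≤
      ENNReal.ofReal (K * (b - a)) * x := by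
  calc ∫⁻ t in Icc a b, ∫⁻ y, ENNReal.ofReal (p y * (k t * ‖F t y‖ ^ 2))
      ≤ ∫⁻ _ in Icc a b, ENNReal.ofReal K * x := by
        refine setLIntegral_mono' measurableSet_Icc fun t ht => ?_
        refine le_trans ?_ (mul_le_mul_right (hx t ht) _)
        rw [wInt, ← lintegral_const_mul' _ _ ENNReal.ofReal_ne_top]
        refine lintegral_mono fun y => ?_
        rw [← ENNReal.ofReal_mul hK]
        refine ENNReal.ofReal_le_ofReal ?_
        have := mul_le_mul_of_nonneg_right (hk t ht) (mul_nonneg (hp y) (sq_nonneg ‖F t y‖))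
        linarith
    _ = _ := by
        rw [setLIntegral_const, Real.volume_Icc, ENNReal.ofReal_mul hK]
        ring

namespace ClassicalSol

variable {ν U : ℝ} {u : ℝ → ℝ} {F Fy : ℕ → ℝ → ℝ → ℂ}

theorem Icc_subset {a b : ℝ} (ha : 0 ≤ a) : Icc a b ×ˢ (univ : Set ℝ) ⊆ Ici 0 ×ˢ univ :=
  prod_mono (fun _ h => ha.trans h.1) Subset.rfl

/-- The second derivative in `y`, from the equation. -/
def yy (ν : ℝ) (u : ℝ → ℝ) (F : ℕ → ℝ → ℝ → ℂ) (j : ℕ) (t y : ℝ) : ℂ :=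
  (F (j + 1) t y + Complex.I * u y * F j t y) / ν

/-- The third derivative in `y`, from the equation. -/
def yyy (ν : ℝ) (u : ℝ → ℝ) (F Fy : ℕ → ℝ → ℝ → ℂ) (j : ℕ) (t y : ℝ) : ℂ :=
  (Fy (j + 1) t y + Complex.I * (deriv u y * F j t y + u y * Fy j t y)) / ν

/-- The fourth derivative in `y`, from the equation. -/
def yyyy (ν : ℝ) (u : ℝ → ℝ) (F Fy : ℕ → ℝ → ℝ → ℂ) (j : ℕ) (t y : ℝ) : ℂ :=
  (yy ν u F (j + 1) t y + Complex.I * (iteratedDeriv 2 u y * F j t y + 2 * deriv u y * Fy j t y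
    + u y * yy ν u F j t y)) / ν

theorem continuous_slice (hF : ClassicalSol ν u F Fy) (j : ℕ) {t : ℝ} (ht : 0 ≤ t) :
    Continuous (F j t) :=
  slice_continuous (a := 0) (b := t) ((hF.continuous j).mono (Icc_subset le_rfl)) ⟨ht, le_rfl⟩

theorem continuous_slice_y (hF : ClassicalSol ν u F Fy) (j : ℕ) {t : ℝ} (ht : 0 ≤ t) :
    Continuous (Fy j t) :=
  slice_continuous (a := 0) (b := t) ((hF.continuous_y j).mono (Icc_subset le_rfl)) ⟨ht, le_rfl⟩

theorem continuous_yy (hF : ClassicalSol ν u F Fy) (hu : IsShear U u) (j : ℕ) :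
    ContinuousOn (Function.uncurry (yy ν u F j)) (Ici 0 ×ˢ univ) := by
  have h1 := hF.continuous (j + 1)
  have h2 := hF.continuous j
  have h3 : ContinuousOn (fun q : ℝ × ℝ => (u q.2 : ℂ)) (Ici 0 ×ˢ univ) :=
    continuousOn_snd_comp (Complex.continuous_ofReal.comp hu.continuous) _
  exact (h1.add ((continuousOn_const.mul h3).mul h2)).div_const _

theorem continuous_yyy (hF : ClassicalSol ν u F Fy) (hu : IsShear U u) (j : ℕ) :
    ContinuousOn (Function.uncurry (yyy ν u F Fy j)) (Ici 0 ×ˢ univ) := by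
  have h1 := hF.continuous_y (j + 1)
  have h2 := hF.continuous j
  have h2' := hF.continuous_y j
  have h3 : ContinuousOn (fun q : ℝ × ℝ => (u q.2 : ℂ)) (Ici 0 ×ˢ univ) :=
    continuousOn_snd_comp (Complex.continuous_ofReal.comp hu.continuous) _
  have h4 : ContinuousOn (fun q : ℝ × ℝ => ((deriv u q.2 : ℝ) : ℂ)) (Ici 0 ×ˢ univ) :=
    continuousOn_snd_comp (Complex.continuous_ofReal.comp hu.continuous_deriv) _
  exact (h1.add (continuousOn_const.mul ((h4.mul h2).add (h3.mul h2')))).div_const _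

theorem deriv_yyy (hF : ClassicalSol ν u F Fy) (hu : IsShear U u) (j : ℕ) {t : ℝ} (ht : 0 ≤ t)
    (y : ℝ) : HasDerivAt (yy ν u F j t) (yyy ν u F Fy j t y) y := by
  have h1 := hF.deriv_y (j + 1) t ht y
  have h2 := hF.deriv_y j t ht y
  have h3 := (hu.hasDerivAt y).ofReal_comp
  exact ((h1.add ((h3.const_mul Complex.I).mul h2)).div_const (ν : ℂ)).congr_deriv
    (by simp only [yyy]; ring)

theorem deriv_yyyy (hF : ClassicalSol ν u F Fy) (hu : IsShear U u) (j : ℕ) {t : ℝ} (ht : 0 ≤ t)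
    (y : ℝ) : HasDerivAt (yyy ν u F Fy j t) (yyyy ν u F Fy j t y) y := by
  have h1 : HasDerivAt (Fy (j + 1) t) (yy ν u F (j + 1) t y) y := hF.deriv_yy (j + 1) t ht y
  have h2 := hF.deriv_y j t ht y
  have h2' : HasDerivAt (Fy j t) (yy ν u F j t y) y := hF.deriv_yy j t ht y
  have h3 := (hu.hasDerivAt y).ofReal_comp
  have h4 := (hu.hasDerivAt_deriv y).ofReal_comp
  exact ((h1.add (((h4.mul h2).add (h3.mul h2')).const_mul Complex.I)).div_const (ν : ℂ)).congr_deriv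
    (by simp only [yyyy]; ring)

/-- There is no source here: the only lower order term is `14U²ν|w|²`, caused by the derivative of
the weight, and `28U²ν(b - a) ≤ 1` is exactly what makes it absorbable. -/
theorem energy (hF : ClassicalSol ν u F Fy) (hu : IsShear U u) (hU : 1 ≤ U) (hν : 0 < ν)
    {a b : ℝ} (ha : 0 ≤ a) (hab : a < b) (hsmall : 28 * U ^ 2 * ν * (b - a) ≤ 1)
    {p p' : ℝ → ℝ} (hp : IsWeight U p p') (hfin : ∫⁻ t in Icc a b, wInt p (F 0 t) ≠ ⊤) :
    (∀ t ∈ Icc a b, wInt p (F 0 t) ≤ 2 * wInt p (F 0 a)) ∧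
      ENNReal.ofReal ν * ∫⁻ t in Icc a b, wInt p (Fy 0 t) ≤ 2 * wInt p (F 0 a) := by
  have hs := Icc_subset (b := b) ha
  have hν' : (ν : ℂ) ≠ 0 := by exact_mod_cast hν.ne'
  have h0 : ∀ t ∈ Icc a b, 0 ≤ t := fun t h => ha.trans h.1
  have := energy_estimate (u := u) (w := F 0) (wt := F 1) (wy := Fy 0) (E := fun _ _ => 0)
    (Z := yy ν u F 0) (E0 := fun _ _ => 0) (S := fun _ _ => 0) hU hν.le hab hp
    ((hF.continuous 0).mono hs) ((hF.continuous 1).mono hs) ((hF.continuous_y 0).mono hs)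
    (fun _ _ => continuous_const) (fun _ _ => continuous_const)
  simp only [mul_zero, ENNReal.ofReal_zero, lintegral_zero, add_zero] at this
  refine this (fun t ht => slice_continuous ((hF.continuous_yy hu 0).mono hs) ht)
    continuousOn_const (fun t ht y => hF.deriv_y 0 t (h0 t ht) y)
    (fun t ht y => hF.deriv_yy 0 t (h0 t ht) y)
    (fun t ht y => hF.deriv_t 0 t (lt_of_le_of_lt ha ht.1) y) (fun t ht y => ?_)
    (fun _ _ => le_rfl) (fun t ht y => ?_) hfin
  · simp only [yy]; field_simp; ring
  · have hL : 0 < b - a := sub_pos.2 hab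
    rw [norm_zero, mul_zero, zero_mul, zero_add, zero_pow two_ne_zero, add_zero]
    rw [le_div_iff₀ (by positivity)]
    nlinarith [sq_nonneg ‖F 0 t y‖]

/-- The commuting vector field `v ∂_y + i (t - c)` applied to the `j`-th time derivative. -/
def vf (u : ℝ → ℝ) (F Fy : ℕ → ℝ → ℝ → ℂ) (c : ℝ) (j : ℕ) (t y : ℝ) : ℂ :=
  invSlope u y * Fy j t y + Complex.I * (t - c : ℝ) * F j t y

/-- The derivative in `y` of `vf`. -/
def vfy (ν : ℝ) (u : ℝ → ℝ) (F Fy : ℕ → ℝ → ℝ → ℂ) (c : ℝ) (j : ℕ) (t y : ℝ) : ℂ :=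
  invSlope₁ u y * Fy j t y + invSlope u y * yy ν u F j t y + Complex.I * (t - c : ℝ) * Fy j t y

theorem continuousOn_fst_ofReal (g : ℝ → ℝ) (hg : Continuous g) (s : Set (ℝ × ℝ)) :
    ContinuousOn (fun q : ℝ × ℝ => (g q.1 : ℂ)) s :=
  (Complex.continuous_ofReal.comp (hg.comp continuous_fst)).continuousOn

theorem continuousOn_snd_ofReal (g : ℝ → ℝ) (hg : Continuous g) (s : Set (ℝ × ℝ)) :
    ContinuousOn (fun q : ℝ × ℝ => (g q.2 : ℂ)) s :=
  (Complex.continuous_ofReal.comp (hg.comp continuous_snd)).continuousOn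

theorem continuous_vf (hF : ClassicalSol ν u F Fy) (hu : IsShear U u) (hU : 1 ≤ U) (c : ℝ) (j : ℕ) :
    ContinuousOn (Function.uncurry (vf u F Fy c j)) (Ici 0 ×ˢ univ) :=
  ((continuousOn_snd_ofReal _ (hu.continuous_invSlope hU) _).mul (hF.continuous_y j)).add
    ((continuousOn_const.mul (continuousOn_fst_ofReal (fun t => t - c) (by fun_prop) _)).mul
      (hF.continuous j))

theorem continuous_vfy (hF : ClassicalSol ν u F Fy) (hu : IsShear U u) (hU : 1 ≤ U) (c : ℝ) (j : ℕ) :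
    ContinuousOn (Function.uncurry (vfy ν u F Fy c j)) (Ici 0 ×ˢ univ) :=
  (((continuousOn_snd_ofReal _ (hu.continuous_invSlope₁ hU) _).mul (hF.continuous_y j)).add
    ((continuousOn_snd_ofReal _ (hu.continuous_invSlope hU) _).mul (hF.continuous_yy hu j))).add
    ((continuousOn_const.mul (continuousOn_fst_ofReal (fun t => t - c) (by fun_prop) _)).mul
      (hF.continuous_y j))

theorem deriv_vf (hF : ClassicalSol ν u F Fy) (hu : IsShear U u) (hU : 1 ≤ U) (c : ℝ) (j : ℕ)
    {t : ℝ} (ht : 0 ≤ t) (y : ℝ) : HasDerivAt (vf u F Fy c j t) (vfy ν u F Fy c j t y) y := by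
  have h2 := hF.deriv_y j t ht y
  have h2' : HasDerivAt (Fy j t) (yy ν u F j t y) y := hF.deriv_yy j t ht y
  have h3 := (hu.hasDerivAt_invSlope hU y).ofReal_comp
  exact ((h3.mul h2').add (h2.const_mul (Complex.I * (t - c : ℝ)))).congr_deriv (by rfl)

theorem continuousOn_mul_norm_sq {k : ℝ → ℝ} (hk : Continuous k) {w : ℝ → ℝ → ℂ}
    {s : Set (ℝ × ℝ)} (h : ContinuousOn (Function.uncurry w) s) :
    ContinuousOn (Function.uncurry fun t y => k t * ‖w t y‖ ^ 2) s :=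
  (hk.comp continuous_fst).continuousOn.mul (h.norm.pow 2)

theorem invSlope_mul_ofReal (hu : IsShear U u) (hU : 1 ≤ U) (y : ℝ) :
    (invSlope u y : ℂ) * deriv u y = 1 := by
  exact_mod_cast congrArg (fun x : ℝ => (x : ℂ)) (hu.invSlope_mul hU y)

/-- From `v F_y = JF - i(t - c)F`. This trades the derivative in the commutators for the unknown
`JF` itself and a multiple of `F`. -/
theorem norm_Fy_le (hu : IsShear U u) (hU : 1 ≤ U) (F Fy : ℕ → ℝ → ℝ → ℂ) (c t y : ℝ) (j : ℕ) :
    invSlope u y * ‖Fy j t y‖ ≤ ‖vf u F Fy c j t y‖ + |t - c| * ‖F j t y‖ := by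
  have e : (invSlope u y : ℂ) * Fy j t y = vf u F Fy c j t y - Complex.I * (t - c : ℝ) * F j t y := by
    simp only [vf]; ring
  have h1 : ‖(invSlope u y : ℂ) * Fy j t y‖ = invSlope u y * ‖Fy j t y‖ := by
    rw [norm_mul, Complex.norm_real, Real.norm_of_nonneg (hu.invSlope_pos hU y).le]
  rw [← h1, e]
  refine (norm_sub_le _ _).trans ?_
  rw [norm_mul, norm_mul, Complex.norm_I, one_mul, Complex.norm_real, Real.norm_eq_abs]

/-- The transport part commutes with `J`, and `v F_yyy = ∂_y(∂_y(v F_y) - 2v'F_y) + v''F_y` puts the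
viscous commutator in the form of `energy_estimate`. Both remainders are bounded by `v|F_y|`, hence
by `|JF| + (t - c)|F|`: the first part is absorbed and the second is the source. -/
theorem energy_vf (hF : ClassicalSol ν u F Fy) (hu : IsShear U u) (hU : 1 ≤ U) (hν : 0 < ν)
    {a b c : ℝ} (ha : 0 ≤ a) (hab : a < b) (hc : c ≤ a) (hsmall : 270 * U ^ 4 * ν * (b - a) ≤ 1)
    {p p' : ℝ → ℝ} (hp : IsWeight U p p') (hfin : ∫⁻ t in Icc a b, wInt p (vf u F Fy c 0 t) ≠ ⊤)
    {x : ℝ≥0∞} (hx : ∀ t ∈ Icc a b, wInt p (F 0 t) ≤ x) :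
    (∀ t ∈ Icc a b, wInt p (vf u F Fy c 0 t) ≤ 2 * (wInt p (vf u F Fy c 0 a)
      + ENNReal.ofReal (135 * U ^ 4 * ν * (b - c) ^ 2 * (b - a)) * x)) ∧
      ENNReal.ofReal ν * ∫⁻ t in Icc a b, wInt p (vfy ν u F Fy c 0 t) ≤
        2 * (wInt p (vf u F Fy c 0 a)
      + ENNReal.ofReal (135 * U ^ 4 * ν * (b - c) ^ 2 * (b - a)) * x) := by
  have hs := Icc_subset (b := b) ha
  have hν' : (ν : ℂ) ≠ 0 := by exact_mod_cast hν.ne'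
  have h0 : ∀ t ∈ Icc a b, 0 ≤ t := fun t h => ha.trans h.1
  have hU0 : 0 < U := by linarith
  have hL : 0 < b - a := sub_pos.2 hab
  have cv := hu.continuous_invSlope hU
  have cv1 := hu.continuous_invSlope₁ hU
  have cv2 := hu.continuous_invSlope₂ hU
  have src := source_bound (K := 135 * U ^ 4 * ν * (b - c) ^ 2) (by positivity)
    (fun y => (hp.pos y).le) (F := F 0) (k := fun t => 135 * U ^ 4 * ν * (t - c) ^ 2)
    (fun t ht => by
      have h1 : 0 ≤ t - c := by linarith [ht.1]
      have h2 : t - c ≤ b - c := by linarith [ht.2]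
      gcongr) hx
  have := energy_estimate (u := u) (w := vf u F Fy c 0)
    (wt := fun t y => vf u F Fy c 1 t y + Complex.I * F 0 t y)
    (wy := vfy ν u F Fy c 0) (E := fun t y => -2 * invSlope₁ u y * Fy 0 t y)
    (Z := fun t y => invSlope u y * yyy ν u F Fy 0 t y - invSlope₂ u y * Fy 0 t y
      + Complex.I * (t - c : ℝ) * yy ν u F 0 t y)
    (E0 := fun t y => ν * (invSlope₂ u y * Fy 0 t y))
    (S := fun t y => 135 * U ^ 4 * ν * (t - c) ^ 2 * ‖F 0 t y‖ ^ 2) hU hν.le hab hp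
    ((hF.continuous_vf hu hU c 0).mono hs)
    (((hF.continuous_vf hu hU c 1).add (continuousOn_const.mul (hF.continuous 0))).mono hs)
    ((hF.continuous_vfy hu hU c 0).mono hs)
    (fun t ht => by have := hF.continuous_slice_y 0 (h0 t ht); fun_prop)
    (fun t ht => by have := hF.continuous_slice_y 0 (h0 t ht); fun_prop)
    (fun t ht => by
      have := hF.continuous_slice_y 0 (h0 t ht)
      have := slice_continuous ((hF.continuous_yy hu 0).mono hs) ht
      have := slice_continuous ((hF.continuous_yyy hu 0).mono hs) ht
      fun_prop)
    ((continuousOn_mul_norm_sq (k := fun t => 135 * U ^ 4 * ν * (t - c) ^ 2) (by fun_prop)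
      (hF.continuous 0)).mono hs)
    (fun t ht y => hF.deriv_vf hu hU c 0 (h0 t ht) y)
    (fun t ht y => by
      have h2 := hF.deriv_y 0 t (h0 t ht) y
      have h2' : HasDerivAt (Fy 0 t) (yy ν u F 0 t y) y := hF.deriv_yy 0 t (h0 t ht) y
      have h2'' := hF.deriv_yyy hu 0 (h0 t ht) y
      have h3 := (hu.hasDerivAt_invSlope hU y).ofReal_comp
      have h4 := (hu.hasDerivAt_invSlope₁ hU y).ofReal_comp
      exact ((((h4.mul h2').add (h3.mul h2'')).add (h2'.const_mul (Complex.I * (t - c : ℝ)))).add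
        ((h4.const_mul (-2)).mul h2')).congr_deriv (by ring))
    (fun t ht y => by
      have ht0 : 0 < t := lt_of_le_of_lt ha ht.1
      have h1 := hF.deriv_t 0 t ht0 y
      have h2 := hF.deriv_ty 0 t ht0 y
      have h3 : HasDerivAt (fun s : ℝ => ((s - c : ℝ) : ℂ)) 1 t := by
        simpa using ((hasDerivAt_id t).sub_const c).ofReal_comp
      exact ((h2.const_mul (invSlope u y : ℂ)).add ((h3.const_mul Complex.I).mul h1)).congr_deriv
        (by simp only [vf]; ring))
    (fun t ht y => by
      -- The cancellation that makes `J` useful: `v u' = 1` removes the term `iF` produced by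
      -- differentiating `t`.
      have hv := invSlope_mul_ofReal hu hU y
      have e : (ν : ℂ) * yyy ν u F Fy 0 t y = Fy 1 t y + Complex.I * (deriv u y * F 0 t y
        + u y * Fy 0 t y) := by simp only [yyy]; field_simp
      have e2 : (ν : ℂ) * yy ν u F 0 t y = F 1 t y + Complex.I * u y * F 0 t y := by
        simp only [yy]; field_simp
      simp only [vf]
      linear_combination (-(invSlope u y : ℂ)) * e - (Complex.I * (t - c : ℝ)) * e2
        - Complex.I * F 0 t y * hv + (-(t - c : ℝ) * u y * F 0 t y + (t - c : ℝ) * u y * F 0 t y) * Complex.I_sq)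
    (fun t y => by positivity)
    (fun t ht y => by
      have hG := norm_Fy_le hu hU F Fy c t y 0
      have ht' : 0 ≤ t - c := by linarith [ht.1]
      rw [abs_of_nonneg ht'] at hG
      set g := ‖vf u F Fy c 0 t y‖ with hg
      set φ := ‖F 0 t y‖ with hφ
      set q := (t - c) * φ with hq
      have hq0 : 0 ≤ q := by positivity
      have hv := (hu.invSlope_pos hU y).le
      have hE : ‖-2 * (invSlope₁ u y : ℂ) * Fy 0 t y‖ ≤ 2 * U * (g + q) := by
        rw [norm_mul, norm_mul, Complex.norm_real, norm_neg, Real.norm_eq_abs]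
        have h1 := mul_le_mul_of_nonneg_right (hu.abs_invSlope₁_le hU y) (norm_nonneg (Fy 0 t y))
        have h2 := mul_le_mul_of_nonneg_left hG hU0.le
        norm_num
        nlinarith
      have hE0 : ‖(ν : ℂ) * ((invSlope₂ u y : ℂ) * Fy 0 t y)‖ ≤ 3 * U ^ 2 * ν * (g + q) := by
        rw [norm_mul, norm_mul, Complex.norm_real, Complex.norm_real, Real.norm_eq_abs,
          Real.norm_eq_abs, abs_of_pos hν]
        have h1 := mul_le_mul_of_nonneg_right (hu.abs_invSlope₂_le hU y) (norm_nonneg (Fy 0 t y))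
        have h2 := mul_le_mul_of_nonneg_left hG (by positivity : 0 ≤ 3 * U ^ 2)
        have h3 := mul_le_mul_of_nonneg_left (h1.trans (le_of_eq_of_le (by ring) h2)) hν.le
        nlinarith
      have hg0 : 0 ≤ g := norm_nonneg _
      have hU2 : U ^ 2 ≤ U ^ 4 := pow_le_pow_right₀ hU (by norm_num)
      have hEsq : ‖-2 * (invSlope₁ u y : ℂ) * Fy 0 t y‖ ^ 2 ≤ 8 * U ^ 2 * (g ^ 2 + q ^ 2) := by
        refine (pow_le_pow_left₀ (norm_nonneg _) hE 2).trans ?_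
        nlinarith [sq_nonneg (g - q), mul_nonneg (sq_nonneg U) (sq_nonneg (g - q))]
      have hE0g : 2 * ‖(ν : ℂ) * ((invSlope₂ u y : ℂ) * Fy 0 t y)‖ * g ≤
          3 * U ^ 2 * ν * (3 * g ^ 2 + q ^ 2) := by
        have h1 := mul_le_mul_of_nonneg_right hE0 hg0
        have h2 : (g + q) * g * 2 ≤ 3 * g ^ 2 + q ^ 2 := by nlinarith [sq_nonneg (g - q)]
        have h3 := mul_le_mul_of_nonneg_left h2 (by positivity : 0 ≤ 3 * U ^ 2 * ν)
        nlinarith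
      have hEs := mul_le_mul_of_nonneg_left hEsq (by positivity : 0 ≤ 14 * U ^ 2 * ν)
      -- The constant is `14 + 112 + 9`: the weight term, `14 · 8` from `E`, and `3 · 3` from `E0`.
      have main : 2 * ‖(ν : ℂ) * ((invSlope₂ u y : ℂ) * Fy 0 t y)‖ * g +
          14 * U ^ 2 * ν * (g ^ 2 + ‖-2 * (invSlope₁ u y : ℂ) * Fy 0 t y‖ ^ 2)
          ≤ 135 * U ^ 4 * ν * (g ^ 2 + q ^ 2) := by
        have h5 := mul_le_mul_of_nonneg_right hU2 (by positivity : 0 ≤ ν * g ^ 2)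
        have h6 := mul_le_mul_of_nonneg_right hU2 (by positivity : 0 ≤ ν * q ^ 2)
        have h7 : 0 ≤ U ^ 4 * (ν * q ^ 2) := by positivity
        linarith
      have h7 : 135 * U ^ 4 * ν * g ^ 2 ≤ g ^ 2 / (2 * (b - a)) := by
        rw [le_div_iff₀ (by positivity)]
        have := mul_le_mul_of_nonneg_right hsmall (sq_nonneg g)
        linarith
      have h8 : 135 * U ^ 4 * ν * (t - c) ^ 2 * φ ^ 2 = 135 * U ^ 4 * ν * q ^ 2 := by
        rw [hq]; ring
      rw [h8]
      linarith) hfin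
  refine ⟨fun t ht => (this.1 t ht).trans ?_, this.2.trans ?_⟩ <;> gcongr

end ClassicalSol

/-! ### The second order operator -/

theorem source_bound_add {a b K₁ K₂ : ℝ} (hK₁ : 0 ≤ K₁) (hK₂ : 0 ≤ K₂) {p : ℝ → ℝ}
    (hp : ∀ y, 0 ≤ p y) (cp : Continuous p)
    {F G : ℝ → ℝ → ℂ} {k₁ k₂ : ℝ → ℝ} (hk₁ : ∀ t ∈ Icc a b, k₁ t ≤ K₁)
    (hk₂ : ∀ t ∈ Icc a b, k₂ t ≤ K₂) (cG : ∀ t ∈ Icc a b, Continuous (G t)) {x z : ℝ≥0∞}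
    (hx : ∀ t ∈ Icc a b, wInt p (G t) ≤ x) (hz : ∀ t ∈ Icc a b, wInt p (F t) ≤ z) :
    ∫⁻ t in Icc a b, ∫⁻ y, ENNReal.ofReal (p y * (k₁ t * ‖G t y‖ ^ 2 + k₂ t * ‖F t y‖ ^ 2)) ≤
      ENNReal.ofReal (K₁ * (b - a)) * x + ENNReal.ofReal (K₂ * (b - a)) * z := by
  calc ∫⁻ t in Icc a b, ∫⁻ y, ENNReal.ofReal (p y * (k₁ t * ‖G t y‖ ^ 2 + k₂ t * ‖F t y‖ ^ 2))
      ≤ ∫⁻ _ in Icc a b, (ENNReal.ofReal K₁ * x + ENNReal.ofReal K₂ * z) := by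
        refine setLIntegral_mono' measurableSet_Icc fun t ht => ?_
        refine le_trans ?_ (add_le_add (mul_le_mul_right (hx t ht) _) (mul_le_mul_right (hz t ht) _))
        have := cG t ht
        rw [wInt, wInt, ← lintegral_const_mul' _ _ ENNReal.ofReal_ne_top,
          ← lintegral_const_mul' _ _ ENNReal.ofReal_ne_top, ← lintegral_add_left]
        · refine lintegral_mono fun y => ?_
          have h1 := mul_nonneg (hp y) (sq_nonneg ‖G t y‖)
          have h2 := mul_nonneg (hp y) (sq_nonneg ‖F t y‖)
          rw [← ENNReal.ofReal_mul hK₁, ← ENNReal.ofReal_mul hK₂, ← ENNReal.ofReal_add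
            (mul_nonneg hK₁ h1) (mul_nonneg hK₂ h2)]
          refine ENNReal.ofReal_le_ofReal ?_
          have := mul_le_mul_of_nonneg_right (hk₁ t ht) h1
          have := mul_le_mul_of_nonneg_right (hk₂ t ht) h2
          linarith
        · exact ((Continuous.measurable (by fun_prop)).ennreal_ofReal).const_mul _
    _ = _ := by
        rw [setLIntegral_const, Real.volume_Icc, ENNReal.ofReal_mul hK₁, ENNReal.ofReal_mul hK₂]
        ring

namespace ClassicalSol

variable {ν U : ℝ} {u : ℝ → ℝ} {F Fy : ℕ → ℝ → ℝ → ℂ}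

/-- The second order operator `(v ∂_y + i (t - c)) (v ∂_y + i t)`, up to the term `v v' ∂_y`. -/
def vf₂ (ν : ℝ) (u : ℝ → ℝ) (F Fy : ℕ → ℝ → ℝ → ℂ) (c : ℝ) (j : ℕ) (t y : ℝ) : ℂ :=
  invSlope u y ^ 2 * yy ν u F j t y + Complex.I * (2 * t - c : ℝ) * (invSlope u y * Fy j t y)
    - (t * (t - c) : ℝ) * F j t y

/-- The derivative in `y` of `vf₂`. -/
def vf₂y (ν : ℝ) (u : ℝ → ℝ) (F Fy : ℕ → ℝ → ℝ → ℂ) (c : ℝ) (j : ℕ) (t y : ℝ) : ℂ :=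
  2 * invSlope u y * invSlope₁ u y * yy ν u F j t y + invSlope u y ^ 2 * yyy ν u F Fy j t y
    + Complex.I * (2 * t - c : ℝ) * (invSlope₁ u y * Fy j t y + invSlope u y * yy ν u F j t y)
    - (t * (t - c) : ℝ) * Fy j t y

theorem continuous_vf₂ (hF : ClassicalSol ν u F Fy) (hu : IsShear U u) (hU : 1 ≤ U) (c : ℝ)
    (j : ℕ) : ContinuousOn (Function.uncurry (vf₂ ν u F Fy c j)) (Ici 0 ×ˢ univ) := by
  have cv := continuousOn_snd_ofReal _ (hu.continuous_invSlope hU) (Ici 0 ×ˢ univ)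
  exact (((cv.pow 2).mul (hF.continuous_yy hu j)).add
    ((continuousOn_const.mul (continuousOn_fst_ofReal (fun t => 2 * t - c) (by fun_prop) _)).mul
      (cv.mul (hF.continuous_y j)))).sub
    ((continuousOn_fst_ofReal (fun t => t * (t - c)) (by fun_prop) _).mul (hF.continuous j))

theorem continuous_vf₂y (hF : ClassicalSol ν u F Fy) (hu : IsShear U u) (hU : 1 ≤ U) (c : ℝ)
    (j : ℕ) : ContinuousOn (Function.uncurry (vf₂y ν u F Fy c j)) (Ici 0 ×ˢ univ) := by
  have cv := continuousOn_snd_ofReal _ (hu.continuous_invSlope hU) (Ici 0 ×ˢ univ)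
  have cv1 := continuousOn_snd_ofReal _ (hu.continuous_invSlope₁ hU) (Ici 0 ×ˢ univ)
  exact (((((continuousOn_const.mul cv).mul cv1).mul (hF.continuous_yy hu j)).add
    ((cv.pow 2).mul (hF.continuous_yyy hu j))).add
    ((continuousOn_const.mul (continuousOn_fst_ofReal (fun t => 2 * t - c) (by fun_prop) _)).mul
      ((cv1.mul (hF.continuous_y j)).add (cv.mul (hF.continuous_yy hu j))))).sub
    ((continuousOn_fst_ofReal (fun t => t * (t - c)) (by fun_prop) _).mul (hF.continuous_y j))

theorem deriv_vf₂ (hF : ClassicalSol ν u F Fy) (hu : IsShear U u) (hU : 1 ≤ U) (c : ℝ) (j : ℕ)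
    {t : ℝ} (ht : 0 ≤ t) (y : ℝ) : HasDerivAt (vf₂ ν u F Fy c j t) (vf₂y ν u F Fy c j t y) y := by
  have h1 := hF.deriv_y j t ht y
  have h2 : HasDerivAt (Fy j t) (yy ν u F j t y) y := hF.deriv_yy j t ht y
  have h3 := hF.deriv_yyy hu j ht y
  have hv := (hu.hasDerivAt_invSlope hU y).ofReal_comp
  exact ((((hv.pow 2).mul h3).add ((hv.mul h2).const_mul (Complex.I * (2 * t - c : ℝ)))).sub
    (h1.const_mul ((t * (t - c) : ℝ) : ℂ))).congr_deriv (by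
      simp only [vf₂y, Pi.pow_apply]; push_cast; ring)

/-- With the term `v v' ∂_y` restored, `vf₂` would be a product of two commuting vector fields and
would commute with `∂_t + iu`. Leaving it out trades this exactness for the source `i v' F`, which
carries no `ν`; in return `E` and `E0` contain no derivative of `v` beyond the second. -/
theorem vf₂_equation (hu : IsShear U u) (hU : 1 ≤ U) (hν : ν ≠ 0) (c t y : ℝ) :
    vf₂ ν u F Fy c 1 t y + 2 * Complex.I * (invSlope u y * Fy 0 t y) - (2 * t - c : ℝ) * F 0 t y
    = -Complex.I * u y * vf₂ ν u F Fy c 0 t y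
      + ν * (invSlope u y ^ 2 * yyyy ν u F Fy 0 t y
        - (2 * invSlope₁ u y ^ 2 + 2 * invSlope u y * invSlope₂ u y) * yy ν u F 0 t y
        + Complex.I * (2 * t - c : ℝ) * (invSlope u y * yyy ν u F Fy 0 t y
          - invSlope₂ u y * Fy 0 t y) - (t * (t - c) : ℝ) * yy ν u F 0 t y)
      + (ν * ((2 * invSlope₁ u y ^ 2 + 2 * invSlope u y * invSlope₂ u y) * yy ν u F 0 t y
        + Complex.I * (2 * t - c : ℝ) * (invSlope₂ u y * Fy 0 t y))
        + Complex.I * invSlope₁ u y * F 0 t y) := by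
  have hν' : (ν : ℂ) ≠ 0 := by exact_mod_cast hν
  have hv := invSlope_mul_ofReal hu hU y
  have hv1 : (invSlope₁ u y : ℂ) = -invSlope u y ^ 2 * iteratedDeriv 2 u y := by
    exact_mod_cast congrArg (fun x : ℝ => (x : ℂ)) (hu.invSlope₁_eq hU y)
  have e3 : (ν : ℂ) * yyy ν u F Fy 0 t y = Fy 1 t y + Complex.I * (deriv u y * F 0 t y
    + u y * Fy 0 t y) := by simp only [yyy]; field_simp
  have e2 : (ν : ℂ) * yy ν u F 0 t y = F 1 t y + Complex.I * u y * F 0 t y := by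
    simp only [yy]; field_simp
  have e4 : (ν : ℂ) * yyyy ν u F Fy 0 t y = yy ν u F 1 t y + Complex.I * (iteratedDeriv 2 u y *
      F 0 t y + 2 * deriv u y * Fy 0 t y + u y * yy ν u F 0 t y) := by
    simp only [yyyy]; field_simp
  simp only [vf₂]
  linear_combination (-(invSlope u y : ℂ) ^ 2) * e4
    - Complex.I * (2 * t - c : ℝ) * invSlope u y * e3 + (t * (t - c) : ℝ) * e2
    - 2 * Complex.I * invSlope u y * Fy 0 t y * hv + (2 * t - c : ℝ) * F 0 t y * hv
    - Complex.I * F 0 t y * hv1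
    - (2 * t - c : ℝ) * invSlope u y * ((deriv u y : ℝ) : ℂ) * F 0 t y * Complex.I_sq

/-- `v² F_yy` is recovered from `vf₂`, and `v F_y` from `vf`; since `0 ≤ c ≤ t`, the coefficients
`2t - c` and `t(t - c)` are at most `2t` and `t²`. The common quantity `|vf₂| + 3t|vf| + 4t²|F|`
dominates everything of commutator type. -/
theorem vf₂_bounds (hu : IsShear U u) (hU : 1 ≤ U) (hν : 0 ≤ ν) {c t : ℝ} (hc : 0 ≤ c)
    (hct : c ≤ t) (y : ℝ) :
    ‖-4 * (invSlope u y * invSlope₁ u y) * yy ν u F 0 t y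
        - 2 * (Complex.I * (2 * t - c : ℝ) * (invSlope₁ u y * Fy 0 t y))‖
      ≤ 4 * U * (‖vf₂ ν u F Fy c 0 t y‖ + 3 * t * ‖vf u F Fy 0 0 t y‖ + 4 * t ^ 2 * ‖F 0 t y‖) ∧
    ‖ν * ((2 * invSlope₁ u y ^ 2 + 2 * invSlope u y * invSlope₂ u y) * yy ν u F 0 t y
        + Complex.I * (2 * t - c : ℝ) * (invSlope₂ u y * Fy 0 t y))
        + Complex.I * invSlope₁ u y * F 0 t y‖
      ≤ 8 * U ^ 2 * ν * (‖vf₂ ν u F Fy c 0 t y‖ + 3 * t * ‖vf u F Fy 0 0 t y‖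
        + 4 * t ^ 2 * ‖F 0 t y‖) + U ^ 2 * ‖F 0 t y‖ := by
  have hU0 : 0 < U := by linarith
  have ht : 0 ≤ t := hc.trans hct
  have hA := norm_Fy_le hu hU F Fy 0 t y 0
  rw [sub_zero, abs_of_nonneg ht] at hA
  have hv := (hu.invSlope_pos hU y).le
  have hv1 := hu.abs_invSlope₁_le hU y
  have hv2 := hu.abs_invSlope₂_le hU y
  have hvU := hu.invSlope_le hU y
  have n2 : ‖((2 * t - c : ℝ) : ℂ)‖ ≤ 2 * t := by
    rw [Complex.norm_real, Real.norm_of_nonneg (by linarith)]; linarith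
  have n3 : ‖((t * (t - c) : ℝ) : ℂ)‖ ≤ t ^ 2 := by
    rw [Complex.norm_real, Real.norm_of_nonneg (mul_nonneg ht (by linarith))]; nlinarith
  set g := ‖vf u F Fy 0 0 t y‖ with hg
  set h := ‖vf₂ ν u F Fy c 0 t y‖ with hh
  set φ := ‖F 0 t y‖ with hφ
  set v := invSlope u y with hvdef
  set A := ‖Fy 0 t y‖ with hAdef
  set Y := ‖yy ν u F 0 t y‖ with hYdef
  have hg0 : 0 ≤ g := norm_nonneg _
  have hφ0 : 0 ≤ φ := norm_nonneg _
  have hA0 : 0 ≤ A := norm_nonneg _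
  have hY0 : 0 ≤ Y := norm_nonneg _
  have hY : v ^ 2 * Y ≤ h + 2 * t * (v * A) + t ^ 2 * φ := by
    have e : (v : ℂ) ^ 2 * yy ν u F 0 t y = vf₂ ν u F Fy c 0 t y
        - Complex.I * (2 * t - c : ℝ) * (v * Fy 0 t y) + (t * (t - c) : ℝ) * F 0 t y := by
      simp only [vf₂]; ring
    have e1 : ‖(v : ℂ) ^ 2 * yy ν u F 0 t y‖ = v ^ 2 * Y := by
      rw [norm_mul, norm_pow, Complex.norm_real, Real.norm_of_nonneg hv]
    rw [← e1, e]
    refine (norm_add_le _ _).trans (add_le_add ((norm_sub_le _ _).trans (add_le_add le_rfl ?_)) ?_)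
    · rw [norm_mul, norm_mul, norm_mul, Complex.norm_I, one_mul, Complex.norm_real v,
        Real.norm_of_nonneg hv]
      gcongr
    · rw [norm_mul]
      gcongr
  have hY' : v ^ 2 * Y ≤ h + 2 * t * g + 3 * t ^ 2 * φ := by
    nlinarith [mul_le_mul_of_nonneg_left hA ht]
  have hvA : t * (v * A) ≤ t * g + t ^ 2 * φ := by
    nlinarith [mul_le_mul_of_nonneg_left hA ht]
  have nv1 : ‖(invSlope₁ u y : ℂ)‖ ≤ U * v := by
    rw [Complex.norm_real, Real.norm_eq_abs]; exact hv1
  have nv2 : ‖(invSlope₂ u y : ℂ)‖ ≤ 3 * U ^ 2 * v := by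
    rw [Complex.norm_real, Real.norm_eq_abs]; exact hv2
  have nv : ‖(v : ℂ)‖ = v := by rw [Complex.norm_real, Real.norm_of_nonneg hv]
  constructor
  · calc _ ≤ 4 * (v * (U * v)) * Y + 2 * (1 * (2 * t) * (U * v * A)) := by
          refine (norm_sub_le _ _).trans (add_le_add ?_ ?_)
          · rw [norm_mul, norm_mul, norm_mul, nv, norm_neg, Complex.norm_ofNat]
            gcongr
          · rw [norm_mul, norm_mul, norm_mul, norm_mul, Complex.norm_ofNat, Complex.norm_I]
            gcongr
      _ = 4 * U * (v ^ 2 * Y) + 4 * U * (t * (v * A)) := by ring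
      _ ≤ 4 * U * (h + 2 * t * g + 3 * t ^ 2 * φ) + 4 * U * (t * g + t ^ 2 * φ) := by gcongr
      _ = _ := by ring
  · calc _ ≤ ν * ((2 * (U * v) ^ 2 + 2 * v * (3 * U ^ 2 * v)) * Y
            + 1 * (2 * t) * (3 * U ^ 2 * v * A)) + 1 * (U * v) * φ := by
          refine (norm_add_le _ _).trans (add_le_add ?_ ?_)
          · rw [norm_mul, Complex.norm_real, Real.norm_of_nonneg hν]
            refine mul_le_mul_of_nonneg_left ((norm_add_le _ _).trans (add_le_add ?_ ?_)) hν
            · rw [norm_mul]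
              refine mul_le_mul_of_nonneg_right ((norm_add_le _ _).trans (add_le_add ?_ ?_)) hY0
              · rw [norm_mul, norm_pow, Complex.norm_ofNat]
                gcongr
              · rw [norm_mul, norm_mul, Complex.norm_ofNat, nv]
                gcongr
            · rw [norm_mul, norm_mul, norm_mul, Complex.norm_I]
              gcongr
          · rw [norm_mul, norm_mul, Complex.norm_I]
            gcongr
      _ = ν * (8 * U ^ 2 * (v ^ 2 * Y) + 6 * U ^ 2 * (t * (v * A))) + U * v * φ := by ring
      _ ≤ ν * (8 * U ^ 2 * (h + 2 * t * g + 3 * t ^ 2 * φ) + 6 * U ^ 2 * (t * g + t ^ 2 * φ))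
          + U * U * φ := by gcongr
      _ ≤ _ := by
          have h1 : 0 ≤ ν * U ^ 2 * (t * g) := by positivity
          have h2 : 0 ≤ ν * U ^ 2 * (t ^ 2 * φ) := by positivity
          nlinarith

/-- As for the first vector field, but the absorbable budget `h²/(2(b - a))` is split in two: one
half for the viscous commutators, the other for the inviscid source `i v' F`. The latter is not
small, and Young's inequality at the scale `b - a` costs `4(b - a)U⁴|F|²`. -/
theorem energy_vf₂ (hF : ClassicalSol ν u F Fy) (hu : IsShear U u) (hU : 1 ≤ U) (hν : 0 < ν)
    {a b c : ℝ} (hc : 0 ≤ c) (hca : c ≤ a) (hab : a < b) (hsmall : 2936 * U ^ 4 * ν * (b - a) ≤ 1)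
    {p p' : ℝ → ℝ} (hp : IsWeight U p p')
    (hfin : ∫⁻ t in Icc a b, wInt p (vf₂ ν u F Fy c 0 t) ≠ ⊤)
    {x z : ℝ≥0∞} (hx : ∀ t ∈ Icc a b, wInt p (vf u F Fy 0 0 t) ≤ x)
    (hz : ∀ t ∈ Icc a b, wInt p (F 0 t) ≤ z) :
    ∀ t ∈ Icc a b, wInt p (vf₂ ν u F Fy c 0 t) ≤ 2 * (wInt p (vf₂ ν u F Fy c 0 a)
      + (ENNReal.ofReal (734 * U ^ 4 * ν * (9 * b ^ 2) * (b - a)) * x +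
        ENNReal.ofReal ((734 * U ^ 4 * ν * (16 * b ^ 4) + 4 * (b - a) * U ^ 4) * (b - a)) * z)) := by
  have ha : 0 ≤ a := hc.trans hca
  have hs := Icc_subset (b := b) ha
  have h0 : ∀ t ∈ Icc a b, 0 ≤ t := fun t h => ha.trans h.1
  have hU0 : 0 < U := by linarith
  have hL : 0 < b - a := sub_pos.2 hab
  have cv := hu.continuous_invSlope hU
  have cv1 := hu.continuous_invSlope₁ hU
  have cv2 := hu.continuous_invSlope₂ hU
  have src := source_bound_add (K₁ := 734 * U ^ 4 * ν * (9 * b ^ 2))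
    (K₂ := 734 * U ^ 4 * ν * (16 * b ^ 4) + 4 * (b - a) * U ^ 4) (by positivity)
    (by positivity) (fun y => (hp.pos y).le) hp.continuous (F := F 0) (G := vf u F Fy 0 0)
    (k₁ := fun t => 734 * U ^ 4 * ν * (9 * t ^ 2))
    (k₂ := fun t => 734 * U ^ 4 * ν * (16 * t ^ 4) + 4 * (b - a) * U ^ 4)
    (fun t ht => by
      have := h0 t ht
      have := ht.2
      gcongr)
    (fun t ht => by
      have := h0 t ht
      have := ht.2
      gcongr) (fun t ht => slice_continuous ((hF.continuous_vf hu hU 0 0).mono hs) ht) hx hz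
  have cS : ContinuousOn (Function.uncurry fun t y =>
      734 * U ^ 4 * ν * (9 * t ^ 2) * ‖vf u F Fy 0 0 t y‖ ^ 2
      + (734 * U ^ 4 * ν * (16 * t ^ 4) + 4 * (b - a) * U ^ 4) * ‖F 0 t y‖ ^ 2)
      (Ici 0 ×ˢ univ) :=
    (continuousOn_mul_norm_sq (k := fun t => 734 * U ^ 4 * ν * (9 * t ^ 2)) (by fun_prop)
      (hF.continuous_vf hu hU 0 0)).add
      (continuousOn_mul_norm_sq (k := fun t => 734 * U ^ 4 * ν * (16 * t ^ 4) + 4 * (b - a) * U ^ 4)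
        (by fun_prop) (hF.continuous 0))
  have := (energy_estimate (u := u) (w := vf₂ ν u F Fy c 0)
    (wt := fun t y => vf₂ ν u F Fy c 1 t y + 2 * Complex.I * (invSlope u y * Fy 0 t y)
      - (2 * t - c : ℝ) * F 0 t y)
    (wy := vf₂y ν u F Fy c 0) (E := fun t y => -4 * (invSlope u y * invSlope₁ u y) * yy ν u F 0 t y
        - 2 * (Complex.I * (2 * t - c : ℝ) * (invSlope₁ u y * Fy 0 t y)))
    (Z := fun t y => invSlope u y ^ 2 * yyyy ν u F Fy 0 t y
        - (2 * invSlope₁ u y ^ 2 + 2 * invSlope u y * invSlope₂ u y) * yy ν u F 0 t y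
        + Complex.I * (2 * t - c : ℝ) * (invSlope u y * yyy ν u F Fy 0 t y
          - invSlope₂ u y * Fy 0 t y) - (t * (t - c) : ℝ) * yy ν u F 0 t y)
    (E0 := fun t y => ν * ((2 * invSlope₁ u y ^ 2 + 2 * invSlope u y * invSlope₂ u y) * yy ν u F 0 t y
        + Complex.I * (2 * t - c : ℝ) * (invSlope₂ u y * Fy 0 t y))
        + Complex.I * invSlope₁ u y * F 0 t y)
    (S := fun t y => 734 * U ^ 4 * ν * (9 * t ^ 2) * ‖vf u F Fy 0 0 t y‖ ^ 2
      + (734 * U ^ 4 * ν * (16 * t ^ 4) + 4 * (b - a) * U ^ 4) * ‖F 0 t y‖ ^ 2) hU hν.le hab hp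
    ((hF.continuous_vf₂ hu hU c 0).mono hs)
    ((((hF.continuous_vf₂ hu hU c 1).add (continuousOn_const.mul
      ((continuousOn_snd_ofReal _ cv _).mul (hF.continuous_y 0)))).sub
      ((continuousOn_fst_ofReal (fun t => 2 * t - c) (by fun_prop) _).mul
        (hF.continuous 0))).mono hs)
    ((hF.continuous_vf₂y hu hU c 0).mono hs)
    (fun t ht => by
      have := hF.continuous_slice_y 0 (h0 t ht)
      have := slice_continuous ((hF.continuous_yy hu 0).mono hs) ht
      fun_prop)
    (fun t ht => by
      have := hF.continuous_slice 0 (h0 t ht)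
      have := hF.continuous_slice_y 0 (h0 t ht)
      have := slice_continuous ((hF.continuous_yy hu 0).mono hs) ht
      fun_prop)
    (fun t ht => by
      have := hF.continuous_slice 0 (h0 t ht)
      have := hF.continuous_slice_y 0 (h0 t ht)
      have := slice_continuous ((hF.continuous_yy hu 0).mono hs) ht
      have := slice_continuous ((hF.continuous_yy hu 1).mono hs) ht
      have := slice_continuous ((hF.continuous_yyy hu 0).mono hs) ht
      have := hu.continuous
      have := hu.continuous_deriv
      have := hu.continuous_deriv2
      unfold yyyy
      fun_prop)
    (cS.mono hs)
    (fun t ht y => hF.deriv_vf₂ hu hU c 0 (h0 t ht) y)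
    (fun t ht y => by
      have h1 := hF.deriv_y 0 t (h0 t ht) y
      have h2 : HasDerivAt (Fy 0 t) (yy ν u F 0 t y) y := hF.deriv_yy 0 t (h0 t ht) y
      have h3 := hF.deriv_yyy hu 0 (h0 t ht) y
      have h4 := hF.deriv_yyyy hu 0 (h0 t ht) y
      have hv := (hu.hasDerivAt_invSlope hU y).ofReal_comp
      have hv1 := (hu.hasDerivAt_invSlope₁ hU y).ofReal_comp
      exact (((((((hv.const_mul 2).mul hv1).mul h3).add ((hv.pow 2).mul h4)).add
        (((hv1.mul h2).add (hv.mul h3)).const_mul (Complex.I * (2 * t - c : ℝ)))).sub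
        (h2.const_mul ((t * (t - c) : ℝ) : ℂ))).add ((((hv.mul hv1).const_mul (-4)).mul h3).sub
          (((hv1.mul h2).const_mul (Complex.I * (2 * t - c : ℝ))).const_mul 2))).congr_deriv (by
            simp only [Pi.pow_apply, Pi.mul_apply]; push_cast; ring))
    (fun t ht y => by
      have ht0 : 0 < t := lt_of_le_of_lt ha ht.1
      have h1 := hF.deriv_t 0 t ht0 y
      have h2 := hF.deriv_ty 0 t ht0 y
      have h3 : HasDerivAt (fun s => yy ν u F 0 s y) (yy ν u F 1 t y) t :=
        ((hF.deriv_t 1 t ht0 y).add (h1.const_mul (Complex.I * u y))).div_const (ν : ℂ)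
      have h4 : HasDerivAt (fun s : ℝ => ((2 * s - c : ℝ) : ℂ)) 2 t := by
        simpa using (((hasDerivAt_id t).const_mul 2).sub_const c).ofReal_comp
      have h5 : HasDerivAt (fun s : ℝ => ((s * (s - c) : ℝ) : ℂ)) (2 * t - c : ℝ) t := by
        refine (((hasDerivAt_id t).mul ((hasDerivAt_id t).sub_const c)).congr_deriv
          (by simp; ring)).ofReal_comp
      exact (((h3.const_mul ((invSlope u y : ℂ) ^ 2)).add ((h4.const_mul Complex.I).mul
        (h2.const_mul (invSlope u y : ℂ)))).sub (h5.mul h1)).congr_deriv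
        (by simp only [vf₂]; ring))
    (fun t ht y => vf₂_equation hu hU hν.ne' c t y)
    (fun t y => by positivity)
    (fun t ht y => by
      obtain ⟨hE, hE0⟩ := vf₂_bounds (F := F) (Fy := Fy) hu hU hν.le hc (hca.trans ht.1) y
      have ht0 := h0 t ht
      set e := ‖-4 * ((invSlope u y : ℂ) * invSlope₁ u y) * yy ν u F 0 t y
        - 2 * (Complex.I * (2 * t - c : ℝ) * (invSlope₁ u y * Fy 0 t y))‖ with he
      set e0 := ‖(ν : ℂ) * ((2 * invSlope₁ u y ^ 2 + 2 * invSlope u y * invSlope₂ u y) * yy ν u F 0 t y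
        + Complex.I * (2 * t - c : ℝ) * (invSlope₂ u y * Fy 0 t y))
        + Complex.I * invSlope₁ u y * F 0 t y‖ with he0
      set g := ‖vf u F Fy 0 0 t y‖ with hg
      set h := ‖vf₂ ν u F Fy c 0 t y‖ with hh
      set φ := ‖F 0 t y‖ with hφ
      have hg0 : 0 ≤ g := norm_nonneg _
      have hh0 : 0 ≤ h := norm_nonneg _
      have hφ0 : 0 ≤ φ := norm_nonneg _
      have he00 : 0 ≤ e := norm_nonneg _
      set Q := h + 3 * t * g + 4 * t ^ 2 * φ with hQ
      have hQ0 : 0 ≤ Q := by positivity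
      have hhQ : h ≤ Q := by
        have : 0 ≤ 3 * t * g + 4 * t ^ 2 * φ := by positivity
        linarith
      have hQ2 : Q ^ 2 ≤ 3 * (h ^ 2 + 9 * t ^ 2 * g ^ 2 + 16 * t ^ 4 * φ ^ 2) := by
        rw [hQ]
        nlinarith [sq_nonneg (h - 3 * t * g), sq_nonneg (h - 4 * t ^ 2 * φ),
          sq_nonneg (3 * t * g - 4 * t ^ 2 * φ)]
      have he2 : e ^ 2 ≤ 16 * U ^ 2 * Q ^ 2 :=
        (pow_le_pow_left₀ he00 hE 2).trans (le_of_eq (by ring))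
      have hL' : 2 * U ^ 2 * φ * h ≤ h ^ 2 / (4 * (b - a)) + 4 * (b - a) * U ^ 4 * φ ^ 2 := by
        have h1 : 0 ≤ (h / (2 * (b - a)) - 2 * U ^ 2 * φ) ^ 2 * (b - a) := by positivity
        have h2 : (h / (2 * (b - a)) - 2 * U ^ 2 * φ) ^ 2 * (b - a) =
          h ^ 2 / (4 * (b - a)) + 4 * (b - a) * U ^ 4 * φ ^ 2 - 2 * U ^ 2 * φ * h := by
          field_simp; ring
        linarith
      have he0h : 2 * e0 * h ≤ 16 * U ^ 2 * ν * Q ^ 2 + 2 * U ^ 2 * φ * h := by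
        have h1 := mul_le_mul_of_nonneg_right hE0 hh0
        have h2 : Q * h ≤ Q ^ 2 := by nlinarith
        have h3 := mul_le_mul_of_nonneg_left h2 (by positivity : 0 ≤ 16 * U ^ 2 * ν)
        linarith
      have hU2 : U ^ 2 ≤ U ^ 4 := pow_le_pow_right₀ hU (by norm_num)
      set W := h ^ 2 + 9 * t ^ 2 * g ^ 2 + 16 * t ^ 4 * φ ^ 2 with hW
      have hhW : h ^ 2 ≤ W := by
        have : 0 ≤ 9 * t ^ 2 * g ^ 2 + 16 * t ^ 4 * φ ^ 2 := by positivity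
        linarith
      have hW0 : 0 ≤ W := (sq_nonneg h).trans hhW
      -- Here `734 = 62 + 672`, with `62 = 3·16 + 14` and `672 = 14·16·3`. The smallness constant
      -- 2936 is four times 734, since only half of the budget is available.
      have main : 16 * U ^ 2 * ν * Q ^ 2 + 14 * U ^ 2 * ν * (h ^ 2 + e ^ 2) ≤
          734 * U ^ 4 * ν * W := by
        calc _ ≤ 16 * U ^ 2 * ν * (3 * W) + 14 * U ^ 2 * ν * (W + 16 * U ^ 2 * (3 * W)) := by
              gcongr
              exact he2.trans (by gcongr)
          _ = 62 * (U ^ 2 * (ν * W)) + 672 * U ^ 4 * ν * W := by ring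
          _ ≤ 62 * (U ^ 4 * (ν * W)) + 672 * U ^ 4 * ν * W := by gcongr
          _ = _ := by ring
      have h7 : 734 * U ^ 4 * ν * h ^ 2 ≤ h ^ 2 / (4 * (b - a)) := by
        rw [le_div_iff₀ (by positivity)]
        have := mul_le_mul_of_nonneg_right hsmall (sq_nonneg h)
        linarith
      have h8 : h ^ 2 / (2 * (b - a)) = h ^ 2 / (4 * (b - a)) + h ^ 2 / (4 * (b - a)) := by
        field_simp; ring
      rw [h8]
      rw [hW] at main
      linarith) hfin).1
  exact fun t ht => (this t ht).trans (by gcongr)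

end ClassicalSol

/-! ### Good times and decay over one window -/

theorem wInt_le_add {p : ℝ → ℝ} (hp : ∀ y, 0 ≤ p y) (cp : Continuous p) {A B : ℝ} (hA : 0 ≤ A)
    (hB : 0 ≤ B) {w w₁ w₂ : ℝ → ℂ} (c₁ : Continuous w₁)
    (h : ∀ y, ‖w y‖ ^ 2 ≤ A * ‖w₁ y‖ ^ 2 + B * ‖w₂ y‖ ^ 2) :
    wInt p w ≤ ENNReal.ofReal A * wInt p w₁ + ENNReal.ofReal B * wInt p w₂ := by
  rw [wInt, wInt, wInt, ← lintegral_const_mul' _ _ ENNReal.ofReal_ne_top,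
    ← lintegral_const_mul' _ _ ENNReal.ofReal_ne_top, ← lintegral_add_left]
  · refine lintegral_mono fun y => ?_
    have h1 := mul_nonneg (hp y) (sq_nonneg ‖w₁ y‖)
    have h2 := mul_nonneg (hp y) (sq_nonneg ‖w₂ y‖)
    rw [← ENNReal.ofReal_mul hA, ← ENNReal.ofReal_mul hB, ← ENNReal.ofReal_add
      (mul_nonneg hA h1) (mul_nonneg hB h2)]
    refine ENNReal.ofReal_le_ofReal ?_
    have := mul_le_mul_of_nonneg_left (h y) (hp y)
    linarith
  · exact ((Continuous.measurable (by fun_prop)).ennreal_ofReal).const_mul _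

theorem wInt_le_add₄ {p : ℝ → ℝ} (hp : ∀ y, 0 ≤ p y) (cp : Continuous p) {A B C D : ℝ}
    (hA : 0 ≤ A) (hB : 0 ≤ B) (hC : 0 ≤ C) (hD : 0 ≤ D) {w w₁ w₂ w₃ w₄ : ℝ → ℂ}
    (c₁ : Continuous w₁) (c₂ : Continuous w₂) (c₃ : Continuous w₃)
    (h : ∀ y, ‖w y‖ ^ 2 ≤ A * ‖w₁ y‖ ^ 2 + B * ‖w₂ y‖ ^ 2 + C * ‖w₃ y‖ ^ 2 + D * ‖w₄ y‖ ^ 2) :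
    wInt p w ≤ ENNReal.ofReal A * wInt p w₁ + ENNReal.ofReal B * wInt p w₂
      + ENNReal.ofReal C * wInt p w₃ + ENNReal.ofReal D * wInt p w₄ := by
  have n0 : ∀ (w : ℝ → ℂ) y, 0 ≤ p y * ‖w y‖ ^ 2 := fun w y => mul_nonneg (hp y) (sq_nonneg _)
  have m : ∀ {E : ℝ} {w : ℝ → ℂ}, Continuous w →
      Measurable fun y => ENNReal.ofReal E * ENNReal.ofReal (p y * ‖w y‖ ^ 2) := fun hw =>
    ((Continuous.measurable (by fun_prop)).ennreal_ofReal).const_mul _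
  simp only [wInt, ← lintegral_const_mul' _ _ ENNReal.ofReal_ne_top]
  have m₂ : Measurable fun y => ENNReal.ofReal A * ENNReal.ofReal (p y * ‖w₁ y‖ ^ 2)
      + ENNReal.ofReal B * ENNReal.ofReal (p y * ‖w₂ y‖ ^ 2) := (m c₁).add (m c₂)
  have m₃ : Measurable fun y => ENNReal.ofReal A * ENNReal.ofReal (p y * ‖w₁ y‖ ^ 2)
      + ENNReal.ofReal B * ENNReal.ofReal (p y * ‖w₂ y‖ ^ 2)
      + ENNReal.ofReal C * ENNReal.ofReal (p y * ‖w₃ y‖ ^ 2) := m₂.add (m c₃)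
  rw [← lintegral_add_left (m c₁), ← lintegral_add_left m₂, ← lintegral_add_left m₃]
  refine lintegral_mono fun y => ?_
  rw [← ENNReal.ofReal_mul hA, ← ENNReal.ofReal_mul hB, ← ENNReal.ofReal_mul hC,
    ← ENNReal.ofReal_mul hD, ← ENNReal.ofReal_add (mul_nonneg hA (n0 _ y))
    (mul_nonneg hB (n0 _ y)), ← ENNReal.ofReal_add (add_nonneg (mul_nonneg hA (n0 _ y))
    (mul_nonneg hB (n0 _ y))) (mul_nonneg hC (n0 _ y)), ← ENNReal.ofReal_add
    (add_nonneg (add_nonneg (mul_nonneg hA (n0 _ y))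
    (mul_nonneg hB (n0 _ y))) (mul_nonneg hC (n0 _ y))) (mul_nonneg hD (n0 _ y))]
  refine ENNReal.ofReal_le_ofReal ?_
  have := mul_le_mul_of_nonneg_left (h y) (hp y)
  linarith

theorem aemeasurable_wInt {a b : ℝ} (hab : a ≤ b) {p : ℝ → ℝ} (cp : Continuous p)
    {w : ℝ → ℝ → ℂ} (cw : ContinuousOn (Function.uncurry w) (Icc a b ×ˢ univ)) :
    AEMeasurable (fun t => wInt p (w t)) (volume.restrict (Icc a b)) := by
  have h1 : Continuous (Function.uncurry fun t y => w (projIcc a b hab t) y) := by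
    rw [← continuousOn_univ]
    refine cw.comp (f := fun q : ℝ × ℝ => ((projIcc a b hab q.1 : ℝ), q.2)) ?_ ?_
    · exact (((continuous_subtype_val.comp continuous_projIcc).comp continuous_fst).prodMk
        continuous_snd).continuousOn
    · exact fun q _ => ⟨(projIcc a b hab q.1).2, mem_univ _⟩
  have h2 : Measurable fun t => wInt p (w (projIcc a b hab t)) := by
    refine Measurable.lintegral_prod_right' (f := fun q : ℝ × ℝ =>
      ENNReal.ofReal (p q.2 * ‖w (projIcc a b hab q.1) q.2‖ ^ 2)) ?_
    exact ((cp.comp continuous_snd).mul (h1.norm.pow 2)).measurable.ennreal_ofReal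
  refine ⟨_, h2, ?_⟩
  filter_upwards [ae_restrict_mem measurableSet_Icc] with t ht
  rw [projIcc_of_mem hab ht]

/-- On a subinterval some time does no worse than the average, so the dissipation bound becomes a
pointwise bound at that time. -/
theorem exists_good_time {a b a' b' ν X : ℝ} (hν : 0 < ν) (ha : a ≤ a') (hab : a' < b')
    (hb : b' ≤ b) {p : ℝ → ℝ} (cp : Continuous p) {w : ℝ → ℝ → ℂ}
    (cw : ContinuousOn (Function.uncurry w) (Icc a b ×ˢ univ))
    (h : ENNReal.ofReal ν * ∫⁻ t in Icc a b, wInt p (w t) ≤ ENNReal.ofReal X) :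
    ∃ t ∈ Icc a' b', wInt p (w t) ≤ ENNReal.ofReal (X / (ν * (b' - a'))) := by
  have hsub : Icc a' b' ⊆ Icc a b := Icc_subset_Icc ha hb
  have hL : 0 < b' - a' := sub_pos.2 hab
  obtain ⟨t, ht, hle⟩ := exists_le_setLAverage (μ := volume) (s := Icc a' b')
    (f := fun t => wInt p (w t)) (by simp [hab]) (by simp)
    (aemeasurable_wInt hab.le cp (cw.mono (prod_mono hsub Subset.rfl)))
  refine ⟨t, ht, hle.trans ?_⟩
  rw [setLAverage_eq, Real.volume_Icc]
  have h1 : ∫⁻ t in Icc a' b', wInt p (w t) ≤ ∫⁻ t in Icc a b, wInt p (w t) :=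
    lintegral_mono_set hsub
  have hν' : ENNReal.ofReal ν ≠ 0 := (ENNReal.ofReal_pos.2 hν).ne'
  have h2 : ∫⁻ t in Icc a' b', wInt p (w t) ≤ ENNReal.ofReal X / ENNReal.ofReal ν := by
    rw [ENNReal.le_div_iff_mul_le (Or.inl hν') (Or.inl ENNReal.ofReal_ne_top), mul_comm]
    exact (mul_le_mul_right h1 _).trans h
  refine (ENNReal.div_le_div_right h2 _).trans (le_of_eq ?_)
  rw [← ENNReal.ofReal_div_of_pos hν, ← ENNReal.ofReal_div_of_pos hL, div_div]

namespace ClassicalSol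

variable {ν U : ℝ} {u : ℝ → ℝ} {F Fy : ℕ → ℝ → ℝ → ℂ} {p p' : ℝ → ℝ}

/-- The qualitative finiteness required by the energy estimate; it is here that the weight has to be
bounded. -/
theorem lintegral_wInt_ne_top (hF : ClassicalSol ν u F Fy) {K : ℝ} (hK : 0 ≤ K)
    (hpK : ∀ y, p y ≤ K) {a b : ℝ} (ha : 0 ≤ a) : ∫⁻ t in Icc a b, wInt p (F 0 t) ≠ ⊤ := by
  obtain ⟨M, hM⟩ := hF.bounded b
  refine ne_top_of_le_ne_top ?_ (setLIntegral_mono' (g := fun _ => ENNReal.ofReal K *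
    ENNReal.ofReal M) measurableSet_Icc fun t ht =>
      (wInt_le_of_bound hK hpK _).trans (mul_le_mul_right (hM t ⟨ha.trans ht.1, ht.2⟩) _))
  rw [setLIntegral_const, Real.volume_Icc]
  exact ENNReal.mul_ne_top (ENNReal.mul_ne_top ENNReal.ofReal_ne_top ENNReal.ofReal_ne_top)
    ENNReal.ofReal_ne_top

theorem energy_real (hF : ClassicalSol ν u F Fy) (hu : IsShear U u) (hU : 1 ≤ U) (hν : 0 < ν)
    {a b : ℝ} (ha : 0 ≤ a) (hab : a < b) (hsmall : 28 * U ^ 2 * ν * (b - a) ≤ 1)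
    (hp : IsWeight U p p') {K : ℝ} (hK : 0 ≤ K) (hpK : ∀ y, p y ≤ K) {X : ℝ}
    (hX : wInt p (F 0 a) ≤ ENNReal.ofReal X) :
    (∀ t ∈ Icc a b, wInt p (F 0 t) ≤ ENNReal.ofReal (2 * X)) ∧
      ENNReal.ofReal ν * ∫⁻ t in Icc a b, wInt p (Fy 0 t) ≤ ENNReal.ofReal (2 * X) := by
  obtain ⟨h1, h2⟩ := hF.energy hu hU hν ha hab hsmall hp (hF.lintegral_wInt_ne_top hK hpK ha)
  rw [ENNReal.ofReal_mul two_pos.le, ENNReal.ofReal_ofNat]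
  have := mul_le_mul_right hX (2 : ℝ≥0∞)
  exact ⟨fun t ht => (h1 t ht).trans this, h2.trans this⟩

theorem vf_sq_le (hu : IsShear U u) (hU : 1 ≤ U) (F Fy : ℕ → ℝ → ℝ → ℂ) (c t y : ℝ) (j : ℕ) :
    ‖vf u F Fy c j t y‖ ^ 2 ≤ 2 * U ^ 2 * ‖Fy j t y‖ ^ 2 + 2 * (t - c) ^ 2 * ‖F j t y‖ ^ 2 := by
  have hv := (hu.invSlope_pos hU y).le
  have h1 : ‖vf u F Fy c j t y‖ ≤ U * ‖Fy j t y‖ + |t - c| * ‖F j t y‖ := by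
    refine (norm_add_le _ _).trans (add_le_add ?_ ?_)
    · rw [norm_mul, Complex.norm_real, Real.norm_of_nonneg hv]
      gcongr
      exact hu.invSlope_le hU y
    · rw [norm_mul, norm_mul, Complex.norm_I, one_mul, Complex.norm_real, Real.norm_eq_abs]
  have h2 := pow_le_pow_left₀ (norm_nonneg _) h1 2
  rw [← sq_abs (t - c)]
  nlinarith [sq_nonneg (U * ‖Fy j t y‖ - |t - c| * ‖F j t y‖)]

theorem lintegral_vf_ne_top (hF : ClassicalSol ν u F Fy) (hu : IsShear U u) (hU : 1 ≤ U)
    {a b c : ℝ} (ha : 0 ≤ a) (hca : c ≤ a) (hab : a ≤ b) (hp : IsWeight U p p')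
    (h1 : ∫⁻ t in Icc a b, wInt p (F 0 t) ≠ ⊤) (h2 : ∫⁻ t in Icc a b, wInt p (Fy 0 t) ≠ ⊤) :
    ∫⁻ t in Icc a b, wInt p (vf u F Fy c 0 t) ≠ ⊤ := by
  have hs := Icc_subset (b := b) ha
  refine ne_top_of_le_ne_top ?_ (setLIntegral_mono' (g := fun t =>
    ENNReal.ofReal (2 * U ^ 2) * wInt p (Fy 0 t) + ENNReal.ofReal (2 * (b - c) ^ 2) *
      wInt p (F 0 t)) measurableSet_Icc fun t ht => ?_)
  · rw [lintegral_add_left' ((aemeasurable_wInt hab hp.continuous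
      ((hF.continuous_y 0).mono hs)).const_mul _), lintegral_const_mul' _ _ ENNReal.ofReal_ne_top,
      lintegral_const_mul' _ _ ENNReal.ofReal_ne_top]
    exact ENNReal.add_ne_top.2 ⟨ENNReal.mul_ne_top ENNReal.ofReal_ne_top h2,
      ENNReal.mul_ne_top ENNReal.ofReal_ne_top h1⟩
  · refine wInt_le_add (fun y => (hp.pos y).le) hp.continuous (by positivity) (by positivity)
      (hF.continuous_slice_y 0 (ha.trans ht.1)) fun y => (vf_sq_le hu hU F Fy c t y 0).trans ?_
    have h3 : 0 ≤ t - c := by linarith [ht.1]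
    have h4 : t - c ≤ b - c := by linarith [ht.2]
    gcongr

theorem energy_vf_real (hF : ClassicalSol ν u F Fy) (hu : IsShear U u) (hU : 1 ≤ U) (hν : 0 < ν)
    {a b c : ℝ} (ha : 0 ≤ a) (hab : a < b) (hc : c ≤ a) (hsmall : 270 * U ^ 4 * ν * (b - a) ≤ 1)
    (hp : IsWeight U p p') (hfin : ∫⁻ t in Icc a b, wInt p (Fy 0 t) ≠ ⊤)
    {X Y : ℝ} (hX0 : 0 ≤ X) (hY0 : 0 ≤ Y) (hX : ∀ t ∈ Icc a b, wInt p (F 0 t) ≤ ENNReal.ofReal X)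
    (hY : wInt p (vf u F Fy c 0 a) ≤ ENNReal.ofReal Y) :
    (∀ t ∈ Icc a b, wInt p (vf u F Fy c 0 t) ≤
      ENNReal.ofReal (2 * (Y + 135 * U ^ 4 * ν * (b - c) ^ 2 * (b - a) * X))) ∧
      ENNReal.ofReal ν * ∫⁻ t in Icc a b, wInt p (vfy ν u F Fy c 0 t) ≤
        ENNReal.ofReal (2 * (Y + 135 * U ^ 4 * ν * (b - c) ^ 2 * (b - a) * X)) := by
  have hL : 0 < b - a := sub_pos.2 hab
  have hU0 : 0 < U := by linarith
  have h1 : ∫⁻ t in Icc a b, wInt p (F 0 t) ≠ ⊤ := by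
    refine ne_top_of_le_ne_top ?_ (setLIntegral_mono' measurableSet_Icc hX)
    rw [setLIntegral_const, Real.volume_Icc]
    exact ENNReal.mul_ne_top ENNReal.ofReal_ne_top ENNReal.ofReal_ne_top
  obtain ⟨e1, e2⟩ := hF.energy_vf hu hU hν ha hab hc hsmall hp
    (hF.lintegral_vf_ne_top hu hU ha hc hab.le hp h1 hfin) hX
  have e : 2 * (wInt p (vf u F Fy c 0 a)
      + ENNReal.ofReal (135 * U ^ 4 * ν * (b - c) ^ 2 * (b - a)) * ENNReal.ofReal X) ≤
      ENNReal.ofReal (2 * (Y + 135 * U ^ 4 * ν * (b - c) ^ 2 * (b - a) * X)) := by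
    rw [ENNReal.ofReal_mul two_pos.le, ENNReal.ofReal_ofNat, ENNReal.ofReal_add hY0 (by positivity),
      ← ENNReal.ofReal_mul (by positivity)]
    gcongr
  exact ⟨fun t ht => (e1 t ht).trans e, e2.trans e⟩

/-- Over one time window of length `T` the weighted square integral drops by a factor `256`. -/
theorem window (hF : ClassicalSol ν u F Fy) (hu : IsShear U u) (hU : 1 ≤ U) (hν : 0 < ν)
    {T a : ℝ} (hT : 0 < T) (hT1 : 655360 * U ^ 2 ≤ ν * T ^ 3) (hT2 : 20000000 * U ^ 4 * ν * T ≤ 1)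
    (ha : 0 ≤ a) (hp : IsWeight U p p') {K : ℝ} (hK : 0 ≤ K) (hpK : ∀ y, p y ≤ K) {X : ℝ}
    (hX0 : 0 ≤ X) (hX : wInt p (F 0 a) ≤ ENNReal.ofReal X) :
    (∀ t ∈ Icc a (a + T), wInt p (F 0 t) ≤ ENNReal.ofReal (2 * X)) ∧
      wInt p (F 0 (a + T)) ≤ ENNReal.ofReal (X / 256) := by
  have hU0 : 0 < U := by linarith
  have hUU : U ^ 2 ≤ U ^ 4 := pow_le_pow_right₀ hU (by norm_num)
  have hνT : 0 < ν * T := mul_pos hν hT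
  have small : ∀ {L : ℝ}, 0 ≤ L → L ≤ T → 270 * U ^ 4 * ν * L ≤ 1 := fun {L} h0 h => by
    have h1 : U ^ 4 * ν * L ≤ U ^ 4 * ν * T := by gcongr
    have h2 : 0 ≤ U ^ 4 * ν * T := by positivity
    nlinarith
  have small' : ∀ {L : ℝ}, 0 ≤ L → L ≤ T → 28 * U ^ 2 * ν * L ≤ 1 := fun {L} h0 h => by
    have h1 : U ^ 2 * ν * L ≤ U ^ 4 * ν * L := by gcongr
    have h2 : 0 ≤ U ^ 4 * ν * L := by positivity
    linarith [small h0 h]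
  have hs := Icc_subset (b := a + T) ha
  obtain ⟨E1, E2⟩ := hF.energy_real hu hU hν ha (by linarith : a < a + T)
    (small' (by linarith) (by linarith)) hp hK hpK hX
  refine ⟨E1, ?_⟩
  -- Two good times, in the first quarter and in the second half, so that they are at least `T/4`
  -- apart.
  obtain ⟨t₁, ht₁, g₁⟩ := exists_good_time (a' := a) (b' := a + T / 4) hν le_rfl (by linarith)
    (by linarith) hp.continuous ((hF.continuous_y 0).mono hs) E2
  obtain ⟨t₂, ht₂, g₂⟩ := exists_good_time (a' := a + T / 2) (b' := a + T) hν (by linarith)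
    (by linarith) le_rfl hp.continuous ((hF.continuous_y 0).mono hs) E2
  have ht₁0 : 0 ≤ t₁ := ha.trans ht₁.1
  have ht₂0 : 0 ≤ t₂ := by linarith [ht₂.1]
  have hp0 := fun y => (hp.pos y).le
  have f1 : ∫⁻ t in Icc t₁ (a + T), wInt p (Fy 0 t) ≠ ⊤ := by
    refine ne_top_of_le_ne_top ?_ (lintegral_mono_set (Icc_subset_Icc_left ht₁.1))
    intro h
    rw [h, ENNReal.mul_top (ENNReal.ofReal_pos.2 hν).ne'] at E2
    exact ENNReal.ofReal_ne_top (top_le_iff.1 E2)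
  -- The clock is restarted at `c = t₁`, where `J` reduces to `v ∂_y`. Hence `Y` is `U²` times the
  -- bound `2X/(ν · T/4)` at the good time.
  set Y := 8 * U ^ 2 * X / (ν * T) with hYdef
  have hY0 : 0 ≤ Y := by positivity
  have hY : wInt p (vf u F Fy t₁ 0 t₁) ≤ ENNReal.ofReal Y := by
    have h1 := wInt_le_add (p := p) hp0 hp.continuous (A := U ^ 2) (B := 0) (by positivity) le_rfl
      (w := vf u F Fy t₁ 0 t₁) (w₂ := fun _ => 0) (hF.continuous_slice_y 0 ht₁0) (fun y => by
        have hv := (hu.invSlope_pos hU y).le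
        simp only [vf, sub_self, Complex.ofReal_zero, mul_zero, zero_mul, add_zero, norm_mul,
          Complex.norm_real, Real.norm_of_nonneg hv, mul_pow]
        gcongr
        exact hu.invSlope_le hU y)
    rw [ENNReal.ofReal_zero, zero_mul, add_zero] at h1
    refine h1.trans ((mul_le_mul_right g₁ _).trans (le_of_eq ?_))
    rw [← ENNReal.ofReal_mul (by positivity)]
    congr 1
    rw [hYdef, show a + T / 4 - a = T / 4 by ring]; field_simp; ring
  have hlen : 0 ≤ a + T - t₁ := by linarith [ht₁.2]
  have hlen' : a + T - t₁ ≤ T := by linarith [ht₁.1]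
  obtain ⟨G1, -⟩ := hF.energy_vf_real hu hU hν ht₁0 (by linarith [ht₁.2] : t₁ < a + T) le_rfl
    (small hlen hlen') hp f1 (by positivity : 0 ≤ 2 * X) hY0
    (fun t ht => E1 t ⟨ht₁.1.trans ht.1, ht.2⟩) hY
  have hG2 := G1 t₂ ⟨by linarith [ht₁.2, ht₂.1], ht₂.2⟩
  have hsrc : 2 * (Y + 135 * U ^ 4 * ν * (a + T - t₁) ^ 2 * (a + T - t₁) * (2 * X)) ≤
      2 * (Y + 270 * U ^ 4 * ν * T ^ 3 * X) := by
    have : 135 * U ^ 4 * ν * (a + T - t₁) ^ 2 * (a + T - t₁) * (2 * X) ≤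
      135 * U ^ 4 * ν * T ^ 2 * T * (2 * X) := by gcongr
    linarith
  have hG3 := hG2.trans (ENNReal.ofReal_le_ofReal hsrc)
  have hF2 : wInt p (F 0 t₂) ≤ ENNReal.ofReal (X / 512) := by
    have h1 := wInt_le_add (p := p) hp0 hp.continuous (A := 32 / T ^ 2) (B := 32 / T ^ 2 * U ^ 2)
      (by positivity) (by positivity) (w := F 0 t₂) (w₁ := vf u F Fy t₁ 0 t₂) (w₂ := Fy 0 t₂)
      (slice_continuous ((hF.continuous_vf hu hU t₁ 0).mono (Icc_subset le_rfl)) ⟨ht₂0, le_rfl⟩)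
      (fun y => by
        have hv := (hu.invSlope_pos hU y).le
        have hτ : T / 4 ≤ t₂ - t₁ := by linarith [ht₁.2, ht₂.1]
        have e : Complex.I * (t₂ - t₁ : ℝ) * F 0 t₂ y =
          vf u F Fy t₁ 0 t₂ y - invSlope u y * Fy 0 t₂ y := by simp only [vf]; ring
        have e1 : (t₂ - t₁) * ‖F 0 t₂ y‖ ≤ ‖vf u F Fy t₁ 0 t₂ y‖ + U * ‖Fy 0 t₂ y‖ := by
          have h2 : ‖Complex.I * (t₂ - t₁ : ℝ) * F 0 t₂ y‖ = (t₂ - t₁) * ‖F 0 t₂ y‖ := by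
            rw [norm_mul, norm_mul, Complex.norm_I, one_mul, Complex.norm_real,
              Real.norm_of_nonneg (by linarith)]
          rw [← h2, e]
          refine (norm_sub_le _ _).trans (add_le_add le_rfl ?_)
          rw [norm_mul, Complex.norm_real, Real.norm_of_nonneg hv]
          gcongr
          exact hu.invSlope_le hU y
        have e2 : T / 4 * ‖F 0 t₂ y‖ ≤ ‖vf u F Fy t₁ 0 t₂ y‖ + U * ‖Fy 0 t₂ y‖ :=
          (mul_le_mul_of_nonneg_right hτ (norm_nonneg _)).trans e1
        have e3 := pow_le_pow_left₀ (by positivity) e2 2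
        have e4 : (T / 4 * ‖F 0 t₂ y‖) ^ 2 ≤ 2 * ‖vf u F Fy t₁ 0 t₂ y‖ ^ 2
            + 2 * (U ^ 2 * ‖Fy 0 t₂ y‖ ^ 2) := by
          nlinarith [sq_nonneg (‖vf u F Fy t₁ 0 t₂ y‖ - U * ‖Fy 0 t₂ y‖)]
        have e5 : 32 / T ^ 2 * ‖vf u F Fy t₁ 0 t₂ y‖ ^ 2 + 32 / T ^ 2 * U ^ 2 * ‖Fy 0 t₂ y‖ ^ 2
            = 16 / T ^ 2 * (2 * ‖vf u F Fy t₁ 0 t₂ y‖ ^ 2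
            + 2 * (U ^ 2 * ‖Fy 0 t₂ y‖ ^ 2)) := by ring
        have e6 : ‖F 0 t₂ y‖ ^ 2 = 16 / T ^ 2 * (T / 4 * ‖F 0 t₂ y‖) ^ 2 := by field_simp; ring
        rw [e5, e6]
        gcongr)
    refine h1.trans ((add_le_add (mul_le_mul_right hG3 _) (mul_le_mul_right g₂ _)).trans ?_)
    rw [← ENNReal.ofReal_mul (by positivity), ← ENNReal.ofReal_mul (by positivity),
      ← ENNReal.ofReal_add (by positivity) (by
        have : 0 ≤ a + T - (a + T / 2) := by linarith
        positivity)]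
    refine ENNReal.ofReal_le_ofReal ?_
    -- The two competing requirements on `T` appear: the first term is small if `νT³` is large, the
    -- second if `νT` is small. Each is at most `X/1024`; this gives `X/512` at `t₂`, and the energy
    -- at most doubles in what is left of the window.
    have e7 : 32 / T ^ 2 * (2 * (Y + 270 * U ^ 4 * ν * T ^ 3 * X))
        + 32 / T ^ 2 * U ^ 2 * (2 * X / (ν * (a + T - (a + T / 2)))) =
        640 * U ^ 2 / (ν * T ^ 3) * X + 17280 * U ^ 4 * ν * T * X := by
      rw [hYdef, show a + T - (a + T / 2) = T / 2 by ring]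
      field_simp
      ring
    rw [e7]
    have e8 : 640 * U ^ 2 / (ν * T ^ 3) ≤ 1 / 1024 := by
      rw [div_le_div_iff₀ (by positivity) (by norm_num)]
      linarith
    have e9 : 17280 * U ^ 4 * ν * T ≤ 1 / 1024 := by linarith
    have := mul_le_mul_of_nonneg_right e8 hX0
    have := mul_le_mul_of_nonneg_right e9 hX0
    linarith
  rcases eq_or_lt_of_le ht₂.2 with h | h
  · rw [← h]
    exact hF2.trans (ENNReal.ofReal_le_ofReal (by linarith))
  · have := (hF.energy_real hu hU hν ht₂0 h (small' (by linarith) (by linarith [ht₂.1]))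
      hp hK hpK hF2).1 (a + T) ⟨ht₂.2, le_rfl⟩
    exact this.trans (ENNReal.ofReal_le_ofReal (by linarith))

theorem decay (hF : ClassicalSol ν u F Fy) (hu : IsShear U u) (hU : 1 ≤ U) (hν : 0 < ν)
    {T : ℝ} (hT : 0 < T) (hT1 : 655360 * U ^ 2 ≤ ν * T ^ 3) (hT2 : 20000000 * U ^ 4 * ν * T ≤ 1)
    (hp : IsWeight U p p') {K : ℝ} (hK : 0 ≤ K) (hpK : ∀ y, p y ≤ K) {X : ℝ}
    (hX0 : 0 ≤ X) (hX : wInt p (F 0 0) ≤ ENNReal.ofReal X) (n : ℕ) :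
    wInt p (F 0 (n * T)) ≤ ENNReal.ofReal (X / 256 ^ n) ∧
    ∀ t ∈ Icc (n * T) ((n + 1) * T), wInt p (F 0 t) ≤ ENNReal.ofReal (2 * (X / 256 ^ n)) := by
  have step : ∀ n : ℕ, wInt p (F 0 (n * T)) ≤ ENNReal.ofReal (X / 256 ^ n) →
      (∀ t ∈ Icc (n * T) ((n + 1) * T), wInt p (F 0 t) ≤ ENNReal.ofReal (2 * (X / 256 ^ n))) ∧
      wInt p (F 0 ((n + 1) * T)) ≤ ENNReal.ofReal (X / 256 ^ n / 256) := fun n h => by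
    have := hF.window hu hU hν hT hT1 hT2 (by positivity : 0 ≤ n * T) hp hK hpK
      (by positivity : 0 ≤ X / 256 ^ n) h
    rwa [show (n : ℝ) * T + T = (n + 1) * T by ring] at this
  have main : ∀ n : ℕ, wInt p (F 0 (n * T)) ≤ ENNReal.ofReal (X / 256 ^ n) := fun n => by
    induction n with
    | zero => simpa using hX
    | succ n ih =>
      have := (step n ih).2
      rw [div_div, ← pow_succ] at this
      exact_mod_cast this
  exact ⟨main n, (step n (main n)).1⟩

end ClassicalSol

/-! ### Decay of the vector field -/

namespace ClassicalSol

variable {ν U : ℝ} {u : ℝ → ℝ} {F Fy : ℕ → ℝ → ℝ → ℂ}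

/-- This is `(v∂_y + i(t - c))JF - v v' F_y`, with `v F_y` rewritten as `JF - itF`. It involves only
`∂_y(JF)`, `JF` and `F`, so the pair (`vf₂`, `JF`) can be treated like the pair (`JF`, `F`). -/
theorem vf₂_eq (ν : ℝ) (u : ℝ → ℝ) (F Fy : ℕ → ℝ → ℝ → ℂ) (c t y : ℝ) :
    vf₂ ν u F Fy c 0 t y = invSlope u y * vfy ν u F Fy 0 0 t y
      + (Complex.I * (t - c : ℝ) - invSlope₁ u y) * vf u F Fy 0 0 t y
      + Complex.I * t * invSlope₁ u y * F 0 t y := by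
  simp only [vf₂, vfy, vf, sub_zero]
  push_cast
  linear_combination (-(t : ℂ) * (t - c) * F 0 t y) * Complex.I_sq

/-- Bounds the second order quantity at its starting time, and shows its integrability later. The
vanishing fourth term only gives the shape expected by `wInt_le_add₄`. -/
theorem vf₂_sq_le (hu : IsShear U u) (hU : 1 ≤ U) {c t b : ℝ} (hct : c ≤ t) (hc : 0 ≤ c)
    (htb : t ≤ b) (y : ℝ) :
    ‖vf₂ ν u F Fy c 0 t y‖ ^ 2 ≤ 3 * U ^ 4 * ‖vfy ν u F Fy 0 0 t y‖ ^ 2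
      + 3 * ((t - c) + U ^ 2) ^ 2 * ‖vf u F Fy 0 0 t y‖ ^ 2
      + 3 * (U ^ 4 * b ^ 2) * ‖F 0 t y‖ ^ 2 + 0 * ‖(0 : ℂ)‖ ^ 2 := by
  have hv := (hu.invSlope_pos hU y).le
  have hvU := hu.invSlope_le hU y
  have hv1 : |invSlope₁ u y| ≤ U ^ 2 := by
    nlinarith [hu.abs_invSlope₁_le hU y]
  have ht : 0 ≤ t := hc.trans hct
  have e : ‖vf₂ ν u F Fy c 0 t y‖ ≤ U ^ 2 * ‖vfy ν u F Fy 0 0 t y‖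
      + ((t - c) + U ^ 2) * ‖vf u F Fy 0 0 t y‖ + U ^ 2 * b * ‖F 0 t y‖ := by
    rw [vf₂_eq]
    refine (norm_add₃_le ..).trans (add_le_add (add_le_add ?_ ?_) ?_)
    · rw [norm_mul, Complex.norm_real, Real.norm_of_nonneg hv]
      gcongr
      nlinarith
    · rw [norm_mul]
      refine mul_le_mul_of_nonneg_right ((norm_sub_le _ _).trans (add_le_add ?_ ?_)) (norm_nonneg _)
      · rw [norm_mul, Complex.norm_I, one_mul, Complex.norm_real, Real.norm_of_nonneg (by linarith)]
      · rwa [Complex.norm_real]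
    · rw [norm_mul, norm_mul, norm_mul, Complex.norm_I, one_mul, Complex.norm_real,
        Complex.norm_real, Real.norm_of_nonneg ht, mul_comm t]
      gcongr
      exact hv1
  have e2 := pow_le_pow_left₀ (norm_nonneg _) e 2
  set x := U ^ 2 * ‖vfy ν u F Fy 0 0 t y‖ with hx
  set z := ((t - c) + U ^ 2) * ‖vf u F Fy 0 0 t y‖ with hz
  set w := U ^ 2 * b * ‖F 0 t y‖ with hw
  have e3 : (x + z + w) ^ 2 ≤ 3 * (x ^ 2 + z ^ 2 + w ^ 2) := by
    nlinarith [sq_nonneg (x - z), sq_nonneg (x - w), sq_nonneg (z - w)]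
  refine e2.trans (e3.trans (le_of_eq ?_))
  rw [hx, hz, hw]
  ring

/-- `vf₂_eq` solved for `i(t - c)JF` and divided by `t - c ≥ T/4`. `JF` reappears on the right, but
with the factor `U⁴/T²`, which is small. -/
theorem vf_sq_le_of_vf₂ (hu : IsShear U u) (hU : 1 ≤ U) {c t b T : ℝ} (hT : 0 < T)
    (hct : T / 4 ≤ t - c) (hc : 0 ≤ c) (htb : t ≤ b) (y : ℝ) :
    ‖vf u F Fy 0 0 t y‖ ^ 2 ≤ 64 / T ^ 2 * ‖vf₂ ν u F Fy c 0 t y‖ ^ 2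
      + 64 / T ^ 2 * U ^ 2 * ‖vfy ν u F Fy 0 0 t y‖ ^ 2
      + 64 / T ^ 2 * U ^ 4 * ‖vf u F Fy 0 0 t y‖ ^ 2
      + 64 / T ^ 2 * (U ^ 4 * b ^ 2) * ‖F 0 t y‖ ^ 2 := by
  have hv := (hu.invSlope_pos hU y).le
  have hvU := hu.invSlope_le hU y
  have hv1 : |invSlope₁ u y| ≤ U ^ 2 := by
    nlinarith [hu.abs_invSlope₁_le hU y]
  have ht : 0 ≤ t := by linarith
  set x := ‖vf₂ ν u F Fy c 0 t y‖ with hx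
  set z := U * ‖vfy ν u F Fy 0 0 t y‖ with hz
  set s := U ^ 2 * ‖vf u F Fy 0 0 t y‖ with hs
  set w := U ^ 2 * b * ‖F 0 t y‖ with hw
  have e : T / 4 * ‖vf u F Fy 0 0 t y‖ ≤ x + z + s + w := by
    have e0 : Complex.I * (t - c : ℝ) * vf u F Fy 0 0 t y = vf₂ ν u F Fy c 0 t y
        - invSlope u y * vfy ν u F Fy 0 0 t y + invSlope₁ u y * vf u F Fy 0 0 t y
        - Complex.I * t * invSlope₁ u y * F 0 t y := by rw [vf₂_eq]; ring
    have e1 : ‖Complex.I * (t - c : ℝ) * vf u F Fy 0 0 t y‖ = (t - c) * ‖vf u F Fy 0 0 t y‖ := by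
      rw [norm_mul, norm_mul, Complex.norm_I, one_mul, Complex.norm_real,
        Real.norm_of_nonneg (by linarith)]
    refine (mul_le_mul_of_nonneg_right hct (norm_nonneg _)).trans ?_
    rw [← e1, e0]
    refine (norm_sub_le _ _).trans (add_le_add ((norm_add_le _ _).trans (add_le_add
      ((norm_sub_le _ _).trans (add_le_add le_rfl ?_)) ?_)) ?_)
    · rw [norm_mul, Complex.norm_real, Real.norm_of_nonneg hv, hz]
      gcongr
    · rw [norm_mul, Complex.norm_real, hs]
      gcongr
      exact hv1
    · rw [norm_mul, norm_mul, norm_mul, Complex.norm_I, one_mul, Complex.norm_real,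
        Complex.norm_real, Real.norm_of_nonneg ht, mul_comm t, hw]
      gcongr
      exact hv1
  have e2 := pow_le_pow_left₀ (by positivity) e 2
  have e3 : (x + z + s + w) ^ 2 ≤ 4 * (x ^ 2 + z ^ 2 + s ^ 2 + w ^ 2) := by
    nlinarith [sq_nonneg (x - z), sq_nonneg (x - w), sq_nonneg (z - w), sq_nonneg (x - s),
      sq_nonneg (z - s), sq_nonneg (w - s)]
  have e6 : ‖vf u F Fy 0 0 t y‖ ^ 2 = 16 / T ^ 2 * (T / 4 * ‖vf u F Fy 0 0 t y‖) ^ 2 := by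
    field_simp; ring
  rw [e6]
  refine (mul_le_mul_of_nonneg_left (e2.trans e3) (by positivity)).trans (le_of_eq ?_)
  rw [hz, hs, hw]
  field_simp
  ring

/-- The coefficient of `B` contains `1/(νT³)`, `1/T²` and `νb²/T`, all made small by hypothesis;
this is the contraction. The last of them, the growth of the commutators with the absolute time `b`,
is what limits the argument to `b` of order `ρ⁻²`. The coefficient of `f` is dominated by `U⁴νT³m⁴`,
where `m` counts the windows elapsed. -/
theorem window_vf_arith {U ν T b m A f : ℝ} (hU : 1 ≤ U) (hν : 0 < ν) (hT : 0 < T)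
    (hT1 : 1000000 * U ^ 4 ≤ ν * T ^ 3) (hT3 : 1000000 * U ^ 4 ≤ T ^ 2) (hm : 1 ≤ m) (hb0 : 0 ≤ b)
    (hb : b ≤ m * T) (hb2 : 1000000000 * U ^ 4 * ν * b ^ 2 ≤ T) (hA : 0 ≤ A) (hf : 0 ≤ f)
    {B : ℝ} (hB : B = 2 * (A + 135 * U ^ 4 * ν * b ^ 2 * T * f)) :
    2 * (64 / T ^ 2 * (2 * ((3 * U ^ 4 * (4 * B / (ν * T)) + 3 * U ^ 4 * B + 3 * (U ^ 4 * b ^ 2) * f)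
      + (734 * U ^ 4 * ν * (9 * b ^ 2) * T * B
      + (734 * U ^ 4 * ν * (16 * b ^ 4) + 4 * T * U ^ 4) * T * f)))
      + 64 / T ^ 2 * U ^ 2 * (2 * B / (ν * T)) + 64 / T ^ 2 * U ^ 4 * B
      + 64 / T ^ 2 * (U ^ 4 * b ^ 2) * f + 135 * U ^ 4 * ν * b ^ 2 * T * f) ≤
      A / 64 + 3100000 * U ^ 4 * (ν * T ^ 3) * m ^ 4 * f := by
  have hU0 : 0 < U := by linarith
  have hU2 : U ^ 2 ≤ U ^ 4 := pow_le_pow_right₀ hU (by norm_num)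
  have hB0 : 0 ≤ B := by rw [hB]; positivity
  have q1 : U ^ 4 / (ν * T ^ 3) ≤ 1 / 1000000 := by
    rw [div_le_div_iff₀ (by positivity) (by norm_num)]; linarith
  have q1' : U ^ 2 / (ν * T ^ 3) ≤ 1 / 1000000 := by
    rw [div_le_div_iff₀ (by positivity) (by norm_num)]; linarith
  have q2 : U ^ 4 / T ^ 2 ≤ 1 / 1000000 := by
    rw [div_le_div_iff₀ (by positivity) (by norm_num)]; linarith
  have q3 : U ^ 4 * ν * b ^ 2 / T ≤ 1 / 1000000000 := by
    rw [div_le_div_iff₀ (by positivity) (by norm_num)]; linarith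
  have hbm2 : b ^ 2 ≤ m ^ 2 * T ^ 2 := by rw [← mul_pow]; gcongr
  have hm2 : m ^ 2 ≤ m ^ 4 := pow_le_pow_right₀ hm (by norm_num)
  have hm4 : 1 ≤ m ^ 4 := one_le_pow₀ hm
  set R := U ^ 4 * (ν * T ^ 3) * m ^ 4 with hR
  have hR4 : 1000000 * U ^ 4 ≤ R := by
    have h1 : U ^ 4 * (ν * T ^ 3) * 1 ≤ R := by rw [hR]; gcongr
    have h2 : 1 ≤ U ^ 4 := one_le_pow₀ hU
    have h3 : 1 * (ν * T ^ 3) ≤ U ^ 4 * (ν * T ^ 3) := by gcongr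
    linarith
  have q4 : U ^ 4 * b ^ 2 / T ^ 2 ≤ R / 1000000 := by
    have h1 : U ^ 4 * b ^ 2 / T ^ 2 ≤ U ^ 4 * m ^ 4 := by
      rw [div_le_iff₀ (by positivity)]
      calc U ^ 4 * b ^ 2 ≤ U ^ 4 * (m ^ 2 * T ^ 2) := by gcongr
        _ = U ^ 4 * m ^ 2 * T ^ 2 := by ring
        _ ≤ _ := by gcongr
    have h2 : 1 ≤ U ^ 4 := one_le_pow₀ hU
    have h3 : U ^ 4 * 1000000 * m ^ 4 ≤ R := by
      rw [hR]; gcongr; linarith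
    linarith
  have q5 : U ^ 4 * ν * b ^ 4 / T ≤ R := by
    rw [div_le_iff₀ hT, hR]
    calc U ^ 4 * ν * b ^ 4 ≤ U ^ 4 * ν * (m * T) ^ 4 := by gcongr
      _ = _ := by ring
  have q6 : U ^ 4 * ν * b ^ 2 * T ≤ R := by
    calc U ^ 4 * ν * b ^ 2 * T ≤ U ^ 4 * ν * (m ^ 2 * T ^ 2) * T := by gcongr
      _ = U ^ 4 * (ν * T ^ 3) * m ^ 2 := by ring
      _ ≤ R := by rw [hR]; gcongr
  have e : 2 * (64 / T ^ 2 * (2 * ((3 * U ^ 4 * (4 * B / (ν * T)) + 3 * U ^ 4 * B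
      + 3 * (U ^ 4 * b ^ 2) * f) + (734 * U ^ 4 * ν * (9 * b ^ 2) * T * B
      + (734 * U ^ 4 * ν * (16 * b ^ 4) + 4 * T * U ^ 4) * T * f)))
      + 64 / T ^ 2 * U ^ 2 * (2 * B / (ν * T)) + 64 / T ^ 2 * U ^ 4 * B
      + 64 / T ^ 2 * (U ^ 4 * b ^ 2) * f + 135 * U ^ 4 * ν * b ^ 2 * T * f) =
      (3072 * (U ^ 4 / (ν * T ^ 3)) + 256 * (U ^ 2 / (ν * T ^ 3)) + 896 * (U ^ 4 / T ^ 2)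
        + 1691136 * (U ^ 4 * ν * b ^ 2 / T)) * B
      + (896 * (U ^ 4 * b ^ 2 / T ^ 2) + 3006464 * (U ^ 4 * ν * b ^ 4 / T) + 1024 * U ^ 4
        + 270 * (U ^ 4 * ν * b ^ 2 * T)) * f := by
    field_simp
    ring
  have k1 : 3072 * (U ^ 4 / (ν * T ^ 3)) + 256 * (U ^ 2 / (ν * T ^ 3)) + 896 * (U ^ 4 / T ^ 2)
        + 1691136 * (U ^ 4 * ν * b ^ 2 / T) ≤ 1 / 128 := by linarith
  have k2 : 896 * (U ^ 4 * b ^ 2 / T ^ 2) + 3006464 * (U ^ 4 * ν * b ^ 4 / T) + 1024 * U ^ 4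
        + 270 * (U ^ 4 * ν * b ^ 2 * T) ≤ 3010000 * R := by
    have : 0 ≤ R := by positivity
    linarith
  have k3 := mul_le_mul_of_nonneg_right k1 hB0
  have k4 := mul_le_mul_of_nonneg_right k2 hf
  have k5 := mul_le_mul_of_nonneg_right q6 hf
  have k6 : 0 ≤ R * f := by positivity
  rw [e, show 3100000 * U ^ 4 * (ν * T ^ 3) * m ^ 4 * f = 3100000 * (R * f) by rw [hR]; ring]
  rw [hB] at k3 ⊢
  linarith

/-- Over one time window, the norm of the vector field drops by a factor, up to the norm of the
solution. -/
theorem window_vf (hF : ClassicalSol ν u F Fy) (hu : IsShear U u) (hU : 1 ≤ U) (hν : 0 < ν)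
    {T a m : ℝ} (hT : 0 < T) (hT1 : 1000000 * U ^ 4 ≤ ν * T ^ 3)
    (hT2 : 20000000 * U ^ 4 * ν * T ≤ 1) (hT3 : 1000000 * U ^ 4 ≤ T ^ 2) (ha : 0 ≤ a)
    (hm : 1 ≤ m) (hb : a + T ≤ m * T) (hb2 : 1000000000 * U ^ 4 * ν * (a + T) ^ 2 ≤ T)
    {p p' : ℝ → ℝ} (hp : IsWeight U p p') (hfin : ∫⁻ t in Icc a (a + T), wInt p (Fy 0 t) ≠ ⊤)
    {A f : ℝ} (hA0 : 0 ≤ A) (hf0 : 0 ≤ f)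
    (hA : wInt p (vf u F Fy 0 0 a) ≤ ENNReal.ofReal A)
    (hf : ∀ t ∈ Icc a (a + T), wInt p (F 0 t) ≤ ENNReal.ofReal f) :
    (∀ t ∈ Icc a (a + T), wInt p (vf u F Fy 0 0 t) ≤
      ENNReal.ofReal (2 * (A + 135 * U ^ 4 * ν * (a + T) ^ 2 * T * f))) ∧
    wInt p (vf u F Fy 0 0 (a + T)) ≤
      ENNReal.ofReal (A / 64 + 3100000 * U ^ 4 * (ν * T ^ 3) * m ^ 4 * f) := by
  have hU0 : 0 < U := by linarith
  have hs := Icc_subset (b := a + T) ha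
  have hp0 := fun y => (hp.pos y).le
  have small : ∀ {L : ℝ}, 0 ≤ L → L ≤ T → 2936 * U ^ 4 * ν * L ≤ 1 := fun {L} h0 h => by
    have h1 : U ^ 4 * ν * L ≤ U ^ 4 * ν * T := by gcongr
    have h2 : 0 ≤ U ^ 4 * ν * T := by positivity
    nlinarith
  have small' : ∀ {L : ℝ}, 0 ≤ L → L ≤ T → 270 * U ^ 4 * ν * L ≤ 1 := fun {L} h0 h => by
    have h2 : 0 ≤ U ^ 4 * ν * L := by positivity
    linarith [small h0 h]
  have hab : a < a + T := by linarith
  obtain ⟨G1, G2⟩ := hF.energy_vf_real hu hU hν ha hab ha (small' (by linarith) (by linarith)) hp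
    hfin hf0 hA0 hf hA
  rw [sub_zero, add_sub_cancel_left] at G1 G2
  refine ⟨G1, ?_⟩
  obtain ⟨B, hB⟩ : ∃ B, B = 2 * (A + 135 * U ^ 4 * ν * (a + T) ^ 2 * T * f) := ⟨_, rfl⟩
  have hB0 : 0 ≤ B := by rw [hB]; positivity
  rw [← hB] at G1 G2
  have cvfy := (hF.continuous_vfy hu hU 0 0).mono hs
  -- As in `window`, but with times that are good for `∂_y(JF)`.
  obtain ⟨t₁, ht₁, g₁⟩ := exists_good_time (a' := a) (b' := a + T / 4) hν le_rfl (by linarith)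
    (by linarith) hp.continuous cvfy G2
  obtain ⟨t₂, ht₂, g₂⟩ := exists_good_time (a' := a + T / 2) (b' := a + T) hν (by linarith)
    (by linarith) le_rfl hp.continuous cvfy G2
  rw [show B / (ν * (a + T / 4 - a)) = 4 * B / (ν * T) by
    rw [show a + T / 4 - a = T / 4 by ring]; field_simp] at g₁
  rw [show B / (ν * (a + T - (a + T / 2))) = 2 * B / (ν * T) by
    rw [show a + T - (a + T / 2) = T / 2 by ring]; field_simp] at g₂
  have ht₁0 : 0 ≤ t₁ := ha.trans ht₁.1
  have m₁ : t₁ ∈ Icc a (a + T) := ⟨ht₁.1, by linarith [ht₁.2]⟩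
  have m₂ : t₂ ∈ Icc a (a + T) := ⟨by linarith [ht₂.1], ht₂.2⟩
  have ht₁b : t₁ < a + T := by linarith [ht₁.2]
  have cvf := fun {t} (ht : t ∈ Icc a (a + T)) =>
    slice_continuous ((hF.continuous_vf hu hU 0 0).mono hs) ht
  have cvy := fun {t} (ht : t ∈ Icc a (a + T)) => slice_continuous cvfy ht
  have cF := fun {t} (ht : t ∈ Icc a (a + T)) => hF.continuous_slice 0 (ha.trans ht.1)
  -- With `c = t₁` the large factor `t - c` is absent at the start; only `∂_y(JF)`, `JF` and `F`
  -- remain.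
  have h20 : wInt p (vf₂ ν u F Fy t₁ 0 t₁) ≤ ENNReal.ofReal (3 * U ^ 4 * (4 * B / (ν * T))
      + 3 * U ^ 4 * B + 3 * (U ^ 4 * (a + T) ^ 2) * f) := by
    refine (wInt_le_add₄ hp0 hp.continuous (by positivity) (by positivity) (by positivity) le_rfl
      (cvy m₁) (cvf m₁) (cF m₁) (w₄ := fun _ => 0) fun y =>
        (vf₂_sq_le hu hU le_rfl ht₁0 ht₁b.le y)).trans ?_
    rw [ENNReal.ofReal_zero, zero_mul, add_zero]
    refine (add_le_add (add_le_add (mul_le_mul_right g₁ _) (mul_le_mul_right (G1 t₁ m₁) _))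
      (mul_le_mul_right (hf t₁ m₁) _)).trans (le_of_eq ?_)
    rw [← ENNReal.ofReal_mul (by positivity), ← ENNReal.ofReal_mul (by positivity),
      ← ENNReal.ofReal_mul (by positivity), ← ENNReal.ofReal_add (by positivity) (by positivity),
      ← ENNReal.ofReal_add (by positivity) (by positivity)]
    congr 1
    ring
  -- Purely qualitative: `energy_vf₂` needs finiteness, and the dissipation of `JF` provides it.
  have fin2 : ∫⁻ t in Icc t₁ (a + T), wInt p (vf₂ ν u F Fy t₁ 0 t) ≠ ⊤ := by
    have hsub : Icc t₁ (a + T) ⊆ Icc a (a + T) := Icc_subset_Icc_left ht₁.1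
    refine ne_top_of_le_ne_top ?_ (setLIntegral_mono' (g := fun t =>
      ENNReal.ofReal (3 * U ^ 4) * wInt p (vfy ν u F Fy 0 0 t) +
      (ENNReal.ofReal (3 * (T + U ^ 2) ^ 2) * ENNReal.ofReal B
        + ENNReal.ofReal (3 * (U ^ 4 * (a + T) ^ 2)) * ENNReal.ofReal f)) measurableSet_Icc
        fun t ht => ?_)
    · rw [lintegral_add_right _ measurable_const, lintegral_const_mul' _ _ ENNReal.ofReal_ne_top,
        setLIntegral_const, Real.volume_Icc]
      refine ENNReal.add_ne_top.2 ⟨ENNReal.mul_ne_top ENNReal.ofReal_ne_top ?_, ?_⟩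
      · refine ne_top_of_le_ne_top ?_ (lintegral_mono_set hsub)
        intro h
        rw [h, ENNReal.mul_top (ENNReal.ofReal_pos.2 hν).ne'] at G2
        exact ENNReal.ofReal_ne_top (top_le_iff.1 G2)
      · exact ENNReal.mul_ne_top (ENNReal.add_ne_top.2
          ⟨ENNReal.mul_ne_top ENNReal.ofReal_ne_top ENNReal.ofReal_ne_top,
          ENNReal.mul_ne_top ENNReal.ofReal_ne_top ENNReal.ofReal_ne_top⟩) ENNReal.ofReal_ne_top
    · have ht' := hsub ht
      refine (wInt_le_add₄ hp0 hp.continuous (A := 3 * U ^ 4) (C := 3 * (U ^ 4 * (a + T) ^ 2)) (by positivity)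
        (B := 3 * (T + U ^ 2) ^ 2) (by positivity) (by positivity) le_rfl
        (cvy ht') (cvf ht') (cF ht') (w₄ := fun _ => 0) fun y =>
          (vf₂_sq_le hu hU ht.1 ht₁0 ht.2 y).trans ?_).trans ?_
      · have h1 : t - t₁ ≤ T := by linarith [ht.2, ht₁.1]
        have h2 : 0 ≤ t - t₁ := by linarith [ht.1]
        gcongr
      · rw [ENNReal.ofReal_zero, zero_mul, add_zero, add_assoc]
        exact add_le_add le_rfl (add_le_add (mul_le_mul_right (G1 t ht') _)
          (mul_le_mul_right (hf t ht') _))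
  have h22 : wInt p (vf₂ ν u F Fy t₁ 0 t₂) ≤ ENNReal.ofReal (2 * ((3 * U ^ 4 * (4 * B / (ν * T))
      + 3 * U ^ 4 * B + 3 * (U ^ 4 * (a + T) ^ 2) * f)
      + (734 * U ^ 4 * ν * (9 * (a + T) ^ 2) * T * B
      + (734 * U ^ 4 * ν * (16 * (a + T) ^ 4) + 4 * T * U ^ 4) * T * f))) := by
    have hL0 : 0 ≤ a + T - t₁ := by linarith
    have hLT : a + T - t₁ ≤ T := by linarith [ht₁.1]
    refine (hF.energy_vf₂ hu hU hν ht₁0 le_rfl ht₁b (small hL0 hLT) hp fin2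
      (fun t ht => G1 t ⟨ht₁.1.trans ht.1, ht.2⟩) (fun t ht => hf t ⟨ht₁.1.trans ht.1, ht.2⟩) t₂
      ⟨by linarith [ht₁.2, ht₂.1], ht₂.2⟩).trans ?_
    rw [ENNReal.ofReal_mul two_pos.le, ENNReal.ofReal_ofNat,
      ENNReal.ofReal_add (by positivity) (by positivity),
      ENNReal.ofReal_add (p := 734 * U ^ 4 * ν * (9 * (a + T) ^ 2) * T * B) (by positivity)
        (by positivity)]
    refine mul_le_mul_right (add_le_add h20 (add_le_add ?_ ?_)) _
    · rw [← ENNReal.ofReal_mul (by positivity)]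
      refine ENNReal.ofReal_le_ofReal (by gcongr)
    · rw [← ENNReal.ofReal_mul (by positivity)]
      refine ENNReal.ofReal_le_ofReal (by gcongr)
  have h3 : wInt p (vf u F Fy 0 0 t₂) ≤ ENNReal.ofReal
      (64 / T ^ 2 * (2 * ((3 * U ^ 4 * (4 * B / (ν * T)) + 3 * U ^ 4 * B
      + 3 * (U ^ 4 * (a + T) ^ 2) * f) + (734 * U ^ 4 * ν * (9 * (a + T) ^ 2) * T * B
      + (734 * U ^ 4 * ν * (16 * (a + T) ^ 4) + 4 * T * U ^ 4) * T * f)))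
      + 64 / T ^ 2 * U ^ 2 * (2 * B / (ν * T)) + 64 / T ^ 2 * U ^ 4 * B
      + 64 / T ^ 2 * (U ^ 4 * (a + T) ^ 2) * f) := by
    have ht₂0 : 0 ≤ t₂ := ha.trans m₂.1
    refine (wInt_le_add₄ hp0 hp.continuous (by positivity) (by positivity) (by positivity)
      (by positivity) (slice_continuous ((hF.continuous_vf₂ hu hU t₁ 0).mono hs) m₂)
      (cvy m₂) (cvf m₂) fun y => vf_sq_le_of_vf₂ hu hU hT (by linarith [ht₁.2, ht₂.1]) ht₁0
        ht₂.2 y).trans ?_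
    refine (add_le_add (add_le_add (add_le_add (mul_le_mul_right h22 _) (mul_le_mul_right g₂ _))
      (mul_le_mul_right (G1 t₂ m₂) _)) (mul_le_mul_right (hf t₂ m₂) _)).trans (le_of_eq ?_)
    rw [← ENNReal.ofReal_mul (by positivity), ← ENNReal.ofReal_mul (by positivity),
      ← ENNReal.ofReal_mul (by positivity), ← ENNReal.ofReal_mul (by positivity),
      ← ENNReal.ofReal_add (by positivity) (by positivity),
      ← ENNReal.ofReal_add (by positivity) (by positivity),
      ← ENNReal.ofReal_add (by positivity) (by positivity)]
  have key := window_vf_arith hU hν hT hT1 hT3 hm (by linarith : 0 ≤ a + T) hb hb2 hA0 hf0 hB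
  -- If `t₂` is the end of the window there is nothing left to propagate; otherwise the energy
  -- estimate covers the remaining time.
  rcases eq_or_lt_of_le ht₂.2 with h | h
  · rw [← h]
    refine h3.trans (ENNReal.ofReal_le_ofReal ?_)
    rw [← h] at key
    refine le_trans ?_ key
    rw [h] at key ⊢
    have k1 : 0 ≤ 135 * U ^ 4 * ν * (a + T) ^ 2 * T * f := by positivity
    refine le_trans (le_add_of_nonneg_right k1) (le_mul_of_one_le_left (by positivity) one_le_two)
  · have hL0 : 0 ≤ a + T - t₂ := by linarith
    have hLT : a + T - t₂ ≤ T := by linarith [m₂.1]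
    have ht₂0 : 0 ≤ t₂ := ha.trans m₂.1
    have fin3 : ∫⁻ t in Icc t₂ (a + T), wInt p (Fy 0 t) ≠ ⊤ :=
      ne_top_of_le_ne_top hfin (lintegral_mono_set (Icc_subset_Icc_left m₂.1))
    have := (hF.energy_vf_real hu hU hν ht₂0 h ht₂0 (small' hL0 hLT) hp fin3 hf0
      (by positivity) (fun t ht => hf t ⟨m₂.1.trans ht.1, ht.2⟩) h3).1 (a + T) ⟨ht₂.2, le_rfl⟩
    refine this.trans (ENNReal.ofReal_le_ofReal (le_trans ?_ key))
    rw [sub_zero]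
    gcongr

end ClassicalSol

/-! ### Mixing for classical solutions -/

theorem norm_integral_mul_le {f g : ℝ → ℂ} (hf : AEStronglyMeasurable f)
    (hg : AEStronglyMeasurable g) {A B : ℝ} (hA : 0 ≤ A) (hB : 0 ≤ B)
    (h1 : wInt (fun _ => 1) f ≤ ENNReal.ofReal (A ^ 2))
    (h2 : wInt (fun _ => 1) g ≤ ENNReal.ofReal (B ^ 2)) : ‖∫ y, f y * g y‖ ≤ A * B := by
  have e : ∀ (f : ℝ → ℂ) (A : ℝ), 0 ≤ A → wInt (fun _ => 1) f ≤ ENNReal.ofReal (A ^ 2) →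
      (∫⁻ y, ‖f y‖ₑ ^ (2 : ℝ)) ^ (1 / 2 : ℝ) ≤ ENNReal.ofReal A := fun f A hA h => by
    have h3 : ∫⁻ y, ‖f y‖ₑ ^ (2 : ℝ) = wInt (fun _ => 1) f := by
      refine lintegral_congr fun y => ?_
      rw [one_mul, ENNReal.ofReal_pow (norm_nonneg _), ofReal_norm, ENNReal.rpow_ofNat]
    rw [h3]
    refine (ENNReal.rpow_le_rpow h (by norm_num)).trans (le_of_eq ?_)
    rw [ENNReal.ofReal_rpow_of_nonneg (sq_nonneg _) (by norm_num), ← Real.sqrt_eq_rpow,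
      Real.sqrt_sq hA]
  have h3 : ‖∫ y, f y * g y‖ₑ ≤ ENNReal.ofReal (A * B) := by
    refine (enorm_integral_le_lintegral_enorm _).trans ?_
    simp only [enorm_mul]
    refine (ENNReal.lintegral_mul_le_Lp_mul_Lq volume Real.HolderConjugate.two_two hf.enorm
      hg.enorm).trans ?_
    rw [ENNReal.ofReal_mul hA]
    exact mul_le_mul' (e f A hA h1) (e g B hB h2)
  rw [← ofReal_norm] at h3
  exact (ENNReal.ofReal_le_ofReal_iff (mul_nonneg hA hB)).1 h3

/-- With `n` the number of elapsed windows, `t/T ≤ n + 1` and `e < 3` give `4^{-n} ≤ 4e^{-t/T}`,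
where `1/T = ρ/M`. Adding the bounds on `I` and `tI`, and using `√(1 + t²) ≤ 1 + t`, produces the
constant `5 · 4 = 20`. -/
theorem decay_combine {M ρ T t Y Φ I : ℝ} {n : ℕ} (hM1 : 2 ≤ M) (hρ : 0 < ρ) (hTdef : T = M / ρ)
    (ht : 0 ≤ t) (htn : t < (n + 1) * T) (hY0 : 0 ≤ Y) (hΦ0 : 0 ≤ Φ) (hI : 0 ≤ I)
    (b0 : I ≤ 2 * Y / 16 ^ n * Φ) (b1 : t * I ≤ 4 * M ^ 2 * (Y / 4 ^ n * Φ)) :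
    I ≤ 20 * M ^ 2 * (exp (-(1 / M * ρ * t)) / √(1 + t ^ 2)) * (Y * Φ) := by
  have hM0 : 0 < M := by linarith
  have hM2 : M ≤ M ^ 2 := le_self_pow₀ (by linarith) (by norm_num)
  have hT : 0 < T := by rw [hTdef]; positivity
  have hsq : √(1 + t ^ 2) ≤ 1 + t := by
    rw [Real.sqrt_le_left (by linarith)]
    nlinarith
  have hsq0 : 0 < √(1 + t ^ 2) := Real.sqrt_pos.2 (by positivity)
  have hexp : 1 / 4 ^ n ≤ 4 * exp (-(1 / M * ρ * t)) := by
    have e1 : 1 / M * ρ * t = t / T := by rw [hTdef]; field_simp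
    have e2 : t / T ≤ n + 1 := ((div_lt_iff₀ hT).2 htn).le
    have e3 : exp (t / T) ≤ 4 ^ (n + 1) := by
      have e5 : exp (t / T) ≤ exp ((n + 1 : ℕ) * 1) := by
        rw [Real.exp_le_exp]; push_cast; linarith
      refine e5.trans ?_
      rw [Real.exp_nat_mul]
      gcongr
      linarith [Real.exp_one_lt_three]
    rw [e1, Real.exp_neg, div_le_iff₀ (by positivity), ← div_eq_mul_inv, div_mul_eq_mul_div,
      le_div_iff₀ (exp_pos _), one_mul]
    exact e3.trans_eq (by ring)
  have fin : √(1 + t ^ 2) * I ≤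
      20 * M ^ 2 * exp (-(1 / M * ρ * t)) * (Y * Φ) := by
    have s1 : √(1 + t ^ 2) * I ≤ (1 + t) * I := by gcongr
    have s2 : 2 * Y / 16 ^ n * Φ ≤ 2 * Y / 4 ^ n * Φ := by gcongr; norm_num
    have s3 : 5 * M ^ 2 * (Y * Φ) * (1 / 4 ^ n) ≤
        5 * M ^ 2 * (Y * Φ) * (4 * exp (-(1 / M * ρ * t))) := by gcongr
    have s4 : 2 * (Y / 4 ^ n * Φ) ≤ M ^ 2 * (Y / 4 ^ n * Φ) := by
      refine mul_le_mul_of_nonneg_right ?_ (by positivity)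
      nlinarith
    have s5 : 5 * M ^ 2 * (Y * Φ) * (1 / 4 ^ n) = 5 * M ^ 2 * (Y / 4 ^ n * Φ) := by ring
    have s6 : 2 * Y / 4 ^ n * Φ = 2 * (Y / 4 ^ n * Φ) := by ring
    linarith
  calc I = √(1 + t ^ 2) * I / √(1 + t ^ 2) := by
        field_simp
    _ ≤ 20 * M ^ 2 * exp (-(1 / M * ρ * t)) * (Y * Φ) / √(1 + t ^ 2) := by gcongr
    _ = _ := by ring

namespace ClassicalSol

variable {ν U : ℝ} {u : ℝ → ℝ} {F Fy : ℕ → ℝ → ℝ → ℂ}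

/-- Iterates `window_vf`. The source grows like `(n + 1)⁴` because of the absolute time, but `F`
loses 256 per window, so the net source decays like `16^{-n}` and the vector field follows it. The
hypothesis `hn` keeps the time below `ρ⁻²`. -/
theorem decay_vf (hF : ClassicalSol ν u F Fy) (hu : IsShear U u) (hU : 1 ≤ U)
    {M ρ : ℝ} (hM : M = 1000000000 * U ^ 4) (hρ : 0 < ρ) (hρ1 : 200000000 * U ^ 4 * ρ ≤ 1)
    (hν : ν = ρ ^ 3) {X : ℝ} (hX0 : 0 ≤ X) (hX : wInt (fun _ => 1) (F 0 0) ≤ ENNReal.ofReal X)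
    (hXy : wInt (fun _ => 1) (Fy 0 0) ≤ ENNReal.ofReal X) (n : ℕ)
    (hn : ρ ^ 2 * ((n + 1) * (M / ρ)) ≤ 1) :
    ∀ t ∈ Icc (n * (M / ρ)) ((n + 1) * (M / ρ)), wInt (fun _ => 1) (vf u F Fy 0 0 t) ≤
      ENNReal.ofReal (M ^ 4 * X / 16 ^ n) := by
  have hU0 : 0 < U := by linarith
  have hU4 : 1 ≤ U ^ 4 := one_le_pow₀ hU
  have hU2 : U ^ 2 ≤ U ^ 4 := pow_le_pow_right₀ hU (by norm_num)
  have hM0 : 0 < M := by rw [hM]; positivity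
  have hM1 : 1 ≤ M := by rw [hM]; linarith
  have hν0 : 0 < ν := by rw [hν]; positivity
  obtain ⟨T, hTdef⟩ : ∃ T, T = M / ρ := ⟨_, rfl⟩
  rw [← hTdef] at hn ⊢
  have hT : 0 < T := by rw [hTdef]; positivity
  have hTρ : T * ρ = M := by rw [hTdef]; field_simp
  have hνT : ν * T ^ 3 = M ^ 3 := by rw [hν, ← hTρ]; ring
  have hM2 : M ≤ M ^ 2 := le_self_pow₀ hM1 (by norm_num)
  have hM3 : M ≤ M ^ 3 := le_self_pow₀ hM1 (by norm_num)
  have hρ2 : ρ ≤ 1 := by nlinarith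
  have hTM : M ≤ T := by rw [← hTρ]; nlinarith
  have hT1 : 1000000 * U ^ 4 ≤ ν * T ^ 3 := by rw [hνT]; linarith
  have hT1' : 655360 * U ^ 2 ≤ ν * T ^ 3 := by linarith
  have hT2 : 20000000 * U ^ 4 * ν * T ≤ 1 := by
    have h1 : 20000000 * U ^ 4 * ν * T = (200000000 * U ^ 4 * ρ) ^ 2 / 2 := by
      rw [hν, show 20000000 * U ^ 4 * ρ ^ 3 * T = 20000000 * U ^ 4 * ρ ^ 2 * (T * ρ) by ring, hTρ,
        hM]
      ring
    have h2 : (200000000 * U ^ 4 * ρ) ^ 2 ≤ 1 := pow_le_one₀ (by positivity) hρ1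
    linarith
  have hT3 : 1000000 * U ^ 4 ≤ T ^ 2 := by nlinarith
  have hone := IsWeight.one hU
  have dec := hF.decay hu hU hν0 hT hT1' hT2 hone zero_le_one (fun _ => le_rfl) hX0 hX
  -- Twice the constant 3100000 of `window_vf`, since inside a window the energy of `F` is bounded
  -- by `2X/256ⁿ`, with `νT³ = M³`.
  set D := 6200000 * U ^ 4 * M ^ 3 with hD
  have hD0 : 0 < D := by positivity
  -- From `n + 1 ≤ 2ⁿ`, so that `(n + 1)⁴ ≤ 16ⁿ`.
  have pw : ∀ n : ℕ, ((n : ℝ) + 1) ^ 4 / 256 ^ n ≤ 1 / 16 ^ n := fun n => by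
    rw [div_le_div_iff₀ (by positivity) (by positivity), one_mul,
      show (256 : ℝ) = 16 * 16 by norm_num, mul_pow]
    refine mul_le_mul_of_nonneg_right ?_ (by positivity)
    have h1 : (n : ℝ) + 1 ≤ 2 ^ n := by exact_mod_cast Nat.lt_two_pow_self
    calc ((n : ℝ) + 1) ^ 4 ≤ (2 ^ n) ^ 4 := by gcongr
      _ = 16 ^ n := by rw [← pow_mul, mul_comm, pow_mul]; norm_num
  -- The level `32D` reproduces itself: `32/64 + 1 = 3/2` is below `32/16 = 2`. Inside the window
  -- twice the level plus a small source gives 65.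
  have step : ∀ n : ℕ, ρ ^ 2 * ((n + 1) * T) ≤ 1 →
      wInt (fun _ => 1) (vf u F Fy 0 0 (n * T)) ≤ ENNReal.ofReal (32 * D * X / 16 ^ n) →
      (∀ t ∈ Icc (n * T) ((n + 1) * T), wInt (fun _ => 1) (vf u F Fy 0 0 t) ≤
        ENNReal.ofReal (65 * D * X / 16 ^ n)) ∧
      wInt (fun _ => 1) (vf u F Fy 0 0 ((n + 1) * T)) ≤
        ENNReal.ofReal (32 * D * X / 16 ^ n / 16) := fun n hn h => by
    have ha : 0 ≤ (n : ℝ) * T := by positivity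
    have hm : (1 : ℝ) ≤ n + 1 := by linarith [n.cast_nonneg (α := ℝ)]
    have e : (n : ℝ) * T + T = (n + 1) * T := by ring
    have hfin : ∫⁻ t in Icc (n * T) (n * T + T), wInt (fun _ => 1) (Fy 0 t) ≠ ⊤ := by
      have := (hF.energy_real hu hU hν0 ha (by linarith : n * T < n * T + T) (by
        rw [add_sub_cancel_left]
        have h1 : U ^ 2 * ν * T ≤ U ^ 4 * ν * T := by gcongr
        have : 0 ≤ U ^ 4 * ν * T := by positivity
        linarith) hone zero_le_one (fun _ => le_rfl) (dec n).1).2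
      intro h
      rw [h, ENNReal.mul_top (ENNReal.ofReal_pos.2 hν0).ne'] at this
      exact ENNReal.ofReal_ne_top (top_le_iff.1 this)
    have hb2 : 1000000000 * U ^ 4 * ν * (n * T + T) ^ 2 ≤ T := by
      rw [e, ← hM, hν, ← hTρ]
      have h1 : T * ρ * ρ ^ 3 * ((n + 1) * T) ^ 2 = T * (ρ ^ 2 * ((n + 1) * T)) ^ 2 := by ring
      rw [h1]
      exact mul_le_of_le_one_right hT.le (pow_le_one₀ (by positivity) hn)
    have w := hF.window_vf hu hU hν0 hT hT1 hT2 hT3 ha hm e.le hb2 hone hfin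
      (by positivity) (by positivity : 0 ≤ 2 * (X / 256 ^ n)) h (by rw [e]; exact (dec n).2)
    rw [e, hνT] at w
    have p1 : 3100000 * U ^ 4 * M ^ 3 * ((n : ℝ) + 1) ^ 4 * (2 * (X / 256 ^ n)) ≤
        D * X / 16 ^ n := by
      calc _ = D * X * (((n : ℝ) + 1) ^ 4 / 256 ^ n) := by rw [hD]; ring
        _ ≤ D * X * (1 / 16 ^ n) := mul_le_mul_of_nonneg_left (pw n) (by positivity)
        _ = _ := by ring
    have p2 : 135 * U ^ 4 * ν * ((n + 1) * T) ^ 2 * T * (2 * (X / 256 ^ n)) ≤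
        D * X / 16 ^ n / 1000 := by
      have hm2 : ((n : ℝ) + 1) ^ 2 ≤ (n + 1) ^ 4 := pow_le_pow_right₀ hm (by norm_num)
      calc 135 * U ^ 4 * ν * ((n + 1) * T) ^ 2 * T * (2 * (X / 256 ^ n))
          = 135 * U ^ 4 * (ν * T ^ 3) * (n + 1) ^ 2 * (2 * (X / 256 ^ n)) := by ring
        _ ≤ 3100 * U ^ 4 * (ν * T ^ 3) * (n + 1) ^ 4 * (2 * (X / 256 ^ n)) := by
            gcongr; norm_num
        _ = 3100000 * U ^ 4 * M ^ 3 * ((n : ℝ) + 1) ^ 4 * (2 * (X / 256 ^ n)) / 1000 := by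
            rw [hνT]; ring
        _ ≤ _ := by gcongr
    have p3 : 0 ≤ D * X / 16 ^ n := by positivity
    have p4 : ∀ c : ℝ, c * D * X / 16 ^ n = c * (D * X / 16 ^ n) := fun c => by ring
    refine ⟨fun t ht => (w.1 t ht).trans (ENNReal.ofReal_le_ofReal ?_),
      w.2.trans (ENNReal.ofReal_le_ofReal ?_)⟩
    · rw [p4 65, p4 32]
      linarith
    · rw [p4 32]
      linarith
  have main : ∀ n : ℕ, ρ ^ 2 * (n * T) ≤ 1 →
      wInt (fun _ => 1) (vf u F Fy 0 0 (n * T)) ≤ ENNReal.ofReal (32 * D * X / 16 ^ n) := by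
    intro n
    induction n with
    | zero =>
      intro _
      have h1 := wInt_le_add (p := fun _ => 1) (fun _ => zero_le_one) continuous_const
        (A := U ^ 2) (B := 0) (by positivity) le_rfl (w := vf u F Fy 0 0 0) (w₂ := fun _ => 0)
        (hF.continuous_slice_y 0 le_rfl) (fun y => by
          have hv := (hu.invSlope_pos hU y).le
          simp only [vf, sub_self, Complex.ofReal_zero, mul_zero, zero_mul, add_zero, norm_mul,
            Complex.norm_real, Real.norm_of_nonneg hv, mul_pow]
          gcongr
          exact hu.invSlope_le hU y)
      rw [ENNReal.ofReal_zero, zero_mul, add_zero] at h1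
      simp only [Nat.cast_zero, zero_mul, pow_zero, div_one]
      refine h1.trans ((mul_le_mul_right hXy _).trans ?_)
      rw [← ENNReal.ofReal_mul (by positivity)]
      refine ENNReal.ofReal_le_ofReal (mul_le_mul_of_nonneg_right ?_ hX0)
      have : U ^ 4 * 1 ≤ U ^ 4 * M ^ 3 := by gcongr; linarith
      have : 0 ≤ U ^ 4 * M ^ 3 := by positivity
      rw [hD]
      linarith
    | succ n ih =>
      intro h
      push_cast at h ⊢
      have h0 : ρ ^ 2 * (n * T) ≤ 1 := by
        refine le_trans ?_ h
        gcongr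
        linarith
      have := (step n h (ih h0)).2
      rwa [div_div, ← pow_succ] at this
  have h0 : ρ ^ 2 * (n * T) ≤ 1 := by
    refine le_trans ?_ hn
    gcongr
    linarith
  refine fun t ht => ((step n hn (main n h0)).1 t ht).trans (ENNReal.ofReal_le_ofReal ?_)
  gcongr
  have h1 : 65 * D ≤ M * M ^ 3 := by
    rw [hD, ← mul_assoc]
    gcongr
    linarith
  exact h1.trans (le_of_eq (by ring))

/-- Integration by parts in `∫ v F_y φ`. A factor `t` is gained against one derivative of the test
function and one application of `J`. -/
theorem integral_mul_vf (hF : ClassicalSol ν u F Fy) (hu : IsShear U u) (hU : 1 ≤ U)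
    {t : ℝ} (ht : 0 ≤ t) {φ φ' : ℝ → ℂ} (hφ : ∀ y, HasDerivAt φ (φ' y) y) (cφ' : Continuous φ')
    (sφ : HasCompactSupport φ) :
    Complex.I * t * ∫ y, F 0 t y * φ y = (∫ y, vf u F Fy 0 0 t y * φ y)
      + ∫ y, F 0 t y * (invSlope₁ u y * φ y + invSlope u y * φ' y) := by
  have cφ : Continuous φ := continuous_iff_continuousAt.2 fun y => (hφ y).continuousAt
  have sφ' : HasCompactSupport φ' := by
    have : φ' = deriv φ := funext fun y => (hφ y).deriv.symm
    rw [this]; exact sφ.deriv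
  have cF := hF.continuous_slice 0 ht
  have cFy := hF.continuous_slice_y 0 ht
  have cv : Continuous fun y => (invSlope u y : ℂ) :=
    Complex.continuous_ofReal.comp (hu.continuous_invSlope hU)
  have cv1 : Continuous fun y => (invSlope₁ u y : ℂ) :=
    Complex.continuous_ofReal.comp (hu.continuous_invSlope₁ hU)
  have i0 : Integrable fun y => F 0 t y * φ y :=
    (cF.mul cφ).integrable_of_hasCompactSupport sφ.mul_left
  have i1 : Integrable fun y => F 0 t y * (invSlope₁ u y * φ y + invSlope u y * φ' y) :=
    Continuous.integrable_of_hasCompactSupport (by fun_prop)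
      (HasCompactSupport.mul_left (sφ.mul_left.add sφ'.mul_left))
  have i2 : Integrable fun y => Fy 0 t y * (invSlope u y * φ y) :=
    Continuous.integrable_of_hasCompactSupport (by fun_prop) (HasCompactSupport.mul_left sφ.mul_left)
  have i3 : Integrable fun y => F 0 t y * (invSlope u y * φ y) :=
    Continuous.integrable_of_hasCompactSupport (by fun_prop) (HasCompactSupport.mul_left sφ.mul_left)
  have ibp := integral_mul_deriv_eq_deriv_mul_of_integrable
    (u := F 0 t) (v := fun y => (invSlope u y : ℂ) * φ y)
    (fun y _ => hF.deriv_y 0 t ht y)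
    (fun y _ => ((hu.hasDerivAt_invSlope hU y).ofReal_comp.mul (hφ y))) i1 i2 i3
  rw [ibp, ← sub_eq_add_neg, ← integral_sub, ← integral_const_mul]
  · refine integral_congr_ae (Eventually.of_forall fun y => ?_)
    simp only [vf, sub_zero]
    ring
  · have : (fun y => vf u F Fy 0 0 t y * φ y) = fun y => Fy 0 t y * (invSlope u y * φ y)
        + Complex.I * t * (F 0 t y * φ y) := by
      funext y
      simp only [vf, sub_zero]
      ring
    rw [this]
    exact i2.add (i0.const_mul _)
  · exact i2

/-- Decay of the solution tested against a compactly supported function. -/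
theorem mixing (hF : ClassicalSol ν u F Fy) (hu : IsShear U u) (hU : 1 ≤ U)
    {M ρ : ℝ} (hM : M = 1000000000 * U ^ 4) (hρ : 0 < ρ) (hρ1 : 200000000 * U ^ 4 * ρ ≤ 1)
    (hν : ν = ρ ^ 3) {Y : ℝ} (hY0 : 0 ≤ Y) (hY : wInt (fun _ => 1) (F 0 0) ≤ ENNReal.ofReal (Y ^ 2))
    (hYy : wInt (fun _ => 1) (Fy 0 0) ≤ ENNReal.ofReal (Y ^ 2)) {t : ℝ} (ht : 0 ≤ t)
    {φ φ' : ℝ → ℂ} (hφ : ∀ y, HasDerivAt φ (φ' y) y) (cφ' : Continuous φ')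
    (sφ : HasCompactSupport φ) {Φ : ℝ} (hΦ0 : 0 ≤ Φ)
    (hΦ : wInt (fun _ => 1) φ ≤ ENNReal.ofReal (Φ ^ 2))
    (hΦ' : wInt (fun _ => 1) φ' ≤ ENNReal.ofReal (Φ ^ 2)) :
    ‖∫ y, F 0 t y * φ y‖ ≤ 20 * M ^ 2 * (exp (-(1 / M * ρ * t)) / √(1 + t ^ 2)) * (Y * Φ) := by
  have hU0 : 0 < U := by linarith
  have hU4 : 1 ≤ U ^ 4 := one_le_pow₀ hU
  have hU2 : U ^ 2 ≤ U ^ 4 := pow_le_pow_right₀ hU (by norm_num)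
  have hM0 : 0 < M := by rw [hM]; positivity
  have hM1 : 1 ≤ M := by rw [hM]; linarith
  have hν0 : 0 < ν := by rw [hν]; positivity
  obtain ⟨T, hTdef⟩ : ∃ T, T = M / ρ := ⟨_, rfl⟩
  have hT : 0 < T := by rw [hTdef]; positivity
  have hTρ : T * ρ = M := by rw [hTdef]; field_simp
  have hνT : ν * T ^ 3 = M ^ 3 := by rw [hν, ← hTρ]; ring
  have hM2 : M ≤ M ^ 2 := le_self_pow₀ hM1 (by norm_num)
  have hM3 : M ≤ M ^ 3 := le_self_pow₀ hM1 (by norm_num)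
  have hT1' : 655360 * U ^ 2 ≤ ν * T ^ 3 := by rw [hνT]; linarith
  have hT2 : 20000000 * U ^ 4 * ν * T ≤ 1 := by
    have h1 : 20000000 * U ^ 4 * ν * T = (200000000 * U ^ 4 * ρ) ^ 2 / 2 := by
      rw [hν, show 20000000 * U ^ 4 * ρ ^ 3 * T = 20000000 * U ^ 4 * ρ ^ 2 * (T * ρ) by ring, hTρ,
        hM]
      ring
    have h2 : (200000000 * U ^ 4 * ρ) ^ 2 ≤ 1 := pow_le_one₀ (by positivity) hρ1
    linarith
  have cφ : Continuous φ := continuous_iff_continuousAt.2 fun y => (hφ y).continuousAt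
  -- The index of the window containing `t`.
  set n := ⌊t / T⌋₊ with hn
  have hnt : n * T ≤ t := by
    rw [← le_div_iff₀ hT]; exact Nat.floor_le (by positivity)
  have htn : t < (n + 1) * T := by
    rw [← div_lt_iff₀ hT]; exact Nat.lt_floor_add_one _
  have tmem : t ∈ Icc (n * T) ((n + 1) * T) := ⟨hnt, htn.le⟩
  have dec := (hF.decay hu hU hν0 hT hT1' hT2 (IsWeight.one hU) zero_le_one (fun _ => le_rfl)
    (sq_nonneg Y) hY n).2 t tmem
  have cF := hF.continuous_slice 0 ht
  have h256 : ((16 : ℝ) ^ n) ^ 2 = 256 ^ n := by rw [← pow_mul, mul_comm, pow_mul]; norm_num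
  have h16 : ((4 : ℝ) ^ n) ^ 2 = 16 ^ n := by rw [← pow_mul, mul_comm, pow_mul]; norm_num
  have h4 : (1 : ℝ) ≤ 4 ^ n := one_le_pow₀ (by norm_num)
  have dec' : wInt (fun _ => 1) (F 0 t) ≤ ENNReal.ofReal ((2 * Y / 16 ^ n) ^ 2) := by
    refine dec.trans (ENNReal.ofReal_le_ofReal ?_)
    rw [div_pow, mul_pow, h256, ← mul_div_assoc]
    gcongr
    norm_num
  have b0 : ‖∫ y, F 0 t y * φ y‖ ≤ 2 * Y / 16 ^ n * Φ :=
    norm_integral_mul_le cF.aestronglyMeasurable cφ.aestronglyMeasurable (by positivity) hΦ0 dec' hΦ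
  have h164 : 2 * Y / 16 ^ n ≤ 2 * Y / 4 ^ n := by
    gcongr; norm_num
  have b1 : t * ‖∫ y, F 0 t y * φ y‖ ≤ 4 * M ^ 2 * (Y / 4 ^ n * Φ) := by
    -- Before the time `ρ⁻²` the vector field decays and provides the factor `1/t`. Afterwards `t ≤
    -- 4ⁿM²`, so the factor `t` is paid for by the gap between the rates `16^{-n}` and `4^{-n}`.
    by_cases hc : ρ ^ 2 * ((n + 1) * T) ≤ 1
    · have dv := hF.decay_vf hu hU hM hρ hρ1 hν (sq_nonneg Y) hY hYy n (by rwa [← hTdef]) t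
        (by rwa [← hTdef])
      have dv' : wInt (fun _ => 1) (vf u F Fy 0 0 t) ≤
          ENNReal.ofReal ((M ^ 2 * Y / 4 ^ n) ^ 2) := by
        refine dv.trans (le_of_eq ?_)
        congr 1
        rw [div_pow, h16]; ring
      have cvf : Continuous (vf u F Fy 0 0 t) := slice_continuous (a := 0) (b := t)
        ((hF.continuous_vf hu hU 0 0).mono (Icc_subset le_rfl)) ⟨ht, le_rfl⟩
      have k1 := norm_integral_mul_le cvf.aestronglyMeasurable cφ.aestronglyMeasurable
        (by positivity) hΦ0 dv' hΦ
      have cv : Continuous fun y => (invSlope u y : ℂ) :=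
        Complex.continuous_ofReal.comp (hu.continuous_invSlope hU)
      have cv1 : Continuous fun y => (invSlope₁ u y : ℂ) :=
        Complex.continuous_ofReal.comp (hu.continuous_invSlope₁ hU)
      have hψ : wInt (fun _ => 1) (fun y => (invSlope₁ u y : ℂ) * φ y + invSlope u y * φ' y) ≤
          ENNReal.ofReal ((2 * U ^ 2 * Φ) ^ 2) := by
        refine (wInt_le_add (p := fun _ => 1) (fun _ => zero_le_one) continuous_const
          (A := 2 * U ^ 4) (B := 2 * U ^ 4) (by positivity) (by positivity) cφ fun y => ?_).trans
          ((add_le_add (mul_le_mul_right hΦ _) (mul_le_mul_right hΦ' _)).trans (le_of_eq ?_))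
        · have hv := (hu.invSlope_pos hU y).le
          have hvU : invSlope u y ≤ U ^ 2 := by nlinarith [hu.invSlope_le hU y]
          have hv1 : |invSlope₁ u y| ≤ U ^ 2 := by
            nlinarith [hu.abs_invSlope₁_le hU y, hu.invSlope_le hU y]
          have h1 : ‖(invSlope₁ u y : ℂ) * φ y + invSlope u y * φ' y‖ ≤
              U ^ 2 * ‖φ y‖ + U ^ 2 * ‖φ' y‖ := by
            refine (norm_add_le _ _).trans (add_le_add ?_ ?_)
            · rw [norm_mul, Complex.norm_real]
              gcongr
              exact hv1
            · rw [norm_mul, Complex.norm_real, Real.norm_of_nonneg hv]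
              gcongr
          have h2 := pow_le_pow_left₀ (norm_nonneg _) h1 2
          nlinarith [sq_nonneg (U ^ 2 * ‖φ y‖ - U ^ 2 * ‖φ' y‖)]
        · rw [← ENNReal.ofReal_mul (by positivity), ← ENNReal.ofReal_add (by positivity)
            (by positivity)]
          congr 1
          ring
      have k2 := norm_integral_mul_le cF.aestronglyMeasurable
        (g := fun y => (invSlope₁ u y : ℂ) * φ y + invSlope u y * φ' y)
        (Continuous.aestronglyMeasurable (by fun_prop)) (by positivity) (by positivity) dec' hψ
      have k3 : ‖Complex.I * t * ∫ y, F 0 t y * φ y‖ = t * ‖∫ y, F 0 t y * φ y‖ := by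
        rw [norm_mul, norm_mul, Complex.norm_I, one_mul, Complex.norm_real, Real.norm_of_nonneg ht]
      rw [← k3, hF.integral_mul_vf hu hU ht hφ cφ' sφ]
      refine (norm_add_le _ _).trans ((add_le_add k1 k2).trans ?_)
      have k4 : 2 * Y / 16 ^ n * (2 * U ^ 2 * Φ) ≤ 2 * Y / 4 ^ n * (2 * U ^ 2 * Φ) := by gcongr
      have k5 : 0 ≤ Y / 4 ^ n * Φ := by positivity
      have k6 : 4 * U ^ 2 * (Y / 4 ^ n * Φ) ≤ 3 * M ^ 2 * (Y / 4 ^ n * Φ) := by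
        refine mul_le_mul_of_nonneg_right ?_ k5
        linarith
      calc _ ≤ M ^ 2 * Y / 4 ^ n * Φ + 2 * Y / 4 ^ n * (2 * U ^ 2 * Φ) := by gcongr
        _ = M ^ 2 * (Y / 4 ^ n * Φ) + 4 * U ^ 2 * (Y / 4 ^ n * Φ) := by ring
        _ ≤ _ := by linarith
    · have hc' : 1 < ρ * ((n + 1) * M) := by
        push Not at hc
        rw [← hTρ]
        exact hc.trans_eq (by ring)
      -- In the late regime `ρ(n + 1)M > 1`; inserting this factor once and using `Tρ = M` bounds
      -- the time by a quantity free of `ρ`.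
      have k1 : (n + 1) * T ≤ ((n + 1) * M) ^ 2 := by
        have : (n + 1) * T * 1 ≤ (n + 1) * T * (ρ * ((n + 1) * M)) := by gcongr
        calc (n + 1) * T ≤ (n + 1) * T * (ρ * ((n + 1) * M)) := by linarith
          _ = (n + 1) ^ 2 * M * (T * ρ) := by ring
          _ = _ := by rw [hTρ]; ring
      have k2 : ((n : ℝ) + 1) ^ 2 ≤ 4 ^ n := by
        have h1 : (n : ℝ) + 1 ≤ 2 ^ n := by exact_mod_cast Nat.lt_two_pow_self
        calc ((n : ℝ) + 1) ^ 2 ≤ (2 ^ n) ^ 2 := by gcongr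
          _ = 4 ^ n := by rw [← pow_mul, mul_comm, pow_mul]; norm_num
      have k3 : t ≤ 4 ^ n * M ^ 2 := by
        calc t ≤ ((n + 1) * M) ^ 2 := htn.le.trans k1
          _ = (n + 1) ^ 2 * M ^ 2 := by ring
          _ ≤ _ := by gcongr
      calc t * ‖∫ y, F 0 t y * φ y‖ ≤ 4 ^ n * M ^ 2 * (2 * Y / 16 ^ n * Φ) := by gcongr
        _ = 2 * M ^ 2 * (Y / 4 ^ n * Φ) := by
          rw [← h16]; field_simp
        _ ≤ _ := by
          refine mul_le_mul_of_nonneg_right ?_ (by positivity)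
          have : 0 ≤ M ^ 2 := by positivity
          linarith
  exact decay_combine (by rw [hM]; linarith) hρ hTdef ht htn hY0 hΦ0 (norm_nonneg _) b0 b1

end ClassicalSol

/-! ### The space `L²` and its closed convex sets -/

/-- Complex square integrable functions of `y`. -/
abbrev L2 : Type := Lp ℂ 2 (volume : Measure ℝ)

/-- Represented by the inner product with the conjugate of `θ`, since the inner product is conjugate
linear in its first slot. -/
theorem exists_pairing {θ : ℝ → ℂ} (hθ : MemLp θ 2) :
    ∃ L : L2 →L[ℂ] ℂ, ∀ w : L2, L w = ∫ y, w y * θ y := by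
  have h1 : MemLp (fun y => (starRingEnd ℂ) (θ y)) 2 := hθ.star
  refine ⟨innerSL ℂ h1.toLp, fun w => ?_⟩
  rw [innerSL_apply_apply, L2.inner_def]
  refine integral_congr_ae ?_
  filter_upwards [h1.coeFn_toLp] with y hy
  rw [hy]
  simp

theorem integrable_mul_of_memLp {θ : ℝ → ℂ} (hθ : MemLp θ 2) (w : L2) :
    Integrable fun y => w y * θ y := (Lp.memLp w).integrable_mul hθ

theorem memLp_of_continuous {θ : ℝ → ℂ} (hθ : Continuous θ) (h : HasCompactSupport θ) :
    MemLp θ 2 := hθ.memLp_of_hasCompactSupport h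

theorem wInt_congr {p : ℝ → ℝ} {f g : ℝ → ℂ} (h : f =ᵐ[volume] g) : wInt p f = wInt p g := by
  refine lintegral_congr_ae ?_
  filter_upwards [h] with y hy
  rw [hy]

theorem wInt_one_eq (f : ℝ → ℂ) : wInt (fun _ => 1) f = eLpNorm f 2 volume ^ 2 := by
  rw [eLpNorm_eq_lintegral_rpow_enorm_toReal two_ne_zero ENNReal.ofNat_ne_top, ← ENNReal.rpow_natCast,
    ← ENNReal.rpow_mul]
  simp only [ENNReal.toReal_ofNat, Nat.cast_ofNat, one_div, ne_eq, OfNat.ofNat_ne_zero,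
    not_false_eq_true, inv_mul_cancel₀, ENNReal.rpow_one]
  refine lintegral_congr fun y => ?_
  rw [one_mul, ENNReal.ofReal_pow (norm_nonneg _), ofReal_norm, ENNReal.rpow_ofNat]

theorem wInt_one_Lp (w : L2) : wInt (fun _ => 1) w = ENNReal.ofReal (‖w‖ ^ 2) := by
  rw [wInt_one_eq, ENNReal.ofReal_pow (norm_nonneg _), Lp.norm_def,
    ENNReal.ofReal_toReal (Lp.eLpNorm_ne_top w)]

theorem wInt_add_le {p : ℝ → ℝ} (hp : ∀ y, 0 ≤ p y) (cp : Continuous p) {f g : ℝ → ℂ}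
    (hf : AEStronglyMeasurable f) :
    wInt p (fun y => f y + g y) ≤ 2 * wInt p f + 2 * wInt p g := by
  have m : AEMeasurable fun y => (2 : ℝ≥0∞) * ENNReal.ofReal (p y * ‖f y‖ ^ 2) :=
    (((cp.aemeasurable.mul (hf.norm.aemeasurable.pow_const 2))).ennreal_ofReal).const_mul _
  rw [wInt, wInt, wInt, ← lintegral_const_mul' _ _ ENNReal.ofNat_ne_top,
    ← lintegral_const_mul' _ _ ENNReal.ofNat_ne_top, ← lintegral_add_left' m]
  refine lintegral_mono fun y => ?_
  have h0 := hp y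
  rw [show (2 : ℝ≥0∞) = ENNReal.ofReal 2 by simp, ← ENNReal.ofReal_mul two_pos.le,
    ← ENNReal.ofReal_mul two_pos.le, ← ENNReal.ofReal_add (by positivity) (by positivity)]
  refine ENNReal.ofReal_le_ofReal ?_
  have h1 := pow_le_pow_left₀ (norm_nonneg _) (norm_add_le (f y) (g y)) 2
  have h2 : ‖f y + g y‖ ^ 2 ≤ 2 * ‖f y‖ ^ 2 + 2 * ‖g y‖ ^ 2 := by
    nlinarith [sq_nonneg (‖f y‖ - ‖g y‖)]
  nlinarith [mul_le_mul_of_nonneg_left h2 h0]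

/-- Transfers a weighted bound between two nearby elements of `L²`, at the price of the sup of the
weight. -/
theorem wInt_Lp_le {p : ℝ → ℝ} (hp : ∀ y, 0 ≤ p y) (cp : Continuous p) {K : ℝ} (hK : 0 ≤ K)
    (hpK : ∀ y, p y ≤ K) (a b : L2) :
    wInt p a ≤ 2 * wInt p b + ENNReal.ofReal (2 * K * ‖a - b‖ ^ 2) := by
  have h1 : wInt p a = wInt p (fun y => b y + (a - b : L2) y) := by
    refine wInt_congr ?_
    filter_upwards [Lp.coeFn_sub a b] with y hy
    rw [hy]; simp
  rw [h1]
  refine (wInt_add_le hp cp (Lp.aestronglyMeasurable b)).trans (add_le_add le_rfl ?_)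
  rw [mul_assoc, ENNReal.ofReal_mul two_pos.le, ENNReal.ofReal_ofNat, ENNReal.ofReal_mul hK,
    ← wInt_one_Lp]
  exact mul_le_mul_right (wInt_le_of_bound hK hpK _) _

/-- Together with closedness, this makes every energy bound stable under averaging in time, even
where the weight is unbounded and the energy is not continuous on `L²`. -/
theorem convex_wInt_le {p : ℝ → ℝ} (hp : ∀ y, 0 ≤ p y) (cp : Continuous p) (c : ℝ≥0∞) :
    Convex ℝ {w : L2 | wInt p w ≤ c} := by
  intro f hf g hg a b ha hb hab
  simp only [mem_ofPred_eq] at hf hg ⊢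
  have e : wInt p (a • f + b • g : L2) = wInt p (fun y => a • f y + b • g y) := by
    refine wInt_congr ?_
    filter_upwards [Lp.coeFn_add (a • f) (b • g), Lp.coeFn_smul a f, Lp.coeFn_smul b g]
      with y h1 h2 h3
    rw [h1, Pi.add_apply, h2, h3]; rfl
  rw [e]
  calc wInt p (fun y => a • f y + b • g y)
      ≤ ENNReal.ofReal a * wInt p f + ENNReal.ofReal b * wInt p g := by
        have m : AEMeasurable fun y => ENNReal.ofReal a * ENNReal.ofReal (p y * ‖f y‖ ^ 2) :=
          (((cp.aemeasurable.mul ((Lp.aestronglyMeasurable f).norm.aemeasurable.pow_const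
            2))).ennreal_ofReal).const_mul _
        rw [wInt, wInt, wInt, ← lintegral_const_mul' _ _ ENNReal.ofReal_ne_top,
          ← lintegral_const_mul' _ _ ENNReal.ofReal_ne_top, ← lintegral_add_left' m]
        refine lintegral_mono fun y => ?_
        have h0 := hp y
        rw [← ENNReal.ofReal_mul ha, ← ENNReal.ofReal_mul hb,
          ← ENNReal.ofReal_add (by positivity) (by positivity)]
        refine ENNReal.ofReal_le_ofReal ?_
        have h1 : ‖a • f y + b • g y‖ ≤ a * ‖f y‖ + b * ‖g y‖ := by
          refine (norm_add_le _ _).trans (le_of_eq ?_)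
          rw [norm_smul, norm_smul, Real.norm_of_nonneg ha, Real.norm_of_nonneg hb]
        have h2 := pow_le_pow_left₀ (norm_nonneg _) h1 2
        have h3 : (a * ‖f y‖ + b * ‖g y‖) ^ 2 ≤ a * ‖f y‖ ^ 2 + b * ‖g y‖ ^ 2 := by
          have hb' : b = 1 - a := by linarith
          have : 0 ≤ a * b * (‖f y‖ - ‖g y‖) ^ 2 := by positivity
          rw [hb'] at this ⊢
          nlinarith
        nlinarith [mul_le_mul_of_nonneg_left (h2.trans h3) h0]
    _ ≤ ENNReal.ofReal a * c + ENNReal.ofReal b * c := by gcongr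
    _ = c := by rw [← add_mul, ← ENNReal.ofReal_add ha hb, hab, ENNReal.ofReal_one, one_mul]

/-- Fatou's lemma along an almost everywhere convergent subsequence. -/
theorem isClosed_wInt_le {p : ℝ → ℝ} (cp : Continuous p) (c : ℝ≥0∞) :
    IsClosed {w : L2 | wInt p w ≤ c} := by
  refine IsSeqClosed.isClosed fun x w hx hw => ?_
  have h1 : TendstoInMeasure volume (fun n => (x n : ℝ → ℂ)) atTop w :=
    tendstoInMeasure_of_tendsto_Lp hw
  obtain ⟨ns, -, hns⟩ := h1.exists_seq_tendsto_ae
  simp only [mem_ofPred_eq] at hx ⊢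
  have m : ∀ n, AEMeasurable fun y => ENNReal.ofReal (p y * ‖x (ns n) y‖ ^ 2) := fun n =>
    (cp.aemeasurable.mul ((Lp.aestronglyMeasurable _).norm.aemeasurable.pow_const 2)).ennreal_ofReal
  calc wInt p w = ∫⁻ y, liminf (fun n => ENNReal.ofReal (p y * ‖x (ns n) y‖ ^ 2)) atTop := by
        refine lintegral_congr_ae ?_
        filter_upwards [hns] with y hy
        refine (Tendsto.liminf_eq ?_).symm
        exact (ENNReal.continuous_ofReal.tendsto _).comp ((hy.norm.pow 2).const_mul _)
    _ ≤ liminf (fun n => wInt p (x (ns n))) atTop := lintegral_liminf_le' m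
    _ ≤ c := liminf_le_of_frequently_le' (Frequently.of_forall fun n => hx (ns n))

/-! ### Weak solutions and their mollification in time -/

/-- A weak solution of `∂_t h + i u h = ν ∂_yy h`, continuous in time with values in `L²`. -/
structure IsWeakSol (ν : ℝ) (u : ℝ → ℝ) (h : ℝ → L2) : Prop where
  continuousOn : ContinuousOn h (Ici 0)
  weak : ∀ ψ : ℝ → ℝ, ContDiff ℝ ∞ ψ → HasCompactSupport ψ → ∀ t, 0 < t →
    HasDerivAt (fun s => ∫ y, h s y * ψ y)
      (∫ y, h t y * (ν * iteratedDeriv 2 ψ y - Complex.I * u y * ψ y)) t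

/-- A smooth averaging kernel that looks ahead by a time between `δ` and `2δ`. -/
structure IsTimeKernel (δ : ℝ) (η : ℝ → ℝ) : Prop where
  contDiff : ContDiff ℝ ∞ η
  support : tsupport η ⊆ Icc (-(2 * δ)) (-δ)
  nonneg : ∀ s, 0 ≤ η s
  integral : ∫ s, η s = 1

theorem exists_timeKernel {δ : ℝ} (hδ : 0 < δ) : ∃ η, IsTimeKernel δ η := by
  let b : ContDiffBump (-(3 / 2 * δ)) := ⟨δ / 4, δ / 2, by positivity, by linarith⟩
  refine ⟨b.normed volume, b.contDiff_normed, ?_, b.nonneg_normed, b.integral_normed⟩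
  rw [b.tsupport_normed_eq, Real.closedBall_eq_Icc]
  refine Icc_subset_Icc ?_ ?_ <;> simp only [b] <;> linarith

namespace IsTimeKernel

variable {δ : ℝ} {η : ℝ → ℝ}

theorem hasCompactSupport (hη : IsTimeKernel δ η) : HasCompactSupport η :=
  isCompact_Icc.of_isClosed_subset (isClosed_tsupport _) hη.support

theorem continuous_iteratedDeriv (hη : IsTimeKernel δ η) (j : ℕ) :
    Continuous (iteratedDeriv j η) :=
  hη.contDiff.continuous_iteratedDeriv j (by exact_mod_cast le_top)

theorem tsupport_iteratedDeriv (hη : IsTimeKernel δ η) (j : ℕ) :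
    tsupport (iteratedDeriv j η) ⊆ Icc (-(2 * δ)) (-δ) := by
  induction j with
  | zero => simpa using hη.support
  | succ j ih =>
    rw [iteratedDeriv_succ]
    exact tsupport_deriv_subset.trans ih

theorem hasCompactSupport_iteratedDeriv (hη : IsTimeKernel δ η) (j : ℕ) :
    HasCompactSupport (iteratedDeriv j η) :=
  isCompact_Icc.of_isClosed_subset (isClosed_tsupport _) (hη.tsupport_iteratedDeriv j)

theorem contDiff_iteratedDeriv (hη : IsTimeKernel δ η) (j : ℕ) :
    ContDiff ℝ 1 (iteratedDeriv j η) := by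
  rw [iteratedDeriv_eq_iterate]
  exact ContDiff.iterate_deriv' 1 j (hη.contDiff.of_le (by exact_mod_cast le_top))

theorem hasDerivAt_iteratedDeriv (hη : IsTimeKernel δ η) (j : ℕ) (s : ℝ) :
    HasDerivAt (iteratedDeriv j η) (iteratedDeriv (j + 1) η s) s := by
  rw [iteratedDeriv_succ]
  exact ((hη.contDiff_iteratedDeriv j).differentiable one_ne_zero s).hasDerivAt

end IsTimeKernel

/-- The `j`-th time derivative of the time average of `h` with kernel `η`. -/
def mollify (η : ℝ → ℝ) (h : ℝ → L2) (j : ℕ) (t : ℝ) : L2 :=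
  ∫ s, iteratedDeriv j η s • h (max (t - s) 0)

namespace IsWeakSol

variable {ν δ : ℝ} {u η : ℝ → ℝ} {h : ℝ → L2}

/-- Clamping the time at 0 only makes the average total: for `t ≥ 0` the kernel sees times in `[t +
δ, t + 2δ]`, where the clamp does nothing. -/
theorem continuous_max (hh : IsWeakSol ν u h) : Continuous fun s => h (max s 0) :=
  hh.continuousOn.comp_continuous (continuous_id.max continuous_const) fun s => le_max_right s 0

theorem integrable_mollify (hh : IsWeakSol ν u h) (hη : IsTimeKernel δ η) (j : ℕ) (t : ℝ) :
    Integrable fun s => iteratedDeriv j η s • h (max (t - s) 0) := by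
  refine Continuous.integrable_of_hasCompactSupport ?_ ?_
  · exact (hη.continuous_iteratedDeriv j).smul (hh.continuous_max.comp (by fun_prop))
  · exact (hη.hasCompactSupport_iteratedDeriv j).smul_right

/-- The derivative falls on the kernel, so the average is smooth in time whatever the regularity of
`h`. -/
theorem hasDerivAt_mollify (hh : IsWeakSol ν u h) (hη : IsTimeKernel δ η) (j : ℕ) (t : ℝ) :
    HasDerivAt (mollify η h j) (mollify η h (j + 1) t) t := by
  have := (hη.hasCompactSupport_iteratedDeriv j).hasDerivAt_convolution_left
    (ContinuousLinearMap.lsmul ℝ ℝ) (hη.contDiff_iteratedDeriv j)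
    (hh.continuous_max.locallyIntegrable (μ := volume)) t
  rw [← iteratedDeriv_succ] at this
  exact this

theorem pairing_mollify (hh : IsWeakSol ν u h) (hη : IsTimeKernel δ η) (j : ℕ) (t : ℝ)
    {θ : ℝ → ℂ} (hθ : MemLp θ 2) : ∫ y, mollify η h j t y * θ y =
      ∫ s, ((iteratedDeriv j η s : ℝ) : ℂ) * ∫ y, h (max (t - s) 0) y * θ y := by
  obtain ⟨L, hL⟩ := exists_pairing hθ
  rw [← hL, mollify, ← L.integral_comp_comm (hh.integrable_mollify hη j t)]
  refine integral_congr_ae (Eventually.of_forall fun s => ?_)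
  simp only
  rw [← hL]
  exact ((L.restrictScalars ℝ).map_smul (iteratedDeriv j η s) _).trans (Complex.real_smul ..)

theorem continuous_pairing (hh : IsWeakSol ν u h) {θ : ℝ → ℂ} (hθ : MemLp θ 2) :
    Continuous fun s => ∫ y, h (max s 0) y * θ y := by
  obtain ⟨L, hL⟩ := exists_pairing hθ
  simp only [← hL]
  exact L.continuous.comp hh.continuous_max

/-- One integration by parts in `s`. The support of the kernel keeps `t - s ≥ δ > 0`, so the weak
equation is used only at positive times, even for `t = 0`. -/
theorem mollify_equation (hh : IsWeakSol ν u h) (hη : IsTimeKernel δ η) (hδ : 0 < δ)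
    (cu : Continuous u) (j : ℕ) {t : ℝ} (ht : 0 ≤ t) {ψ : ℝ → ℝ} (hψ : ContDiff ℝ ∞ ψ)
    (sψ : HasCompactSupport ψ) : ∫ y, mollify η h (j + 1) t y * ψ y =
      ∫ y, mollify η h j t y * (ν * iteratedDeriv 2 ψ y - Complex.I * u y * ψ y) := by
  have cψ := hψ.continuous
  have cψ2 : Continuous (iteratedDeriv 2 ψ) :=
    hψ.continuous_iteratedDeriv 2 (WithTop.coe_le_coe.2 le_top)
  have m1 : MemLp (fun y => (ψ y : ℂ)) 2 :=
    memLp_of_continuous (by fun_prop) (sψ.comp_left Complex.ofReal_zero)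
  have sψ2 : HasCompactSupport (iteratedDeriv 2 ψ) := by
    rw [iteratedDeriv_succ, iteratedDeriv_one]
    exact sψ.deriv.deriv
  have m2 : MemLp (fun y => (ν : ℂ) * iteratedDeriv 2 ψ y - Complex.I * u y * ψ y) 2 :=
    memLp_of_continuous (by fun_prop)
      ((HasCompactSupport.mul_left (sψ2.comp_left Complex.ofReal_zero)).sub
        (HasCompactSupport.mul_left (sψ.comp_left Complex.ofReal_zero)))
  rw [hh.pairing_mollify hη _ _ m1, hh.pairing_mollify hη _ _ m2]
  have c1 := hh.continuous_pairing m1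
  have c2 := hh.continuous_pairing m2
  have sup := fun j => (hη.hasCompactSupport_iteratedDeriv j).comp_left Complex.ofReal_zero
  have cη := fun j => Complex.continuous_ofReal.comp (hη.continuous_iteratedDeriv j)
  have ct : Continuous fun s : ℝ => t - s := by fun_prop
  have key := integral_mul_deriv_eq_deriv_mul_of_integrable
    (u := fun s => ∫ y, h (max (t - s) 0) y * ψ y)
    (u' := fun s => -∫ y, h (max (t - s) 0) y *
      (ν * iteratedDeriv 2 ψ y - Complex.I * u y * ψ y))
    (v := fun s => ((iteratedDeriv j η s : ℝ) : ℂ))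
    (v' := fun s => ((iteratedDeriv (j + 1) η s : ℝ) : ℂ))
    (fun s hs => by
      have hs' : s ∈ tsupport (iteratedDeriv j η) :=
        closure_mono (Function.support_comp_subset Complex.ofReal_zero _) hs
      have hs2 := (hη.tsupport_iteratedDeriv j hs').2
      have hts : 0 < t - s := by linarith
      have h1 := hh.weak ψ hψ sψ (t - s) hts
      have h2 := h1.scomp s ((hasDerivAt_id s).const_sub t)
      rw [neg_one_smul] at h2
      rw [max_eq_left hts.le]
      refine h2.congr_of_eventuallyEq ?_
      filter_upwards [(isOpen_lt continuous_const ct).mem_nhds hts] with x hx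
      simp only [Function.comp_apply]
      rw [max_eq_left (le_of_lt hx)])
    (fun s _ => (hη.hasDerivAt_iteratedDeriv j s).ofReal_comp)
    (((c1.comp ct).mul (cη (j + 1))).integrable_of_hasCompactSupport (sup (j + 1)).mul_left)
    (((c2.comp ct).neg.mul (cη j)).integrable_of_hasCompactSupport (sup j).mul_left)
    (((c1.comp ct).mul (cη j)).integrable_of_hasCompactSupport (sup j).mul_left)
  simp only [neg_mul, integral_neg, neg_neg] at key
  simp only [mul_comm (Complex.ofReal (iteratedDeriv _ η _))]
  exact key

/-- The kernel is a probability density, and the mean of a curve in a closed convex set stays in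
that set. This is how bounds on `h` at later times become bounds on the average at time `t`. -/
theorem mollify_mem (hh : IsWeakSol ν u h) (hη : IsTimeKernel δ η) (hδ : 0 < δ) {t : ℝ}
    (ht : 0 ≤ t) {C : Set L2} (hC : Convex ℝ C) (hC' : IsClosed C)
    (hmem : ∀ s ∈ Icc (t + δ) (t + 2 * δ), h s ∈ C) : mollify η h 0 t ∈ C := by
  have mη : Measurable fun s => ENNReal.ofReal (η s) := hη.contDiff.continuous.measurable.ennreal_ofReal
  let μ : Measure ℝ := volume.withDensity fun s => ENNReal.ofReal (η s)
  have hμ : IsProbabilityMeasure μ := by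
    refine ⟨?_⟩
    rw [withDensity_apply _ MeasurableSet.univ, setLIntegral_univ, ← ofReal_integral_eq_lintegral_ofReal
      (hη.contDiff.continuous.integrable_of_hasCompactSupport hη.hasCompactSupport)
      (Eventually.of_forall hη.nonneg), hη.integral, ENNReal.ofReal_one]
  have hfin : ∀ᵐ s ∂(volume : Measure ℝ), ENNReal.ofReal (η s) < ⊤ :=
    Eventually.of_forall fun s => ENNReal.ofReal_lt_top
  have e : mollify η h 0 t = ∫ s, h (max (t - s) 0) ∂μ := by
    rw [integral_withDensity_eq_integral_toReal_smul mη hfin, mollify]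
    simp only [iteratedDeriv_zero, ENNReal.toReal_ofReal (hη.nonneg _)]
  rw [e]
  refine hC.integral_mem hC' ?_ ?_
  · rw [ae_withDensity_iff mη]
    refine Eventually.of_forall fun s hs => ?_
    have h1 : s ∈ tsupport η := subset_tsupport _ (by
      intro h0
      rw [h0, ENNReal.ofReal_zero] at hs
      exact hs rfl)
    have h2 := hη.support h1
    rw [max_eq_left (by linarith [h2.2])]
    exact hmem _ ⟨by linarith [h2.2], by linarith [h2.1]⟩
  · rw [integrable_withDensity_iff_integrable_smul' mη hfin]
    simpa only [iteratedDeriv_zero, ENNReal.toReal_ofReal (hη.nonneg _)] using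
      hh.integrable_mollify hη 0 t

theorem exists_mollify_close (hh : IsWeakSol ν u h) {t ε : ℝ} (ht : 0 ≤ t) (hε : 0 < ε) :
    ∃ δ₀ > 0, ∀ δ η, 0 < δ → δ ≤ δ₀ → IsTimeKernel δ η → ‖mollify η h 0 t - h t‖ ≤ ε := by
  obtain ⟨d, hd, H⟩ := Metric.continuousOn_iff.1 hh.continuousOn t ht ε hε
  refine ⟨d / 3, by positivity, fun δ η hδ hδd hη => ?_⟩
  rw [← mem_closedBall_iff_norm]
  refine hh.mollify_mem hη hδ ht (convex_closedBall _ _) Metric.isClosed_closedBall fun s hs => ?_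
  refine (H s (by simp only [mem_Ici]; linarith [hs.1]) ?_).le
  rw [Real.dist_eq, abs_of_nonneg (by linarith [hs.1])]
  linarith [hs.2]

end IsWeakSol

/-! ### A local parametrix for the second derivative -/

/-- The profile of the parametrix. -/
def kern (s : ℝ) : ℝ := s - 6 * s ^ 3 + 8 * s ^ 4 - 3 * s ^ 5

/-- The derivatives of `kern`. -/
def kern₁ (s : ℝ) : ℝ := 1 - 18 * s ^ 2 + 32 * s ^ 3 - 15 * s ^ 4
def kern₂ (s : ℝ) : ℝ := -36 * s + 96 * s ^ 2 - 60 * s ^ 3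
def kern₃ (s : ℝ) : ℝ := -36 + 192 * s - 180 * s ^ 2
def kern₄ (s : ℝ) : ℝ := 192 - 360 * s

theorem hasDerivAt_kern (s : ℝ) : HasDerivAt kern (kern₁ s) s :=
  ((((hasDerivAt_id s).sub (((hasDerivAt_id s).pow 3).const_mul 6)).add
    (((hasDerivAt_id s).pow 4).const_mul 8)).sub (((hasDerivAt_id s).pow 5).const_mul 3)).congr_deriv
    (by simp [kern₁]; ring)

theorem hasDerivAt_kern₁ (s : ℝ) : HasDerivAt kern₁ (kern₂ s) s :=
  ((((hasDerivAt_const s 1).sub (((hasDerivAt_id s).pow 2).const_mul 18)).add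
    (((hasDerivAt_id s).pow 3).const_mul 32)).sub (((hasDerivAt_id s).pow 4).const_mul 15)).congr_deriv
    (by simp [kern₂]; ring)

theorem hasDerivAt_kern₂ (s : ℝ) : HasDerivAt kern₂ (kern₃ s) s :=
  ((((hasDerivAt_id s).const_mul (-36)).add (((hasDerivAt_id s).pow 2).const_mul 96)).sub
    (((hasDerivAt_id s).pow 3).const_mul 60)).congr_deriv (by simp [kern₃]; ring)

theorem hasDerivAt_kern₃ (s : ℝ) : HasDerivAt kern₃ (kern₄ s) s :=
  (((hasDerivAt_const s (-36)).add ((hasDerivAt_id s).const_mul 192)).sub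
    (((hasDerivAt_id s).pow 2).const_mul 180)).congr_deriv (by simp [kern₄]; ring)

/-- Restriction to `[0, 1]`, extended by constants. -/
def clamp (κ : ℝ → ℝ) (x : ℝ) : ℝ := κ (max 0 (min x 1))

theorem continuous_clamp {κ : ℝ → ℝ} (h : Continuous κ) : Continuous (clamp κ) :=
  h.comp (by fun_prop)

theorem clamp_of_mem (κ : ℝ → ℝ) {x : ℝ} (h : x ∈ Icc (0 : ℝ) 1) : clamp κ x = κ x := by
  rw [clamp, min_eq_left h.2, max_eq_right h.1]

theorem clamp_of_notMem {κ : ℝ → ℝ} (h0 : κ 0 = 0) (h1 : κ 1 = 0) {x : ℝ}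
    (h : x ∉ Icc (0 : ℝ) 1) : clamp κ x = 0 := by
  rw [clamp]
  rcases lt_or_ge x 0 with hx | hx
  · rw [min_eq_left (by linarith), max_eq_left hx.le, h0]
  · have : 1 < x := by
      by_contra! hc
      exact h ⟨hx, hc⟩
    rw [min_eq_right this.le, max_eq_right zero_le_one, h1]

theorem hasCompactSupport_clamp {κ : ℝ → ℝ} (h0 : κ 0 = 0) (h1 : κ 1 = 0) :
    HasCompactSupport (clamp κ) :=
  HasCompactSupport.intro isCompact_Icc fun _ hx => clamp_of_notMem h0 h1 hx

theorem integral_clamp {κ : ℝ → ℝ} (h0 : κ 0 = 0) (h1 : κ 1 = 0) (f : ℝ → ℂ) :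
    ∫ s, f s * clamp κ s = ∫ s in (0 : ℝ)..1, κ s * f s := by
  rw [intervalIntegral.integral_of_le zero_le_one, ← integral_Icc_eq_integral_Ioc,
    ← setIntegral_eq_integral_of_forall_compl_eq_zero (s := Icc (0 : ℝ) 1)]
  · refine setIntegral_congr_fun measurableSet_Icc fun s hs => ?_
    simp only [clamp_of_mem κ hs, mul_comm]
  · intro s hs
    rw [clamp_of_notMem h0 h1 hs, Complex.ofReal_zero, mul_zero]

theorem integral_clamp_sub {κ : ℝ → ℝ} (h0 : κ 0 = 0) (h1 : κ 1 = 0) (f : ℝ → ℂ) (y : ℝ) :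
    ∫ z, f z * clamp κ (z - y) = ∫ s in (0 : ℝ)..1, κ s * f (y + s) := by
  rw [← integral_clamp h0 h1, ← integral_add_right_eq_self _ y]
  simp only [add_sub_cancel_right, add_comm y]

/-- The coefficients of `kern` are chosen so that `kern` and `kern₂` vanish at 0 and 1, `kern₁ 0 =
1` and `kern₁ 1 = 0`. Extended by zero, `kern` then has as second derivative the unit mass at 0 plus
a continuous function, namely `kern₂` extended by zero. -/
theorem kern_zero : kern 0 = 0 := by simp [kern]
theorem kern_one : kern 1 = 0 := by norm_num [kern]
theorem kern₂_zero : kern₂ 0 = 0 := by simp [kern₂]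
theorem kern₂_one : kern₂ 1 = 0 := by norm_num [kern₂]

theorem continuous_kern : Continuous kern := by unfold kern; fun_prop
theorem continuous_kern₁ : Continuous kern₁ := by unfold kern₁; fun_prop
theorem continuous_kern₂ : Continuous kern₂ := by unfold kern₂; fun_prop
theorem continuous_kern₃ : Continuous kern₃ := by unfold kern₃; fun_prop
theorem continuous_kern₄ : Continuous kern₄ := by unfold kern₄; fun_prop

/-- Exchange of the order of integration against a compactly supported kernel. -/
theorem integral_kernel_swap {w : ℝ → ℂ} (hw : LocallyIntegrable w) {K ψ : ℝ → ℝ} {b : ℝ}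
    (hK : Integrable K) (sK : ∀ x, x ∉ Icc 0 b → K x = 0)
    (cψ : Continuous ψ) (sψ : HasCompactSupport ψ) :
    ∫ y, (∫ z, w z * K (z - y)) * ψ y = ∫ z, w z * (∫ y, K (z - y) * ψ y : ℝ) := by
  obtain ⟨R, hR⟩ := sψ.isCompact.isBounded.subset_closedBall 0
  rw [Real.closedBall_eq_Icc, zero_sub, zero_add] at hR
  have hψ0 : ∀ y, y ∉ Icc (-R) R → ψ y = 0 := fun y hy => image_eq_zero_of_notMem_tsupport
    fun h => hy (hR h)
  set w' := (Icc (-R) (R + b)).indicator w with hw'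
  have iw' : Integrable w' :=
    (integrable_indicator_iff measurableSet_Icc).2 (hw.integrableOn_isCompact isCompact_Icc)
  have e : ∀ y z, w z * K (z - y) * ψ y = w' z * K (z - y) * ψ y := fun y z => by
    by_cases hy : y ∈ Icc (-R) R
    · by_cases hz : z - y ∈ Icc 0 b
      · rw [hw', indicator_of_mem]
        exact ⟨by linarith [hy.1, hz.1], by linarith [hy.2, hz.2]⟩
      · simp [sK _ hz]
    · simp [hψ0 y hy]
  have iK : Integrable fun x => (K (-x) : ℂ) := hK.comp_neg.ofReal
  obtain ⟨C, hC⟩ := sψ.exists_bound_of_continuous cψ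
  have int : Integrable (fun q : ℝ × ℝ => w' q.2 * K (q.2 - q.1) * ψ q.1) := by
    have h1 := iw'.convolution_integrand (ContinuousLinearMap.mul ℂ ℂ) iK (μ := volume)
      (ν := volume)
    simp only [ContinuousLinearMap.mul_apply', neg_sub] at h1
    refine h1.mul_bdd (c := C) ?_ (Eventually.of_forall fun q => ?_)
    · exact (Complex.continuous_ofReal.comp (cψ.comp continuous_fst)).aestronglyMeasurable
    · rw [Complex.norm_real]; exact hC _
  calc ∫ y, (∫ z, w z * K (z - y)) * ψ y = ∫ y, ∫ z, w' z * K (z - y) * ψ y := by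
        refine integral_congr_ae (Eventually.of_forall fun y => ?_)
        simp only
        rw [← integral_mul_const]
        simp only [e]
    _ = ∫ z, ∫ y, w' z * K (z - y) * ψ y := integral_integral_swap int
    _ = _ := by
        refine integral_congr_ae (Eventually.of_forall fun z => ?_)
        simp only [← e]
        rw [← integral_complex_ofReal, ← integral_const_mul]
        refine integral_congr_ae (Eventually.of_forall fun y => ?_)
        push_cast
        ring

theorem iteratedDeriv_two (ψ : ℝ → ℝ) : iteratedDeriv 2 ψ = deriv (deriv ψ) := by
  rw [iteratedDeriv_succ, iteratedDeriv_one]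

theorem average_eq_convolution (K ψ : ℝ → ℝ) : (fun z => ∫ y, K (z - y) * ψ y) =
    convolution K ψ (ContinuousLinearMap.mul ℝ ℝ) volume := by
  funext z
  rw [convolution_eq_swap]
  rfl

/-- Averages of test functions are test functions, and averaging commutes with derivatives. -/
theorem average_test {K ψ : ℝ → ℝ} (hK : Integrable K) (sK : HasCompactSupport K)
    (hψ : ContDiff ℝ ∞ ψ) (sψ : HasCompactSupport ψ) :
    ContDiff ℝ ∞ (fun z => ∫ y, K (z - y) * ψ y) ∧
    HasCompactSupport (fun z => ∫ y, K (z - y) * ψ y) ∧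
    deriv (fun z => ∫ y, K (z - y) * ψ y) = fun z => ∫ y, K (z - y) * deriv ψ y := by
  have h1 : ContDiff ℝ 1 ψ := hψ.of_le (by exact_mod_cast le_top)
  have c1 : ContDiff ℝ ∞ (convolution K ψ (ContinuousLinearMap.mul ℝ ℝ) volume) :=
    HasCompactSupport.contDiff_convolution_right (n := ⊤) (ContinuousLinearMap.mul ℝ ℝ) sψ
      hK.locallyIntegrable hψ
  have c2 : HasCompactSupport (convolution K ψ (ContinuousLinearMap.mul ℝ ℝ) volume) :=
    HasCompactSupport.convolution (L := ContinuousLinearMap.mul ℝ ℝ) sK sψ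
  have c3 : deriv (convolution K ψ (ContinuousLinearMap.mul ℝ ℝ) volume) =
      convolution K (deriv ψ) (ContinuousLinearMap.mul ℝ ℝ) volume := funext fun z =>
    (HasCompactSupport.hasDerivAt_convolution_right (ContinuousLinearMap.mul ℝ ℝ)
      hK.locallyIntegrable sψ h1 z).deriv
  rw [← average_eq_convolution] at c1 c2 c3
  rw [← average_eq_convolution] at c3
  exact ⟨c1, c2, c3⟩

/-- Two integrations by parts on `[0, 1]`; the only boundary value that survives is `kern₁ 0 · ψ z =
ψ z`. -/
theorem parametrix_test {ψ : ℝ → ℝ} (hψ : ContDiff ℝ ∞ ψ) (z : ℝ) :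
    (∫ y, clamp kern (z - y) * iteratedDeriv 2 ψ y) - ∫ y, clamp kern₂ (z - y) * ψ y = ψ z := by
  have conv : ∀ κ : ℝ → ℝ, κ 0 = 0 → κ 1 = 0 → ∀ f : ℝ → ℝ,
      ∫ y, clamp κ (z - y) * f y = ∫ s in (0 : ℝ)..1, κ s * f (z - s) := fun κ h0 h1 f => by
    have h := integral_clamp h0 h1 fun s => (f (z - s) : ℂ)
    have h2 : ∫ s, (f (z - s) : ℂ) * clamp κ s = ((∫ y, clamp κ (z - y) * f y : ℝ) : ℂ) := by
      rw [← integral_complex_ofReal, ← integral_sub_left_eq_self _ volume z]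
      simp only [sub_sub_cancel, Complex.ofReal_mul, mul_comm]
    rw [h2] at h
    have h3 : ∫ s in (0 : ℝ)..1, (κ s : ℂ) * f (z - s) =
        ((∫ s in (0 : ℝ)..1, κ s * f (z - s) : ℝ) : ℂ) := by
      rw [← intervalIntegral.integral_ofReal]
      simp only [Complex.ofReal_mul]
    rw [h3] at h
    exact_mod_cast h
  have hd : Differentiable ℝ ψ := hψ.differentiable (by simp)
  have hd2 : ContDiff ℝ ∞ (deriv ψ) := (contDiff_infty_iff_deriv.1 hψ).2
  have c2 : Continuous (iteratedDeriv 2 ψ) := by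
    rw [iteratedDeriv_two]; exact (contDiff_infty_iff_deriv.1 hd2).2.continuous
  have h1 : ∀ s, HasDerivAt (fun s => ψ (z - s)) (-deriv ψ (z - s)) s := fun s => by
    have := (hd (z - s)).hasDerivAt.scomp s ((hasDerivAt_id s).const_sub z)
    simpa [Function.comp_def] using this
  have h2 : ∀ s, HasDerivAt (fun s => -deriv ψ (z - s)) (iteratedDeriv 2 ψ (z - s)) s := fun s => by
    have := ((hd2.differentiable (by simp) (z - s)).hasDerivAt.scomp s
      ((hasDerivAt_id s).const_sub z)).neg
    simp only [neg_smul, one_smul, neg_neg] at this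
    rw [iteratedDeriv_two]
    exact this
  have ck := continuous_kern
  have ck2 := continuous_kern₂
  have cψ := hψ.continuous
  rw [conv _ kern_zero kern_one, conv _ kern₂_zero kern₂_one, ← intervalIntegral.integral_sub]
  · rw [intervalIntegral.integral_eq_sub_of_hasDerivAt
      (f := fun s => kern s * -deriv ψ (z - s) - kern₁ s * ψ (z - s))]
    · norm_num [kern, kern₁]
    · intro s _
      exact (((hasDerivAt_kern s).mul (h2 s)).sub ((hasDerivAt_kern₁ s).mul (h1 s))).congr_deriv
        (by ring)
    · exact Continuous.intervalIntegrable (by fun_prop) _ _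
  · exact Continuous.intervalIntegrable (by fun_prop) _ _
  · exact Continuous.intervalIntegrable (by fun_prop) _ _

/-- A function with a weak second derivative is a.e. equal to its parametrix representation. -/
theorem parametrix_ae {w g : ℝ → ℂ} (hw : LocallyIntegrable w) (hg : LocallyIntegrable g)
    (h : ∀ ψ : ℝ → ℝ, ContDiff ℝ ∞ ψ → HasCompactSupport ψ →
      ∫ y, w y * iteratedDeriv 2 ψ y = ∫ y, g y * ψ y)
    (c₁ : Continuous fun y => ∫ z, g z * clamp kern (z - y))
    (c₂ : Continuous fun y => ∫ z, w z * clamp kern₂ (z - y)) :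
    w =ᵐ[volume] fun y => (∫ z, g z * clamp kern (z - y)) - ∫ z, w z * clamp kern₂ (z - y) := by
  have iK : ∀ {κ : ℝ → ℝ}, Continuous κ → κ 0 = 0 → κ 1 = 0 → Integrable (clamp κ) :=
    fun hκ h0 h1 => (continuous_clamp hκ).integrable_of_hasCompactSupport
      (hasCompactSupport_clamp h0 h1)
  have i1 := iK continuous_kern kern_zero kern_one
  have i2 := iK continuous_kern₂ kern₂_zero kern₂_one
  refine ae_eq_of_integral_contDiff_smul_eq hw (c₁.sub c₂).locallyIntegrable fun ψ hψ sψ => ?_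
  have cψ := hψ.continuous
  have hψ1 : ContDiff ℝ ∞ (deriv ψ) := (contDiff_infty_iff_deriv.1 hψ).2
  obtain ⟨a1, a2, a3⟩ := average_test i1 (hasCompactSupport_clamp kern_zero kern_one) hψ sψ
  obtain ⟨-, -, b3⟩ := average_test i1 (hasCompactSupport_clamp kern_zero kern_one) hψ1 sψ.deriv
  obtain ⟨d1, d2, -⟩ := average_test i2 (hasCompactSupport_clamp kern₂_zero kern₂_one) hψ sψ
  have e2 : iteratedDeriv 2 (fun z => ∫ y, clamp kern (z - y) * ψ y) =
      fun z => ∫ y, clamp kern (z - y) * iteratedDeriv 2 ψ y := by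
    rw [iteratedDeriv_two, a3, b3, iteratedDeriv_two]
  have off : ∀ {κ : ℝ → ℝ}, κ 0 = 0 → κ 1 = 0 → ∀ x, x ∉ Icc (0 : ℝ) 1 → clamp κ x = 0 :=
    fun h0 h1 x hx => clamp_of_notMem h0 h1 hx
  have loc : ∀ {f : ℝ → ℂ} {θ : ℝ → ℝ}, LocallyIntegrable f → Continuous θ → HasCompactSupport θ →
      Integrable fun z => f z * θ z := fun {f θ} hf hθ sθ => by
    have := hf.integrable_smul_right_of_hasCompactSupport
      (Complex.continuous_ofReal.comp hθ) (sθ.comp_left Complex.ofReal_zero)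
    exact this
  -- The weak identity is tested with the average of `ψ`, which is again a test function;
  -- `integral_kernel_swap` then moves the kernels back onto `g` and `w`.
  have g1 := h _ a1 a2
  rw [e2] at g1
  have a2' : HasCompactSupport fun z => ∫ y, clamp kern (z - y) * iteratedDeriv 2 ψ y := by
    rw [← e2, iteratedDeriv_two]; exact a2.deriv.deriv
  have a1' : Continuous fun z => ∫ y, clamp kern (z - y) * iteratedDeriv 2 ψ y := by
    rw [← e2]; exact a1.continuous_iteratedDeriv 2 (WithTop.coe_le_coe.2 le_top)
  have s1 := integral_kernel_swap hg i1 (off kern_zero kern_one) cψ sψ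
  have s2 := integral_kernel_swap hw i2 (off kern₂_zero kern₂_one) cψ sψ
  have sψ' := sψ.comp_left Complex.ofReal_zero
  have cψ' := Complex.continuous_ofReal.comp cψ
  calc ∫ y, ψ y • w y = ∫ z, w z * ((∫ y, clamp kern (z - y) * iteratedDeriv 2 ψ y : ℝ)
        - (∫ y, clamp kern₂ (z - y) * ψ y : ℝ)) := by
        refine integral_congr_ae (Eventually.of_forall fun z => ?_)
        simp only [Complex.real_smul]
        rw [← Complex.ofReal_sub, parametrix_test hψ z, mul_comm]
    _ = (∫ z, w z * (∫ y, clamp kern (z - y) * iteratedDeriv 2 ψ y : ℝ))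
        - ∫ z, w z * (∫ y, clamp kern₂ (z - y) * ψ y : ℝ) := by
        rw [← integral_sub (loc hw a1' a2') (loc hw d1.continuous d2)]
        simp only [mul_sub]
    _ = (∫ y, (∫ z, g z * clamp kern (z - y)) * ψ y)
        - ∫ y, (∫ z, w z * clamp kern₂ (z - y)) * ψ y := by rw [s1, s2, g1]
    _ = _ := by
        rw [← integral_sub (f := fun y => (∫ z, g z * clamp kern (z - y)) * (ψ y : ℂ))
          (g := fun y => (∫ z, w z * clamp kern₂ (z - y)) * (ψ y : ℂ))
          ((c₁.mul cψ').integrable_of_hasCompactSupport sψ'.mul_left)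
          ((c₂.mul cψ').integrable_of_hasCompactSupport sψ'.mul_left)]
        refine integral_congr_ae (Eventually.of_forall fun z => ?_)
        simp only [Complex.real_smul]
        ring

/-- The average is rewritten by parts with the primitive `Q` of `q`, so it can be differentiated
although `q` is only continuous. -/
theorem hasDerivAt_average {κ κ' : ℝ → ℝ} (hκ : ∀ s, HasDerivAt κ (κ' s) s) (cκ' : Continuous κ')
    {q : ℝ → ℂ} (hq : Continuous q) (y : ℝ) :
    HasDerivAt (fun y => ∫ s in (0 : ℝ)..1, κ s * q (y + s))
      (κ 1 * q (y + 1) - κ 0 * q y - ∫ s in (0 : ℝ)..1, κ' s * q (y + s)) y := by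
  set Q : ℝ → ℂ := fun x => ∫ s in (0 : ℝ)..x, q s with hQ
  have hQd : ∀ x, HasDerivAt Q (q x) x := fun x => hq.integral_hasStrictDerivAt 0 x |>.hasDerivAt
  have cκ : Continuous κ := continuous_iff_continuousAt.2 fun s => (hκ s).continuousAt
  have cQ : Continuous Q := continuous_iff_continuousAt.2 fun s => (hQd s).continuousAt
  have e : (fun y => ∫ s in (0 : ℝ)..1, κ s * q (y + s)) = fun y =>
      κ 1 * Q (y + 1) - κ 0 * Q (y + 0) - ∫ s in (0 : ℝ)..1, κ' s * Q (y + s) := by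
    funext y
    exact intervalIntegral.integral_mul_deriv_eq_deriv_mul
      (u := fun s => (κ s : ℂ)) (v := fun s => Q (y + s)) (u' := fun s => (κ' s : ℂ))
      (v' := fun s => q (y + s)) (fun s _ => (hκ s).ofReal_comp)
      (fun s _ => (hQd (y + s)).comp_const_add y s)
      (Continuous.intervalIntegrable (by fun_prop) _ _)
      (Continuous.intervalIntegrable (by fun_prop) _ _)
  rw [e]
  have h1 := hasDerivAt_integral_param (a := y - 1) (b := y + 1)
    (φ := fun y s => (κ' s : ℂ) * Q (y + s)) (ψ := fun y s => (κ' s : ℂ) * q (y + s))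
    (Continuous.continuousOn (by fun_prop)) (Continuous.continuousOn (by fun_prop))
    (fun t _ s => ((hQd (t + s)).comp_add_const t s).const_mul _) 0 1
    (⟨by linarith, by linarith⟩ : y ∈ Ioo (y - 1) (y + 1))
  have h2 := ((hQd (y + 1)).comp_add_const y 1).const_mul (κ 1 : ℂ)
  have h3 := ((hQd (y + 0)).comp_add_const y 0).const_mul (κ 0 : ℂ)
  rw [add_zero] at h3
  exact (h2.sub h3).sub h1

/-- The derivative of a function given by its parametrix representation. -/
def parametrixDeriv (w g : ℝ → ℂ) (y : ℝ) : ℂ :=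
  (∫ s in (0 : ℝ)..1, kern₃ s * w (y + s)) - ∫ s in (0 : ℝ)..1, kern₁ s * g (y + s)

/-- The representation gives one derivative, since `kern` and `kern₂` are smooth on `[0, 1]` and
vanish at the ends. The derivative is again an average of continuous functions, hence has a
continuous derivative `D`, and the weak identity forces `D = g`. -/
theorem parametrix_hasDerivAt {w g : ℝ → ℂ} (cw : Continuous w) (cg : Continuous g)
    (hrep : ∀ y, w y = (∫ z, g z * clamp kern (z - y)) - ∫ z, w z * clamp kern₂ (z - y))
    (h : ∀ ψ : ℝ → ℝ, ContDiff ℝ ∞ ψ → HasCompactSupport ψ →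
      ∫ y, w y * iteratedDeriv 2 ψ y = ∫ y, g y * ψ y) :
    (∀ y, HasDerivAt w (parametrixDeriv w g y) y) ∧
      ∀ y, HasDerivAt (parametrixDeriv w g) (g y) y := by
  have d1 : ∀ y, HasDerivAt w (parametrixDeriv w g y) y := fun y => by
    have e : w = fun y => (∫ s in (0 : ℝ)..1, kern s * g (y + s))
        - ∫ s in (0 : ℝ)..1, kern₂ s * w (y + s) := funext fun y => by
      conv_lhs => rw [hrep y, integral_clamp_sub kern_zero kern_one,
        integral_clamp_sub kern₂_zero kern₂_one]
    have h1 := (hasDerivAt_average hasDerivAt_kern continuous_kern₁ cg y).sub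
      (hasDerivAt_average hasDerivAt_kern₂ continuous_kern₃ cw y)
    refine (h1.congr_deriv ?_).congr_of_eventuallyEq (Eventually.of_forall (congrFun e))
    rw [kern_zero, kern_one, kern₂_zero, kern₂_one, parametrixDeriv]
    simp only [Complex.ofReal_zero, zero_mul, sub_zero, zero_sub]
    ring
  obtain ⟨D, hD, cD⟩ : ∃ D : ℝ → ℂ, (∀ y, HasDerivAt (parametrixDeriv w g) (D y) y) ∧
      Continuous D := by
    refine ⟨_, fun y => (hasDerivAt_average hasDerivAt_kern₃ continuous_kern₄ cw y).sub
      (hasDerivAt_average hasDerivAt_kern₁ continuous_kern₂ cg y), ?_⟩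
    have c4 := continuous_kern₄
    have c2 := continuous_kern₂
    have i1 : Continuous fun y => ∫ s in (0 : ℝ)..1, (kern₄ s : ℂ) * w (y + s) :=
      intervalIntegral.continuous_parametric_intervalIntegral_of_continuous'
        (f := fun y s => (kern₄ s : ℂ) * w (y + s)) (by fun_prop) 0 1
    have i2 : Continuous fun y => ∫ s in (0 : ℝ)..1, (kern₂ s : ℂ) * g (y + s) :=
      intervalIntegral.continuous_parametric_intervalIntegral_of_continuous'
        (f := fun y s => (kern₂ s : ℂ) * g (y + s)) (by fun_prop) 0 1
    fun_prop
  have hDg : D = g := by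
    refine cD.ae_eq_iff_eq volume cg |>.1 ?_
    refine ae_eq_of_integral_contDiff_smul_eq cD.locallyIntegrable cg.locallyIntegrable
      fun ψ hψ sψ => ?_
    have cw1 : Continuous (parametrixDeriv w g) :=
      continuous_iff_continuousAt.2 fun y => (hD y).continuousAt
    have hψ1 : ContDiff ℝ ∞ (deriv ψ) := (contDiff_infty_iff_deriv.1 hψ).2
    have e1 : ∀ y, HasDerivAt (fun y => (ψ y : ℂ)) (deriv ψ y : ℝ) y := fun y =>
      (hψ.differentiable (by simp) y).hasDerivAt.ofReal_comp
    have e2 : ∀ y, HasDerivAt (fun y => ((deriv ψ y : ℝ) : ℂ)) (iteratedDeriv 2 ψ y : ℝ) y :=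
      fun y => by
        rw [iteratedDeriv_two]
        exact (hψ1.differentiable (by simp) y).hasDerivAt.ofReal_comp
    have c0 : Continuous fun y => (ψ y : ℂ) := Complex.continuous_ofReal.comp hψ.continuous
    have c1 : Continuous fun y => ((deriv ψ y : ℝ) : ℂ) :=
      Complex.continuous_ofReal.comp hψ1.continuous
    have c2 : Continuous fun y => ((iteratedDeriv 2 ψ y : ℝ) : ℂ) := by
      rw [iteratedDeriv_two]
      exact Complex.continuous_ofReal.comp (contDiff_infty_iff_deriv.1 hψ1).2.continuous
    have s0 : HasCompactSupport fun y => (ψ y : ℂ) := sψ.comp_left Complex.ofReal_zero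
    have s1 : HasCompactSupport fun y => ((deriv ψ y : ℝ) : ℂ) :=
      sψ.deriv.comp_left Complex.ofReal_zero
    have s2 : HasCompactSupport fun y => ((iteratedDeriv 2 ψ y : ℝ) : ℂ) := by
      rw [iteratedDeriv_two]; exact sψ.deriv.deriv.comp_left Complex.ofReal_zero
    have int : ∀ {f θ : ℝ → ℂ}, Continuous f → Continuous θ → HasCompactSupport θ →
        Integrable (f * θ) := fun hf hθ sθ =>
      (hf.mul hθ).integrable_of_hasCompactSupport sθ.mul_left
    have k1 := integral_mul_deriv_eq_deriv_mul_of_integrable (u := w)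
      (v := fun y => ((deriv ψ y : ℝ) : ℂ)) (fun y _ => d1 y) (fun y _ => e2 y) (int cw c2 s2)
      (int cw1 c1 s1) (int cw c1 s1)
    have k2 := integral_mul_deriv_eq_deriv_mul_of_integrable (u := parametrixDeriv w g)
      (v := fun y => (ψ y : ℂ)) (fun y _ => hD y) (fun y _ => e1 y) (int cw1 c1 s1)
      (int cD c0 s0) (int cw1 c0 s0)
    rw [k2, neg_neg, h ψ hψ sψ] at k1
    simp only [Complex.real_smul, mul_comm (ψ _ : ℂ)]
    exact k1.symm
  rw [hDg] at hD
  exact ⟨d1, hD⟩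

theorem continuous_parametrixDeriv {w g : ℝ → ℝ → ℂ} (cw : Continuous (Function.uncurry w))
    (cg : Continuous (Function.uncurry g)) :
    Continuous (Function.uncurry fun t => parametrixDeriv (w t) (g t)) := by
  have sh : Continuous fun r : (ℝ × ℝ) × ℝ => (r.1.1, r.1.2 + r.2) := by fun_prop
  have i1 := intervalIntegral.continuous_parametric_intervalIntegral_of_continuous' (μ := volume)
    (f := fun (q : ℝ × ℝ) s => (kern₃ s : ℂ) * w q.1 (q.2 + s))
    ((Complex.continuous_ofReal.comp (continuous_kern₃.comp continuous_snd)).mul (cw.comp sh)) 0 1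
  have i2 := intervalIntegral.continuous_parametric_intervalIntegral_of_continuous' (μ := volume)
    (f := fun (q : ℝ × ℝ) s => (kern₁ s : ℂ) * g q.1 (q.2 + s))
    ((Complex.continuous_ofReal.comp (continuous_kern₁.comp continuous_snd)).mul (cg.comp sh)) 0 1
  exact i1.sub i2

theorem hasDerivAt_parametrixDeriv {w wt g gt : ℝ → ℝ → ℂ} (cw : Continuous (Function.uncurry w))
    (cwt : Continuous (Function.uncurry wt)) (cg : Continuous (Function.uncurry g))
    (cgt : Continuous (Function.uncurry gt))
    (dw : ∀ t y, HasDerivAt (fun s => w s y) (wt t y) t)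
    (dg : ∀ t y, HasDerivAt (fun s => g s y) (gt t y) t) (t y : ℝ) :
    HasDerivAt (fun s => parametrixDeriv (w s) (g s) y) (parametrixDeriv (wt t) (gt t) y) t := by
  have sh : Continuous fun q : ℝ × ℝ => (q.1, y + q.2) := by fun_prop
  have mem : t ∈ Ioo (t - 1) (t + 1) := ⟨by linarith, by linarith⟩
  have k3 : Continuous fun q : ℝ × ℝ => (kern₃ q.2 : ℂ) :=
    Complex.continuous_ofReal.comp (continuous_kern₃.comp continuous_snd)
  have k1 : Continuous fun q : ℝ × ℝ => (kern₁ q.2 : ℂ) :=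
    Complex.continuous_ofReal.comp (continuous_kern₁.comp continuous_snd)
  have i1 := hasDerivAt_integral_param (a := t - 1) (b := t + 1)
    (φ := fun t s => (kern₃ s : ℂ) * w t (y + s)) (ψ := fun t s => (kern₃ s : ℂ) * wt t (y + s))
    (k3.mul (cw.comp sh)).continuousOn (k3.mul (cwt.comp sh)).continuousOn
    (fun t _ s => (dw t (y + s)).const_mul _) 0 1 mem
  have i2 := hasDerivAt_integral_param (a := t - 1) (b := t + 1)
    (φ := fun t s => (kern₁ s : ℂ) * g t (y + s)) (ψ := fun t s => (kern₁ s : ℂ) * gt t (y + s))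
    (k1.mul (cg.comp sh)).continuousOn (k1.mul (cgt.comp sh)).continuousOn
    (fun t _ s => (dg t (y + s)).const_mul _) 0 1 mem
  exact i1.sub i2

/-- The pairing is an inner product in `L²`, so it suffices that `y ↦ A y ·` is continuous into
`L²`. For `y` near `y₀` all supports lie in one compact interval, where the square distance `J` is a
continuous parametric integral vanishing at `y₀`. -/
theorem continuous_pairing_kernel {W : ℝ → L2} (cW : Continuous W) {A : ℝ → ℝ → ℂ}
    (cA : Continuous (Function.uncurry A)) (sA : ∀ y z, z ∉ Icc y (y + 1) → A y z = 0) :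
    Continuous fun q : ℝ × ℝ => ∫ z, W q.1 z * A q.2 z := by
  have cA1 : ∀ y, Continuous (A y) := fun y => cA.comp (by fun_prop : Continuous fun z => (y, z))
  have mA : ∀ y, MemLp (fun z => (starRingEnd ℂ) (A y z)) 2 := fun y =>
    (memLp_of_continuous (cA1 y) (HasCompactSupport.intro isCompact_Icc (sA y))).star
  have e : ∀ (w : L2) y, ∫ z, w z * A y z = inner ℂ (mA y).toLp w := fun w y => by
    rw [L2.inner_def]
    refine integral_congr_ae ?_
    filter_upwards [(mA y).coeFn_toLp] with z hz
    rw [hz]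
    simp
  simp only [e]
  refine Continuous.inner (Continuous.comp (g := fun y => (mA y).toLp) ?_ continuous_snd)
    (cW.comp continuous_fst)
  rw [continuous_iff_continuousAt]
  intro y₀
  set J : ℝ → ℝ := fun y => ∫ z in Icc (y₀ - 1) (y₀ + 2), ‖A y z - A y₀ z‖ ^ 2 with hJ
  have cJ : Continuous J := continuous_parametric_integral_of_continuous
    (f := fun y z => ‖A y z - A y₀ z‖ ^ 2) (by
      have h1 : Continuous fun q : ℝ × ℝ => A q.1 q.2 := cA
      have h2 := (cA1 y₀).comp (continuous_snd (X := ℝ))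
      exact (h1.sub h2).norm.pow 2) isCompact_Icc
  have J0 : J y₀ = 0 := by simp [hJ]
  have bound : ∀ y ∈ Ioo (y₀ - 1) (y₀ + 1), ‖(mA y).toLp - (mA y₀).toLp‖ ^ 2 ≤ J y := by
    intro y hy
    have hJ0 : 0 ≤ J y := integral_nonneg fun z => sq_nonneg _
    rw [← ENNReal.ofReal_le_ofReal_iff hJ0, ← wInt_one_Lp, ← MemLp.toLp_sub,
      wInt_congr (((mA y).sub (mA y₀)).coeFn_toLp), wInt,
      ofReal_integral_eq_lintegral_ofReal _ (Eventually.of_forall fun z => sq_nonneg _)]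
    · refine le_of_eq ?_
      rw [← setLIntegral_eq_of_support_subset (s := Icc (y₀ - 1) (y₀ + 2))]
      · refine lintegral_congr fun z => ?_
        simp only [one_mul, Pi.sub_apply, ← map_sub, RCLike.norm_conj]
      · intro z hz
        by_contra hz'
        refine hz ?_
        have h1 : A y z = 0 := sA y z fun h => hz' ⟨by linarith [h.1, hy.1], by linarith [h.2, hy.2]⟩
        have h2 : A y₀ z = 0 := sA y₀ z fun h => hz' ⟨by linarith [h.1], by linarith [h.2]⟩
        simp [h1, h2]
    · have h1 := cA1 y
      have h2 := cA1 y₀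
      exact (Continuous.continuousOn (by fun_prop)).integrableOn_compact isCompact_Icc
  rw [ContinuousAt, tendsto_iff_norm_sub_tendsto_zero]
  have t1 : Tendsto (fun y => √(J y)) (𝓝 y₀) (𝓝 0) := by
    have := (Real.continuous_sqrt.comp cJ).tendsto y₀
    simpa [J0, Function.comp_def] using this
  refine squeeze_zero' (Eventually.of_forall fun y => norm_nonneg _) ?_ t1
  filter_upwards [Ioo_mem_nhds (by linarith : y₀ - 1 < y₀) (by linarith : y₀ < y₀ + 1)] with y hy
  exact Real.le_sqrt_of_sq_le (bound y hy)

/-! ### The mollified solution is classical -/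

/-- The continuous representative of `mollify η h j t`. -/
def smoothRep (ν : ℝ) (u η : ℝ → ℝ) (h : ℝ → L2) (j : ℕ) (t y : ℝ) : ℂ :=
  (∫ z, mollify η h (j + 1) t z * (clamp kern (z - y) / ν : ℂ))
    + (∫ z, mollify η h j t z * (Complex.I * u z * clamp kern (z - y) / ν))
    - ∫ z, mollify η h j t z * (clamp kern₂ (z - y) : ℂ)

/-- The derivative in `y` of `smoothRep`. -/
def smoothRepDeriv (ν : ℝ) (u η : ℝ → ℝ) (h : ℝ → L2) (j : ℕ) (t y : ℝ) : ℂ :=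
  parametrixDeriv (smoothRep ν u η h j t)
    (fun y => (smoothRep ν u η h (j + 1) t y + Complex.I * u y * smoothRep ν u η h j t y) / ν) y

namespace IsWeakSol

variable {ν δ : ℝ} {u η : ℝ → ℝ} {h : ℝ → L2}

theorem continuous_mollify (hh : IsWeakSol ν u h) (hη : IsTimeKernel δ η) (j : ℕ) :
    Continuous (mollify η h j) :=
  continuous_iff_continuousAt.2 fun t => (hh.hasDerivAt_mollify hη j t).continuousAt

theorem continuous_kernel {κ : ℝ → ℝ} (hκ : Continuous κ) :
    Continuous (Function.uncurry fun y z : ℝ => (clamp κ (z - y) : ℂ)) :=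
  Complex.continuous_ofReal.comp ((continuous_clamp hκ).comp
    (by fun_prop : Continuous fun q : ℝ × ℝ => q.2 - q.1))

theorem kernel_eq_zero {κ : ℝ → ℝ} (h0 : κ 0 = 0) (h1 : κ 1 = 0) (y z : ℝ)
    (hz : z ∉ Icc y (y + 1)) : (clamp κ (z - y) : ℂ) = 0 := by
  rw [clamp_of_notMem h0 h1, Complex.ofReal_zero]
  exact fun h => hz ⟨by linarith [h.1], by linarith [h.2]⟩

theorem continuous_kernels (cu : Continuous u) (ν : ℝ) :
    Continuous (Function.uncurry fun y z : ℝ => (clamp kern (z - y) / ν : ℂ)) ∧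
    Continuous (Function.uncurry fun y z : ℝ => Complex.I * u z * clamp kern (z - y) / ν) ∧
    Continuous (Function.uncurry fun y z : ℝ => (clamp kern₂ (z - y) : ℂ)) := by
  have c1 := continuous_kernel continuous_kern
  have c2 := continuous_kernel continuous_kern₂
  refine ⟨c1.div_const _, ?_, c2⟩
  exact ((continuous_const.mul (Complex.continuous_ofReal.comp (cu.comp continuous_snd))).mul
    c1).div_const _

theorem continuous_smoothRep (hh : IsWeakSol ν u h) (hη : IsTimeKernel δ η) (cu : Continuous u)
    (j : ℕ) : Continuous (Function.uncurry (smoothRep ν u η h j)) := by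
  obtain ⟨c1, c2, c3⟩ := continuous_kernels cu ν
  have z1 := kernel_eq_zero kern_zero kern_one
  have z2 := kernel_eq_zero kern₂_zero kern₂_one
  exact ((continuous_pairing_kernel (hh.continuous_mollify hη (j + 1)) c1
    fun y z hz => by rw [z1 y z hz, zero_div]).add
    (continuous_pairing_kernel (hh.continuous_mollify hη j) c2
      fun y z hz => by rw [z1 y z hz, mul_zero, zero_div])).sub
    (continuous_pairing_kernel (hh.continuous_mollify hη j) c3 z2)

theorem hasDerivAt_smoothRep (hh : IsWeakSol ν u h) (hη : IsTimeKernel δ η) (cu : Continuous u)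
    (j : ℕ) (t y : ℝ) :
    HasDerivAt (fun s => smoothRep ν u η h j s y) (smoothRep ν u η h (j + 1) t y) t := by
  obtain ⟨c1, c2, c3⟩ := continuous_kernels cu ν
  have z1 := kernel_eq_zero kern_zero kern_one
  have z2 := kernel_eq_zero kern₂_zero kern₂_one
  have key : ∀ {θ : ℝ → ℝ → ℂ}, Continuous (Function.uncurry θ) →
      (∀ z, z ∉ Icc y (y + 1) → θ y z = 0) → ∀ j, HasDerivAt (fun s => ∫ z, mollify η h j s z * θ y z)
        (∫ z, mollify η h (j + 1) t z * θ y z) t := fun {θ} hθ sθ j => by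
    have m : MemLp (θ y) 2 := memLp_of_continuous (hθ.comp (by fun_prop : Continuous fun z => (y, z)))
      (HasCompactSupport.intro isCompact_Icc sθ)
    obtain ⟨L, hL⟩ := exists_pairing m
    simp only [← hL]
    exact (L.restrictScalars ℝ).hasFDerivAt.comp_hasDerivAt t (hh.hasDerivAt_mollify hη j t)
  exact ((key c1 (fun z hz => by rw [z1 y z hz, zero_div]) (j + 1)).add
    (key c2 (fun z hz => by rw [z1 y z hz, mul_zero, zero_div]) j)).sub
    (key c3 (fun z hz => z2 y z hz) j)

/-- The second derivative in `y` of the mollified solution, from the equation. -/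
def mollifyYY (ν : ℝ) (u η : ℝ → ℝ) (h : ℝ → L2) (j : ℕ) (t z : ℝ) : ℂ :=
  (mollify η h (j + 1) t z + Complex.I * u z * mollify η h j t z) / ν

theorem locallyIntegrable_L2 (w : L2) : LocallyIntegrable w :=
  (Lp.memLp w).locallyIntegrable (by norm_num)

theorem locallyIntegrable_mollifyYY (cu : Continuous u) (j : ℕ) (t : ℝ) :
    LocallyIntegrable (mollifyYY ν u η h j t) := by
  have h1 := (locallyIntegrable_L2 (mollify η h j t)).smul_continuous
    (g := fun z => Complex.I * u z) (by fun_prop)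
  have h2 : LocallyIntegrable fun z => mollify η h (j + 1) t z +
    mollify η h j t z • (Complex.I * u z) := (locallyIntegrable_L2 (mollify η h (j + 1) t)).add h1
  refine (h2.smul (ν : ℂ)⁻¹).congr (Eventually.of_forall fun z => ?_)
  simp only [mollifyYY, Pi.smul_apply, smul_eq_mul]
  ring

theorem weak_mollifyYY (hh : IsWeakSol ν u h) (hη : IsTimeKernel δ η) (hδ : 0 < δ)
    (cu : Continuous u) (hν : ν ≠ 0) (j : ℕ) {t : ℝ} (ht : 0 ≤ t) {ψ : ℝ → ℝ}
    (hψ : ContDiff ℝ ∞ ψ) (sψ : HasCompactSupport ψ) :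
    ∫ y, mollify η h j t y * iteratedDeriv 2 ψ y = ∫ y, mollifyYY ν u η h j t y * ψ y := by
  have hν' : (ν : ℂ) ≠ 0 := by exact_mod_cast hν
  have eq := hh.mollify_equation hη hδ cu j ht hψ sψ
  have cψ := hψ.continuous
  have cψ2 : Continuous (iteratedDeriv 2 ψ) :=
    hψ.continuous_iteratedDeriv 2 (WithTop.coe_le_coe.2 le_top)
  have sψ' : HasCompactSupport fun y => (ψ y : ℂ) := sψ.comp_left Complex.ofReal_zero
  have sψ2 : HasCompactSupport fun y => ((iteratedDeriv 2 ψ y : ℝ) : ℂ) := by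
    rw [iteratedDeriv_two]; exact sψ.deriv.deriv.comp_left Complex.ofReal_zero
  have a1 : MemLp (fun y => (ν : ℂ) * (iteratedDeriv 2 ψ y : ℝ)) 2 :=
    memLp_of_continuous (by fun_prop) sψ2.mul_left
  have a2 : MemLp (fun y => Complex.I * u y * ψ y) 2 :=
    memLp_of_continuous (by fun_prop) sψ'.mul_left
  have a3 : MemLp (fun y => (ψ y : ℂ)) 2 := memLp_of_continuous (by fun_prop) sψ'
  simp only [mul_sub] at eq
  rw [integral_sub (integrable_mul_of_memLp a1 _) (integrable_mul_of_memLp a2 _)] at eq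
  have e3 : ∫ y, mollify η h j t y * ((ν : ℂ) * (iteratedDeriv 2 ψ y : ℝ)) =
      ν * ∫ y, mollify η h j t y * (iteratedDeriv 2 ψ y : ℝ) := by
    rw [← integral_const_mul]
    refine integral_congr_ae (Eventually.of_forall fun z => ?_)
    simp only
    ring
  have e4 : ∫ y, mollifyYY ν u η h j t y * ψ y = (ν : ℂ)⁻¹ * ((∫ y, mollify η h (j + 1) t y * ψ y)
      + ∫ y, mollify η h j t y * (Complex.I * u y * ψ y)) := by
    rw [← integral_add (integrable_mul_of_memLp a3 _) (integrable_mul_of_memLp a2 _),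
      ← integral_const_mul]
    refine integral_congr_ae (Eventually.of_forall fun z => ?_)
    simp only [mollifyYY]
    field_simp
  rw [e4, eq, sub_add_cancel, e3, inv_mul_cancel_left₀ hν']

/-- The definition of `smoothRep` keeps the term with `u` as a separate pairing, because `u` times
an element of `L²` need not be in `L²`; against the compactly supported kernel the pieces recombine.
-/
theorem smoothRep_eq (cu : Continuous u) (j : ℕ) (t y : ℝ) :
    smoothRep ν u η h j t y = (∫ z, mollifyYY ν u η h j t z * clamp kern (z - y))
      - ∫ z, mollify η h j t z * clamp kern₂ (z - y) := by
  obtain ⟨c1, c2, -⟩ := continuous_kernels cu ν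
  have z1 := kernel_eq_zero kern_zero kern_one y
  have m1 : MemLp (fun z => (clamp kern (z - y) / ν : ℂ)) 2 := memLp_of_continuous
    (c1.comp (by fun_prop : Continuous fun z => (y, z)))
    (HasCompactSupport.intro (isCompact_Icc (a := y) (b := y + 1)) fun z hz => by
      rw [z1 z hz, zero_div])
  have m2 : MemLp (fun z => Complex.I * u z * clamp kern (z - y) / ν) 2 := memLp_of_continuous
    (c2.comp (by fun_prop : Continuous fun z => (y, z)))
    (HasCompactSupport.intro (isCompact_Icc (a := y) (b := y + 1)) fun z hz => by
      rw [z1 z hz, mul_zero, zero_div])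
  rw [smoothRep, ← integral_add (integrable_mul_of_memLp m1 _) (integrable_mul_of_memLp m2 _)]
  congr 1
  refine integral_congr_ae (Eventually.of_forall fun z => ?_)
  simp only [mollifyYY]
  ring

theorem continuous_pairings (hh : IsWeakSol ν u h) (hη : IsTimeKernel δ η) (cu : Continuous u)
    (j : ℕ) (t : ℝ) :
    (Continuous fun y => ∫ z, mollifyYY ν u η h j t z * clamp kern (z - y)) ∧
      Continuous fun y => ∫ z, mollify η h j t z * clamp kern₂ (z - y) := by
  obtain ⟨-, -, c3⟩ := continuous_kernels cu ν
  have k2 : Continuous fun y => ∫ z, mollify η h j t z * clamp kern₂ (z - y) :=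
    (continuous_pairing_kernel (hh.continuous_mollify hη j) c3
      (kernel_eq_zero kern₂_zero kern₂_one)).comp (by fun_prop : Continuous fun y => (t, y))
  have k1 : Continuous (smoothRep ν u η h j t) :=
    (hh.continuous_smoothRep hη cu j).uncurry_left t
  refine ⟨(k1.add k2).congr fun y => ?_, k2⟩
  rw [Pi.add_apply, smoothRep_eq cu, sub_add_cancel]

theorem smoothRep_ae (hh : IsWeakSol ν u h) (hη : IsTimeKernel δ η) (hδ : 0 < δ)
    (cu : Continuous u) (hν : ν ≠ 0) (j : ℕ) {t : ℝ} (ht : 0 ≤ t) :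
    mollify η h j t =ᵐ[volume] smoothRep ν u η h j t := by
  obtain ⟨k1, k2⟩ := hh.continuous_pairings hη cu j t
  refine (parametrix_ae (locallyIntegrable_L2 (mollify η h j t)) (locallyIntegrable_mollifyYY cu j t)
    (fun ψ hψ sψ => hh.weak_mollifyYY hη hδ cu hν j ht hψ sψ) k1 k2).trans
    (Eventually.of_forall fun y => ?_)
  rw [smoothRep_eq cu]

/-- Almost everywhere equality with the average transfers the weak second derivative to the
continuous representative, to which `parametrix_hasDerivAt` applies. -/
theorem smoothRep_hasDerivAt_y (hh : IsWeakSol ν u h) (hη : IsTimeKernel δ η) (hδ : 0 < δ)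
    (cu : Continuous u) (hν : ν ≠ 0) (j : ℕ) {t : ℝ} (ht : 0 ≤ t) :
    (∀ y, HasDerivAt (smoothRep ν u η h j t) (smoothRepDeriv ν u η h j t y) y) ∧
      ∀ y, HasDerivAt (smoothRepDeriv ν u η h j t)
        ((smoothRep ν u η h (j + 1) t y + Complex.I * u y * smoothRep ν u η h j t y) / ν) y := by
  have cF1 : ∀ j, Continuous (smoothRep ν u η h j t) := fun j =>
    (hh.continuous_smoothRep hη cu j).uncurry_left t
  have a0 := hh.smoothRep_ae hη hδ cu hν j ht
  have a1 := hh.smoothRep_ae hη hδ cu hν (j + 1) ht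
  have ag : mollifyYY ν u η h j t =ᵐ[volume] fun y =>
      (smoothRep ν u η h (j + 1) t y + Complex.I * u y * smoothRep ν u η h j t y) / ν := by
    filter_upwards [a0, a1] with y h0 h1
    rw [mollifyYY, h0, h1]
  have h0 := cF1 j
  have h1 := cF1 (j + 1)
  refine parametrix_hasDerivAt h0 (by fun_prop) (fun y => ?_) fun ψ hψ sψ => ?_
  · rw [smoothRep_eq cu]
    congr 1
    · refine integral_congr_ae ?_
      filter_upwards [ag] with z hz
      rw [hz]
    · refine integral_congr_ae ?_
      filter_upwards [a0] with z hz
      rw [hz]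
  · have := hh.weak_mollifyYY hη hδ cu hν j ht hψ sψ
    have e0 : ∫ y, mollify η h j t y * iteratedDeriv 2 ψ y =
        ∫ y, smoothRep ν u η h j t y * iteratedDeriv 2 ψ y := by
      refine integral_congr_ae ?_
      filter_upwards [a0] with z hz
      rw [hz]
    rw [← e0, this]
    refine integral_congr_ae ?_
    filter_upwards [ag] with z hz
    rw [hz]

/-- The second derivative in `y` of `smoothRep`, from the equation. -/
def smoothRepYY (ν : ℝ) (u η : ℝ → ℝ) (h : ℝ → L2) (j : ℕ) (t y : ℝ) : ℂ :=
  (smoothRep ν u η h (j + 1) t y + Complex.I * u y * smoothRep ν u η h j t y) / ν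

theorem continuous_smoothRepYY (hh : IsWeakSol ν u h) (hη : IsTimeKernel δ η) (cu : Continuous u)
    (j : ℕ) : Continuous (Function.uncurry (smoothRepYY ν u η h j)) :=
  ((hh.continuous_smoothRep hη cu (j + 1)).add ((continuous_const.mul
    (Complex.continuous_ofReal.comp (cu.comp continuous_snd))).mul
    (hh.continuous_smoothRep hη cu j))).div_const _

theorem hasDerivAt_smoothRepYY (hh : IsWeakSol ν u h) (hη : IsTimeKernel δ η) (cu : Continuous u)
    (j : ℕ) (t y : ℝ) :
    HasDerivAt (fun s => smoothRepYY ν u η h j s y) (smoothRepYY ν u η h (j + 1) t y) t :=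
  ((hh.hasDerivAt_smoothRep hη cu (j + 1) t y).add
    ((hh.hasDerivAt_smoothRep hη cu j t y).const_mul (Complex.I * u y))).div_const _

/-- Time derivatives come from the kernel and derivatives in `y` from the parametrix. The latter is
also explicit enough to be continuous and differentiable in time jointly with `y`. -/
theorem classicalSol (hh : IsWeakSol ν u h) (hη : IsTimeKernel δ η) (hδ : 0 < δ)
    (cu : Continuous u) (hν : ν ≠ 0) :
    ClassicalSol ν u (smoothRep ν u η h) (smoothRepDeriv ν u η h) where
  continuous j := (hh.continuous_smoothRep hη cu j).continuousOn
  continuous_y j := (continuous_parametrixDeriv (hh.continuous_smoothRep hη cu j)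
    (hh.continuous_smoothRepYY hη cu j)).continuousOn
  deriv_y j t ht := (hh.smoothRep_hasDerivAt_y hη hδ cu hν j ht).1
  deriv_yy j t ht := (hh.smoothRep_hasDerivAt_y hη hδ cu hν j ht).2
  deriv_t j t _ y := hh.hasDerivAt_smoothRep hη cu j t y
  deriv_ty j t _ y := hasDerivAt_parametrixDeriv (hh.continuous_smoothRep hη cu j)
    (hh.continuous_smoothRep hη cu (j + 1)) (hh.continuous_smoothRepYY hη cu j)
    (hh.continuous_smoothRepYY hη cu (j + 1)) (fun t y => hh.hasDerivAt_smoothRep hη cu j t y)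
    (fun t y => hh.hasDerivAt_smoothRepYY hη cu j t y) t y
  bounded T := by
    obtain ⟨C, hC⟩ := (isCompact_Icc (a := 0) (b := T)).exists_bound_of_continuousOn
      (hh.continuous_mollify hη 0).continuousOn
    refine ⟨C ^ 2, fun t ht => ?_⟩
    rw [← wInt_congr (hh.smoothRep_ae hη hδ cu hν 0 ht.1), wInt_one_Lp]
    exact ENNReal.ofReal_le_ofReal (pow_le_pow_left₀ (norm_nonneg _) (hC t ht) 2)

end IsWeakSol

/-! ### Decay of weak solutions in the full weight -/

/-- The weight of the norm `‖·‖_{u'}`. -/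
def fullWeight (u : ℝ → ℝ) (y : ℝ) : ℝ := 1 + deriv u y ^ 2

theorem IsShear.continuous_fullWeight {U : ℝ} {u : ℝ → ℝ} (hu : IsShear U u) :
    Continuous (fullWeight u) := by
  have := hu.continuous_deriv
  unfold fullWeight
  fun_prop

theorem fullWeight_nonneg (u : ℝ → ℝ) (y : ℝ) : 0 ≤ fullWeight u y := by
  unfold fullWeight; positivity

theorem one_le_fullWeight (u : ℝ → ℝ) (y : ℝ) : 1 ≤ fullWeight u y := by
  unfold fullWeight
  nlinarith [sq_nonneg (deriv u y)]

/-- Fatou's lemma over the saturated weights, each of which is admissible in the decay theorem. -/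
theorem wInt_fullWeight_le {U : ℝ} {u : ℝ → ℝ} (hu : IsShear U u) (hU : 1 ≤ U) {w : ℝ → ℂ}
    (hw : AEStronglyMeasurable w) {c : ℝ≥0∞} (h : ∀ n : ℕ, wInt (slopeWeight u (n + 1)) w ≤ c) :
    wInt (fullWeight u) w ≤ c := by
  have m : ∀ n : ℕ, AEMeasurable fun y => ENNReal.ofReal (slopeWeight u (n + 1) y * ‖w y‖ ^ 2) :=
    fun n => ((isWeight_slopeWeight hu hU (n := (n : ℝ) + 1)
      (by positivity)).continuous.aemeasurable.mul (hw.norm.aemeasurable.pow_const 2)).ennreal_ofReal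
  calc wInt (fullWeight u) w
      = ∫⁻ y, liminf (fun n : ℕ => ENNReal.ofReal (slopeWeight u (n + 1) y * ‖w y‖ ^ 2)) atTop := by
        refine lintegral_congr fun y => ?_
        refine (Tendsto.liminf_eq ?_).symm
        exact (ENNReal.continuous_ofReal.tendsto _).comp ((tendsto_slopeWeight u y).mul_const _)
    _ ≤ liminf (fun n : ℕ => wInt (slopeWeight u (n + 1)) w) atTop := lintegral_liminf_le' m
    _ ≤ c := liminf_le_of_frequently_le' (Frequently.of_forall h)

theorem exists_timeKernel_seq : ∃ η : ℕ → ℝ → ℝ, ∀ k : ℕ, IsTimeKernel (1 / ((k : ℝ) + 1)) (η k) := by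
  choose η hη using fun k : ℕ => exists_timeKernel (δ := 1 / ((k : ℝ) + 1)) (by positivity)
  exact ⟨η, hη⟩

namespace IsWeakSol

variable {ν U : ℝ} {u : ℝ → ℝ} {h : ℝ → L2}

theorem tendsto_mollify (hh : IsWeakSol ν u h) {η : ℕ → ℝ → ℝ}
    (hη : ∀ k : ℕ, IsTimeKernel (1 / ((k : ℝ) + 1)) (η k)) {t : ℝ} (ht : 0 ≤ t) :
    Tendsto (fun k => mollify (η k) h 0 t) atTop (𝓝 (h t)) := by
  rw [tendsto_iff_norm_sub_tendsto_zero, Metric.tendsto_atTop]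
  intro ε hε
  obtain ⟨δ₀, hδ₀, H⟩ := hh.exists_mollify_close ht (half_pos hε)
  obtain ⟨N, hN⟩ := exists_nat_one_div_lt hδ₀
  refine ⟨N, fun k hk => ?_⟩
  rw [Real.dist_eq, sub_zero, abs_of_nonneg (norm_nonneg _)]
  refine lt_of_le_of_lt (H _ _ (by positivity) ?_ (hη k)) (half_lt_self hε)
  refine le_trans ?_ hN.le
  have : (N : ℝ) ≤ k := by exact_mod_cast hk
  gcongr

/-- The classical decay is applied to an average close to `h` in `L²` at times 0 and `t`, with a
saturated weight so that closeness in `L²` suffices. The 8 is the product of three factors 2: two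
passages between `h` and its average, and the doubling inside a window. -/
theorem decay_weight (hh : IsWeakSol ν u h) (hu : IsShear U u) (hU : 1 ≤ U) (hν : 0 < ν)
    {T : ℝ} (hT : 0 < T) (hT1 : 655360 * U ^ 2 ≤ ν * T ^ 3) (hT2 : 20000000 * U ^ 4 * ν * T ≤ 1)
    {X : ℝ} (hX0 : 0 ≤ X) (hX : wInt (fullWeight u) (h 0) ≤ ENNReal.ofReal X) (n : ℕ) {t : ℝ}
    (ht : t ∈ Icc (n * T) ((n + 1) * T)) :
    wInt (fullWeight u) (h t) ≤ ENNReal.ofReal (8 * X / 256 ^ n) := by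
  have ht0 : 0 ≤ t := le_trans (by positivity) ht.1
  refine wInt_fullWeight_le hu hU (Lp.aestronglyMeasurable _) fun N => ?_
  have hK : (0 : ℝ) < N + 1 := by positivity
  have hp := isWeight_slopeWeight hu hU hK
  have hp0 := fun y => (hp.pos y).le
  have hpK := slopeWeight_le (u := u) hK
  have hX' : wInt (slopeWeight u (N + 1)) (h 0) ≤ ENNReal.ofReal X :=
    (wInt_mono_weight (slopeWeight_le' hK) _).trans hX
  refine ENNReal.le_of_forall_pos_le_add fun ζ hζ _ => ?_
  have hζ' : (0 : ℝ) < ζ := by exact_mod_cast hζ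
  -- Chosen so that an `L²` error `ε` contributes at most `ζ/5` in the weight, which is bounded by
  -- `N + 1`.
  set ε := √(ζ / (10 * ((N : ℝ) + 1))) with hε
  have hε0 : 0 < ε := Real.sqrt_pos.2 (by positivity)
  have hε2 : ε ^ 2 = ζ / (10 * ((N : ℝ) + 1)) := Real.sq_sqrt (by positivity)
  obtain ⟨δ₁, hδ₁, H₁⟩ := hh.exists_mollify_close ht0 hε0
  obtain ⟨δ₂, hδ₂, H₂⟩ := hh.exists_mollify_close le_rfl hε0
  obtain ⟨η, hη⟩ := exists_timeKernel (lt_min hδ₁ hδ₂)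
  have hδ : 0 < min δ₁ δ₂ := lt_min hδ₁ hδ₂
  have b₁ := H₁ _ η hδ (min_le_left _ _) hη
  have b₂ := H₂ _ η hδ (min_le_right _ _) hη
  have hF := hh.classicalSol hη hδ hu.continuous hν.ne'
  have sq : ∀ {a : ℝ}, 0 ≤ a → a ≤ ε → 2 * ((N : ℝ) + 1) * a ^ 2 ≤ ζ / 5 := fun {a} h0 ha => by
    have h1 : a ^ 2 ≤ ε ^ 2 := pow_le_pow_left₀ h0 ha 2
    have h2 : 2 * ((N : ℝ) + 1) * ε ^ 2 = ζ / 5 := by rw [hε2]; field_simp; norm_num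
    rw [← h2]
    gcongr
  have i0 : wInt (slopeWeight u (N + 1)) (smoothRep ν u η h 0 0) ≤
      ENNReal.ofReal (2 * X + ζ / 5) := by
    rw [← wInt_congr (hh.smoothRep_ae hη hδ hu.continuous hν.ne' 0 le_rfl)]
    refine (wInt_Lp_le hp0 hp.continuous hK.le hpK _ (h 0)).trans ?_
    rw [ENNReal.ofReal_add (by positivity) (by positivity), ENNReal.ofReal_mul two_pos.le,
      ENNReal.ofReal_ofNat]
    exact add_le_add (mul_le_mul_right hX' _) (ENNReal.ofReal_le_ofReal (sq (norm_nonneg _) b₂))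
  have i1 := (hF.decay hu hU hν hT hT1 hT2 hp hK.le hpK (by positivity) i0 n).2 t ht
  rw [← wInt_congr (hh.smoothRep_ae hη hδ hu.continuous hν.ne' 0 ht0)] at i1
  refine (wInt_Lp_le hp0 hp.continuous hK.le hpK (h t) (mollify η h 0 t)).trans ?_
  rw [norm_sub_rev]
  refine (add_le_add (mul_le_mul_right i1 2)
    (ENNReal.ofReal_le_ofReal (sq (norm_nonneg _) b₁))).trans ?_
  rw [show (2 : ℝ≥0∞) = ENNReal.ofReal 2 by simp, ← ENNReal.ofReal_mul two_pos.le,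
    ← ENNReal.ofReal_add (by positivity) (by positivity), ← ENNReal.ofReal_coe_nnreal,
    ← ENNReal.ofReal_add (by positivity) (by positivity)]
  refine ENNReal.ofReal_le_ofReal ?_
  have h256 : (1 : ℝ) ≤ 256 ^ n := one_le_pow₀ (by norm_num)
  have h3 : (ζ : ℝ) / 256 ^ n ≤ ζ := div_le_self hζ'.le h256
  have h4 : 2 * (2 * ((2 * X + ζ / 5) / 256 ^ n)) = 8 * X / 256 ^ n + 4 / 5 * (ζ / 256 ^ n) := by
    ring
  rw [h4]
  linarith

end IsWeakSol

/-! ### Difference quotients -/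

/-- The difference quotient. -/
def diffQuot (τ : ℝ) (f : ℝ → ℂ) (y : ℝ) : ℂ := (f (y + τ) - f y) / τ

theorem ae_eq_diffQuot {f g : ℝ → ℂ} (hfg : f =ᵐ[volume] g) (τ : ℝ) :
    diffQuot τ f =ᵐ[volume] diffQuot τ g := by
  have h1 := (measurePreserving_add_right (volume : Measure ℝ) τ).quasiMeasurePreserving.ae_eq_comp
    hfg
  filter_upwards [hfg, h1] with y h2 h3
  simp only [Function.comp_apply] at h3
  rw [diffQuot, diffQuot, h2, h3]

theorem exists_diffQuot (τ : ℝ) : ∃ D : L2 →L[ℝ] L2, ∀ w : L2, D w =ᵐ[volume] diffQuot τ w := by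
  let S : L2 →L[ℝ] L2 := (Lp.compMeasurePreservingₗᵢ ℝ (fun y : ℝ => y + τ)
    (measurePreserving_add_right (volume : Measure ℝ) τ)).toContinuousLinearMap
  refine ⟨τ⁻¹ • (S - ContinuousLinearMap.id ℝ L2), fun w => ?_⟩
  have h1 : S w =ᵐ[volume] (w : ℝ → ℂ) ∘ fun y => y + τ :=
    Lp.coeFn_compMeasurePreserving w (measurePreserving_add_right (volume : Measure ℝ) τ)
  have e : (τ⁻¹ • (S - ContinuousLinearMap.id ℝ L2)) w = τ⁻¹ • (S w - w) := rfl
  rw [e]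
  filter_upwards [Lp.coeFn_smul τ⁻¹ (S w - w), Lp.coeFn_sub (S w) w, h1] with y h2 h3 h4
  rw [h2, Pi.smul_apply, h3, Pi.sub_apply, h4, diffQuot, Complex.real_smul, Function.comp_apply]
  push_cast
  ring

/-- `log u'` is Lipschitz with constant `U`, because `|u''|/u' ≤ U`. -/
theorem IsShear.deriv_le_exp_mul {U : ℝ} {u : ℝ → ℝ} (hu : IsShear U u) (hU : 1 ≤ U) (x z : ℝ) :
    deriv u z ≤ exp (U * |z - x|) * deriv u x := by
  have hx := hu.deriv_pos hU x
  have hz := hu.deriv_pos hU z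
  have h1 : ∀ y, HasDerivAt (fun y => Real.log (deriv u y)) (iteratedDeriv 2 u y / deriv u y) y :=
    fun y => (hu.hasDerivAt_deriv y).log (hu.deriv_pos hU y).ne'
  have h2 := convex_univ.norm_image_sub_le_of_norm_hasDerivWithin_le (C := U)
    (fun y _ => (h1 y).hasDerivWithinAt) (fun y _ => by
      rw [norm_div, Real.norm_eq_abs, Real.norm_of_nonneg (hu.deriv_pos hU y).le,
        div_le_iff₀ (hu.deriv_pos hU y)]
      exact hu.abs_deriv2_le hU y) (mem_univ x) (mem_univ z)
  rw [Real.norm_eq_abs, Real.norm_eq_abs] at h2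
  have h3 := (le_abs_self _).trans h2
  rw [← Real.log_div hz.ne' hx.ne', Real.log_le_iff_le_exp (by positivity), div_le_iff₀ hx] at h3
  exact h3

/-- On an interval of length at most `1/U` the slope varies by a factor at most `e < 3`. The slope
is taken at `y + τ`, the point where the solution is evaluated in the commutator. -/
theorem IsShear.abs_diff_le {U : ℝ} {u : ℝ → ℝ} (hu : IsShear U u) (hU : 1 ≤ U) {τ : ℝ}
    (hτ : 0 < τ) (hτU : U * τ ≤ 1) (y : ℝ) :
    |u (y + τ) - u y| ≤ 3 * deriv u (y + τ) * τ := by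
  have := (convex_Icc y (y + τ)).norm_image_sub_le_of_norm_hasDerivWithin_le
    (C := 3 * deriv u (y + τ)) (fun z _ => (hu.hasDerivAt z).hasDerivWithinAt) (fun z hz => by
      rw [Real.norm_of_nonneg (hu.deriv_pos hU z).le]
      refine (hu.deriv_le_exp_mul hU (y + τ) z).trans ?_
      refine mul_le_mul_of_nonneg_right ?_ (hu.deriv_pos hU _).le
      refine le_trans (Real.exp_le_exp.2 ?_) Real.exp_one_lt_three.le
      rw [abs_of_nonpos (by linarith [hz.2])]
      refine le_trans ?_ hτU
      gcongr
      linarith [hz.1]) (left_mem_Icc.2 (by linarith)) (right_mem_Icc.2 (by linarith))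
  rwa [add_sub_cancel_left, Real.norm_eq_abs, Real.norm_of_nonneg hτ.le] at this

theorem wInt_one_shift (f : ℝ → ℂ) (τ : ℝ) :
    wInt (fun _ => 1) (fun y => f (y + τ)) = wInt (fun _ => 1) f :=
  lintegral_add_right_eq_self (fun y => ENNReal.ofReal (1 * ‖f y‖ ^ 2)) τ

namespace ClassicalSol

variable {ν U : ℝ} {u : ℝ → ℝ} {F Fy : ℕ → ℝ → ℝ → ℂ}

/-- The quotient of `u F` is `u` times the quotient of `F` plus `(u(y+τ) - u(y))/τ · F(y+τ)`, and
this commutator is bounded by `3u'|F|` at `y + τ`, uniformly in `τ`. It is a source without `ν`;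
Young's inequality gives `4b · 9 = 36b`, and the time integral one more factor `b`. -/
theorem energy_diffQuot (hF : ClassicalSol ν u F Fy) (hu : IsShear U u) (hU : 1 ≤ U) (hν : 0 < ν)
    {b τ : ℝ} (hb : 0 < b) (hsmall : 56 * U ^ 2 * ν * b ≤ 1) (hτ : 0 < τ) (hτU : U * τ ≤ 1)
    {x : ℝ≥0∞} (hx : ∀ t ∈ Icc 0 b, wInt (fullWeight u) (F 0 t) ≤ x) :
    ∀ t ∈ Icc 0 b, wInt (fun _ => 1) (diffQuot τ (F 0 t)) ≤
      2 * (wInt (fun _ => 1) (diffQuot τ (F 0 0)) + ENNReal.ofReal (36 * b ^ 2) * x) := by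
  have hs := Icc_subset (b := b) (le_refl (0 : ℝ))
  have hν' : (ν : ℂ) ≠ 0 := by exact_mod_cast hν.ne'
  have hτ' : (τ : ℂ) ≠ 0 := by exact_mod_cast hτ.ne'
  have csh : ∀ {w : ℝ → ℝ → ℂ}, ContinuousOn (Function.uncurry w) (Ici 0 ×ˢ univ) →
      ContinuousOn (Function.uncurry fun t y => w t (y + τ)) (Icc 0 b ×ˢ univ) := fun hw =>
    (hw.mono hs).comp (f := fun q : ℝ × ℝ => (q.1, q.2 + τ)) (by fun_prop)
      fun q hq => ⟨hq.1, mem_univ _⟩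
  have cdq : ∀ {w : ℝ → ℝ → ℂ}, ContinuousOn (Function.uncurry w) (Ici 0 ×ˢ univ) →
      ContinuousOn (Function.uncurry fun t => diffQuot τ (w t)) (Icc 0 b ×ˢ univ) := fun hw =>
    ((csh hw).sub (hw.mono hs)).div_const _
  have cu := hu.continuous
  set E0 : ℝ → ℝ → ℂ := fun t y => -Complex.I * (((u (y + τ) - u y) / τ : ℝ) : ℂ) * F 0 t (y + τ)
    with hE0
  have cE0 : ContinuousOn (Function.uncurry E0) (Icc 0 b ×ˢ univ) :=
    (continuousOn_const.mul (continuousOn_snd_ofReal (fun y => (u (y + τ) - u y) / τ)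
      (by fun_prop) _)).mul (csh (hF.continuous 0))
  have cS : ContinuousOn (Function.uncurry fun t y => 4 * b * ‖E0 t y‖ ^ 2) (Icc 0 b ×ˢ univ) :=
    continuousOn_mul_norm_sq (k := fun _ => 4 * b) continuous_const cE0
  have hE0le : ∀ t y, ‖E0 t y‖ ^ 2 ≤ 9 * (fullWeight u (y + τ) * ‖F 0 t (y + τ)‖ ^ 2) := by
    intro t y
    have h1 : ‖E0 t y‖ ≤ 3 * deriv u (y + τ) * ‖F 0 t (y + τ)‖ := by
      rw [hE0]
      simp only
      rw [norm_mul, norm_mul, norm_neg, Complex.norm_I, one_mul, Complex.norm_real, norm_div,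
        Real.norm_eq_abs, Real.norm_of_nonneg hτ.le]
      gcongr
      rw [div_le_iff₀ hτ]
      exact hu.abs_diff_le hU hτ hτU y
    have h2 := pow_le_pow_left₀ (norm_nonneg _) h1 2
    refine h2.trans ?_
    rw [fullWeight]
    nlinarith [sq_nonneg ‖F 0 t (y + τ)‖]
  have dyτ : ∀ {f f' : ℝ → ℂ}, (∀ y, HasDerivAt f (f' y) y) → ∀ y,
      HasDerivAt (diffQuot τ f) (diffQuot τ f' y) y := fun {f f'} hf y =>
    (((hf (y + τ)).comp_add_const y τ).sub (hf y)).div_const _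
  -- For fixed `τ` the quotient is bounded by the energy of `F` over `τ²`; the bound blows up as `τ
  -- → 0`, but only finiteness is needed.
  have hfin : ∫⁻ t in Icc 0 b, wInt (fun _ => 1) (diffQuot τ (F 0 t)) ≠ ⊤ := by
    obtain ⟨M, hM⟩ := hF.bounded b
    refine ne_top_of_le_ne_top ?_ (setLIntegral_mono' (g := fun _ =>
      ENNReal.ofReal (2 / τ ^ 2) * ENNReal.ofReal M + ENNReal.ofReal (2 / τ ^ 2) * ENNReal.ofReal M)
      measurableSet_Icc fun t ht => ?_)
    · rw [setLIntegral_const, Real.volume_Icc]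
      exact ENNReal.mul_ne_top (ENNReal.add_ne_top.2
        ⟨ENNReal.mul_ne_top ENNReal.ofReal_ne_top ENNReal.ofReal_ne_top,
        ENNReal.mul_ne_top ENNReal.ofReal_ne_top ENNReal.ofReal_ne_top⟩) ENNReal.ofReal_ne_top
    · have hc := hF.continuous_slice 0 ht.1
      have h1 := wInt_le_add (p := fun _ => 1) (fun _ => zero_le_one) continuous_const
        (A := 2 / τ ^ 2) (B := 2 / τ ^ 2) (by positivity) (by positivity)
        (w := diffQuot τ (F 0 t)) (w₁ := fun y => F 0 t (y + τ)) (w₂ := F 0 t) (by fun_prop)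
        fun y => by
          rw [diffQuot, norm_div, Complex.norm_real, Real.norm_of_nonneg hτ.le, div_pow,
            div_le_iff₀ (by positivity)]
          have h2 := pow_le_pow_left₀ (norm_nonneg _) (norm_sub_le (F 0 t (y + τ)) (F 0 t y)) 2
          have h3 : (2 / τ ^ 2 * ‖F 0 t (y + τ)‖ ^ 2 + 2 / τ ^ 2 * ‖F 0 t y‖ ^ 2) * τ ^ 2 =
              2 * ‖F 0 t (y + τ)‖ ^ 2 + 2 * ‖F 0 t y‖ ^ 2 := by field_simp
          rw [h3]
          nlinarith [sq_nonneg (‖F 0 t (y + τ)‖ - ‖F 0 t y‖)]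
      rw [wInt_one_shift] at h1
      exact h1.trans (add_le_add (mul_le_mul_right (hM t ht) _) (mul_le_mul_right (hM t ht) _))
  have key := (energy_estimate (a := 0) (u := u) (w := fun t => diffQuot τ (F 0 t))
    (wt := fun t => diffQuot τ (F 1 t)) (wy := fun t => diffQuot τ (Fy 0 t)) (E := fun _ _ => 0)
    (Z := fun t => diffQuot τ (yy ν u F 0 t)) (E0 := E0) (S := fun t y => 4 * b * ‖E0 t y‖ ^ 2)
    hU hν.le hb (IsWeight.one hU) (cdq (hF.continuous 0)) (cdq (hF.continuous 1))
    (cdq (hF.continuous_y 0)) (fun _ _ => continuous_const)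
    (fun t ht => slice_continuous cE0 ht)
    (fun t ht => slice_continuous (cdq (hF.continuous_yy hu 0)) ht)
    cS
    (fun t ht y => dyτ (hF.deriv_y 0 t ht.1) y)
    (fun t ht y => by
      simp only [add_zero]
      exact dyτ (f := Fy 0 t) (f' := yy ν u F 0 t) (hF.deriv_yy 0 t ht.1) y)
    (fun t ht y => (((hF.deriv_t 0 t ht.1 (y + τ)).sub (hF.deriv_t 0 t ht.1 y)).div_const _))
    (fun t ht y => by
      simp only [diffQuot, yy, hE0]
      push_cast
      field_simp
      ring)
    (fun t y => by positivity)
    (fun t ht y => by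
      rw [norm_zero, sub_zero]
      set e := ‖E0 t y‖ with he
      set w := ‖diffQuot τ (F 0 t) y‖ with hw
      have h1 : 14 * U ^ 2 * ν * w ^ 2 ≤ w ^ 2 / (4 * b) := by
        rw [le_div_iff₀ (by positivity)]
        nlinarith [sq_nonneg w]
      have h2 : 2 * e * w ≤ w ^ 2 / (4 * b) + 4 * b * e ^ 2 := by
        have h3 : 0 ≤ (w / (2 * b) - 2 * e) ^ 2 * b := by positivity
        have h4 : (w / (2 * b) - 2 * e) ^ 2 * b = w ^ 2 / (4 * b) + 4 * b * e ^ 2 - 2 * e * w := by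
          field_simp; ring
        linarith
      have h5 : w ^ 2 / (2 * b) = w ^ 2 / (4 * b) + w ^ 2 / (4 * b) := by field_simp; ring
      rw [h5, zero_pow two_ne_zero, add_zero]
      linarith) hfin).1
  refine fun t ht => (key t ht).trans ?_
  gcongr
  calc ∫⁻ t in Icc 0 b, ∫⁻ y, ENNReal.ofReal (1 * (4 * b * ‖E0 t y‖ ^ 2))
      ≤ ∫⁻ _ in Icc 0 b, ENNReal.ofReal (36 * b) * x := by
        refine setLIntegral_mono' measurableSet_Icc fun t ht => ?_
        refine le_trans ?_ (mul_le_mul_right (hx t ht) _)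
        have h1 : wInt (fullWeight u) (F 0 t) =
            ∫⁻ y, ENNReal.ofReal (fullWeight u (y + τ) * ‖F 0 t (y + τ)‖ ^ 2) :=
          (lintegral_add_right_eq_self
            (fun y => ENNReal.ofReal (fullWeight u y * ‖F 0 t y‖ ^ 2)) τ).symm
        rw [h1, ← lintegral_const_mul' _ _ ENNReal.ofReal_ne_top]
        refine lintegral_mono fun y => ?_
        rw [← ENNReal.ofReal_mul (by positivity)]
        refine ENNReal.ofReal_le_ofReal ?_
        have := mul_le_mul_of_nonneg_left (hE0le t y) (by positivity : 0 ≤ 4 * b)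
        linarith
    _ = _ := by
        rw [setLIntegral_const, Real.volume_Icc, sub_zero, mul_right_comm,
          ← ENNReal.ofReal_mul (by positivity)]
        congr 2
        ring

end ClassicalSol

/-! ### Increments and weak derivatives -/

theorem sq_lintegral_le {α : Type*} [MeasurableSpace α] (μ : Measure α) {f : α → ℝ≥0∞}
    (hf : AEMeasurable f μ) : (∫⁻ a, f a ∂μ) ^ 2 ≤ μ univ * ∫⁻ a, f a ^ 2 ∂μ := by
  have h := ENNReal.lintegral_mul_le_Lp_mul_Lq μ Real.HolderConjugate.two_two hf
    (aemeasurable_const (b := (1 : ℝ≥0∞)))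
  simp only [Pi.mul_apply, mul_one, lintegral_const, ENNReal.rpow_ofNat] at h
  refine (pow_le_pow_left₀ zero_le h 2).trans (le_of_eq ?_)
  rw [mul_pow, ← ENNReal.rpow_natCast, ← ENNReal.rpow_natCast, ← ENNReal.rpow_mul,
    ← ENNReal.rpow_mul]
  norm_num
  rw [mul_comm]

/-- Tonelli's theorem: each point lies in windows whose left ends fill an interval of length `τ`. -/
theorem lintegral_window {G : ℝ → ℝ≥0∞} (hG : Measurable G) (τ : ℝ) :
    ∫⁻ y, ∫⁻ z in Ioc y (y + τ), G z = ENNReal.ofReal τ * ∫⁻ z, G z := by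
  have h1 : ∀ y, ∫⁻ z in Ioc y (y + τ), G z = ∫⁻ s in Ioc 0 τ, G (y + s) := fun y => by
    rw [← lintegral_indicator measurableSet_Ioc, ← lintegral_indicator measurableSet_Ioc,
      ← lintegral_add_left_eq_self _ y]
    refine lintegral_congr fun s => ?_
    simp only [indicator, mem_Ioc]
    congr 1
    simp only [lt_add_iff_pos_right, add_le_add_iff_left]
  simp_rw [h1]
  have m : Measurable (Function.uncurry fun y s : ℝ => G (y + s)) :=
    hG.comp (measurable_fst.add measurable_snd)
  rw [lintegral_lintegral_swap m.aemeasurable]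
  simp_rw [lintegral_add_right_eq_self G]
  rw [setLIntegral_const, Real.volume_Ioc, sub_zero, mul_comm]

theorem continuous_window {g : ℝ → ℂ} (hg : LocallyIntegrable g) {τ : ℝ} (hτ : 0 ≤ τ) :
    Continuous fun y => ∫ z in Ioc y (y + τ), g z := by
  have ii : ∀ a b, IntervalIntegrable g volume a b := fun a b =>
    (hg.integrableOn_isCompact isCompact_uIcc).intervalIntegrable
  have c := intervalIntegral.continuous_primitive ii 0
  have e : (fun y => ∫ z in Ioc y (y + τ), g z) =
      fun y => (∫ z in (0 : ℝ)..(y + τ), g z) - ∫ z in (0 : ℝ)..y, g z := by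
    funext y
    rw [intervalIntegral.integral_interval_sub_left (ii _ _) (ii _ _),
      intervalIntegral.integral_of_le (by linarith)]
  rw [e]
  exact (c.comp (by fun_prop : Continuous fun y : ℝ => y + τ)).sub c

/-- The increments of a function are the integrals of its weak derivative. -/
theorem increment_ae {w g : ℝ → ℂ} (hw : LocallyIntegrable w) (hg : LocallyIntegrable g)
    (h : ∀ ψ : ℝ → ℝ, ContDiff ℝ ∞ ψ → HasCompactSupport ψ →
      ∫ y, w y * deriv ψ y = -∫ y, g y * ψ y) {τ : ℝ} (hτ : 0 < τ) :
    ∀ᵐ y, w (y + τ) - w y = ∫ z in Ioc y (y + τ), g z := by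
  set K : ℝ → ℝ := (Ioc 0 τ).indicator fun _ => 1 with hK
  have iK : Integrable K := (integrable_indicator_iff measurableSet_Ioc).2
    (integrableOn_const (by simp))
  have sK : HasCompactSupport K := HasCompactSupport.of_support_subset_isCompact isCompact_Icc
    (fun x hx => by
      by_contra hx'
      exact hx (indicator_of_notMem (fun h => hx' (Ioc_subset_Icc_self h)) _))
  have K0 : ∀ x, x ∉ Icc (0 : ℝ) τ → K x = 0 := fun x hx =>
    indicator_of_notMem (fun h => hx (Ioc_subset_Icc_self h)) _
  have e : ∀ y, ∫ z in Ioc y (y + τ), g z = ∫ z, g z * K (z - y) := fun y => by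
    rw [← integral_indicator measurableSet_Ioc]
    refine integral_congr_ae (Eventually.of_forall fun z => ?_)
    simp only [hK, indicator, mem_Ioc, sub_pos, tsub_le_iff_left]
    split_ifs <;> simp
  have e2 : ∀ (ψ : ℝ → ℝ) (z : ℝ), ∫ y, K (z - y) * ψ y = ∫ y in (z - τ)..z, ψ y := fun ψ z => by
    rw [intervalIntegral.integral_of_le (by linarith), ← integral_Ico_eq_integral_Ioc,
      ← integral_indicator measurableSet_Ico]
    refine integral_congr_ae (Eventually.of_forall fun y => ?_)
    simp only [hK, indicator, mem_Ioc, mem_Ico, sub_pos, tsub_le_iff_left]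
    have : (y < z ∧ z ≤ y + τ) ↔ (z ≤ τ + y ∧ y < z) := by rw [add_comm τ, and_comm]
    simp only [this]
    split_ifs <;> simp
  have cW := continuous_window hg hτ.le
  have ws : LocallyIntegrable fun y => w (y + τ) := by
    rw [locallyIntegrable_iff]
    intro k hk
    have hk' : IsCompact ((fun y => y + τ) '' k) := hk.image (by fun_prop)
    have := ((measurePreserving_add_right (volume : Measure ℝ) τ).integrableOn_image
      (measurableEmbedding_addRight τ)).1 (hw.integrableOn_isCompact hk')
    exact this
  refine ae_eq_of_integral_contDiff_smul_eq (ws.sub hw) cW.locallyIntegrable fun ψ hψ sψ => ?_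
  obtain ⟨a1, a2, a3⟩ := average_test iK sK hψ sψ
  have loc : ∀ {f : ℝ → ℂ} {θ : ℝ → ℝ}, LocallyIntegrable f → Continuous θ → HasCompactSupport θ →
      Integrable fun z => f z * θ z := fun {f θ} hf hθ sθ => by
    have := hf.integrable_smul_right_of_hasCompactSupport
      (Complex.continuous_ofReal.comp hθ) (sθ.comp_left Complex.ofReal_zero)
    exact this
  have cψ := hψ.continuous
  -- Averaging with the indicator of `(0, τ]` and then differentiating gives a difference of
  -- translates; tested on `w`, this is the increment of `w`.
  have dψ : ∀ z, deriv (fun z => ∫ y, K (z - y) * ψ y) z = ψ z - ψ (z - τ) := fun z => by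
    rw [a3]
    simp only
    rw [e2]
    refine intervalIntegral.integral_deriv_eq_sub
      (fun x _ => (hψ.differentiable (by simp)) x)
      ((hψ.continuous_deriv (by exact_mod_cast le_top)).intervalIntegrable _ _)
  have k1 := h _ a1 a2
  simp only [dψ] at k1
  have sψ' : HasCompactSupport fun z => ψ (z - τ) := by
    have := sψ.comp_homeomorph (Homeomorph.addRight (-τ))
    exact this
  have i1 := loc hw cψ sψ
  have i2 := loc (θ := fun z => ψ (z - τ)) hw (by fun_prop) sψ'
  have i3 : Integrable fun y => w (y + τ) * ψ y := loc ws cψ sψ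
  have e4 : ∫ y, w (y + τ) * ψ y = ∫ z, w z * ψ (z - τ) := by
    rw [← integral_add_right_eq_self (fun z => w z * ψ (z - τ)) τ]
    simp only [add_sub_cancel_right]
  calc ∫ y, ψ y • (w (y + τ) - w y) = (∫ y, w (y + τ) * ψ y) - ∫ y, w y * ψ y := by
        rw [← integral_sub i3 i1]
        refine integral_congr_ae (Eventually.of_forall fun y => ?_)
        simp only [Complex.real_smul]; ring
    _ = -∫ z, w z * ((ψ z - ψ (z - τ) : ℝ) : ℂ) := by
        rw [e4, ← neg_sub, ← integral_sub i1 i2]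
        congr 1
        refine integral_congr_ae (Eventually.of_forall fun y => ?_)
        simp only; push_cast; ring
    _ = ∫ z, g z * (∫ y, K (z - y) * ψ y : ℝ) := by rw [k1, neg_neg]
    _ = ∫ y, (∫ z, g z * K (z - y)) * ψ y := (integral_kernel_swap hg iK K0 cψ sψ).symm
    _ = ∫ y, ψ y • ∫ z in Ioc y (y + τ), g z := by
        refine integral_congr_ae (Eventually.of_forall fun y => ?_)
        simp only [Complex.real_smul, e]; ring

/-- The quotient is the mean of the weak derivative over `(y, y + τ]`; Cauchy–Schwarz and
`lintegral_window` give the bound uniformly in `τ`. -/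
theorem wInt_diffQuot_le {w g : ℝ → ℂ} (hw : LocallyIntegrable w) (hg : LocallyIntegrable g)
    (h : ∀ ψ : ℝ → ℝ, ContDiff ℝ ∞ ψ → HasCompactSupport ψ →
      ∫ y, w y * deriv ψ y = -∫ y, g y * ψ y) {τ : ℝ} (hτ : 0 < τ) :
    wInt (fun _ => 1) (diffQuot τ w) ≤ wInt (fun _ => 1) g := by
  obtain ⟨g', mg', hg'⟩ := hg.aestronglyMeasurable
  have hG : Measurable fun z => ‖g' z‖ₑ := mg'.enorm
  have e1 : ∀ f : ℝ → ℂ, wInt (fun _ => 1) f = ∫⁻ y, ‖f y‖ₑ ^ 2 := fun f =>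
    lintegral_congr fun y => by
      rw [one_mul, ENNReal.ofReal_pow (norm_nonneg _), ofReal_norm]
  rw [wInt_congr hg', e1, e1]
  calc ∫⁻ y, ‖diffQuot τ w y‖ₑ ^ 2
      ≤ ∫⁻ y, ENNReal.ofReal (1 / τ) * ∫⁻ z in Ioc y (y + τ), ‖g' z‖ₑ ^ 2 := by
        refine lintegral_mono_ae ?_
        filter_upwards [increment_ae hw hg h hτ] with y hy
        have h1 : ‖diffQuot τ w y‖ₑ ≤
            ENNReal.ofReal (1 / τ) * ∫⁻ z in Ioc y (y + τ), ‖g' z‖ₑ := by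
          rw [diffQuot, hy, div_eq_mul_inv, mul_comm, enorm_mul]
          refine mul_le_mul' (le_of_eq ?_) ?_
          · rw [← ofReal_norm, norm_inv, Complex.norm_real, Real.norm_of_nonneg hτ.le, one_div]
          · rw [setIntegral_congr_ae measurableSet_Ioc (hg'.mono fun z hz _ => hz)]
            exact enorm_integral_le_lintegral_enorm _
        refine (pow_le_pow_left₀ zero_le h1 2).trans ?_
        rw [mul_pow, sq (ENNReal.ofReal _), mul_assoc]
        refine mul_le_mul_right ?_ _
        refine (mul_le_mul_right (sq_lintegral_le _ hG.aemeasurable) _).trans ?_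
        rw [Measure.restrict_apply_univ, Real.volume_Ioc, add_sub_cancel_left, ← mul_assoc,
          ← ENNReal.ofReal_mul (by positivity), one_div_mul_cancel hτ.ne', ENNReal.ofReal_one,
          one_mul]
    _ = ∫⁻ z, ‖g' z‖ₑ ^ 2 := by
        rw [lintegral_const_mul' _ _ ENNReal.ofReal_ne_top, lintegral_window (hG.pow_const 2) τ,
          ← mul_assoc, ← ENNReal.ofReal_mul (by positivity), one_div_mul_cancel hτ.ne',
          ENNReal.ofReal_one, one_mul]

theorem wInt_deriv_le {f f' : ℝ → ℂ} (hf : ∀ y, HasDerivAt f (f' y) y) {τ : ℕ → ℝ}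
    (hτ : ∀ n, 0 < τ n) (hτ0 : Tendsto τ atTop (𝓝 0)) {c : ℝ≥0∞}
    (h : ∀ n, wInt (fun _ => 1) (diffQuot (τ n) f) ≤ c) : wInt (fun _ => 1) f' ≤ c := by
  have cf : Continuous f := continuous_iff_continuousAt.2 fun y => (hf y).continuousAt
  have lim : ∀ y, Tendsto (fun n => diffQuot (τ n) f y) atTop (𝓝 (f' y)) := fun y => by
    have h1 := hasDerivAt_iff_tendsto_slope_zero.1 (hf y)
    have h2 : Tendsto τ atTop (𝓝[≠] 0) :=
      tendsto_nhdsWithin_iff.2 ⟨hτ0, Eventually.of_forall fun n => (hτ n).ne'⟩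
    refine (h1.comp h2).congr fun n => ?_
    simp only [Function.comp_apply, diffQuot, Complex.real_smul]
    push_cast
    rw [div_eq_inv_mul]
  have m : ∀ n, AEMeasurable fun y => ENNReal.ofReal (1 * ‖diffQuot (τ n) f y‖ ^ 2) := fun n => by
    have : Continuous (diffQuot (τ n) f) := by unfold diffQuot; fun_prop
    exact (ENNReal.continuous_ofReal.comp (by fun_prop :
      Continuous fun y => 1 * ‖diffQuot (τ n) f y‖ ^ 2)).aemeasurable
  calc wInt (fun _ => 1) f'
      = ∫⁻ y, liminf (fun n => ENNReal.ofReal (1 * ‖diffQuot (τ n) f y‖ ^ 2)) atTop := by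
        refine lintegral_congr fun y => (Tendsto.liminf_eq ?_).symm
        exact (ENNReal.continuous_ofReal.tendsto _).comp (((lim y).norm.pow 2).const_mul _)
    _ ≤ liminf (fun n => wInt (fun _ => 1) (diffQuot (τ n) f)) atTop := lintegral_liminf_le' m
    _ ≤ c := liminf_le_of_frequently_le' (Frequently.of_forall h)

/-! ### Mixing for weak solutions with diffusion -/

namespace IsWeakSol

variable {ν U : ℝ} {u : ℝ → ℝ} {h : ℝ → L2}

theorem weight_bound (hh : IsWeakSol ν u h) (hu : IsShear U u) (hU : 1 ≤ U) (hν : 0 < ν)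
    {T : ℝ} (hT : 0 < T) (hT1 : 655360 * U ^ 2 ≤ ν * T ^ 3) (hT2 : 20000000 * U ^ 4 * ν * T ≤ 1)
    {X : ℝ} (hX0 : 0 ≤ X) (hX : wInt (fullWeight u) (h 0) ≤ ENNReal.ofReal X) {t : ℝ} (ht : 0 ≤ t) :
    wInt (fullWeight u) (h t) ≤ ENNReal.ofReal (8 * X) := by
  refine (hh.decay_weight hu hU hν hT hT1 hT2 hX0 hX ⌊t / T⌋₊ ⟨?_, ?_⟩).trans
    (ENNReal.ofReal_le_ofReal (div_le_self (by positivity) (one_le_pow₀ (by norm_num))))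
  · rw [← le_div_iff₀ hT]; exact Nat.floor_le (by positivity)
  · rw [← div_le_iff₀ hT]; exact (Nat.lt_floor_add_one _).le

/-- For fixed `τ` the quotient is a bounded operator on `L²`, so the classical estimate passes to
the limit of the time averages in norm. The averages satisfy the weighted bound because it defines a
closed convex set. -/
theorem diffQuot_bound (hh : IsWeakSol ν u h) (hu : IsShear U u) (hU : 1 ≤ U) (hν : 0 < ν)
    {X : ℝ} (hX0 : 0 ≤ X)
    (hX : ∀ t, 0 ≤ t → wInt (fullWeight u) (h t) ≤ ENNReal.ofReal X) {b τ : ℝ} (hb : 0 < b)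
    (hsmall : 56 * U ^ 2 * ν * b ≤ 1) (hτ : 0 < τ) (hτU : U * τ ≤ 1) {D : L2 →L[ℝ] L2}
    (hD : ∀ w : L2, D w =ᵐ[volume] diffQuot τ w) {t : ℝ} (ht : t ∈ Icc 0 b) :
    ‖D (h t)‖ ^ 2 ≤ 2 * (‖D (h 0)‖ ^ 2 + 36 * b ^ 2 * X) := by
  obtain ⟨η, hη⟩ := exists_timeKernel_seq
  have lim : ∀ t, 0 ≤ t → Tendsto (fun k => ‖D (mollify (η k) h 0 t)‖ ^ 2) atTop
      (𝓝 (‖D (h t)‖ ^ 2)) := fun t ht =>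
    (((D.continuous.tendsto _).comp (hh.tendsto_mollify hη ht)).norm.pow 2)
  refine le_of_tendsto_of_tendsto' (lim t ht.1)
    (((lim 0 le_rfl).add_const (36 * b ^ 2 * X)).const_mul 2) fun k => ?_
  have hδ : (0 : ℝ) < 1 / ((k : ℝ) + 1) := by positivity
  have hF := hh.classicalSol (hη k) hδ hu.continuous hν.ne'
  have ae := fun t (ht : 0 ≤ t) => hh.smoothRep_ae (hη k) hδ hu.continuous hν.ne' 0 ht
  have key := hF.energy_diffQuot hu hU hν hb hsmall hτ hτU (x := ENNReal.ofReal X)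
    (fun t ht => by
      rw [← wInt_congr (ae t ht.1)]
      exact hh.mollify_mem (hη k) hδ ht.1
        (convex_wInt_le (fullWeight_nonneg u) hu.continuous_fullWeight _)
        (isClosed_wInt_le hu.continuous_fullWeight _) fun s hs => hX s (by linarith [hs.1, ht.1])) t ht
  have e : ∀ t, 0 ≤ t → wInt (fun _ => 1) (diffQuot τ (smoothRep ν u (η k) h 0 t)) =
      ENNReal.ofReal (‖D (mollify (η k) h 0 t)‖ ^ 2) := fun t ht => by
    rw [← wInt_one_Lp, wInt_congr (hD _), wInt_congr (ae_eq_diffQuot (ae t ht) τ)]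
  have e2 : ∀ c : ℝ, (2 : ℝ≥0∞) * ENNReal.ofReal c = ENNReal.ofReal (2 * c) := fun c => by
    rw [ENNReal.ofReal_mul two_pos.le, ENNReal.ofReal_ofNat]
  rw [e t ht.1, e 0 le_rfl, ← ENNReal.ofReal_mul (by positivity),
    ← ENNReal.ofReal_add (by positivity) (by positivity),
    e2, ENNReal.ofReal_le_ofReal_iff (by positivity)] at key
  exact key

/-- Decay of a weak solution tested against a compactly supported function. -/
theorem mixing (hh : IsWeakSol ν u h) (hu : IsShear U u) (hU : 1 ≤ U) {M ρ : ℝ}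
    (hM : M = 1000000000 * U ^ 4) (hρ : 0 < ρ) (hρ1 : 200000000 * U ^ 4 * ρ ≤ 1) (hν : ν = ρ ^ 3)
    {X A : ℝ} (hX0 : 0 ≤ X) (hA0 : 0 ≤ A)
    (hX : wInt (fullWeight u) (h 0) ≤ ENNReal.ofReal X)
    {g : ℝ → ℂ} (hg : LocallyIntegrable g)
    (hgh : ∀ ψ : ℝ → ℝ, ContDiff ℝ ∞ ψ → HasCompactSupport ψ →
      ∫ y, h 0 y * deriv ψ y = -∫ y, g y * ψ y)
    (hA : wInt (fun _ => 1) g ≤ ENNReal.ofReal A) {Y : ℝ} (hY0 : 0 ≤ Y) (hY : 8 * (X + A) ≤ Y ^ 2)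
    {t : ℝ} (ht : 0 ≤ t) {φ φ' : ℝ → ℂ} (hφ : ∀ y, HasDerivAt φ (φ' y) y) (cφ' : Continuous φ')
    (sφ : HasCompactSupport φ) {Φ : ℝ} (hΦ0 : 0 ≤ Φ)
    (hΦ : wInt (fun _ => 1) φ ≤ ENNReal.ofReal (Φ ^ 2))
    (hΦ' : wInt (fun _ => 1) φ' ≤ ENNReal.ofReal (Φ ^ 2)) :
    ‖∫ y, h t y * φ y‖ ≤ 20 * M ^ 2 * (exp (-(1 / M * ρ * t)) / √(1 + t ^ 2)) * (Y * Φ) := by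
  have hU0 : 0 < U := by linarith
  have hU4 : 1 ≤ U ^ 4 := one_le_pow₀ hU
  have hU2 : U ^ 2 ≤ U ^ 4 := pow_le_pow_right₀ hU (by norm_num)
  have hM0 : 0 < M := by rw [hM]; positivity
  have hM1 : 1 ≤ M := by rw [hM]; linarith
  have hν0 : 0 < ν := by rw [hν]; positivity
  obtain ⟨T, hTdef⟩ : ∃ T, T = M / ρ := ⟨_, rfl⟩
  have hT : 0 < T := by rw [hTdef]; positivity
  have hTρ : T * ρ = M := by rw [hTdef]; field_simp
  have hνT : ν * T ^ 3 = M ^ 3 := by rw [hν, ← hTρ]; ring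
  have hM3 : M ≤ M ^ 3 := le_self_pow₀ hM1 (by norm_num)
  have hT1 : 655360 * U ^ 2 ≤ ν * T ^ 3 := by rw [hνT]; linarith
  have hT2 : 20000000 * U ^ 4 * ν * T ≤ 1 := by
    have h1 : 20000000 * U ^ 4 * ν * T = (200000000 * U ^ 4 * ρ) ^ 2 / 2 := by
      rw [hν, show 20000000 * U ^ 4 * ρ ^ 3 * T = 20000000 * U ^ 4 * ρ ^ 2 * (T * ρ) by ring, hTρ,
        hM]
      ring
    have h2 : (200000000 * U ^ 4 * ρ) ^ 2 ≤ 1 := pow_le_one₀ (by positivity) hρ1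
    linarith
  have hρ2 : ρ ≤ 1 := by nlinarith
  have hν1 : ν ≤ 1 := by rw [hν]; exact pow_le_one₀ hρ.le hρ2
  have bd := fun t (ht : 0 ≤ t) => hh.weight_bound hu hU hν0 hT hT1 hT2 hX0 hX ht
  -- A time on which difference quotients can be propagated, uniformly in `ν ≤ 1`; the averaging
  -- kernel must fit in `[0, b]`.
  obtain ⟨b, hbdef⟩ : ∃ b, b = 1 / (56 * U ^ 2) := ⟨_, rfl⟩
  have hb : 0 < b := by rw [hbdef]; positivity
  have hbU : 56 * U ^ 2 * b = 1 := by rw [hbdef]; field_simp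
  have hsmall : 56 * U ^ 2 * ν * b ≤ 1 := by
    rw [mul_right_comm, hbU, one_mul]; exact hν1
  have hb1 : b ≤ 1 / 56 := by
    rw [hbdef]
    refine one_div_le_one_div_of_le (by norm_num) ?_
    nlinarith [one_le_pow₀ hU (n := 2)]
  -- Here `576 = 2 · 36 · 8`, the last factor coming from `weight_bound`; the quotients of `h` on
  -- `[0, b]` then stay below `2A + X`.
  have hb2 : 576 * b ^ 2 ≤ 1 := by nlinarith
  have dq : ∀ (τ : ℝ), 0 < τ → U * τ ≤ 1 → ∀ δ η, 0 < δ → 2 * δ ≤ b → IsTimeKernel δ η →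
      wInt (fun _ => 1) (diffQuot τ (mollify η h 0 0)) ≤ ENNReal.ofReal (2 * A + X) := by
    intro τ hτ hτU δ η hδ hδb hη
    obtain ⟨D, hD⟩ := exists_diffQuot τ
    have d0 : ‖D (h 0)‖ ^ 2 ≤ A := by
      rw [← ENNReal.ofReal_le_ofReal_iff hA0, ← wInt_one_Lp, wInt_congr (hD _)]
      exact (wInt_diffQuot_le (locallyIntegrable_L2 _) hg hgh hτ).trans hA
    -- The preimage of a ball under the quotient operator is closed and convex, so the average
    -- inherits the bound.
    have d1 : mollify η h 0 0 ∈ D ⁻¹' (Metric.closedBall 0 (√(2 * A + X))) := by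
      refine hh.mollify_mem hη hδ le_rfl
        ((convex_closedBall (0 : L2) _).linear_preimage D.toLinearMap)
        (Metric.isClosed_closedBall.preimage D.continuous) fun s hs => ?_
      rw [mem_preimage, mem_closedBall_zero_iff]
      refine Real.le_sqrt_of_sq_le ?_
      have := hh.diffQuot_bound hu hU hν0 (by positivity) bd hb hsmall hτ hτU hD
        (t := s) ⟨by linarith [hs.1], by linarith [hs.2]⟩
      nlinarith
    rw [mem_preimage, mem_closedBall_zero_iff] at d1
    rw [← wInt_congr (hD _), wInt_one_Lp]
    refine ENNReal.ofReal_le_ofReal ?_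
    calc _ ≤ √(2 * A + X) ^ 2 := pow_le_pow_left₀ (norm_nonneg _) d1 2
      _ = _ := Real.sq_sqrt (by positivity)
  obtain ⟨η, hη⟩ := exists_timeKernel_seq
  have cφ : Continuous φ := continuous_iff_continuousAt.2 fun y => (hφ y).continuousAt
  obtain ⟨L, hL⟩ := exists_pairing (memLp_of_continuous cφ sφ)
  have lim : Tendsto (fun k => ‖L (mollify (η k) h 0 t)‖) atTop (𝓝 ‖L (h t)‖) :=
    ((L.continuous.tendsto _).comp (hh.tendsto_mollify hη ht)).norm
  rw [hL] at lim
  obtain ⟨N, hN⟩ := exists_nat_one_div_lt (half_pos hb)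
  refine le_of_tendsto lim (eventually_atTop.2 ⟨N, fun k hk => ?_⟩)
  have hδ : (0 : ℝ) < 1 / ((k : ℝ) + 1) := by positivity
  have hδb : 2 * (1 / ((k : ℝ) + 1)) ≤ b := by
    have : 1 / ((k : ℝ) + 1) ≤ 1 / ((N : ℝ) + 1) := by
      have : (N : ℝ) ≤ k := by exact_mod_cast hk
      gcongr
    linarith
  have hF := hh.classicalSol (hη k) hδ hu.continuous hν0.ne'
  have ae := fun t (ht : 0 ≤ t) => hh.smoothRep_ae (hη k) hδ hu.continuous hν0.ne' 0 ht
  have e : L (mollify (η k) h 0 t) = ∫ y, smoothRep ν u (η k) h 0 t y * φ y := by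
    rw [hL]
    refine integral_congr_ae ?_
    filter_upwards [ae t ht] with y hy
    rw [hy]
  rw [e]
  refine hF.mixing hu hU hM hρ hρ1 hν hY0 ?_ ?_ ht hφ cφ' sφ hΦ0 hΦ hΦ'
  · rw [← wInt_congr (ae 0 le_rfl)]
    refine le_trans (wInt_mono_weight (one_le_fullWeight u) _) ?_
    refine le_trans (hh.mollify_mem (hη k) hδ le_rfl
      (convex_wInt_le (fullWeight_nonneg u) hu.continuous_fullWeight _)
      (isClosed_wInt_le hu.continuous_fullWeight _) fun s hs => bd s (by linarith [hs.1])) ?_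
    exact ENNReal.ofReal_le_ofReal (by linarith)
  -- The average has a classical derivative at time 0; it is bounded by letting `τ = 1/(U(n + 1))`
  -- tend to 0 in `dq`.
  · refine le_trans (wInt_deriv_le (hF.deriv_y 0 0 le_rfl) (τ := fun n : ℕ => 1 / U * (1 / ((n : ℝ) + 1)))
      (fun n => by positivity) ?_ (c := ENNReal.ofReal (2 * A + X)) fun n => ?_)
      (ENNReal.ofReal_le_ofReal (by linarith))
    · simpa using (tendsto_one_div_add_atTop_nhds_zero_nat (𝕜 := ℝ)).const_mul (1 / U)
    · rw [← wInt_congr (ae_eq_diffQuot (ae 0 le_rfl) _)]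
      refine dq _ (by positivity) ?_ _ _ hδ hδb (hη k)
      rw [← mul_assoc, mul_one_div_cancel hU0.ne', one_mul]
      exact (div_le_one (by positivity)).2 (by linarith [Nat.cast_nonneg (α := ℝ) n])

end IsWeakSol

/-! ### Transport without diffusion -/

/-- Multiplication by the transport phase. -/
def phase (u : ℝ → ℝ) (θ : ℝ → ℂ) (t y : ℝ) : ℂ := Complex.exp (Complex.I * ((-(u y * t) : ℝ) : ℂ)) * θ y

theorem norm_phase (u : ℝ → ℝ) (θ : ℝ → ℂ) (t y : ℝ) : ‖phase u θ t y‖ = ‖θ y‖ := by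
  rw [phase, norm_mul, Complex.norm_exp_I_mul_ofReal, one_mul]

theorem continuous_phase {u : ℝ → ℝ} {θ : ℝ → ℂ} (cu : Continuous u) (cθ : Continuous θ) (t : ℝ) :
    Continuous (phase u θ t) := by
  unfold phase; fun_prop

theorem memLp_phase {u : ℝ → ℝ} {θ : ℝ → ℂ} (cu : Continuous u) (cθ : Continuous θ)
    (sθ : HasCompactSupport θ) (t : ℝ) : MemLp (phase u θ t) 2 :=
  memLp_of_continuous (continuous_phase cu cθ t) sθ.mul_left

theorem norm_exp_sub_one_sub_le (a : ℝ) :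
    ‖Complex.exp (Complex.I * a) - 1 - Complex.I * a‖ ≤ 2 * a ^ 2 := by
  have e : ‖Complex.I * (a : ℂ)‖ = |a| := by
    rw [norm_mul, Complex.norm_I, one_mul, Complex.norm_real, Real.norm_eq_abs]
  rcases le_or_gt |a| 1 with h | h
  · refine (Complex.norm_exp_sub_one_sub_id_le (by rwa [e])).trans ?_
    rw [e, sq_abs]
    nlinarith [sq_nonneg a]
  · refine (norm_sub_le _ _).trans ?_
    have h1 := Real.norm_exp_I_mul_ofReal_sub_one_le (x := a)
    rw [Real.norm_eq_abs] at h1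
    rw [e]
    nlinarith [sq_abs a]

/-- Differentiability in `L²`, not only pointwise: the Taylor remainder is bounded by `2u²(s -
t)²|θ|`, and `u²θ` is in `L²` because `θ` has compact support. -/
theorem hasDerivAt_phase {u : ℝ → ℝ} {θ : ℝ → ℂ} (cu : Continuous u) (cθ : Continuous θ)
    (sθ : HasCompactSupport θ) (t : ℝ) :
    HasDerivAt (fun s => (memLp_phase cu cθ sθ s).toLp)
      ((memLp_phase (θ := fun y => -(Complex.I * u y) * θ y) cu (by fun_prop) sθ.mul_left t).toLp) t := by
  have mg : MemLp (fun y => (2 * (u y : ℂ) ^ 2) * θ y) 2 :=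
    memLp_of_continuous (by fun_prop) sθ.mul_left
  rw [hasDerivAt_iff_isLittleO]
  refine Asymptotics.IsBigO.trans_isLittleO (g := fun s => (s - t) ^ 2) ?_ ?_
  · refine Asymptotics.IsBigO.of_bound ‖mg.toLp‖ (Eventually.of_forall fun s => ?_)
    rw [mul_comm, norm_pow, Real.norm_eq_abs, sq_abs]
    refine Lp.norm_le_mul_norm_of_ae_le_mul ?_
    have m0 := fun s => (memLp_phase cu cθ sθ s).coeFn_toLp
    have m1 := (memLp_phase (θ := fun y => -(Complex.I * u y) * θ y) cu (by fun_prop)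
      sθ.mul_left t).coeFn_toLp
    filter_upwards [m0 s, m0 t, m1, mg.coeFn_toLp, Lp.coeFn_sub ((memLp_phase cu cθ sθ s).toLp -
      (memLp_phase cu cθ sθ t).toLp) ((s - t) • (memLp_phase (θ := fun y => -(Complex.I * u y) * θ y)
        cu (by fun_prop) sθ.mul_left t).toLp), Lp.coeFn_sub (memLp_phase cu cθ sθ s).toLp
      (memLp_phase cu cθ sθ t).toLp, Lp.coeFn_smul (s - t) (memLp_phase
        (θ := fun y => -(Complex.I * u y) * θ y) cu (by fun_prop) sθ.mul_left t).toLp]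
      with y h1 h2 h3 h4 h5 h6 h7
    rw [h5, Pi.sub_apply, h6, h7, Pi.sub_apply, Pi.smul_apply, h1, h2, h3, h4]
    have e : phase u θ s y - phase u θ t y - (s - t) • phase u (fun y => -(Complex.I * u y) * θ y) t y
        = Complex.exp (Complex.I * ((-(u y * t) : ℝ) : ℂ)) *
          (Complex.exp (Complex.I * ((-(u y * (s - t)) : ℝ) : ℂ)) - 1
            - Complex.I * ((-(u y * (s - t)) : ℝ) : ℂ)) * θ y := by
      have h8 : Complex.exp (Complex.I * ((-(u y * s) : ℝ) : ℂ)) =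
          Complex.exp (Complex.I * ((-(u y * t) : ℝ) : ℂ)) *
          Complex.exp (Complex.I * ((-(u y * (s - t)) : ℝ) : ℂ)) := by
        rw [← Complex.exp_add]; congr 1; push_cast; ring
      simp only [phase, h8, Complex.real_smul]
      push_cast
      ring
    rw [e, norm_mul, norm_mul, Complex.norm_exp_I_mul_ofReal, one_mul, norm_mul]
    have h9 := norm_exp_sub_one_sub_le (-(u y * (s - t)))
    have h10 : ‖(2 * (u y : ℂ) ^ 2)‖ = 2 * u y ^ 2 := by
      rw [norm_mul, norm_pow, Complex.norm_real, Real.norm_eq_abs, sq_abs]; simp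
    rw [h10]
    calc _ ≤ 2 * (-(u y * (s - t))) ^ 2 * ‖θ y‖ := by gcongr
      _ = _ := by ring
  · simpa only [Real.norm_eq_abs, sq_abs] using
      Asymptotics.isLittleO_pow_sub_sub (E' := ℝ) t one_lt_two

namespace IsWeakSol

variable {U : ℝ} {u : ℝ → ℝ} {h : ℝ → L2}

/-- Without diffusion the equation for the averages holds pointwise almost everywhere, which also
shows that `u` times the average is in `L²`. -/
theorem mollify_transport (hh : IsWeakSol 0 u h) {δ : ℝ} {η : ℝ → ℝ} (hη : IsTimeKernel δ η)
    (hδ : 0 < δ) (cu : Continuous u) (j : ℕ) {t : ℝ} (ht : 0 ≤ t) :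
    mollify η h (j + 1) t =ᵐ[volume] fun y => -(Complex.I * u y) * mollify η h j t y := by
  have l1 : LocallyIntegrable fun y => -(Complex.I * u y) * mollify η h j t y := by
    have := (locallyIntegrable_L2 (mollify η h j t)).smul_continuous
      (by fun_prop : Continuous fun y => -(Complex.I * (u y : ℂ)))
    refine this.congr (Eventually.of_forall fun y => ?_)
    simp only [smul_eq_mul, mul_comm]
  refine ae_eq_of_integral_contDiff_smul_eq (locallyIntegrable_L2 _) l1 fun ψ hψ sψ => ?_
  have := hh.mollify_equation hη hδ cu j ht hψ sψ
  simp only [Complex.real_smul]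
  calc ∫ y, (ψ y : ℂ) * mollify η h (j + 1) t y = ∫ y, mollify η h (j + 1) t y * ψ y := by
        simp only [mul_comm]
    _ = _ := by
        rw [this]
        refine integral_congr_ae (Eventually.of_forall fun y => ?_)
        simp only [Complex.ofReal_zero, zero_mul, zero_sub]
        ring

theorem inner_phase {θ : ℝ → ℂ} (cu : Continuous u) (cθ : Continuous θ)
    (sθ : HasCompactSupport θ) (t : ℝ) (w : L2) :
    inner ℂ (memLp_phase cu cθ sθ t).toLp w = ∫ y, w y * starRingEnd ℂ (phase u θ t y) := by
  rw [L2.inner_def]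
  refine integral_congr_ae ?_
  filter_upwards [(memLp_phase cu cθ sθ t).coeFn_toLp] with y hy
  rw [hy, RCLike.inner_apply]

/-- Duality: pair the solution with a test function carried by the same flow. For time averages the
pairing is differentiable with derivative zero, and the averages converge in `L²`. -/
theorem inner_phase_eq (hh : IsWeakSol 0 u h) (cu : Continuous u) {θ : ℝ → ℂ} (cθ : Continuous θ)
    (sθ : HasCompactSupport θ) {t : ℝ} (ht : 0 ≤ t) :
    (inner ℂ (memLp_phase cu cθ sθ t).toLp (h t) : ℂ) =
      inner ℂ (memLp_phase cu cθ sθ 0).toLp (h 0) := by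
  obtain ⟨η, hη⟩ := exists_timeKernel_seq
  have lim : ∀ t, 0 ≤ t → Tendsto (fun k => (inner ℂ (memLp_phase cu cθ sθ t).toLp
      (mollify (η k) h 0 t) : ℂ)) atTop (𝓝 (inner ℂ (memLp_phase cu cθ sθ t).toLp (h t))) :=
    fun t ht => tendsto_const_nhds.inner (hh.tendsto_mollify hη ht)
  refine tendsto_nhds_unique (lim t ht) ((lim 0 le_rfl).congr fun k => ?_)
  have hδ : (0 : ℝ) < 1 / ((k : ℝ) + 1) := by positivity
  have d : ∀ s, 0 ≤ s → HasDerivAt (fun s => (inner ℂ (memLp_phase cu cθ sθ s).toLp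
      (mollify (η k) h 0 s) : ℂ)) 0 s := fun s hs => by
    have h1 := (hasDerivAt_phase cu cθ sθ s).inner ℂ (hh.hasDerivAt_mollify (hη k) 0 s)
    have e : (inner ℂ (memLp_phase cu cθ sθ s).toLp (mollify (η k) h (0 + 1) s) : ℂ) +
        inner ℂ ((memLp_phase (θ := fun y => -(Complex.I * u y) * θ y) cu (by fun_prop)
          sθ.mul_left s).toLp) (mollify (η k) h 0 s) = 0 := by
      have i1 : Integrable fun y => mollify (η k) h (0 + 1) s y * starRingEnd ℂ (phase u θ s y) :=
        integrable_mul_of_memLp (memLp_phase cu cθ sθ s).star _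
      have i2 : Integrable fun y => mollify (η k) h 0 s y *
          starRingEnd ℂ (phase u (fun y => -(Complex.I * u y) * θ y) s y) :=
        integrable_mul_of_memLp (memLp_phase (θ := fun y => -(Complex.I * u y) * θ y) cu
          (by fun_prop) sθ.mul_left s).star _
      rw [inner_phase cu cθ sθ, inner_phase (θ := fun y => -(Complex.I * u y) * θ y) cu
        (by fun_prop) sθ.mul_left, ← integral_add i1 i2]
      rw [integral_eq_zero_of_ae]
      filter_upwards [hh.mollify_transport (hη k) hδ cu 0 hs] with y hy
      rw [hy]
      simp only [phase, map_mul, map_neg, Complex.conj_I, Complex.conj_ofReal, Pi.zero_apply]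
      ring
    rwa [e] at h1
  exact (constant_of_has_deriv_right_zero (fun s hs => (d s hs.1).continuousAt.continuousWithinAt)
    (fun s hs => (d s hs.1).hasDerivWithinAt) t ⟨ht, le_rfl⟩).symm

theorem transport (hh : IsWeakSol 0 u h) (cu : Continuous u) {t : ℝ} (ht : 0 ≤ t) :
    h t =ᵐ[volume] phase u (h 0) t := by
  have l1 : LocallyIntegrable fun y =>
      h t y • Complex.exp (Complex.I * ((u y * t : ℝ) : ℂ)) :=
    (locallyIntegrable_L2 (h t)).smul_continuous (by fun_prop)
  have key := ae_eq_of_integral_contDiff_smul_eq l1 (locallyIntegrable_L2 (h 0))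
    fun ψ hψ sψ => by
      have cψ := hψ.continuous
      have c1 : Continuous fun y => (ψ y : ℂ) := by fun_prop
      have s1 : HasCompactSupport fun y => (ψ y : ℂ) := sψ.comp_left Complex.ofReal_zero
      have := hh.inner_phase_eq cu c1 s1 ht
      rw [inner_phase cu c1 s1, inner_phase cu c1 s1] at this
      refine Eq.trans ?_ (this.trans ?_)
      · refine integral_congr_ae (Eventually.of_forall fun y => ?_)
        simp only [phase, map_mul, ← Complex.exp_conj, Complex.conj_I, Complex.conj_ofReal,
          Complex.real_smul, smul_eq_mul]
        push_cast
        rw [neg_mul_neg]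
        ring
      · refine integral_congr_ae (Eventually.of_forall fun y => ?_)
        simp [phase, mul_comm]
  filter_upwards [key] with y hy
  rw [phase, ← hy, smul_eq_mul, mul_left_comm, ← Complex.exp_add]
  push_cast
  rw [← mul_add, neg_add_cancel, mul_zero, Complex.exp_zero, mul_one]

end IsWeakSol

/-! ### Mixing without diffusion -/

/-- Integration by parts for a `C¹` function `ξ`, with `ξ'` replaced by its backward quotients,
which move onto `w` as forward quotients. The smooth test functions of a weak derivative do not
suffice, as `ξ` will contain `u`, which is only `C³`. -/
theorem norm_integral_mul_deriv_le {w : ℝ → ℂ} (hw : LocallyIntegrable w) {ξ ξ' : ℝ → ℂ}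
    (hξ : ∀ y, HasDerivAt ξ (ξ' y) y) (cξ' : Continuous ξ') (sξ : HasCompactSupport ξ) {B Ξ : ℝ}
    (hB0 : 0 ≤ B) (hΞ0 : 0 ≤ Ξ)
    (hB : ∀ τ, 0 < τ → wInt (fun _ => 1) (diffQuot τ w) ≤ ENNReal.ofReal (B ^ 2))
    (hΞ : wInt (fun _ => 1) ξ ≤ ENNReal.ofReal (Ξ ^ 2)) : ‖∫ y, w y * ξ' y‖ ≤ B * Ξ := by
  have cξ : Continuous ξ := continuous_iff_continuousAt.2 fun y => (hξ y).continuousAt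
  have dξ : deriv ξ = ξ' := funext fun y => (hξ y).deriv
  have sξ' : HasCompactSupport ξ' := dξ ▸ sξ.deriv
  obtain ⟨R, hR⟩ := sξ.isCompact.isBounded.subset_closedBall 0
  rw [Real.closedBall_eq_Icc, zero_sub, zero_add] at hR
  have ξ0 : ∀ y, y ∉ Icc (-R) R → ξ y = 0 := fun y hy => image_eq_zero_of_notMem_tsupport
    fun h => hy (hR h)
  obtain ⟨C, hC⟩ := sξ'.exists_bound_of_continuous cξ'
  have hC0 : 0 ≤ C := (norm_nonneg _).trans (hC 0)
  have loc : ∀ {f θ : ℝ → ℂ}, LocallyIntegrable f → Continuous θ → HasCompactSupport θ →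
      Integrable fun z => f z * θ z := fun {f θ} hf hθ sθ => by
    have := hf.integrable_smul_right_of_hasCompactSupport hθ sθ
    exact this
  let τ : ℕ → ℝ := fun n => 1 / ((n : ℝ) + 1)
  have hτ : ∀ n, 0 < τ n := fun n => by positivity
  have hτ1 : ∀ n, τ n ≤ 1 := fun n => by
    exact (div_le_one (by positivity)).2 (by linarith [Nat.cast_nonneg (α := ℝ) n])
  have hτ0 : Tendsto τ atTop (𝓝 0) := tendsto_one_div_add_atTop_nhds_zero_nat
  have lim : Tendsto (fun n => ∫ y, w y * ((ξ y - ξ (y - τ n)) / τ n)) atTop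
      (𝓝 (∫ y, w y * ξ' y)) := by
    have iw : IntegrableOn w (Icc (-R) (R + 1)) := hw.integrableOn_isCompact isCompact_Icc
    refine tendsto_integral_of_dominated_convergence
      (fun y => C * ‖(Icc (-R) (R + 1)).indicator w y‖) (fun n => ?_)
      ((iw.integrable_indicator measurableSet_Icc).norm.const_mul C) (fun n => ?_) ?_
    · exact hw.aestronglyMeasurable.mul (by fun_prop : Continuous fun y =>
        (ξ y - ξ (y - τ n)) / (τ n : ℂ)).aestronglyMeasurable
    · refine Eventually.of_forall fun y => ?_
      by_cases hy : y ∈ Icc (-R) (R + 1)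
      · rw [indicator_of_mem hy, norm_mul, mul_comm]
        refine mul_le_mul_of_nonneg_right ?_ (norm_nonneg _)
        rw [norm_div, Complex.norm_real, Real.norm_of_nonneg (hτ n).le, div_le_iff₀ (hτ n)]
        have := convex_univ.norm_image_sub_le_of_norm_hasDerivWithin_le (C := C)
          (fun y _ => (hξ y).hasDerivWithinAt) (fun y _ => hC y) (mem_univ (y - τ n)) (mem_univ y)
        rwa [sub_sub_cancel, Real.norm_of_nonneg (hτ n).le] at this
      · have h1 : ξ y = 0 := ξ0 y fun h => hy ⟨h.1, by linarith [h.2]⟩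
        have h2 : ξ (y - τ n) = 0 := ξ0 _ fun h => hy
          ⟨by linarith [h.1, hτ n], by linarith [h.2, hτ1 n]⟩
        rw [h1, h2, indicator_of_notMem hy]
        simp
    · refine Eventually.of_forall fun y => Tendsto.const_mul _ ?_
      have h1 := hasDerivAt_iff_tendsto_slope_zero.1 (hξ y)
      have h2 : Tendsto (fun n => -τ n) atTop (𝓝[≠] 0) :=
        tendsto_nhdsWithin_iff.2 ⟨by simpa using hτ0.neg,
          Eventually.of_forall fun n => by simpa using (hτ n).ne'⟩
      refine (h1.comp h2).congr fun n => ?_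
      have := (hτ n).ne'
      simp only [Function.comp_apply, Complex.real_smul, ← sub_eq_add_neg]
      push_cast
      field_simp
      ring
  refine le_of_tendsto lim.norm (Eventually.of_forall fun n => ?_)
  have i1 := loc hw cξ sξ
  have sξs : HasCompactSupport fun z => ξ (z - τ n) := by
    have := sξ.comp_homeomorph (Homeomorph.addRight (-τ n))
    exact this
  have i2 := loc (θ := fun z => ξ (z - τ n)) hw (by fun_prop) sξs
  have i3 : Integrable fun y => w (y + τ n) * ξ y := by
    have := i2.comp_add_right (τ n)
    simpa only [add_sub_cancel_right] using this
  have e : ∫ y, w y * ((ξ y - ξ (y - τ n)) / τ n) = -∫ y, diffQuot (τ n) w y * ξ y := by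
    have e1 : ∫ y, w (y + τ n) * ξ y = ∫ z, w z * ξ (z - τ n) := by
      rw [← integral_add_right_eq_self (fun z => w z * ξ (z - τ n)) (τ n)]
      simp only [add_sub_cancel_right]
    calc _ = ((τ n : ℂ))⁻¹ * ((∫ y, w y * ξ y) - ∫ z, w z * ξ (z - τ n)) := by
          rw [← integral_sub i1 i2, ← integral_const_mul]
          refine integral_congr_ae (Eventually.of_forall fun y => ?_)
          simp only; ring
      _ = -(((τ n : ℂ))⁻¹ * ((∫ y, w (y + τ n) * ξ y) - ∫ y, w y * ξ y)) := by rw [e1]; ring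
      _ = _ := by
          rw [← integral_sub i3 i1, ← integral_const_mul]
          congr 1
          refine integral_congr_ae (Eventually.of_forall fun y => ?_)
          simp only [diffQuot]; ring
  rw [e, norm_neg]
  have mw : AEStronglyMeasurable (diffQuot (τ n) w) := by
    have h1 := hw.aestronglyMeasurable.comp_quasiMeasurePreserving
      (measurePreserving_add_right (volume : Measure ℝ) (τ n)).quasiMeasurePreserving
    exact (h1.sub hw.aestronglyMeasurable).mul_const ((τ n : ℂ)⁻¹)
  exact norm_integral_mul_le mw cξ.aestronglyMeasurable hB0 hΞ0 (hB _ (hτ n)) hΞ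

theorem wInt_one_le_of_norm_le {f φ : ℝ → ℂ} {K Φ : ℝ}
    (h : ∀ y, ‖f y‖ ≤ K * ‖φ y‖) (hφ : wInt (fun _ => 1) φ ≤ ENNReal.ofReal (Φ ^ 2)) :
    wInt (fun _ => 1) f ≤ ENNReal.ofReal ((K * Φ) ^ 2) := by
  rw [mul_pow, ENNReal.ofReal_mul (by positivity)]
  refine le_trans ?_ (mul_le_mul_right hφ _)
  rw [wInt, wInt, ← lintegral_const_mul' _ _ ENNReal.ofReal_ne_top]
  refine lintegral_mono fun y => ?_
  rw [← ENNReal.ofReal_mul (by positivity)]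
  refine ENNReal.ofReal_le_ofReal ?_
  rw [one_mul, one_mul, ← mul_pow]
  exact pow_le_pow_left₀ (norm_nonneg _) (h y) 2

theorem inviscid_combine {I t U Y Φ : ℝ} (hI : 0 ≤ I) (hU : 1 ≤ U) (ht : 0 ≤ t) (hY : 0 ≤ Y)
    (hΦ : 0 ≤ Φ) (b0 : I ≤ Y * Φ) (b1 : t * I ≤ Y * (U * Φ) + Y * (U ^ 2 * Φ) + Y * (U * Φ)) :
    I ≤ 4 * U ^ 2 / √(1 + t ^ 2) * (Y * Φ) := by
  have h1 : √(1 + t ^ 2) ≤ 1 + t := Real.sqrt_le_iff.2 ⟨by positivity, by nlinarith⟩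
  have h2 : 0 < √(1 + t ^ 2) := Real.sqrt_pos.2 (by positivity)
  have hYΦ : 0 ≤ Y * Φ := by positivity
  have hU2 : U ≤ U ^ 2 := by nlinarith
  rw [div_mul_eq_mul_div, le_div_iff₀ h2]
  have h3 : U * (Y * Φ) ≤ U ^ 2 * (Y * Φ) := mul_le_mul_of_nonneg_right hU2 hYΦ
  have h4 : 1 * (Y * Φ) ≤ U ^ 2 * (Y * Φ) := mul_le_mul_of_nonneg_right (by linarith) hYΦ
  nlinarith [mul_le_mul_of_nonneg_left h1 hI]

/-- Nonstationary phase for `∫ h(0) e^{-iut} φ`: since `v u' = 1`, the derivative of `e^{-iut} v φ`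
is `-it e^{-iut} φ` plus terms without `t`, and the derivative falls on `h(0)`. -/
theorem IsWeakSol.mixing_inviscid {U : ℝ} {u : ℝ → ℝ} {h : ℝ → L2} (hh : IsWeakSol 0 u h)
    (hu : IsShear U u) (hU : 1 ≤ U) {Y : ℝ} (hY0 : 0 ≤ Y)
    (hY : wInt (fun _ => 1) (h 0) ≤ ENNReal.ofReal (Y ^ 2))
    {g : ℝ → ℂ} (hg : LocallyIntegrable g)
    (hgh : ∀ ψ : ℝ → ℝ, ContDiff ℝ ∞ ψ → HasCompactSupport ψ →
      ∫ y, h 0 y * deriv ψ y = -∫ y, g y * ψ y)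
    (hgY : wInt (fun _ => 1) g ≤ ENNReal.ofReal (Y ^ 2))
    {t : ℝ} (ht : 0 ≤ t) {φ φ' : ℝ → ℂ} (hφ : ∀ y, HasDerivAt φ (φ' y) y) (cφ' : Continuous φ')
    (sφ : HasCompactSupport φ) {Φ : ℝ} (hΦ0 : 0 ≤ Φ)
    (hΦ : wInt (fun _ => 1) φ ≤ ENNReal.ofReal (Φ ^ 2))
    (hΦ' : wInt (fun _ => 1) φ' ≤ ENNReal.ofReal (Φ ^ 2)) :
    ‖∫ y, h t y * φ y‖ ≤ 4 * U ^ 2 / √(1 + t ^ 2) * (Y * Φ) := by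
  have hU0 : 0 ≤ U := by linarith
  have cu := hu.continuous
  have cv := hu.continuous_invSlope hU
  have cv₁ := hu.continuous_invSlope₁ hU
  have cφ : Continuous φ := continuous_iff_continuousAt.2 fun y => (hφ y).continuousAt
  have dφ : deriv φ = φ' := funext fun y => (hφ y).deriv
  have sφ' : HasCompactSupport φ' := dφ ▸ sφ.deriv
  have hw := locallyIntegrable_L2 (h 0)
  have e0 : ∫ y, h t y * φ y = ∫ y, h 0 y * phase u φ t y := by
    refine integral_congr_ae ?_
    filter_upwards [hh.transport cu ht] with y hy
    rw [hy, phase, phase]; ring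
  have dq : ∀ τ, 0 < τ → wInt (fun _ => 1) (diffQuot τ (h 0)) ≤ ENNReal.ofReal (Y ^ 2) :=
    fun τ hτ => (wInt_diffQuot_le hw hg hgh hτ).trans hgY
  have vle : ∀ y, ‖(invSlope u y : ℂ)‖ ≤ U := fun y => by
    rw [Complex.norm_real, Real.norm_of_nonneg (hu.invSlope_pos hU y).le]
    exact hu.invSlope_le hU y
  have v₁le : ∀ y, ‖(invSlope₁ u y : ℂ)‖ ≤ U ^ 2 := fun y => by
    rw [Complex.norm_real, Real.norm_eq_abs]
    refine (hu.abs_invSlope₁_le hU y).trans ?_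
    rw [sq]
    exact mul_le_mul_of_nonneg_left (hu.invSlope_le hU y) hU0
  have hξ : ∀ y, HasDerivAt (phase u (fun y => invSlope u y * φ y) t)
      (-(Complex.I * t) * phase u φ t y + phase u (fun y => invSlope₁ u y * φ y) t y +
        phase u (fun y => invSlope u y * φ' y) t y) y := fun y => by
    have h1 : HasDerivAt (fun y => Complex.exp (Complex.I * ((-(u y * t) : ℝ) : ℂ)))
        (Complex.exp (Complex.I * ((-(u y * t) : ℝ) : ℂ)) *
          (Complex.I * ((-(deriv u y * t) : ℝ) : ℂ))) y :=
      (((hu.hasDerivAt y).mul_const t).neg.ofReal_comp.const_mul Complex.I).cexp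
    have h2 : HasDerivAt (fun y => (invSlope u y : ℂ) * φ y)
        (invSlope₁ u y * φ y + invSlope u y * φ' y) y :=
      (hu.hasDerivAt_invSlope hU y).ofReal_comp.mul (hφ y)
    refine (h1.mul h2).congr_deriv ?_
    have h3 : ((invSlope u y : ℝ) : ℂ) * ((deriv u y : ℝ) : ℂ) = 1 := by
      exact_mod_cast hu.invSlope_mul hU y
    simp only [phase]
    push_cast
    linear_combination (-(Complex.I * t) * Complex.exp (Complex.I * (-(u y * t))) * φ y) * h3
  have c1 := continuous_phase cu cφ t
  have c2 := continuous_phase (θ := fun y => invSlope₁ u y * φ y) cu (by fun_prop) t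
  have c3 := continuous_phase (θ := fun y => invSlope u y * φ' y) cu (by fun_prop) t
  have c4 := continuous_phase (θ := fun y => invSlope u y * φ y) cu (by fun_prop) t
  have b := norm_integral_mul_deriv_le hw hξ (by fun_prop) (sφ.mul_left.mul_left) hY0
    (by positivity) dq (wInt_one_le_of_norm_le (Φ := Φ) (fun y => by
      rw [norm_phase, norm_mul]
      exact mul_le_mul_of_nonneg_right (vle y) (norm_nonneg _)) hΦ)
  have mh := Lp.aestronglyMeasurable (h 0)
  have b2 := norm_integral_mul_le mh c2.aestronglyMeasurable hY0 (by positivity) hY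
    (wInt_one_le_of_norm_le (K := U ^ 2) (Φ := Φ) (fun y => by
      rw [norm_phase, norm_mul]
      exact mul_le_mul_of_nonneg_right (v₁le y) (norm_nonneg _)) hΦ)
  have b3 := norm_integral_mul_le mh c3.aestronglyMeasurable hY0 (by positivity) hY
    (wInt_one_le_of_norm_le (Φ := Φ) (fun y => by
      rw [norm_phase, norm_mul]
      exact mul_le_mul_of_nonneg_right (vle y) (norm_nonneg _)) hΦ')
  have b0 := norm_integral_mul_le mh c1.aestronglyMeasurable hY0 hΦ0 hY
    ((wInt_one_le_of_norm_le (Φ := Φ) (fun y => by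
      rw [norm_phase, one_mul]) hΦ).trans (by rw [one_mul]))
  have i1 := integrable_mul_of_memLp (memLp_phase cu cφ sφ t) (h 0)
  have i2 := integrable_mul_of_memLp (memLp_phase (θ := fun y => invSlope₁ u y * φ y) cu
    (by fun_prop) sφ.mul_left t) (h 0)
  have i3 := integrable_mul_of_memLp (memLp_phase (θ := fun y => invSlope u y * φ' y) cu
    (by fun_prop) sφ'.mul_left t) (h 0)
  have e1 : ∫ y, h 0 y * (-(Complex.I * t) * phase u φ t y + phase u (fun y => invSlope₁ u y * φ y) t y
      + phase u (fun y => invSlope u y * φ' y) t y) =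
      -(Complex.I * t) * (∫ y, h 0 y * phase u φ t y)
      + (∫ y, h 0 y * phase u (fun y => invSlope₁ u y * φ y) t y)
      + ∫ y, h 0 y * phase u (fun y => invSlope u y * φ' y) t y := by
    have i1' := i1.const_mul (-(Complex.I * t))
    have i12 : Integrable fun y => -(Complex.I * t) * (h 0 y * phase u φ t y) +
        h 0 y * phase u (fun y => invSlope₁ u y * φ y) t y := i1'.add i2
    rw [← integral_const_mul, ← integral_add i1' i2, ← integral_add i12 i3]
    refine integral_congr_ae (Eventually.of_forall fun y => ?_)
    simp only
    ring
  rw [e1] at b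
  rw [e0]
  refine inviscid_combine (norm_nonneg _) hU ht hY0 hΦ0 b0 ?_
  have e2 : t * ‖∫ y, h 0 y * phase u φ t y‖ = ‖-(Complex.I * t) * ∫ y, h 0 y * phase u φ t y‖ := by
    rw [norm_mul, norm_neg, norm_mul, Complex.norm_I, one_mul, Complex.norm_real,
      Real.norm_of_nonneg ht]
  rw [e2]
  generalize -(Complex.I * t) * ∫ y, h 0 y * phase u φ t y = a at b ⊢
  generalize (∫ y, h 0 y * phase u (fun y => invSlope₁ u y * φ y) t y) = a2 at b b2
  generalize (∫ y, h 0 y * phase u (fun y => invSlope u y * φ' y) t y) = a3 at b b3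
  calc ‖a‖ = ‖(a + a2 + a3) - a2 - a3‖ := by congr 1; ring
    _ ≤ ‖a + a2 + a3‖ + ‖a2‖ + ‖a3‖ :=
      (norm_sub_le _ _).trans (add_le_add (norm_sub_le _ _) le_rfl)
    _ ≤ _ := by linarith

/-! ### Fourier coefficients in `x` -/

theorem xCoeff_eq (F : Dom → ℝ) (l : ℤ) (y : ℝ) :
    xCoeff F l y = ((2 * π)⁻¹ : ℝ) * ∫ x : Circ, fourier (-l) x * (F (x, y) : ℂ) := by
  rw [xCoeff, fourierCoeff, AddCircle.integral_haarAddCircle, Complex.real_smul]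
  simp only [smul_eq_mul]

theorem norm_fourier_apply (l : ℤ) (x : Circ) : ‖fourier l x‖ = 1 := by
  rw [fourier_apply, Circle.norm_coe]

theorem fourier_coe (l : ℤ) (x : ℝ) : fourier l (x : Circ) = Complex.exp (Complex.I * l * x) := by
  rw [fourier_coe_apply]
  congr 1
  push_cast
  field_simp

theorem fourier_add_coe (l : ℤ) (x y : Circ) : fourier l (x + y) = fourier l x * fourier l y := by
  rw [fourier_apply, fourier_apply, fourier_apply, smul_add, AddCircle.toCircle_add, Circle.coe_mul]

theorem volume_dom : (volume : Measure Dom) = (volume : Measure Circ).prod (volume : Measure ℝ) := rfl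

/-- The circle is compact, so local integrability covers slabs, and Fubini's theorem applies to each
of them. -/
theorem integrable_slice {F : Dom → ℝ} (hF : LocallyIntegrable F) :
    ∀ᵐ y : ℝ, Integrable fun x : Circ => F (x, y) := by
  have h : ∀ n : ℕ, ∀ᵐ y : ℝ, y ∈ Icc (-(n : ℝ)) n → Integrable fun x : Circ => F (x, y) := fun n => by
    have h1 := hF.integrableOn_isCompact (isCompact_univ.prod (isCompact_Icc (a := -(n : ℝ)) (b := n)))
    rw [IntegrableOn, volume_dom, ← Measure.prod_restrict, Measure.restrict_univ] at h1
    exact (ae_restrict_iff' measurableSet_Icc).1 h1.prod_left_ae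
  filter_upwards [ae_all_iff.2 h] with y hy
  obtain ⟨n, hn⟩ := exists_nat_ge |y|
  exact hy n (abs_le.1 hn)

theorem xCoeff_congr {F G : Dom → ℝ} (h : F =ᵐ[volume] G) (l : ℤ) :
    xCoeff F l =ᵐ[volume] xCoeff G l := by
  have h1 : ∀ᵐ y : ℝ, ∀ᵐ x : Circ, F (x, y) = G (x, y) := by
    have : ∀ᵐ z ∂(volume : Measure ℝ).prod (volume : Measure Circ), F z.swap = G z.swap :=
      Measure.measurePreserving_swap.quasiMeasurePreserving.ae h
    exact Measure.ae_ae_of_ae_prod this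
  filter_upwards [h1] with y hy
  rw [xCoeff_eq, xCoeff_eq]
  congr 1
  refine integral_congr_ae ?_
  filter_upwards [hy] with x hx
  rw [hx]

theorem aestronglyMeasurable_xCoeff {F : Dom → ℝ} (hF : AEStronglyMeasurable F) (l : ℤ) :
    AEStronglyMeasurable (xCoeff F l) := by
  have e : xCoeff F l = fun y => (((2 * π)⁻¹ : ℝ) : ℂ) * ∫ x : Circ, fourier (-l) x * (F (x, y) : ℂ) :=
    funext (xCoeff_eq F l)
  rw [e]
  refine AEStronglyMeasurable.const_mul ?_ _
  have h1 : AEStronglyMeasurable (fun p : Dom => fourier (-l) p.1 * (F p : ℂ)) :=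
    ((fourier (-l)).continuous.comp continuous_fst).aestronglyMeasurable.mul
      (Complex.continuous_ofReal.comp_aestronglyMeasurable hF)
  exact h1.prod_swap.integral_prod_right'

theorem integrable_fourier_mul {f : Circ → ℝ} (hf : Integrable f) (l : ℤ) :
    Integrable fun x => fourier l x * (f x : ℂ) := by
  refine hf.ofReal.bdd_mul (c := 1) (fourier l).continuous.aestronglyMeasurable
    (Eventually.of_forall fun x => (norm_fourier_apply l x).le)

theorem xCoeff_sub {F G : Dom → ℝ} (hF : LocallyIntegrable F) (hG : LocallyIntegrable G) (l : ℤ) :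
    xCoeff (F - G) l =ᵐ[volume] fun y => xCoeff F l y - xCoeff G l y := by
  filter_upwards [integrable_slice hF, integrable_slice hG] with y h1 h2
  rw [xCoeff_eq, xCoeff_eq, xCoeff_eq, ← mul_sub, ← integral_sub (integrable_fourier_mul h1 _)
    (integrable_fourier_mul h2 _)]
  congr 1
  refine integral_congr_ae (Eventually.of_forall fun x => ?_)
  simp only [Pi.sub_apply]
  push_cast
  ring

theorem integral_fourier_eq_zero {l : ℤ} (hl : l ≠ 0) : ∫ x : Circ, fourier l x = 0 := by
  have h := integral_add_right_eq_self (μ := (volume : Measure Circ)) (fun x => fourier l x)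
    ((2 * π / 2 / l : ℝ) : Circ)
  simp only [fourier_add_half_inv_index hl Real.two_pi_pos, integral_neg] at h
  exact self_eq_neg.1 h.symm

theorem integral_fourier_zero : ∫ x : Circ, (fourier 0 x : ℂ) = (2 * π : ℝ) := by
  simp only [fourier_zero]
  rw [integral_const, Complex.real_smul, mul_one, Measure.real, AddCircle.measure_univ,
    ENNReal.toReal_ofReal Real.two_pi_pos.le]

/-- An `x`-average has no mode `l ≠ 0`. The equality holds at every `y`, not just almost every one.
-/
theorem xCoeff_nonzeroPart (F : Dom → ℝ) {l : ℤ} (hl : l ≠ 0) :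
    xCoeff (nonzeroPart F) l = xCoeff F l := by
  funext y
  rw [xCoeff_eq, xCoeff_eq]
  congr 1
  set m : ℝ := (2 * π)⁻¹ * ∫ x : Circ, F (x, y) with hm
  have e : ∀ x : Circ, nonzeroPart F (x, y) = F (x, y) - m := fun x => rfl
  simp only [e]
  by_cases h : Integrable fun x : Circ => F (x, y)
  · have h1 := integrable_fourier_mul h (-l)
    have h2 := integrable_fourier_mul (integrable_const m : Integrable fun _ : Circ => m) (-l)
    have h3 : ∫ x : Circ, fourier (-l) x * (m : ℂ) = 0 := by
      rw [integral_mul_const, integral_fourier_eq_zero (neg_ne_zero.2 hl), zero_mul]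
    calc _ = ∫ x : Circ, (fourier (-l) x * (F (x, y) : ℂ) - fourier (-l) x * (m : ℂ)) := by
          refine integral_congr_ae (Eventually.of_forall fun x => ?_)
          simp only; push_cast; ring
      _ = _ := by rw [integral_sub h1 h2, h3, sub_zero]
  -- On a non-integrable slice both integrals take the default value 0. Integrability is unaffected
  -- by the unimodular factor and by the constant `m`.
  · have key : ∀ G : Circ → ℝ, (Integrable fun x => fourier (-l) x * (G x : ℂ)) → Integrable G :=
      fun G hG => by
        have h1 := hG.bdd_mul (c := 1) (fourier l).continuous.aestronglyMeasurable
          (Eventually.of_forall fun x => (norm_fourier_apply l x).le)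
        refine (h1.re).congr (Eventually.of_forall fun x => ?_)
        have : fourier l x * (fourier (-l) x * (G x : ℂ)) = G x := by
          rw [← mul_assoc, ← fourier_add, add_neg_cancel, fourier_zero, one_mul]
        simp only [this]
        exact Complex.ofReal_re _
    rw [integral_undef fun h' => h (key _ h'), integral_undef fun h' => h ?_]
    have := (key _ h').add (integrable_const m)
    refine this.congr (Eventually.of_forall fun x => ?_)
    simp

/-- Bessel's inequality for one coefficient. -/
theorem wInt_xCoeff_le {F : Dom → ℝ} (hF : AEStronglyMeasurable F) (l : ℤ) :
    wInt (fun _ => 1) (xCoeff F l) ≤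
      ENNReal.ofReal (2 * π)⁻¹ * ∫⁻ p, ENNReal.ofReal (F p ^ 2) := by
  have hm : AEMeasurable (fun p : Dom => ENNReal.ofReal (F p ^ 2)) :=
    (hF.aemeasurable.pow_const 2).ennreal_ofReal
  rw [volume_dom, lintegral_prod_symm _ hm, ← lintegral_const_mul' _ _ ENNReal.ofReal_ne_top]
  have hs : ∀ᵐ y : ℝ, AEStronglyMeasurable fun x : Circ => F (x, y) := by
    have := hF.prod_swap.prodMk_left
    exact this
  refine lintegral_mono_ae ?_
  filter_upwards [hs] with y hy
  have h1 : ‖xCoeff F l y‖ₑ ≤ ENNReal.ofReal (2 * π)⁻¹ * ∫⁻ x : Circ, ‖F (x, y)‖ₑ := by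
    rw [xCoeff_eq, enorm_mul]
    refine mul_le_mul' (le_of_eq ?_) ?_
    · rw [← ofReal_norm, Complex.norm_real, Real.norm_of_nonneg (by positivity)]
    · refine (enorm_integral_le_lintegral_enorm _).trans (le_of_eq (lintegral_congr fun x => ?_))
      rw [enorm_mul, ← ofReal_norm, norm_fourier_apply, ENNReal.ofReal_one, one_mul, ← ofReal_norm,
        Complex.norm_real, ofReal_norm]
  have h2 := sq_lintegral_le (volume : Measure Circ) hy.enorm
  rw [AddCircle.measure_univ] at h2
  calc ENNReal.ofReal (1 * ‖xCoeff F l y‖ ^ 2) = ‖xCoeff F l y‖ₑ ^ 2 := by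
        rw [one_mul, ENNReal.ofReal_pow (norm_nonneg _), ofReal_norm]
    _ ≤ (ENNReal.ofReal (2 * π)⁻¹ * ∫⁻ x : Circ, ‖F (x, y)‖ₑ) ^ 2 := pow_le_pow_left₀ zero_le h1 2
    _ ≤ ENNReal.ofReal (2 * π)⁻¹ ^ 2 * (ENNReal.ofReal (2 * π) * ∫⁻ x : Circ, ‖F (x, y)‖ₑ ^ 2) := by
        rw [mul_pow]
        exact mul_le_mul_right h2 _
    _ = _ := by
        rw [← mul_assoc, ← ENNReal.ofReal_pow (by positivity), ← ENNReal.ofReal_mul (by positivity)]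
        congr 2
        · field_simp
        · funext x
          rw [← ofReal_norm, ← ENNReal.ofReal_pow (norm_nonneg _), Real.norm_eq_abs, sq_abs]

theorem integral_dom_mul {F : Dom → ℝ} (hF : LocallyIntegrable F) (l : ℤ) {χ : ℝ → ℂ}
    (cχ : Continuous χ) (sχ : HasCompactSupport χ) :
    Integrable (fun p : Dom => (F p : ℂ) * (fourier (-l) p.1 * χ p.2)) ∧
    ∫ p : Dom, (F p : ℂ) * (fourier (-l) p.1 * χ p.2) =
      (2 * π : ℝ) * ∫ y, xCoeff F l y * χ y := by
  have sup : HasCompactSupport fun p : Dom => fourier (-l) p.1 * χ p.2 := by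
    refine HasCompactSupport.intro' (isCompact_univ.prod sχ.isCompact)
      (isClosed_univ.prod (isClosed_tsupport _)) fun p hp => ?_
    rw [image_eq_zero_of_notMem_tsupport (f := χ) fun h => hp ⟨mem_univ _, h⟩, mul_zero]
  have hi : Integrable (fun p : Dom => (F p : ℂ) * (fourier (-l) p.1 * χ p.2)) := by
    have h1 : LocallyIntegrable fun p : Dom => (F p : ℂ) := fun p => by
      obtain ⟨s, hs, hi⟩ := hF p
      exact ⟨s, hs, hi.ofReal⟩
    have := h1.integrable_smul_right_of_hasCompactSupport
      (g := fun p : Dom => fourier (-l) p.1 * χ p.2) (by fun_prop) sup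
    exact this
  refine ⟨hi, ?_⟩
  rw [volume_dom, integral_prod_symm _ hi, ← integral_const_mul]
  refine integral_congr_ae (Eventually.of_forall fun y => ?_)
  simp only
  rw [xCoeff_eq, ← mul_assoc, ← mul_assoc, ← Complex.ofReal_mul, mul_inv_cancel₀ (by positivity),
    Complex.ofReal_one, one_mul, ← integral_mul_const]
  refine integral_congr_ae (Eventually.of_forall fun x => ?_)
  simp only
  ring

/-! ### Test functions with one Fourier mode -/

/-- A test function on one Fourier mode, `L` being the real or the imaginary part. -/
def mode (L : ℂ →L[ℝ] ℝ) (l : ℤ) (z : ℂ) (ψ : ℝ → ℝ) (p : Dom) : ℝ :=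
  L (z * fourier l p.1) * ψ p.2

theorem clm_ofReal_mul (L : ℂ →L[ℝ] ℝ) (r : ℝ) (z : ℂ) : L ((r : ℂ) * z) = r * L z := by
  rw [← Complex.real_smul, L.map_smul, smul_eq_mul]

theorem hasDerivAt_fourier_add (l : ℤ) (x : Circ) :
    HasDerivAt (fun s : ℝ => (fourier l (x + (s : Circ)) : ℂ)) (Complex.I * l * fourier l x) 0 := by
  have h1 : HasDerivAt (fun s : ℝ => Complex.exp (Complex.I * l * s)) (Complex.I * l) 0 := by
    have := ((Complex.ofRealCLM.hasDerivAt (x := (0 : ℝ))).const_mul (Complex.I * l)).cexp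
    simpa using this
  have h2 := h1.const_mul (fourier l x : ℂ)
  simp only [fourier_add_coe, fourier_coe]
  exact h2.congr_deriv (mul_comm _ _)

theorem dX_mode (L : ℂ →L[ℝ] ℝ) (l : ℤ) (z : ℂ) (ψ : ℝ → ℝ) :
    dX (mode L l z ψ) = mode L l (Complex.I * l * z) ψ := by
  funext p
  have h1 := (L.hasFDerivAt.comp_hasDerivAt (0 : ℝ)
    ((hasDerivAt_fourier_add l p.1).const_mul z)).mul_const (ψ p.2)
  rw [dX, mode]
  refine h1.deriv.trans ?_
  congr 2
  ring

theorem dY_mode (L : ℂ →L[ℝ] ℝ) (l : ℤ) (z : ℂ) {ψ : ℝ → ℝ} (hψ : Differentiable ℝ ψ) :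
    dY (mode L l z ψ) = mode L l z (deriv ψ) := by
  funext p
  exact ((hψ p.2).hasDerivAt.const_mul (L (z * fourier l p.1))).deriv

theorem contDiff_mode (L : ℂ →L[ℝ] ℝ) (l : ℤ) {E : Type*} [NormedAddCommGroup E] [NormedSpace ℝ E]
    {η a b : E → ℝ} (hη : ContDiff ℝ ∞ η) (ha : ContDiff ℝ ∞ a) (hb : ContDiff ℝ ∞ b) {ψ : ℝ → ℝ}
    (hψ : ContDiff ℝ ∞ ψ) :
    ContDiff ℝ ∞ fun q : E => mode L l (η q : ℂ) ψ ((a q : Circ), b q) := by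
  simp only [mode, fourier_coe]
  have h1 : ContDiff ℝ ∞ fun q : E => Complex.exp (Complex.I * l * a q) :=
    (contDiff_const.mul (Complex.ofRealCLM.contDiff.comp ha)).cexp
  exact (L.contDiff.comp ((Complex.ofRealCLM.contDiff.comp hη).mul h1)).mul (hψ.comp hb)

theorem isTest_mode (L : ℂ →L[ℝ] ℝ) (l : ℤ) (r : ℝ) {ψ : ℝ → ℝ} (hψ : ContDiff ℝ ∞ ψ)
    (sψ : HasCompactSupport ψ) : IsTest (mode L l (r : ℂ) ψ) := by
  refine ⟨contDiff_mode L l (η := fun _ => r) contDiff_const contDiff_fst contDiff_snd hψ,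
    HasCompactSupport.intro' (isCompact_univ.prod sψ.isCompact)
      (isClosed_univ.prod (isClosed_tsupport _)) fun p hp => ?_⟩
  rw [mode, image_eq_zero_of_notMem_tsupport (f := ψ) fun h => hp ⟨mem_univ _, h⟩, mul_zero]

theorem isSpaceTimeTest_mode (L : ℂ →L[ℝ] ℝ) (l : ℤ) {η ψ : ℝ → ℝ} (hη : ContDiff ℝ ∞ η)
    (sη : HasCompactSupport η) (hψ : ContDiff ℝ ∞ ψ) (sψ : HasCompactSupport ψ) :
    IsSpaceTimeTest fun t => mode L l (η t : ℂ) ψ := by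
  refine ⟨contDiff_mode L l (hη.comp contDiff_fst) (contDiff_fst.comp contDiff_snd)
    (contDiff_snd.comp contDiff_snd) hψ,
    HasCompactSupport.intro' (sη.isCompact.prod (isCompact_univ.prod sψ.isCompact))
      ((isClosed_tsupport _).prod (isClosed_univ.prod (isClosed_tsupport _))) fun p hp => ?_⟩
  by_cases h : p.1 ∈ tsupport η
  · simp only [mode]
    rw [image_eq_zero_of_notMem_tsupport (f := ψ) fun h' => hp ⟨h, mem_univ _, h'⟩, mul_zero]
  · simp only [mode]
    rw [image_eq_zero_of_notMem_tsupport h]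
    simp

/-! ### The weak derivative of one mode -/

theorem eq_zero_of_clm {z : ℂ} (h : ∀ L : ℂ →L[ℝ] ℝ, L z = 0) : z = 0 :=
  Complex.ext (h Complex.reCLM) (h Complex.imCLM)

/-- The test functions are real, while the identity is complex: testing with `L(e^{-ilx})ψ` for
every real linear `L` on `ℂ` recovers it. -/
theorem IsWeakDerivY.xCoeff {F G : Dom → ℝ} (h : IsWeakDerivY F G) (l : ℤ) {ψ : ℝ → ℝ}
    (hψ : ContDiff ℝ ∞ ψ) (sψ : HasCompactSupport ψ) :
    ∫ y, xCoeff F l y * (deriv ψ y : ℝ) = -∫ y, xCoeff G l y * ψ y := by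
  obtain ⟨hF, hG, H⟩ := h
  have cψ' : Continuous (deriv ψ) := hψ.continuous_deriv (by exact_mod_cast le_top)
  have cψ := hψ.continuous
  obtain ⟨i1, e1⟩ := integral_dom_mul hF l (χ := fun y => ((deriv ψ y : ℝ) : ℂ)) (by fun_prop)
    (sψ.deriv.comp_left Complex.ofReal_zero)
  obtain ⟨i2, e2⟩ := integral_dom_mul hG l (χ := fun y => (ψ y : ℂ)) (by fun_prop)
    (sψ.comp_left Complex.ofReal_zero)
  have key : (2 * π : ℝ) * (∫ y, StableMixing.xCoeff F l y * (deriv ψ y : ℝ)) +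
      (2 * π : ℝ) * (∫ y, StableMixing.xCoeff G l y * ψ y) = 0 := by
    rw [← e1, ← e2]
    refine eq_zero_of_clm fun L => ?_
    rw [map_add, ← L.integral_comp_comm i1, ← L.integral_comp_comm i2]
    have h1 := H (mode L (-l) ((1 : ℝ) : ℂ) ψ) (isTest_mode L _ 1 hψ sψ)
    rw [dY_mode _ _ _ (hψ.differentiable (by simp))] at h1
    have pt : ∀ (φ : ℝ → ℝ) (a : ℝ) (p : Dom), L ((a : ℂ) * (fourier (-l) p.1 * (φ p.2 : ℂ))) =
        a * mode L (-l) ((1 : ℝ) : ℂ) φ p := fun φ a p => by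
      rw [mode, clm_ofReal_mul, mul_comm (fourier (-l) p.1 : ℂ), clm_ofReal_mul,
        Complex.ofReal_one, one_mul, mul_comm (φ p.2)]
    simp only [pt, h1, neg_add_cancel]
  rw [← mul_add] at key
  have h2 := (mul_eq_zero.1 key).resolve_left
    (Complex.ofReal_ne_zero.2 (by positivity))
  exact eq_neg_of_add_eq_zero_left h2

/-! ### The equation for one mode -/

/-- Extend `A` by its initial value to negative times. The initial term in the identity is then
exactly the integral over `t ≤ 0`, and the weak derivative on the line is `B` cut off to `t > 0`.
Integrating it gives `A` as a primitive of the continuous `B`. -/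
theorem hasDerivAt_of_weak {A B : ℝ → ℂ} (cA : ContinuousOn A (Ici 0)) (cB : ContinuousOn B (Ici 0))
    (h : ∀ η : ℝ → ℝ, ContDiff ℝ ∞ η → HasCompactSupport η →
      (∫ t in Ioi 0, (A t * (deriv η t : ℝ) + B t * η t)) + A 0 * η 0 = 0) {t : ℝ} (ht : 0 < t) :
    HasDerivAt A (B t) t := by
  have cm : Continuous fun s : ℝ => max s 0 := by fun_prop
  have cA' : Continuous fun s => A (max s 0) :=
    cA.comp_continuous cm fun s => le_max_right s 0
  have cB' : Continuous fun s => B (max s 0) :=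
    cB.comp_continuous cm fun s => le_max_right s 0
  set g : ℝ → ℂ := (Ioi 0).indicator fun s => B (max s 0) with hg
  have lg : LocallyIntegrable g := cB'.locallyIntegrable.indicator measurableSet_Ioi
  have loc : ∀ {f : ℝ → ℂ} {θ : ℝ → ℝ}, LocallyIntegrable f → Continuous θ → HasCompactSupport θ →
      Integrable fun z => f z * θ z := fun {f θ} hf hθ sθ => by
    have := hf.integrable_smul_right_of_hasCompactSupport
      (Complex.continuous_ofReal.comp hθ) (sθ.comp_left Complex.ofReal_zero)
    exact this
  have hw : ∀ η : ℝ → ℝ, ContDiff ℝ ∞ η → HasCompactSupport η →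
      ∫ s, A (max s 0) * (deriv η s : ℝ) = -∫ s, g s * η s := fun η hη sη => by
    have cη' : Continuous (deriv η) := hη.continuous_deriv (by exact_mod_cast le_top)
    have i1 := loc cA'.locallyIntegrable cη' sη.deriv
    have i2 := loc cB'.locallyIntegrable hη.continuous sη
    have e1 : ∫ s in Iic 0, A (max s 0) * (deriv η s : ℝ) = A 0 * η 0 := by
      rw [← sη.integral_Iic_deriv_eq (hη.of_le (by exact_mod_cast le_top)) 0, ← integral_complex_ofReal,
        ← integral_const_mul]
      refine setIntegral_congr_fun measurableSet_Iic fun s hs => ?_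
      rw [max_eq_right (mem_Iic.1 hs)]
    have e2 : ∫ s, g s * η s = ∫ s in Ioi 0, B (max s 0) * η s := by
      rw [← integral_indicator measurableSet_Ioi]
      refine integral_congr_ae (Eventually.of_forall fun s => ?_)
      simp only [hg, indicator]
      split_ifs <;> simp
    have e3 : ∫ s in Ioi 0, (A s * (deriv η s : ℝ) + B s * η s) =
        ∫ s in Ioi 0, (A (max s 0) * (deriv η s : ℝ) + B (max s 0) * η s) :=
      setIntegral_congr_fun measurableSet_Ioi fun s hs => by
        rw [max_eq_left (mem_Ioi.1 hs).le]
    have h0 := h η hη sη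
    rw [e3, integral_add i1.integrableOn i2.integrableOn] at h0
    rw [← intervalIntegral.integral_Iic_add_Ioi i1.integrableOn i1.integrableOn (b := 0), e1, e2]
    linear_combination h0
  have inc : ∀ s, 0 < s → A s = A 0 + ∫ r in (0 : ℝ)..s, B (max r 0) := fun s hs => by
    have c1 : Continuous fun y => A (max (y + s) 0) - A (max y 0) :=
      (cA'.comp (by fun_prop : Continuous fun y : ℝ => y + s)).sub cA'
    have h1 := (c1.ae_eq_iff_eq volume (continuous_window lg hs.le)).1
      (increment_ae cA'.locallyIntegrable lg hw hs)
    have h2 := congrFun h1 0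
    simp only [zero_add, max_self] at h2
    rw [max_eq_left hs.le, setIntegral_congr_fun measurableSet_Ioc (g := fun s => B (max s 0))
      (fun r hr => indicator_of_mem (mem_Ioi.2 hr.1) _)] at h2
    rw [intervalIntegral.integral_of_le hs.le, ← h2]
    ring
  have h3 : HasDerivAt (fun s => A 0 + ∫ r in (0 : ℝ)..s, B (max r 0)) (B (max t 0)) t :=
    (intervalIntegral.integral_hasDerivAt_right (cB'.intervalIntegrable _ _)
      cB'.aestronglyMeasurable.stronglyMeasurableAtFilter cB'.continuousAt).const_add _
  rw [max_eq_left ht.le] at h3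
  refine h3.congr_of_eventuallyEq ?_
  filter_upwards [Ioi_mem_nhds ht] with s hs using inc s hs

namespace IsSolution

variable {σ ν : ℝ} {u : ℝ → ℝ} {fin : Dom → ℝ} {f : ℝ → Dom → ℝ}

theorem locallyIntegrable_initial (hf : IsSolution σ ν u fin f) : LocallyIntegrable fin :=
  (hf.locInt_slice 0 le_rfl).congr hf.initial

/-- The operator acting on a test function of `y` in the equation for the mode `l`. -/
def modeOp (σ ν : ℝ) (u : ℝ → ℝ) (l : ℤ) (ψ : ℝ → ℝ) (y : ℝ) : ℂ :=
  ν * iteratedDeriv 2 ψ y - Complex.I * l * u y * ψ y - ν * σ * l ^ 2 * ψ y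

theorem continuous_modeOp (cu : Continuous u) (l : ℤ) {ψ : ℝ → ℝ} (hψ : ContDiff ℝ ∞ ψ) :
    Continuous (modeOp σ ν u l ψ) := by
  have cψ := hψ.continuous
  have cψ2 : Continuous (iteratedDeriv 2 ψ) :=
    hψ.continuous_iteratedDeriv 2 (WithTop.coe_le_coe.2 le_top)
  unfold modeOp
  fun_prop

theorem modeOp_eq_zero {l : ℤ} {ψ : ℝ → ℝ} {y : ℝ} (hy : y ∉ tsupport ψ) :
    modeOp σ ν u l ψ y = 0 := by
  have h2 : iteratedDeriv 2 ψ y = 0 := by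
    rw [iteratedDeriv_two]
    exact image_eq_zero_of_notMem_tsupport fun h =>
      hy (tsupport_deriv_subset (tsupport_deriv_subset h))
  rw [modeOp, h2, image_eq_zero_of_notMem_tsupport hy]
  simp

theorem hasCompactSupport_modeOp {l : ℤ} {ψ : ℝ → ℝ} (sψ : HasCompactSupport ψ) :
    HasCompactSupport (modeOp σ ν u l ψ) :=
  HasCompactSupport.intro sψ.isCompact fun _ hy => modeOp_eq_zero hy

/-- The equation is tested with `L(η e^{-ilx})ψ`; compact supports in `t` and `y` make all integrals
absolutely convergent, so the integral over `x` can be done first. -/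
theorem weak_mode (hf : IsSolution σ ν u fin f) (cu : Continuous u) (l : ℤ) {η ψ : ℝ → ℝ}
    (hη : ContDiff ℝ ∞ η) (sη : HasCompactSupport η) (hψ : ContDiff ℝ ∞ ψ)
    (sψ : HasCompactSupport ψ) :
    (∫ t in Ioi 0, ∫ y, xCoeff (f t) l y * ((deriv η t : ℝ) * ψ y + η t * modeOp σ ν u l ψ y)) +
      ∫ y, xCoeff fin l y * (η 0 * ψ y) = 0 := by
  have cψ := hψ.continuous
  have cη := hη.continuous
  have cη' : Continuous (deriv η) := hη.continuous_deriv (by exact_mod_cast le_top)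
  have cop := continuous_modeOp (σ := σ) (ν := ν) cu l hψ
  set Θ : ℝ → ℝ → ℂ := fun t y => (deriv η t : ℝ) * ψ y + η t * modeOp σ ν u l ψ y with hΘ
  have cΘ : ∀ t, Continuous (Θ t) := fun t => by simp only [hΘ]; fun_prop
  have Θ0 : ∀ t y, y ∉ tsupport ψ → Θ t y = 0 := fun t y hy => by
    simp only [hΘ]
    rw [modeOp_eq_zero hy, image_eq_zero_of_notMem_tsupport hy]
    simp
  have Θ0' : ∀ t y, t ∉ tsupport η → Θ t y = 0 := fun t y ht => by
    simp only [hΘ]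
    rw [image_eq_zero_of_notMem_tsupport ht,
      image_eq_zero_of_notMem_tsupport fun h => ht (tsupport_deriv_subset h)]
    simp
  have sΘ : ∀ t, HasCompactSupport (Θ t) := fun t =>
    HasCompactSupport.intro sψ.isCompact fun y hy => Θ0 t y hy
  set Z : ℝ × Dom → ℂ := fun q => (f q.1 q.2 : ℂ) * (fourier (-l) q.2.1 * Θ q.1 q.2.2) with hZ
  have iZ : IntegrableOn Z (Ioi (0 : ℝ) ×ˢ univ) := by
    set K : Set (ℝ × Dom) := (tsupport η ∩ Ici 0) ×ˢ (univ ×ˢ tsupport ψ) with hK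
    have kK : IsCompact K := (sη.isCompact.inter_right isClosed_Ici).prod
      (isCompact_univ.prod sψ.isCompact)
    have i1 : IntegrableOn (fun q : ℝ × Dom => f q.1 q.2) K :=
      hf.locInt.integrableOn_compact_subset (fun q hq => ⟨hq.1.2, mem_univ _⟩) kK
    have cG : Continuous fun q : ℝ × Dom => fourier (-l) q.2.1 * Θ q.1 q.2.2 := by
      simp only [hΘ]; fun_prop
    have i2 : IntegrableOn Z K := by
      have i1' : IntegrableOn (fun q : ℝ × Dom => (f q.1 q.2 : ℂ)) K := i1.ofReal
      exact i1'.mul_continuousOn cG.continuousOn kK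
    refine i2.of_forall_sdiff_eq_zero (measurableSet_Ioi.prod MeasurableSet.univ) fun q hq => ?_
    have h1 : Θ q.1 q.2.2 = 0 := by
      by_cases h : q.1 ∈ tsupport η
      · exact Θ0 _ _ fun h' => hq.2 ⟨⟨h, (mem_Ioi.1 hq.1.1).le⟩, mem_univ _, h'⟩
      · exact Θ0' _ _ h
    simp only [hZ, h1, mul_zero]
  obtain ⟨i0, e0⟩ := integral_dom_mul hf.locallyIntegrable_initial l
    (χ := fun y => (η 0 : ℂ) * ψ y) (by fun_prop) (sψ.comp_left Complex.ofReal_zero).mul_left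
  have eZ : ∫ q in Ioi (0 : ℝ) ×ˢ univ, Z q = (2 * π : ℝ) *
      ∫ t in Ioi 0, ∫ y, xCoeff (f t) l y * Θ t y := by
    have := setIntegral_prod (μ := volume) (ν := (volume : Measure Dom)) Z iZ
    refine this.trans ?_
    rw [← integral_const_mul]
    refine setIntegral_congr_fun measurableSet_Ioi fun t ht => ?_
    simp only [Measure.restrict_univ, hZ]
    exact (integral_dom_mul (hf.locInt_slice t (le_of_lt ht)) l (cΘ t) (sΘ t)).2
  have key : (∫ q in Ioi (0 : ℝ) ×ˢ univ, Z q) +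
      ∫ p, (fin p : ℂ) * (fourier (-l) p.1 * ((η 0 : ℂ) * ψ p.2)) = 0 := by
    refine eq_zero_of_clm fun L => ?_
    rw [map_add, ← L.integral_comp_comm iZ, ← L.integral_comp_comm i0]
    have h := hf.weak _ (isSpaceTimeTest_mode L (-l) hη sη hψ sψ)
    refine Eq.trans ?_ h
    congr 1
    · refine integral_congr_ae (Eventually.of_forall fun q => ?_)
      have d1 : deriv (fun s => mode L (-l) (η s : ℂ) ψ q.2) q.1 =
          mode L (-l) ((deriv η q.1 : ℝ) : ℂ) ψ q.2 :=
        ((L.hasFDerivAt.comp_hasDerivAt q.1 ((((hη.differentiable (by simp)) q.1).hasDerivAt.ofReal_comp).mul_const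
          (fourier (-l) q.2.1 : ℂ))).mul_const (ψ q.2.2)).deriv
      have hψ1 : ContDiff ℝ ∞ (deriv ψ) := (contDiff_infty_iff_deriv.1 hψ).2
      simp only
      rw [d1, dX_mode, dX_mode, dY_mode _ _ _ (hψ.differentiable (by simp)),
        dY_mode _ _ _ (hψ1.differentiable (by simp)), ← iteratedDeriv_two]
      simp only [mode, hZ, hΘ, modeOp]
      have e : (f q.1 q.2 : ℂ) * (fourier (-l) q.2.1 * ((deriv η q.1 : ℝ) * ψ q.2.2 + η q.1 *
          (ν * iteratedDeriv 2 ψ q.2.2 - Complex.I * l * u q.2.2 * ψ q.2.2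
            - ν * σ * l ^ 2 * ψ q.2.2))) =
        ((f q.1 q.2 * ψ q.2.2 : ℝ) : ℂ) * (((deriv η q.1 : ℝ) : ℂ) * fourier (-l) q.2.1) +
        ((f q.1 q.2 * u q.2.2 * ψ q.2.2 : ℝ) : ℂ) *
          (Complex.I * ((-l : ℤ) : ℂ) * (η q.1 : ℂ) * fourier (-l) q.2.1) +
        ((f q.1 q.2 * ν * σ * ψ q.2.2 : ℝ) : ℂ) *
          (Complex.I * ((-l : ℤ) : ℂ) * (Complex.I * ((-l : ℤ) : ℂ) * (η q.1 : ℂ)) * fourier (-l) q.2.1) +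
        ((f q.1 q.2 * ν * iteratedDeriv 2 ψ q.2.2 : ℝ) : ℂ) *
          ((η q.1 : ℂ) * fourier (-l) q.2.1) := by
        push_cast
        linear_combination (-(f q.1 q.2 : ℂ) * ν * σ * ψ q.2.2 * l ^ 2 * η q.1 *
          fourier (-l) q.2.1) * Complex.I_sq
      rw [e]
      simp only [map_add, clm_ofReal_mul]
      ring
    · refine integral_congr_ae (Eventually.of_forall fun p => ?_)
      simp only [mode]
      rw [clm_ofReal_mul, show (fourier (-l) p.1 : ℂ) * ((η 0 : ℂ) * ψ p.2) =
        (ψ p.2 : ℂ) * ((η 0 : ℂ) * fourier (-l) p.1) by ring, clm_ofReal_mul]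
      ring
  rw [eZ, e0, ← mul_add] at key
  exact (mul_eq_zero.1 key).resolve_left (Complex.ofReal_ne_zero.2 (by positivity))

end IsSolution

/-! ### The modes as curves in `L²` -/

theorem lintegral_sq_eq (F : Dom → ℝ) :
    ∫⁻ p, ENNReal.ofReal (F p ^ 2) = eLpNorm F 2 volume ^ 2 := by
  rw [eLpNorm_eq_lintegral_rpow_enorm_toReal two_ne_zero ENNReal.ofNat_ne_top, ← ENNReal.rpow_natCast,
    ← ENNReal.rpow_mul]
  simp only [ENNReal.toReal_ofNat, Nat.cast_ofNat, one_div, ne_eq, OfNat.ofNat_ne_zero,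
    not_false_eq_true, inv_mul_cancel₀, ENNReal.rpow_one]
  refine lintegral_congr fun p => ?_
  rw [← sq_abs, ENNReal.ofReal_pow (abs_nonneg _), ← Real.norm_eq_abs, ofReal_norm, ENNReal.rpow_ofNat]

theorem eLpNorm_xCoeff_le {F : Dom → ℝ} (hF : AEStronglyMeasurable F) (l : ℤ) :
    eLpNorm (xCoeff F l) 2 volume ≤ eLpNorm F 2 volume := by
  have h := wInt_xCoeff_le hF l
  rw [wInt_one_eq, lintegral_sq_eq] at h
  refine (ENNReal.pow_le_pow_left_iff two_ne_zero).1 (h.trans ?_)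
  refine mul_le_of_le_one_left' ?_
  rw [ENNReal.ofReal_le_one]
  exact inv_le_one_of_one_le₀ (by linarith [Real.pi_gt_three])

open Classical in
/-- The Fourier mode of a time dependent function, as an element of `L²`. -/
def modeL2 (f : ℝ → Dom → ℝ) (l : ℤ) (t : ℝ) : L2 :=
  if h : MemLp (xCoeff (f t) l) 2 then h.toLp else 0

namespace IsSolution

variable {σ ν : ℝ} {u : ℝ → ℝ} {fin : Dom → ℝ} {f : ℝ → Dom → ℝ}

theorem memLp_xCoeff (hf : IsSolution σ ν u fin f) {l : ℤ} (hl : l ≠ 0) {t : ℝ} (ht : 0 ≤ t) :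
    MemLp (xCoeff (f t) l) 2 := by
  have h := hf.memLp t ht
  rw [← xCoeff_nonzeroPart _ hl]
  exact ⟨aestronglyMeasurable_xCoeff h.1 l, (eLpNorm_xCoeff_le h.1 l).trans_lt h.2⟩

theorem modeL2_eq (hf : IsSolution σ ν u fin f) {l : ℤ} (hl : l ≠ 0) {t : ℝ} (ht : 0 ≤ t) :
    modeL2 f l t = (hf.memLp_xCoeff hl ht).toLp := dif_pos (hf.memLp_xCoeff hl ht)

theorem coeFn_modeL2 (hf : IsSolution σ ν u fin f) {l : ℤ} (hl : l ≠ 0) {t : ℝ} (ht : 0 ≤ t) :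
    modeL2 f l t =ᵐ[volume] xCoeff (f t) l := by
  rw [hf.modeL2_eq hl ht]
  exact MemLp.coeFn_toLp _

/-- Bessel's inequality applied to differences; only the nonzero part of `f` enters because `l ≠ 0`.
-/
theorem continuousOn_modeL2 (hf : IsSolution σ ν u fin f) {l : ℤ} (hl : l ≠ 0) :
    ContinuousOn (modeL2 f l) (Ici 0) := by
  intro t₀ ht₀
  rw [ContinuousWithinAt, tendsto_iff_edist_tendsto_0]
  refine tendsto_of_tendsto_of_tendsto_of_le_of_le' tendsto_const_nhds (hf.continuous t₀ ht₀)
    (Eventually.of_forall fun _ => zero_le) ?_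
  filter_upwards [self_mem_nhdsWithin] with t ht
  have m := fun t (ht : t ∈ Ici (0 : ℝ)) => hf.memLp t ht
  have loc := fun t ht => (m t ht).locallyIntegrable (by norm_num)
  rw [hf.modeL2_eq hl ht, hf.modeL2_eq hl ht₀, Lp.edist_toLp_toLp]
  refine le_trans (le_of_eq (eLpNorm_congr_ae ?_)) (eLpNorm_xCoeff_le ((m t ht).1.sub (m t₀ ht₀).1) l)
  filter_upwards [xCoeff_sub (loc t ht) (loc t₀ ht₀) l] with y hy
  rw [hy, xCoeff_nonzeroPart _ hl, xCoeff_nonzeroPart _ hl, Pi.sub_apply]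

theorem hasDerivAt_modeL2 (hf : IsSolution σ ν u fin f) (cu : Continuous u) {l : ℤ} (hl : l ≠ 0)
    {ψ : ℝ → ℝ} (hψ : ContDiff ℝ ∞ ψ) (sψ : HasCompactSupport ψ) {t : ℝ} (ht : 0 < t) :
    HasDerivAt (fun s => ∫ y, modeL2 f l s y * ψ y) (∫ y, modeL2 f l t y * modeOp σ ν u l ψ y) t := by
  have cψ := hψ.continuous
  have m1 : MemLp (fun y => (ψ y : ℂ)) 2 :=
    memLp_of_continuous (by fun_prop) (sψ.comp_left Complex.ofReal_zero)
  have m2 : MemLp (modeOp σ ν u l ψ) 2 :=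
    memLp_of_continuous (continuous_modeOp cu l hψ) (hasCompactSupport_modeOp sψ)
  obtain ⟨L₁, hL₁⟩ := exists_pairing m1
  obtain ⟨L₂, hL₂⟩ := exists_pairing m2
  have cm := hf.continuousOn_modeL2 hl
  refine hasDerivAt_of_weak (A := fun s => ∫ y, modeL2 f l s y * ψ y)
    (B := fun s => ∫ y, modeL2 f l s y * modeOp σ ν u l ψ y) ?_ ?_ (fun η hη sη => ?_) ht
  · simp only [← hL₁]
    exact L₁.continuous.comp_continuousOn cm
  · simp only [← hL₂]
    exact L₂.continuous.comp_continuousOn cm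
  · refine Eq.trans ?_ (hf.weak_mode cu l hη sη hψ sψ)
    congr 1
    · refine setIntegral_congr_fun measurableSet_Ioi fun s hs => ?_
      have i1 := (integrable_mul_of_memLp m1 (modeL2 f l s)).mul_const ((deriv η s : ℝ) : ℂ)
      have i2 := (integrable_mul_of_memLp m2 (modeL2 f l s)).mul_const (η s : ℂ)
      rw [← integral_mul_const, ← integral_mul_const, ← integral_add i1 i2]
      refine integral_congr_ae ?_
      filter_upwards [hf.coeFn_modeL2 hl (mem_Ioi.1 hs).le] with y hy
      rw [hy]
      ring
    · rw [← integral_mul_const]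
      refine integral_congr_ae ?_
      filter_upwards [hf.coeFn_modeL2 hl le_rfl, xCoeff_congr hf.initial l] with y h1 h2
      rw [h1, h2]
      ring

/-- After removing the damping in `x` and rescaling time, a Fourier mode is a weak solution of the
hypoelliptic equation for the first mode. -/
theorem exists_isWeakSol (hf : IsSolution σ ν u fin f) (cu : Continuous u) (hσ : 0 ≤ σ) (hν : 0 ≤ ν)
    {k : ℕ} (hk : 1 ≤ k) :
    ∃ h : ℝ → L2, IsWeakSol (ν * (k : ℝ)⁻¹) u h ∧ h 0 =ᵐ[volume] xCoeff fin k ∧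
      ∀ t, 0 ≤ t → ∃ r : ℝ, 0 ≤ r ∧ r ≤ 1 ∧
        xCoeff (f t) k =ᵐ[volume] fun y => (r : ℂ) * h (k * t) y := by
  have hl : (k : ℤ) ≠ 0 := by exact_mod_cast (by omega : k ≠ 0)
  have hk0 : (0 : ℝ) < k := by exact_mod_cast hk
  have hkc : (k : ℂ) ≠ 0 := by exact_mod_cast hk0.ne'
  -- In rescaled time `s = kt` the damping `exp(-νσk²t)` is `exp(-νσks)`, and `E` is its inverse.
  set E : ℝ → ℝ := fun s => exp (ν * σ * k * s) with hE
  have cE : Continuous E := by fun_prop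
  have hE' : ∀ s, HasDerivAt E (E s * (ν * σ * k)) s := fun s => by
    simpa using ((hasDerivAt_id s).const_mul (ν * σ * k)).exp
  refine ⟨fun s => E s • modeL2 f k (s / k), ⟨?_, ?_⟩, ?_, ?_⟩
  · refine cE.continuousOn.smul ((hf.continuousOn_modeL2 hl).comp (by fun_prop) fun s hs => ?_)
    exact div_nonneg hs hk0.le
  · intro ψ hψ sψ t ht
    have cψ := hψ.continuous
    have cψ2 : Continuous (iteratedDeriv 2 ψ) :=
      hψ.continuous_iteratedDeriv 2 (WithTop.coe_le_coe.2 le_top)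
    have sψ2 : HasCompactSupport (iteratedDeriv 2 ψ) := by
      rw [iteratedDeriv_two]; exact sψ.deriv.deriv
    have m1 : MemLp (fun y => (ψ y : ℂ)) 2 :=
      memLp_of_continuous (by fun_prop) (sψ.comp_left Complex.ofReal_zero)
    have m2 : MemLp (fun y => ((ν * (k : ℝ)⁻¹ : ℝ) : ℂ) * iteratedDeriv 2 ψ y
        - Complex.I * u y * ψ y) 2 :=
      memLp_of_continuous (by fun_prop)
        ((HasCompactSupport.mul_left (sψ2.comp_left Complex.ofReal_zero)).sub
          (HasCompactSupport.mul_left (sψ.comp_left Complex.ofReal_zero)))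
    have out : ∀ {θ : ℝ → ℂ}, MemLp θ 2 → ∀ (c : ℝ) (w : L2),
        ∫ y, (c • w : L2) y * θ y = c * ∫ y, w y * θ y := fun {θ} hθ c w => by
      obtain ⟨L, hL⟩ := exists_pairing hθ
      rw [← hL, ← hL]
      exact ((L.restrictScalars ℝ).map_smul c w).trans (Complex.real_smul ..)
    simp only [out m1, out m2]
    have h1 := hf.hasDerivAt_modeL2 cu hl hψ sψ (div_pos ht hk0)
    have h2 := h1.scomp t ((hasDerivAt_id t).div_const (k : ℝ))
    have h3 := (hE' t).ofReal_comp.mul h2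
    refine h3.congr_deriv ?_
    have e : ∫ y, modeL2 f k (t / k) y * modeOp σ ν u k ψ y =
        k * (∫ y, modeL2 f k (t / k) y * (((ν * (k : ℝ)⁻¹ : ℝ) : ℂ) * iteratedDeriv 2 ψ y
          - Complex.I * u y * ψ y)) - ν * σ * k ^ 2 * ∫ y, modeL2 f k (t / k) y * ψ y := by
      rw [← integral_const_mul, ← integral_const_mul, ← integral_sub
        ((integrable_mul_of_memLp m2 _).const_mul _) ((integrable_mul_of_memLp m1 _).const_mul _)]
      refine integral_congr_ae (Eventually.of_forall fun y => ?_)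
      simp only [modeOp]
      push_cast
      field_simp
    simp only [Function.comp_apply, id]
    rw [e]
    generalize (∫ y, modeL2 f k (t / k) y * (((ν * (k : ℝ)⁻¹ : ℝ) : ℂ) * iteratedDeriv 2 ψ y
          - Complex.I * u y * ψ y)) = a
    generalize (∫ y, modeL2 f k (t / k) y * ψ y) = b
    rw [Complex.real_smul]
    push_cast
    field_simp
    ring
  · simp only [hE, mul_zero, exp_zero, one_smul, zero_div]
    exact (hf.coeFn_modeL2 hl le_rfl).trans (xCoeff_congr hf.initial _)
  · intro t ht
    refine ⟨exp (-(ν * σ * k * (k * t))), (exp_pos _).le, ?_, ?_⟩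
    · rw [exp_le_one_iff, neg_nonpos]
      positivity
    · filter_upwards [hf.coeFn_modeL2 hl ht, Lp.coeFn_smul (E (k * t)) (modeL2 f k t)] with y h1 h2
      rw [mul_div_cancel_left₀ _ hk0.ne', h2, Pi.smul_apply, h1, Complex.real_smul, ← mul_assoc,
        ← Complex.ofReal_mul, hE, ← exp_add, neg_add_cancel, exp_zero, Complex.ofReal_one, one_mul]

end IsSolution

/-! ### Bands -/

theorem band_eq {k : ℕ} (hk : 1 ≤ k) (g : Dom → ℝ) (p : Dom) :
    band k g p = 2 * (xCoeff g k p.2 * fourier k p.1).re := by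
  have hne : (k : ℤ) ≠ -(k : ℤ) := by omega
  rw [band, Finset.sum_pair hne, xCoeff_neg, fourier_neg, ← map_mul, Complex.add_re, Complex.conj_re]
  ring

theorem aestronglyMeasurable_band {k : ℕ} (hk : 1 ≤ k) {g : Dom → ℝ} (hg : AEStronglyMeasurable g) :
    AEStronglyMeasurable (band k g) := by
  have e : band k g = fun p : Dom => 2 * (xCoeff g k p.2 * fourier k p.1).re :=
    funext (band_eq hk g)
  rw [e]
  have h1 : AEStronglyMeasurable fun p : Dom => xCoeff g k p.2 :=
    (aestronglyMeasurable_xCoeff hg k).comp_snd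
  have h2 : AEStronglyMeasurable fun p : Dom => xCoeff g k p.2 * fourier k p.1 :=
    h1.mul ((fourier (k : ℤ)).continuous.comp continuous_fst).aestronglyMeasurable
  exact (Complex.continuous_re.comp_aestronglyMeasurable h2).const_mul 2

theorem integral_mul_fourier {l : ℤ} (hl : l ≠ 0) (c : ℂ) : ∫ x : Circ, c * fourier l x = 0 := by
  rw [integral_const_mul, integral_fourier_eq_zero hl, mul_zero]

theorem integrable_const_mul_fourier (c : ℂ) (l : ℤ) : Integrable fun x : Circ => c * fourier l x :=
  (continuous_const.mul (fourier l).continuous).integrable_of_hasCompactSupport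
    (HasCompactSupport.of_compactSpace _)

/-- `(2 Re z)² = 2|z|² + 2 Re z²`, and the square of the mode `l` is the mode `2l`, with mean zero.
-/
theorem integral_sq_band {l : ℤ} (hl : l ≠ 0) (c : ℂ) :
    ∫ x : Circ, (2 * (c * fourier l x).re) ^ 2 = 4 * π * ‖c‖ ^ 2 := by
  have e : ∀ x : Circ, (2 * (c * fourier l x).re) ^ 2 =
      2 * ‖c‖ ^ 2 + 2 * (c ^ 2 * fourier (2 * l) x).re := fun x => by
    have h1 : c ^ 2 * fourier (2 * l) x = (c * fourier l x) ^ 2 := by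
      rw [two_mul l, fourier_add]; ring
    have h2 : ‖c‖ ^ 2 = ‖c * fourier l x‖ ^ 2 := by rw [norm_mul, norm_fourier_apply, mul_one]
    rw [h1, h2]
    generalize c * fourier l x = z
    rw [Complex.sq_norm, Complex.normSq_apply, sq z, Complex.mul_re]
    ring
  have hi := integrable_const_mul_fourier (c ^ 2) (2 * l)
  have h3 : ∫ x : Circ, (c ^ 2 * fourier (2 * l) x).re = 0 := by
    have := Complex.reCLM.integral_comp_comm hi
    simp only [Complex.reCLM_apply] at this
    rw [this, integral_mul_fourier (by omega), Complex.zero_re]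
  simp only [e]
  have i2 : Integrable fun x : Circ => 2 * (c ^ 2 * fourier (2 * l) x).re := hi.re.const_mul 2
  rw [integral_add (integrable_const _) i2, integral_const_mul, integral_const_mul, h3, integral_const,
    smul_eq_mul, Measure.real, AddCircle.measure_univ, ENNReal.toReal_ofReal Real.two_pi_pos.le]
  ring

theorem lintegral_sq_band {l : ℤ} (hl : l ≠ 0) (c : ℂ) :
    ∫⁻ x : Circ, ENNReal.ofReal ((2 * (c * fourier l x).re) ^ 2) =
      ENNReal.ofReal (4 * π * ‖c‖ ^ 2) := by
  rw [← integral_sq_band hl c, ofReal_integral_eq_lintegral_ofReal]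
  · exact Continuous.integrable_of_hasCompactSupport (by fun_prop) (HasCompactSupport.of_compactSpace _)
  · exact Eventually.of_forall fun x => sq_nonneg _

theorem weightedNorm_sq (u : ℝ → ℝ) (g : Dom → ℝ) :
    weightedNorm u g ^ 2 =
      eLpNorm g 2 volume ^ 2 + eLpNorm (fun p : Dom => deriv u p.2 * g p) 2 volume ^ 2 := by
  rw [weightedNorm, ← ENNReal.rpow_natCast, ← ENNReal.rpow_mul]
  norm_num

/-- The two parts of the norm combine into the weight `1 + u'²`, which depends on `y` alone, so
Tonelli's theorem reduces to `integral_sq_band`. -/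
theorem weightedNorm_band {k : ℕ} (hk : 1 ≤ k) {u : ℝ → ℝ} (cu' : Continuous (deriv u)) {g : Dom → ℝ}
    (hg : AEStronglyMeasurable g) :
    weightedNorm u (band k g) ^ 2 = ENNReal.ofReal (4 * π) * wInt (fullWeight u) (xCoeff g k) := by
  have mb := aestronglyMeasurable_band hk hg
  have m1 : AEMeasurable fun p : Dom => ENNReal.ofReal (band k g p ^ 2) :=
    (mb.aemeasurable.pow_const 2).ennreal_ofReal
  have m2 : AEMeasurable fun p : Dom => ENNReal.ofReal (fullWeight u p.2 * band k g p ^ 2) := by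
    have : Continuous fun p : Dom => fullWeight u p.2 := by unfold fullWeight; fun_prop
    exact (this.aemeasurable.mul (mb.aemeasurable.pow_const 2)).ennreal_ofReal
  rw [weightedNorm_sq, ← lintegral_sq_eq, ← lintegral_sq_eq, ← lintegral_add_left' m1]
  have e : ∀ p : Dom, ENNReal.ofReal (band k g p ^ 2) + ENNReal.ofReal ((deriv u p.2 * band k g p) ^ 2)
      = ENNReal.ofReal (fullWeight u p.2 * band k g p ^ 2) := fun p => by
    rw [← ENNReal.ofReal_add (sq_nonneg _) (sq_nonneg _), fullWeight]
    congr 1; ring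
  simp only [e]
  rw [volume_dom, lintegral_prod_symm _ m2, wInt, ← lintegral_const_mul' _ _ ENNReal.ofReal_ne_top]
  refine lintegral_congr fun y => ?_
  simp only [band_eq hk, ENNReal.ofReal_mul (fullWeight_nonneg u y)]
  rw [lintegral_const_mul' _ _ ENNReal.ofReal_ne_top,
    lintegral_sq_band (by exact_mod_cast (by omega : k ≠ 0)), ENNReal.ofReal_mul (by positivity)]
  ring

theorem xCoeff_band {k : ℕ} (hk : 1 ≤ k) (g : Dom → ℝ) : xCoeff (band k g) k = xCoeff g k := by
  funext y
  rw [xCoeff_eq]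
  set c := xCoeff g k y with hc
  have e : ∀ x : Circ, fourier (-(k : ℤ)) x * (band k g (x, y) : ℂ) =
      c * fourier 0 x + starRingEnd ℂ c * fourier (-(2 * k : ℤ)) x := fun x => by
    rw [ofReal_band, Finset.sum_pair (by omega), xCoeff_neg]
    simp only
    rw [← hc, mul_add, show (0 : ℤ) = -k + k by ring, fourier_add,
      show (-(2 * k : ℤ)) = -k + -k by ring, fourier_add]
    ring
  simp only [e]
  rw [integral_add (integrable_const_mul_fourier _ _) (integrable_const_mul_fourier _ _),
    integral_mul_fourier (l := -(2 * k : ℤ)) (by omega), add_zero, integral_const_mul,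
    integral_fourier_zero, mul_comm c,
    ← mul_assoc, ← Complex.ofReal_mul, inv_mul_cancel₀ (by positivity), Complex.ofReal_one, one_mul]

/-! ### Fourier coefficients of test functions -/

/-- The covering map from `ℝ × ℝ` is a quotient map. -/
theorem continuous_of_lift {X : Type*} [TopologicalSpace X] {φ : Dom → X}
    (h : Continuous fun q : ℝ × ℝ => φ ((q.1 : Circ), q.2)) : Continuous φ := by
  have hq : IsOpenQuotientMap fun q : ℝ × ℝ => (((q.1 : Circ), q.2) : Dom) :=
    QuotientAddGroup.isOpenQuotientMap_mk.prodMap IsOpenQuotientMap.id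
  exact hq.isQuotientMap.continuous_iff.2 h

namespace IsTest

variable {φ : Dom → ℝ}

theorem hasDerivAt_lift_x (hφ : IsTest φ) (q : ℝ × ℝ) :
    HasDerivAt (fun s : ℝ => φ ((s : Circ), q.2))
      (fderiv ℝ (fun q : ℝ × ℝ => φ ((q.1 : Circ), q.2)) q (1, 0)) q.1 := by
  have hd : HasFDerivAt (fun q : ℝ × ℝ => φ ((q.1 : Circ), q.2))
      (fderiv ℝ (fun q : ℝ × ℝ => φ ((q.1 : Circ), q.2)) q) ((fun s : ℝ => (s, q.2)) q.1) :=
    ((hφ.1.differentiable (by simp)) q).hasFDerivAt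
  exact hd.comp_hasDerivAt q.1 ((hasDerivAt_id q.1).prodMk (hasDerivAt_const q.1 q.2))

theorem hasDerivAt_lift_y (hφ : IsTest φ) (q : ℝ × ℝ) :
    HasDerivAt (fun s : ℝ => φ ((q.1 : Circ), s))
      (fderiv ℝ (fun q : ℝ × ℝ => φ ((q.1 : Circ), q.2)) q (0, 1)) q.2 := by
  have hd : HasFDerivAt (fun q : ℝ × ℝ => φ ((q.1 : Circ), q.2))
      (fderiv ℝ (fun q : ℝ × ℝ => φ ((q.1 : Circ), q.2)) q) ((fun s : ℝ => (q.1, s)) q.2) :=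
    ((hφ.1.differentiable (by simp)) q).hasFDerivAt
  exact hd.comp_hasDerivAt q.2 ((hasDerivAt_const q.2 q.1).prodMk (hasDerivAt_id q.2))

theorem hasDerivAt_x (hφ : IsTest φ) (q : ℝ × ℝ) :
    HasDerivAt (fun s : ℝ => φ ((s : Circ), q.2)) (dX φ ((q.1 : Circ), q.2)) q.1 := by
  have h1 := hφ.hasDerivAt_lift_x q
  have h2 : HasDerivAt (fun s : ℝ => φ ((q.1 : Circ) + (s : Circ), q.2))
      (fderiv ℝ (fun q : ℝ × ℝ => φ ((q.1 : Circ), q.2)) q (1, 0)) 0 := by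
    have h3 : HasDerivAt (fun s : ℝ => φ ((s : Circ), q.2))
      (fderiv ℝ (fun q : ℝ × ℝ => φ ((q.1 : Circ), q.2)) q (1, 0)) (q.1 + 0) := by rwa [add_zero]
    have := h3.comp_const_add q.1 0
    simpa only [AddCircle.coe_add] using this
  rw [dX, h2.deriv]
  exact h1

theorem hasDerivAt_y (hφ : IsTest φ) (p : Dom) :
    HasDerivAt (fun s : ℝ => φ (p.1, s)) (dY φ p) p.2 := by
  obtain ⟨x, y⟩ := p
  obtain ⟨a, rfl⟩ := QuotientAddGroup.mk_surjective x
  exact (hφ.hasDerivAt_lift_y (a, y)).differentiableAt.hasDerivAt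

theorem continuous (hφ : IsTest φ) : Continuous φ := continuous_of_lift hφ.1.continuous

theorem continuous_dX (hφ : IsTest φ) : Continuous (dX φ) := by
  refine continuous_of_lift ?_
  have e : (fun q : ℝ × ℝ => dX φ ((q.1 : Circ), q.2)) =
      fun q => fderiv ℝ (fun q : ℝ × ℝ => φ ((q.1 : Circ), q.2)) q (1, 0) := funext fun q => by
    exact (hφ.hasDerivAt_x q).unique (hφ.hasDerivAt_lift_x q)
  rw [e]
  exact (hφ.1.continuous_fderiv (by simp)).clm_apply continuous_const

theorem continuous_dY (hφ : IsTest φ) : Continuous (dY φ) := by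
  refine continuous_of_lift ?_
  have e : (fun q : ℝ × ℝ => dY φ ((q.1 : Circ), q.2)) =
      fun q => fderiv ℝ (fun q : ℝ × ℝ => φ ((q.1 : Circ), q.2)) q (0, 1) := funext fun q => by
    exact (hφ.hasDerivAt_y ((q.1 : Circ), q.2)).unique (hφ.hasDerivAt_lift_y q)
  rw [e]
  exact (hφ.1.continuous_fderiv (by simp)).clm_apply continuous_const

theorem exists_support (hφ : IsTest φ) : ∃ R : ℝ, ∀ x y, y ∉ Icc (-R) R → φ (x, y) = 0 ∧ dY φ (x, y) = 0 := by
  obtain ⟨R, hR⟩ := (hφ.2.isCompact.image continuous_snd).isBounded.subset_closedBall 0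
  rw [Real.closedBall_eq_Icc, zero_sub, zero_add] at hR
  have h0 : ∀ x y, y ∉ Icc (-R) R → φ (x, y) = 0 := fun x y hy =>
    image_eq_zero_of_notMem_tsupport fun h => hy (hR ⟨_, h, rfl⟩)
  refine ⟨R, fun x y hy => ⟨h0 x y hy, ?_⟩⟩
  have h1 : (fun s : ℝ => φ (x, s)) =ᶠ[𝓝 y] fun _ => 0 := by
    filter_upwards [isClosed_Icc.isOpen_compl.mem_nhds hy] with s hs using h0 x s hs
  rw [dY, h1.deriv_eq, deriv_const]

theorem hasCompactSupport_dY (hφ : IsTest φ) : HasCompactSupport (dY φ) := by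
  obtain ⟨R, hR⟩ := hφ.exists_support
  exact HasCompactSupport.intro (isCompact_univ.prod (isCompact_Icc (a := -R) (b := R)))
    fun p hp => (hR p.1 p.2 fun h => hp ⟨mem_univ _, h⟩).2

theorem hasCompactSupport_xCoeff (hφ : IsTest φ) (l : ℤ) : HasCompactSupport (xCoeff φ l) := by
  obtain ⟨R, hR⟩ := hφ.exists_support
  refine HasCompactSupport.intro (isCompact_Icc (a := -R) (b := R)) fun y hy => ?_
  rw [xCoeff_eq]
  simp only [(hR _ y hy).1, Complex.ofReal_zero, mul_zero, integral_zero]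

theorem continuous_xCoeff_dY (hφ : IsTest φ) (l : ℤ) : Continuous (xCoeff (dY φ) l) := by
  have e : xCoeff (dY φ) l = fun y => (((2 * π)⁻¹ : ℝ) : ℂ) *
      ∫ x in (univ : Set Circ), fourier (-l) x * (dY φ (x, y) : ℂ) := funext fun y => by
    rw [xCoeff_eq, setIntegral_univ]
  rw [e]
  refine continuous_const.mul (continuous_parametric_integral_of_continuous ?_ isCompact_univ)
  have := hφ.continuous_dY
  simp only [Function.uncurry_def]
  fun_prop

theorem hasDerivAt_xCoeff (hφ : IsTest φ) (l : ℤ) (y : ℝ) :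
    HasDerivAt (xCoeff φ l) (xCoeff (dY φ) l y) y := by
  have e : xCoeff φ l = fun y => (((2 * π)⁻¹ : ℝ) : ℂ) *
      ∫ x : Circ, fourier (-l) x * (φ (x, y) : ℂ) := funext (xCoeff_eq φ l)
  have cφ := hφ.continuous
  have cφ' := hφ.continuous_dY
  have int : ∀ {f : Circ → ℂ}, Continuous f → Integrable f := fun hf =>
    hf.integrable_of_hasCompactSupport (HasCompactSupport.of_compactSpace _)
  obtain ⟨C, hC⟩ := hφ.hasCompactSupport_dY.exists_bound_of_continuous cφ'
  rw [e, xCoeff_eq]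
  refine HasDerivAt.const_mul _ ?_
  refine (hasDerivAt_integral_of_dominated_loc_of_deriv_le (s := univ) (bound := fun _ => C)
    (F := fun y x => fourier (-l) x * (φ (x, y) : ℂ))
    (F' := fun y x => fourier (-l) x * (dY φ (x, y) : ℂ)) univ_mem
    (Eventually.of_forall fun y => (int (by fun_prop)).aestronglyMeasurable) (int (by fun_prop))
    (int (by fun_prop)).aestronglyMeasurable (Eventually.of_forall fun x y _ => ?_)
    (integrable_const C) (Eventually.of_forall fun x y _ => ?_)).2
  · rw [norm_mul, norm_fourier_apply, one_mul, Complex.norm_real]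
    exact hC _
  · exact (hφ.hasDerivAt_y (x, y)).ofReal_comp.const_mul _

theorem xCoeff_dX (hφ : IsTest φ) (l : ℤ) (y : ℝ) :
    xCoeff (dX φ) l y = Complex.I * l * xCoeff φ l y := by
  have cφ := hφ.continuous
  have cφ' := hφ.continuous_dX
  have int : ∀ {f : Circ → ℂ}, Continuous f → Integrable f := fun hf =>
    hf.integrable_of_hasCompactSupport (HasCompactSupport.of_compactSpace _)
  have i1 : Integrable fun x : Circ => fourier (-l) x * (dX φ (x, y) : ℂ) := int (by fun_prop)
  have i2 : Integrable fun x : Circ => fourier (-l) x * (φ (x, y) : ℂ) := int (by fun_prop)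
  have d : ∀ s : ℝ, HasDerivAt (fun s : ℝ => (fourier (-l) (s : Circ) : ℂ) * (φ ((s : Circ), y) : ℂ))
      (-(Complex.I * l) * (fourier (-l) (s : Circ) * (φ ((s : Circ), y) : ℂ)) +
        fourier (-l) (s : Circ) * (dX φ ((s : Circ), y) : ℂ)) s := fun s => by
    have h1 : HasDerivAt (fun s : ℝ => (fourier (-l) (s : Circ) : ℂ))
        (-(Complex.I * l) * fourier (-l) (s : Circ)) s := by
      simp only [fourier_coe]
      have := ((Complex.ofRealCLM.hasDerivAt (x := s)).const_mul (Complex.I * ((-l : ℤ) : ℂ))).cexp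
      refine this.congr_deriv ?_
      push_cast
      simp only [Complex.ofRealCLM_apply, Complex.ofReal_one]
      ring
    refine (h1.mul (hφ.hasDerivAt_x (s, y)).ofReal_comp).congr_deriv ?_
    ring
  have key : ∫ x : Circ, (-(Complex.I * l) * (fourier (-l) x * (φ (x, y) : ℂ)) +
      fourier (-l) x * (dX φ (x, y) : ℂ)) = 0 := by
    rw [← AddCircle.intervalIntegral_preimage (2 * π) 0]
    rw [intervalIntegral.integral_eq_sub_of_hasDerivAt (fun s _ => d s)]
    · rw [zero_add, AddCircle.coe_period, AddCircle.coe_zero, sub_self]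
    · refine Continuous.intervalIntegrable ?_ _ _
      have : Continuous fun s : ℝ => (s : Circ) := AddCircle.continuous_mk' _
      fun_prop
  rw [integral_add (i2.const_mul _) i1, integral_const_mul] at key
  rw [xCoeff_eq, xCoeff_eq]
  linear_combination (((2 * π)⁻¹ : ℝ) : ℂ) * key

/-- For a nonzero mode `|l| ≥ 1`, so `∂_x φ` controls `φ` itself. Duality with `‖∇φ‖ ≤ 1` thus
provides a full `H¹` bound on the coefficient. -/
theorem wInt_bounds (hφ : IsTest φ) (h : ∫⁻ p, ENNReal.ofReal (dX φ p ^ 2 + dY φ p ^ 2) ≤ 1) {l : ℤ}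
    (hl : l ≠ 0) :
    wInt (fun _ => 1) (xCoeff φ l) ≤ ENNReal.ofReal (1 ^ 2) ∧
      wInt (fun _ => 1) (xCoeff (dY φ) l) ≤ ENNReal.ofReal (1 ^ 2) := by
  have hπ : ENNReal.ofReal (2 * π)⁻¹ ≤ 1 := by
    rw [ENNReal.ofReal_le_one]
    exact inv_le_one_of_one_le₀ (by linarith [Real.pi_gt_three])
  rw [one_pow, ENNReal.ofReal_one]
  have b : ∀ F : Dom → ℝ, Continuous F → (∀ p, F p ^ 2 ≤ dX φ p ^ 2 + dY φ p ^ 2) →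
      wInt (fun _ => 1) (xCoeff F l) ≤ 1 := fun F cF hF => by
    refine (wInt_xCoeff_le cF.aestronglyMeasurable l).trans (mul_le_one' hπ (le_trans ?_ h))
    exact lintegral_mono fun p => ENNReal.ofReal_le_ofReal (hF p)
  refine ⟨?_, b _ hφ.continuous_dY fun p => by nlinarith [sq_nonneg (dX φ p)]⟩
  refine le_trans ?_ (b _ hφ.continuous_dX fun p => by nlinarith [sq_nonneg (dY φ p)])
  refine lintegral_mono fun y => ENNReal.ofReal_le_ofReal ?_
  rw [hφ.xCoeff_dX, norm_mul, norm_mul, Complex.norm_I, one_mul, one_mul, one_mul]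
  refine pow_le_pow_left₀ (norm_nonneg _) (le_mul_of_one_le_left (norm_nonneg _) ?_) 2
  rw [Complex.norm_intCast]
  exact_mod_cast Int.one_le_abs hl

/-- Orthogonality in `x`: the band pairs only with the modes `±k` of `φ`, and these two
contributions are conjugate. The factor is `2 · 2π`. -/
theorem integral_band_mul (hφ : IsTest φ) {k : ℕ} (hk : 1 ≤ k) {F : Dom → ℝ}
    (hF : MemLp (xCoeff F k) 2) :
    |∫ p, band k F p * φ p| ≤ 4 * π * ‖∫ y, xCoeff F k y * xCoeff φ (-k) y‖ := by
  obtain ⟨R, hR⟩ := hφ.exists_support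
  have cφ := hφ.continuous
  set c := xCoeff F k with hc
  have ic : Integrable ((Icc (-R) R).indicator c) :=
    ((hF.locallyIntegrable (by norm_num)).integrableOn_isCompact isCompact_Icc).integrable_indicator
      measurableSet_Icc
  have iZ : Integrable fun p : Dom => c p.2 * (fourier (k : ℤ) p.1 * (φ p : ℂ)) := by
    obtain ⟨C, hC⟩ := hφ.2.exists_bound_of_continuous cφ
    have h1 : Integrable fun p : Dom => (1 : ℂ) * (Icc (-R) R).indicator c p.2 :=
      Integrable.mul_prod (integrable_const (μ := (volume : Measure Circ)) (1 : ℂ)) ic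
    have h2 := h1.bdd_mul (c := C) (f := fun p : Dom => fourier (k : ℤ) p.1 * (φ p : ℂ))
      (by fun_prop : Continuous fun p : Dom => (fourier (k : ℤ) p.1 : ℂ) * (φ p : ℂ)).aestronglyMeasurable
      (Eventually.of_forall fun p => by
        rw [norm_mul, norm_fourier_apply, one_mul, Complex.norm_real]; exact hC p)
    refine h2.congr (Eventually.of_forall fun p => ?_)
    simp only
    by_cases hp : p.2 ∈ Icc (-R) R
    · rw [indicator_of_mem hp]; ring
    · rw [indicator_of_notMem hp, show φ p = 0 from (hR p.1 p.2 hp).1]; simp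
  have e1 : ∫ p, band k F p * φ p =
      2 * (∫ p : Dom, c p.2 * (fourier (k : ℤ) p.1 * (φ p : ℂ))).re := by
    have := Complex.reCLM.integral_comp_comm iZ
    simp only [Complex.reCLM_apply] at this
    rw [← this, ← integral_const_mul]
    refine integral_congr_ae (Eventually.of_forall fun p => ?_)
    simp only
    rw [band_eq hk, ← mul_assoc (c p.2), Complex.re_mul_ofReal]
    ring
  have e2 : ∫ p : Dom, c p.2 * (fourier (k : ℤ) p.1 * (φ p : ℂ)) =
      (2 * π : ℝ) * ∫ y, c y * xCoeff φ (-k) y := by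
    rw [volume_dom, integral_prod_symm _ iZ, ← integral_const_mul]
    refine integral_congr_ae (Eventually.of_forall fun y => ?_)
    simp only
    rw [integral_const_mul, xCoeff_eq, neg_neg, mul_left_comm, ← mul_assoc (((2 * π : ℝ)) : ℂ),
      ← Complex.ofReal_mul, mul_inv_cancel₀ (by positivity), Complex.ofReal_one, one_mul]
  rw [e1, e2, abs_mul, abs_two]
  have h3 := Complex.abs_re_le_norm ((2 * π : ℝ) * ∫ y, c y * xCoeff φ (-k) y)
  rw [norm_mul, Complex.norm_real, Real.norm_of_nonneg Real.two_pi_pos.le] at h3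
  linarith

end IsTest

/-! ### Assembly -/

/-- Turns the loss of 256 per window into an exponential, for `x = t/T` and `n` its integer part. It
uses `e < 3`, and `48² = 2304` leaves ample room. -/
theorem inv_pow_floor_le {x : ℝ} {n : ℕ} (h : x ≤ n + 1) :
    8 / (256 : ℝ) ^ n ≤ (48 * exp (-x)) ^ 2 := by
  have h1 : exp (2 * x) ≤ 9 * 256 ^ n := by
    have h2 : exp 1 ^ (2 * (n + 1)) ≤ 3 ^ (2 * (n + 1)) :=
      pow_le_pow_left₀ (exp_pos _).le Real.exp_one_lt_three.le _
    rw [← exp_nat_mul, mul_one] at h2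
    have h3 : exp (2 * x) ≤ exp ((2 * (n + 1) : ℕ) : ℝ) := by
      rw [exp_le_exp]; push_cast; linarith
    have h4 : (3 : ℝ) ^ (2 * (n + 1)) = 9 * 9 ^ n := by rw [pow_mul]; norm_num; ring
    have h5 : (9 : ℝ) ^ n ≤ 256 ^ n := pow_le_pow_left₀ (by norm_num) (by norm_num) n
    linarith
  have h6 : (48 * exp (-x)) ^ 2 = 2304 / exp (2 * x) := by
    rw [mul_pow, ← exp_nat_mul, eq_div_iff (exp_pos _).ne', mul_assoc, ← exp_add]
    norm_num
  rw [h6, div_le_div_iff₀ (by positivity) (exp_pos _)]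
  have h7 : (0 : ℝ) < 256 ^ n := by positivity
  linarith

namespace IsWeakSol

variable {ν U : ℝ} {u : ℝ → ℝ} {h : ℝ → L2}

theorem decay_exp (hh : IsWeakSol ν u h) (hu : IsShear U u) (hU : 1 ≤ U) {M ρ : ℝ}
    (hM : M = 1000000000 * U ^ 4) (hρ : 0 ≤ ρ) (hρ1 : 200000000 * U ^ 4 * ρ ≤ 1) (hν : ν = ρ ^ 3)
    {t : ℝ} (ht : 0 ≤ t) :
    wInt (fullWeight u) (h t) ≤
      ENNReal.ofReal ((48 * exp (-(1 / M * ρ * t))) ^ 2) * wInt (fullWeight u) (h 0) := by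
  have hU0 : 0 < U := by linarith
  have hU4 : 1 ≤ U ^ 4 := one_le_pow₀ hU
  have hU2 : U ^ 2 ≤ U ^ 4 := pow_le_pow_right₀ hU (by norm_num)
  have hM0 : 0 < M := by rw [hM]; positivity
  have hM1 : 1 ≤ M := by rw [hM]; linarith
  -- For `ν = 0` the modulus of the solution is transported unchanged.
  rcases hρ.eq_or_lt with rfl | hρ
  · have hν0 : ν = 0 := by rw [hν]; norm_num
    subst hν0
    have e : wInt (fullWeight u) (h t) = wInt (fullWeight u) (h 0) := by
      rw [wInt_congr (hh.transport hu.continuous ht), wInt, wInt]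
      simp only [norm_phase]
    rw [e]
    refine le_mul_of_one_le_left' ?_
    simp only [mul_zero, zero_mul, neg_zero, exp_zero]
    norm_num
  have hν0 : 0 < ν := by rw [hν]; positivity
  obtain ⟨T, hTdef⟩ : ∃ T, T = M / ρ := ⟨_, rfl⟩
  have hT : 0 < T := by rw [hTdef]; positivity
  have hTρ : T * ρ = M := by rw [hTdef]; field_simp
  have hνT : ν * T ^ 3 = M ^ 3 := by rw [hν, ← hTρ]; ring
  have hM3 : M ≤ M ^ 3 := le_self_pow₀ hM1 (by norm_num)
  have hT1 : 655360 * U ^ 2 ≤ ν * T ^ 3 := by rw [hνT]; linarith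
  have hT2 : 20000000 * U ^ 4 * ν * T ≤ 1 := by
    have h1 : 20000000 * U ^ 4 * ν * T = (200000000 * U ^ 4 * ρ) ^ 2 / 2 := by
      rw [hν, show 20000000 * U ^ 4 * ρ ^ 3 * T = 20000000 * U ^ 4 * ρ ^ 2 * (T * ρ) by ring, hTρ,
        hM]
      ring
    have h2 : (200000000 * U ^ 4 * ρ) ^ 2 ≤ 1 := pow_le_one₀ (by positivity) hρ1
    linarith
  have hx : 1 / M * ρ * t = t / T := by rw [hTdef]; field_simp
  rw [hx]
  -- If the datum has infinite norm the right side is infinite, the exponential factor being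
  -- positive.
  by_cases htop : wInt (fullWeight u) (h 0) = ⊤
  · rw [htop, ENNReal.mul_top (by rw [Ne, ENNReal.ofReal_eq_zero, not_le]; positivity)]
    exact le_top
  obtain ⟨X, hX0, hX⟩ : ∃ X : ℝ, 0 ≤ X ∧ wInt (fullWeight u) (h 0) = ENNReal.ofReal X :=
    ⟨_, ENNReal.toReal_nonneg, (ENNReal.ofReal_toReal htop).symm⟩
  have htn : t / T < ⌊t / T⌋₊ + 1 := Nat.lt_floor_add_one _
  have d := hh.decay_weight hu hU hν0 hT hT1 hT2 hX0 hX.le ⌊t / T⌋₊ (t := t)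
    ⟨by rw [← le_div_iff₀ hT]; exact Nat.floor_le (by positivity),
      by rw [← div_le_iff₀ hT]; exact htn.le⟩
  refine d.trans ?_
  rw [hX, ← ENNReal.ofReal_mul (sq_nonneg _)]
  refine ENNReal.ofReal_le_ofReal ?_
  rw [mul_div_right_comm]
  exact mul_le_mul_of_nonneg_right (inv_pow_floor_le htn.le) hX0

theorem mixing_of_nonneg (hh : IsWeakSol ν u h) (hu : IsShear U u) (hU : 1 ≤ U) {M ρ : ℝ}
    (hM : M = 1000000000 * U ^ 4) (hρ : 0 ≤ ρ) (hρ1 : 200000000 * U ^ 4 * ρ ≤ 1) (hν : ν = ρ ^ 3)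
    {X A : ℝ} (hX0 : 0 ≤ X) (hA0 : 0 ≤ A)
    (hX : wInt (fullWeight u) (h 0) ≤ ENNReal.ofReal X)
    {g : ℝ → ℂ} (hg : LocallyIntegrable g)
    (hgh : ∀ ψ : ℝ → ℝ, ContDiff ℝ ∞ ψ → HasCompactSupport ψ →
      ∫ y, h 0 y * deriv ψ y = -∫ y, g y * ψ y)
    (hA : wInt (fun _ => 1) g ≤ ENNReal.ofReal A) {Y : ℝ} (hY0 : 0 ≤ Y) (hY : 8 * (X + A) ≤ Y ^ 2)
    {t : ℝ} (ht : 0 ≤ t) {φ φ' : ℝ → ℂ} (hφ : ∀ y, HasDerivAt φ (φ' y) y) (cφ' : Continuous φ')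
    (sφ : HasCompactSupport φ) {Φ : ℝ} (hΦ0 : 0 ≤ Φ)
    (hΦ : wInt (fun _ => 1) φ ≤ ENNReal.ofReal (Φ ^ 2))
    (hΦ' : wInt (fun _ => 1) φ' ≤ ENNReal.ofReal (Φ ^ 2)) :
    ‖∫ y, h t y * φ y‖ ≤ 20 * M ^ 2 * (exp (-(1 / M * ρ * t)) / √(1 + t ^ 2)) * (Y * Φ) := by
  rcases hρ.eq_or_lt with rfl | hρ
  · have hν0 : ν = 0 := by rw [hν]; norm_num
    subst hν0
    refine (hh.mixing_inviscid hu hU hY0 ?_ hg hgh ?_ ht hφ cφ' sφ hΦ0 hΦ hΦ').trans ?_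
    · refine (wInt_mono_weight (one_le_fullWeight u) _).trans (hX.trans ?_)
      exact ENNReal.ofReal_le_ofReal (by linarith)
    · exact hA.trans (ENNReal.ofReal_le_ofReal (by linarith))
    · refine mul_le_mul_of_nonneg_right ?_ (by positivity)
      simp only [mul_zero, zero_mul, neg_zero, exp_zero]
      rw [mul_one_div]
      refine div_le_div_of_nonneg_right ?_ (Real.sqrt_nonneg _)
      have hU2 : U ^ 2 ≤ U ^ 4 := pow_le_pow_right₀ hU (by norm_num)
      have hU4 : 1 ≤ U ^ 4 := one_le_pow₀ hU
      have hM2 : M ≤ M ^ 2 := le_self_pow₀ (by rw [hM]; linarith) (by norm_num)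
      nlinarith
  · exact hh.mixing hu hU hM hρ hρ1 hν hX0 hA0 hX hg hgh hA hY0 hY ht hφ cφ' sφ hΦ0 hΦ hΦ'

end IsWeakSol

theorem rpow_third_cube {x : ℝ} (hx : 0 ≤ x) : (x ^ (1 / 3 : ℝ)) ^ 3 = x := by
  rw [← Real.rpow_natCast, ← Real.rpow_mul hx]
  norm_num

/-- Undoes the rescaling: diffusivity `ν/k` and time `kt` give back the rate `ν^{1/3}k^{2/3}`. -/
theorem rescaled_rate {ν : ℝ} (hν : 0 ≤ ν) {k : ℝ} (hk : 0 < k) (t : ℝ) :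
    (ν * k⁻¹) ^ (1 / 3 : ℝ) * (k * t) = ν ^ (1 / 3 : ℝ) * k ^ (2 / 3 : ℝ) * t := by
  have h : k ^ (2 / 3 : ℝ) = (k⁻¹) ^ (1 / 3 : ℝ) * k := by
    rw [Real.inv_rpow hk.le, ← Real.rpow_neg hk.le]
    nth_rewrite 3 [← Real.rpow_one k]
    rw [← Real.rpow_add hk]
    norm_num
  rw [Real.mul_rpow hν (by positivity), h]
  ring

theorem wInt_le_of_ae_eq_mul {p : ℝ → ℝ} (hp : ∀ y, 0 ≤ p y) {f g : ℝ → ℂ} {r : ℝ} (hr0 : 0 ≤ r)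
    (hr1 : r ≤ 1) (h : f =ᵐ[volume] fun y => (r : ℂ) * g y) : wInt p f ≤ wInt p g := by
  rw [wInt_congr h]
  refine lintegral_mono fun y => ENNReal.ofReal_le_ofReal (mul_le_mul_of_nonneg_left ?_ (hp y))
  refine pow_le_pow_left₀ (norm_nonneg _) ?_ 2
  rw [norm_mul, Complex.norm_real, Real.norm_of_nonneg hr0]
  exact mul_le_of_le_one_left (norm_nonneg _) hr1

namespace IsSolution

variable {U σ ν : ℝ} {u : ℝ → ℝ} {fin : Dom → ℝ} {f : ℝ → Dom → ℝ}

theorem enhanced_diffusion (hU : 1 ≤ U) (hu : IsShear U u) (hσ : 0 ≤ σ) (hν : 0 ≤ ν)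
    (hf : IsSolution σ ν u fin f) {k : ℕ} (hk : 1 ≤ k) {M : ℝ} (hM : M = 1000000000 * U ^ 4)
    (hρ1 : 200000000 * U ^ 4 * (ν * (k : ℝ)⁻¹) ^ (1 / 3 : ℝ) ≤ 1) {t : ℝ} (ht : 0 ≤ t) :
    weightedNorm u (band k (f t)) ≤
      ENNReal.ofReal (48 * exp (-(1 / M) * ν ^ (1 / 3 : ℝ) * (k : ℝ) ^ (2 / 3 : ℝ) * t)) *
        weightedNorm u (band k fin) := by
  have hk0 : (0 : ℝ) < k := by exact_mod_cast hk
  have hν' : 0 ≤ ν * (k : ℝ)⁻¹ := by positivity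
  obtain ⟨h, hh, h0, H⟩ := hf.exists_isWeakSol hu.continuous hσ hν hk
  obtain ⟨r, hr0, hr1, hr⟩ := H t ht
  have d := hh.decay_exp hu hU hM (Real.rpow_nonneg hν' _) hρ1 (rpow_third_cube hν').symm
    (t := k * t) (by positivity)
  rw [mul_assoc, rescaled_rate hν hk0] at d
  refine (ENNReal.pow_le_pow_left_iff two_ne_zero).1 ?_
  rw [mul_pow, weightedNorm_band hk hu.continuous_deriv (hf.locInt_slice t ht).aestronglyMeasurable,
    weightedNorm_band hk hu.continuous_deriv hf.locallyIntegrable_initial.aestronglyMeasurable,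
    mul_left_comm]
  refine mul_le_mul_right ?_ _
  refine (wInt_le_of_ae_eq_mul (fullWeight_nonneg u) hr0 hr1 hr).trans (d.trans (le_of_eq ?_))
  rw [wInt_congr h0, ENNReal.ofReal_pow (by positivity)]
  congr 5
  ring

/-- Duality reduces the `Ḣ⁻¹` norm to the pairing of the mode with one coefficient of a test
function, and the damping factor `r ≤ 1` is dropped. -/
theorem stable_mixing (hU : 1 ≤ U) (hu : IsShear U u) (hσ : 0 ≤ σ) (hν : 0 ≤ ν)
    (hf : IsSolution σ ν u fin f) {k : ℕ} (hk : 1 ≤ k) {M : ℝ} (hM : M = 1000000000 * U ^ 4)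
    (hρ1 : 200000000 * U ^ 4 * (ν * (k : ℝ)⁻¹) ^ (1 / 3 : ℝ) ≤ 1) {g : Dom → ℝ}
    (hg : IsWeakDerivY (band k fin) g) {t : ℝ} (ht : 0 ≤ t) :
    hNegOneNorm (band k (f t)) ≤
      ENNReal.ofReal (1280 * M ^ 2 *
        (exp (-(1 / M) * ν ^ (1 / 3 : ℝ) * (k : ℝ) ^ (2 / 3 : ℝ) * t) / √(1 + ((k : ℝ) * t) ^ 2))) *
        (weightedNorm u (band k fin) + weightedNorm u g) := by
  have hk0 : (0 : ℝ) < k := by exact_mod_cast hk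
  have hkz : (k : ℤ) ≠ 0 := by exact_mod_cast (by omega : k ≠ 0)
  have hM0 : 0 < M := by rw [hM]; positivity
  have hν' : 0 ≤ ν * (k : ℝ)⁻¹ := by positivity
  by_cases htop : weightedNorm u (band k fin) + weightedNorm u g = ⊤
  · rw [htop, ENNReal.mul_top (by rw [Ne, ENNReal.ofReal_eq_zero, not_le]; positivity)]
    exact le_top
  obtain ⟨t1, t2⟩ := ENNReal.add_ne_top.1 htop
  obtain ⟨n₁, hn₁, e₁⟩ : ∃ n : ℝ, 0 ≤ n ∧ weightedNorm u (band k fin) = ENNReal.ofReal n :=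
    ⟨_, ENNReal.toReal_nonneg, (ENNReal.ofReal_toReal t1).symm⟩
  obtain ⟨n₂, hn₂, e₂⟩ : ∃ n : ℝ, 0 ≤ n ∧ weightedNorm u g = ENNReal.ofReal n :=
    ⟨_, ENNReal.toReal_nonneg, (ENNReal.ofReal_toReal t2).symm⟩
  obtain ⟨h, hh, h0, H⟩ := hf.exists_isWeakSol hu.continuous hσ hν hk
  obtain ⟨r, hr0, hr1, hr⟩ := H t ht
  have mfin := hf.locallyIntegrable_initial.aestronglyMeasurable
  have mg := hg.2.1.aestronglyMeasurable
  have b₁ : wInt (fullWeight u) (h 0) ≤ ENNReal.ofReal (n₁ ^ 2) := by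
    rw [wInt_congr h0, ENNReal.ofReal_pow hn₁, ← e₁, weightedNorm_band hk hu.continuous_deriv mfin]
    refine le_mul_of_one_le_left' ?_
    rw [ENNReal.one_le_ofReal]
    linarith [Real.pi_gt_three]
  have l₂ : eLpNorm g 2 volume ^ 2 ≤ ENNReal.ofReal (n₂ ^ 2) := by
    rw [ENNReal.ofReal_pow hn₂, ← e₂, weightedNorm_sq]
    exact le_self_add
  have b₂ : wInt (fun _ => 1) (xCoeff g k) ≤ ENNReal.ofReal (n₂ ^ 2) := by
    rw [wInt_one_eq]
    exact (pow_le_pow_left₀ zero_le (eLpNorm_xCoeff_le mg k) 2).trans l₂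
  have mG : MemLp (xCoeff g k) 2 := by
    refine ⟨aestronglyMeasurable_xCoeff mg k, ?_⟩
    rw [wInt_one_eq] at b₂
    by_contra hc
    rw [not_lt, top_le_iff] at hc
    rw [hc] at b₂
    simp at b₂
  have hgh : ∀ ψ : ℝ → ℝ, ContDiff ℝ ∞ ψ → HasCompactSupport ψ →
      ∫ y, h 0 y * deriv ψ y = -∫ y, xCoeff g k y * ψ y := fun ψ hψ sψ => by
    rw [← hg.xCoeff k hψ sψ, xCoeff_band hk]
    refine integral_congr_ae ?_
    filter_upwards [h0] with y hy
    rw [hy]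
  rw [e₁, e₂, ← ENNReal.ofReal_add hn₁ hn₂, ← ENNReal.ofReal_mul (by positivity)]
  refine iSup_le fun φ => iSup_le fun hφ => iSup_le fun hφ1 => ENNReal.ofReal_le_ofReal ?_
  refine (hφ.integral_band_mul hk (hf.memLp_xCoeff hkz ht)).trans ?_
  obtain ⟨w1, w2⟩ := hφ.wInt_bounds hφ1 (neg_ne_zero.2 hkz)
  -- The choice `Y = 4(n₁ + n₂)` satisfies `8(n₁² + n₂²) ≤ Y²`.
  have b := hh.mixing_of_nonneg hu hU hM (Real.rpow_nonneg hν' _) hρ1 (rpow_third_cube hν').symm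
    (sq_nonneg n₁) (sq_nonneg n₂) b₁ (mG.locallyIntegrable (by norm_num)) hgh b₂
    (Y := 4 * (n₁ + n₂)) (by positivity) (by nlinarith) (t := k * t) (by positivity)
    (hφ.hasDerivAt_xCoeff _) (hφ.continuous_xCoeff_dY _) (hφ.hasCompactSupport_xCoeff _) zero_le_one
    w1 w2
  rw [mul_assoc (1 / M), rescaled_rate hν hk0] at b
  have e : ∫ y, xCoeff (f t) k y * xCoeff φ (-k) y = r * ∫ y, h (k * t) y * xCoeff φ (-k) y := by
    rw [← integral_const_mul]
    refine integral_congr_ae ?_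
    filter_upwards [hr] with y hy
    rw [hy]
    ring
  rw [e, norm_mul, Complex.norm_real, Real.norm_of_nonneg hr0]
  have e3 : -(1 / M) * ν ^ (1 / 3 : ℝ) * (k : ℝ) ^ (2 / 3 : ℝ) * t =
      -(1 / M * (ν ^ (1 / 3 : ℝ) * (k : ℝ) ^ (2 / 3 : ℝ) * t)) := by ring
  rw [e3]
  set D := exp (-(1 / M * (ν ^ (1 / 3 : ℝ) * (k : ℝ) ^ (2 / 3 : ℝ) * t))) / √(1 + ((k : ℝ) * t) ^ 2)
    with hD
  have hD0 : 0 ≤ D := by positivity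
  -- With `π ≤ 4` the constants are `4 · 4 · 20 · 4 = 1280`.
  calc 4 * π * (r * ‖∫ y, h (k * t) y * xCoeff φ (-k) y‖)
      ≤ 4 * 4 * (1 * (20 * M ^ 2 * D * (4 * (n₁ + n₂) * 1))) := by
        have := Real.pi_le_four
        gcongr
    _ = _ := by ring

end IsSolution
end StableMixing
end

theorem theorem4p1 (U : ℝ) (hU : 1 ≤ U) :
    ∃ C₀ ε₀ ν₀ : ℝ, 1 ≤ C₀ ∧ 0 < ε₀ ∧ ε₀ < 1 ∧ 0 < ν₀ ∧ ν₀ < 1 ∧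
      ∀ u : ℝ → ℝ, StableMixing.IsShear U u →
      ∀ σ : ℝ, σ = 0 ∨ σ = 1 →
      ∀ ν : ℝ, 0 ≤ ν →
      ∀ (fin : StableMixing.Dom → ℝ) (f : ℝ → StableMixing.Dom → ℝ),
        StableMixing.IsSolution σ ν u fin f →
      ∀ k : ℕ, 1 ≤ k → ν * (k : ℝ)⁻¹ ≤ ν₀ →
        -- enhanced diffusion
        (∀ t : ℝ, 0 ≤ t →
          StableMixing.weightedNorm u (StableMixing.band k (f t)) ≤
            ENNReal.ofReal
                (C₀ * Real.exp (-ε₀ * ν ^ (1 / 3 : ℝ) * (k : ℝ) ^ (2 / 3 : ℝ) * t)) *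
              StableMixing.weightedNorm u (StableMixing.band k fin)) ∧
        -- stable mixing; `g` is the weak derivative in `y` of the band `k` of `fin`
        (∀ g : StableMixing.Dom → ℝ,
          StableMixing.IsWeakDerivY (StableMixing.band k fin) g →
          ∀ t : ℝ, 0 ≤ t →
            StableMixing.hNegOneNorm (StableMixing.band k (f t)) ≤
              ENNReal.ofReal
                  (C₀ * (Real.exp (-ε₀ * ν ^ (1 / 3 : ℝ) * (k : ℝ) ^ (2 / 3 : ℝ) * t) /
                    Real.sqrt (1 + ((k : ℝ) * t) ^ 2))) *
                (StableMixing.weightedNorm u (StableMixing.band k fin) +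
                  StableMixing.weightedNorm u g)) ∧
        -- inviscid mixing
        (ν = 0 → ∀ g : StableMixing.Dom → ℝ,
          StableMixing.IsWeakDerivY (StableMixing.band k fin) g →
          ∀ t : ℝ, 0 ≤ t →
            StableMixing.hNegOneNorm (StableMixing.band k (f t)) ≤
              ENNReal.ofReal (C₀ / Real.sqrt (1 + ((k : ℝ) * t) ^ 2)) *
                (StableMixing.weightedNorm u (StableMixing.band k fin) +
                  StableMixing.weightedNorm u g)) := by
  have hU4 : 1 ≤ U ^ 4 := one_le_pow₀ hU
  obtain ⟨M, hM⟩ : ∃ M, M = 1000000000 * U ^ 4 := ⟨_, rfl⟩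
  -- The largest `ρ` with `200000000 U⁴ρ ≤ 1`, which keeps `νT` small on a window. Since `ρ` is the
  -- cube root of `ν/k`, the threshold is `ν₀ = ρ₀³`; the rate `ε₀ = 1/M` comes from the window
  -- length `M/ρ`.
  obtain ⟨ρ₀, hρ₀⟩ : ∃ ρ, ρ = 1 / (200000000 * U ^ 4) := ⟨_, rfl⟩
  have hM1 : 1000000000 ≤ M := by rw [hM]; linarith
  have hρ0 : 0 < ρ₀ := by rw [hρ₀]; positivity
  have hρ1 : ρ₀ < 1 := by rw [hρ₀, div_lt_one (by positivity)]; linarith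
  have hρU : 200000000 * U ^ 4 * ρ₀ = 1 := by rw [hρ₀]; field_simp
  have hMM : M ≤ M ^ 2 := le_self_pow₀ (by linarith) (by norm_num)
  refine ⟨1280 * M ^ 2, 1 / M, ρ₀ ^ 3, by linarith, by positivity, ?_, by positivity,
    pow_lt_one₀ hρ0.le hρ1 (by norm_num), fun u hu σ hσ ν hν fin f hf k hk hνk => ?_⟩
  · rw [div_lt_one (by linarith)]; linarith
  have hσ0 : 0 ≤ σ := by rcases hσ with rfl | rfl <;> norm_num
  have hsm : 200000000 * U ^ 4 * (ν * (k : ℝ)⁻¹) ^ (1 / 3 : ℝ) ≤ 1 := by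
    refine le_trans (mul_le_mul_of_nonneg_left ?_ (by positivity)) hρU.le
    refine (Real.rpow_le_rpow (by positivity) hνk (by norm_num)).trans (le_of_eq ?_)
    rw [← Real.rpow_natCast, ← Real.rpow_mul hρ0.le]
    norm_num
  have mix := fun g (hg : StableMixing.IsWeakDerivY (StableMixing.band k fin) g) t (ht : 0 ≤ t) =>
    hf.stable_mixing hU hu hσ0 hν hk hM hsm hg ht
  refine ⟨fun t ht => ?_, mix, fun hν0 g hg t ht => ?_⟩
  · refine (hf.enhanced_diffusion hU hu hσ0 hν hk hM hsm ht).trans (mul_le_mul_left ?_ _)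
    refine ENNReal.ofReal_le_ofReal (mul_le_mul_of_nonneg_right (by linarith) (exp_pos _).le)
  · have h := mix g hg t ht
    -- `0^{1/3} = 0`, so the exponential in the stable mixing estimate becomes 1.
    rw [hν0, Real.zero_rpow (by norm_num), mul_zero, zero_mul, zero_mul, exp_zero, mul_one_div] at h
    exact h
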